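/- **Conventions.** Let $\mathbf R$ be a commutative ring, $\Lambda$ an abelian group, and $\mathcal T$ an $\mathbf R$-linear monoidal category (with $\otimes$ bilinear) which is $\Lambda$-graded: $\mathcal T=\bigoplus_{\lambda\in\Lambda}\mathcal T_\lambda$ with $\mathbf 1\in\mathcal T_0$ and $\mathcal T_\lambda\otimes\mathcal T_\mu\subset\mathcal T_{\lambda+\mu}$. That is, the $\mathcal T_\lambda$ are full subcategories closed under isomorphism, there are no nonzero morphisms between objects of different degrees, every object is a finite direct sum of objects of pairwise different degrees, and all such direct sums exist. Let $q\in\mathcal T_0$ be an invertible central object: $q$ is invertible, and there are isomorphisms $q\otimes X\simeq X\otimes q$, natural in $X\in\mathcal T$ and compatible with $\otimes$. Write $q^n=q^{\otimes n}$ $(n\in\mathbb Z)$. An object $X$ is called invertible if $X\otimes-$ and $-\otimes X$ are equivalences. A *graded braider* is a triple $(C,R_C,\phi)$ of an object $C$, a homomorphism $\phi:\Lambda\to\mathbb Z$ and morphisms $R_C(X):C\otimes X\to q^{\phi(\lambda)}\otimes X\otimes C$, natural in $X\in\mathcal T_\lambda$ for each $\lambda\in\Lambda$, such that $R_C(X\otimes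 Y)$ is the composite $$C\otimes X\otimes Y\xrightarrow{R_C(X)\otimes Y}q^{\phi(\lambda)}\otimes X\otimes C\otimes Y\xrightarrow{X\otimes R_C(Y)}q^{\phi(\lambda+\mu)}\otimes X\otimes Y\otimes C\qquad(X\in\mathcal T_\lambda,\ Y\in\mathcal T_\mu)$$ (moving $q^{\phi(\mu)}$ to the left by centrality), and $R_C(\mathbf 1)$ is the canonical isomorphism. A family $(C_i,R_{C_i},\phi_i)_{i\in I}$ of graded braiders is a *real commuting family* if, for some $\lambda_i\in\Lambda$ and all $i,j\in I$: $C_i\in\mathcal T_{\lambda_i}$, $\phi_i(\lambda_i)=0$, $\phi_i(\lambda_j)+\phi_j(\lambda_i)=0$, $R_{C_i}(C_i)\in\mathbf R^\times\mathrm{id}_{C_i\otimes C_i}$ and $R_{C_j}(C_i)\circ R_{C_i}(C_j)\in\mathbf R^\times\mathrm{id}_{C_i\otimes C_j}$ (with $q^0=\mathbf 1$ and $q^{a}\otimes q^{-a}\simeq\mathbf 1$). **Theorem.** Let $(C_i,R_{C_i},\phi_i)_{i\in I}$ be a real commuting family of graded braiders in $\mathcal T$. There exist a $\Lambda$-graded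 $\mathbf R$-linear monoidal category $\widetilde{\mathcal T}$ and an $\mathbf R$-linear monoidal functor $\Upsilon:\mathcal T\to\widetilde{\mathcal T}$ with $\Upsilon(\mathcal T_\lambda)\subset\widetilde{\mathcal T}_\lambda$ for all $\lambda\in\Lambda$, such that: 1. $\Upsilon(C_i)$ is invertible in $\widetilde{\mathcal T}$ for every $i\in I$; 2. $\Upsilon(R_{C_i}(X))$ is an isomorphism for all $i\in I$, $\lambda\in\Lambda$ and $X\in\mathcal T_\lambda$; 3. (universality) if $\Upsilon':\mathcal T\to\mathcal T'$ is an $\mathbf R$-linear monoidal functor to an $\mathbf R$-linear monoidal category for which 1 and 2 hold, then there is an $\mathbf R$-linear monoidal functor $F:\widetilde{\mathcal T}\to\mathcal T'$ with a monoidal isomorphism $\theta:F\circ\Upsilon\simeq\Upsilon'$, and for any two such pairs $(F_1,\theta_1)$, $(F_2,\theta_2)$ there is a unique monoidal isomorphism $F_1\simeq F_2$ compatible with $\theta_1$ and $\theta_2$; 4. $\widetilde{\mathcal T}$ consists of fractions over $\mathcal T$: for every $Z\in\widetilde{\mathcal T}$ there are $i_1,\dots,i_n\in I$ and $X\in\mathcal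 T$ with $\Upsilon(C_{i_1}\otimes\cdots\otimes C_{i_n})\otimes Z\simeq\Upsilon(X)$; and, for $X\in\mathcal T$ and $Y\in\mathcal T_\mu$, $\mathrm{Hom}_{\widetilde{\mathcal T}}(\Upsilon(X),\Upsilon(Y))$ is the inductive limit of $\mathrm{Hom}_{\mathcal T}(C\otimes X,q^{c}\otimes Y\otimes C)$ over tensor products $C$ of the $C_i$, with $c$ determined by $C$ and $\mu$. Precisely: every $g:\Upsilon(X)\to\Upsilon(Y)$ is sent to the image under $\Upsilon$ of a morphism of $\mathcal T$ by finitely many operations $g\mapsto\Upsilon(R_{C_i}(Y))\circ(\Upsilon(C_i)\otimes g)$ (with $Y$ replaced by $q^{\phi_i(\mu)}\otimes Y\otimes C_i$ after each step), and a morphism $f:X\to Y$ of $\mathcal T$ satisfies $\Upsilon(f)=0$ if and only if it is sent to $0$ by finitely many operations $f\mapsto R_{C_i}(Y)\circ(C_i\otimes f)$. Moreover, if $\mathcal T$ is abelian and $\otimes$ is exact in each variable, then $\widetilde{\mathcal T}$ is abelian, its tensor product is exact in each variable, and $\Upsilon$ is exact. -/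

import Mathlib

open CategoryTheory MonoidalCategory Limits

/-! ### Gradings, and the powers of an invertible central object -/

/-- `X` is the direct sum of the `Y l`, `l ∈ s`, with inclusions `ι l` and projections `π l`
(used for objects `Y l` without nonzero morphisms between them, so that `ι l ≫ π m = 0` for
`l ≠ m` in `s` is automatic). -/
def IsDirectSum {Λ 𝒯 : Type*} [Category 𝒯] [Preadditive 𝒯] (s : Finset Λ) (Y : Λ → 𝒯) (X : 𝒯) :
    Prop :=
  ∃ (ι : ∀ l, Y l ⟶ X) (π : ∀ l, X ⟶ Y l), (∀ l ∈ s, ι l ≫ π l = 𝟙 (Y l)) ∧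
    ∑ l ∈ s, π l ≫ ι l = 𝟙 X

/-- A `Λ`-grading `𝒯 = ⨁ 𝒯_l` of a preadditive monoidal category: full replete subcategories `𝒯_l`
without nonzero morphisms between different degrees, such that the objects of `𝒯` are precisely the
finite direct sums of objects of pairwise different degrees (and all these sums exist), `𝟙` lies in
degree `0` and `⊗` adds degrees. -/
structure MonoidalGrading (Λ : Type*) [AddCommGroup Λ] (𝒯 : Type*) [Category 𝒯] [Preadditive 𝒯]
    [MonoidalCategory 𝒯] where
  /-- the subcategory of objects of degree `l` -/
  homogeneous : Λ → ObjectProperty 𝒯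
  closedUnderIso : ∀ l, (homogeneous l).IsClosedUnderIsomorphisms
  hom_eq_zero : ∀ {l m : Λ} {X Y : 𝒯}, homogeneous l X → homogeneous m Y → l ≠ m →
    ∀ f : X ⟶ Y, f = 0
  exists_decomposition : ∀ X : 𝒯, ∃ (s : Finset Λ) (Y : Λ → 𝒯),
    (∀ l ∈ s, homogeneous l (Y l)) ∧ IsDirectSum s Y X
  exists_sum : ∀ (s : Finset Λ) (Y : Λ → 𝒯), (∀ l ∈ s, homogeneous l (Y l)) →
    ∃ X : 𝒯, IsDirectSum s Y X
  unit_mem : homogeneous 0 (𝟙_ 𝒯)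
  tensor_mem : ∀ {l m : Λ} {X Y : 𝒯}, homogeneous l X → homogeneous m Y →
    homogeneous (l + m) (X ⊗ Y)

/-- An object is invertible if tensoring with it, on either side, is an equivalence. -/
def IsInvertibleObj {𝒯 : Type*} [Category 𝒯] [MonoidalCategory 𝒯] (X : 𝒯) : Prop :=
  (tensorLeft X).IsEquivalence ∧ (tensorRight X).IsEquivalence

/-- The system of powers `q ^ n` (`n : ℤ`) of an invertible central object `q` of `𝒯`. A central
object is an object of the Drinfeld center, i.e. an object `q` with isomorphisms `q ⊗ X ≅ X ⊗ q`,
natural and multiplicative in `X`. For an invertible central `q` the tensor powers `q ^ n`, together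
with the coherent isomorphisms `𝟙 ≅ q ^ 0` and `q ^ a ⊗ q ^ b ≅ q ^ (a + b)` of central objects,
form a monoidal functor from the discrete monoidal category `ℤ`, unique up to unique isomorphism;
conversely `q = q ^ 1` is invertible for any such functor. No condition is imposed on the
self-braiding of `q`. -/
structure InvertibleCentralObject (𝒯 : Type*) [Category 𝒯] [MonoidalCategory 𝒯] where
  /-- the functor `n ↦ q ^ n` -/
  power : Discrete ℤ ⥤ Center 𝒯
  /-- the coherent isomorphisms between the powers -/
  monoidal : power.Monoidal

namespace InvertibleCentralObject

variable {𝒯 : Type*} [Category 𝒯] [MonoidalCategory 𝒯] (q : InvertibleCentralObject 𝒯)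

attribute [instance] InvertibleCentralObject.monoidal

/-- The object `q ^ n` of `𝒯`. -/
def pow (n : ℤ) : 𝒯 := (q.power.obj ⟨n⟩).1

/-- The canonical isomorphism `𝟙 ≅ q ^ c` for `c = 0`. -/
noncomputable def powZero (c : ℤ) (h : 0 = c) : 𝟙_ 𝒯 ≅ q.pow c :=
  (Center.forget 𝒯).mapIso
    (Functor.Monoidal.εIso q.power ≪≫
      q.power.mapIso (Discrete.eqToIso (X := 𝟙_ (Discrete ℤ)) (Y := ⟨c⟩) h))

/-- The canonical isomorphism `q ^ a ⊗ q ^ b ≅ q ^ c` for `c = a + b`. -/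
noncomputable def powAdd (a b c : ℤ) (h : a + b = c) : q.pow a ⊗ q.pow b ≅ q.pow c :=
  (Center.forget 𝒯).mapIso
    (Functor.Monoidal.μIso q.power ⟨a⟩ ⟨b⟩ ≪≫
      q.power.mapIso (Discrete.eqToIso (X := (⟨a⟩ : Discrete ℤ) ⊗ ⟨b⟩) (Y := ⟨c⟩) h))

/-- The centrality isomorphism `q ^ n ⊗ X ≅ X ⊗ q ^ n`. -/
def central (n : ℤ) (X : 𝒯) : q.pow n ⊗ X ≅ X ⊗ q.pow n := (q.power.obj ⟨n⟩).2.β X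

/-- The isomorphism `X ⊗ q ^ n ⊗ Z ≅ q ^ n ⊗ X ⊗ Z` given by the centrality of `q ^ n`. -/
def moveLeft (n : ℤ) (X Z : 𝒯) : X ⊗ (q.pow n ⊗ Z) ≅ q.pow n ⊗ (X ⊗ Z) :=
  (α_ X (q.pow n) Z).symm ≪≫ whiskerRightIso (q.central n X).symm Z ≪≫
    α_ (q.pow n) X Z

end InvertibleCentralObject

/-! ### Graded braiders and real commuting families -/

/-- A graded (left) braider `(C, R_C, φ)`: an object `C`, an additive map `φ : Λ → ℤ` and morphisms
`R_C(X) : C ⊗ X ⟶ q ^ φ(l) ⊗ X ⊗ C`, natural in `X` of degree `l`, compatible with the unit and with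
tensor products. The `R_C(X)` need not be isomorphisms. -/
structure GradedBraider {Λ : Type*} [AddCommGroup Λ] {𝒯 : Type*} [Category 𝒯] [Preadditive 𝒯]
    [MonoidalCategory 𝒯] (𝒢 : MonoidalGrading Λ 𝒯) (q : InvertibleCentralObject 𝒯) where
  /-- the object `C` -/
  obj : 𝒯
  /-- the additive map `φ` -/
  φ : Λ →+ ℤ
  /-- the morphism `R_C(X)` -/
  R : ∀ {l : Λ} (X : 𝒯), 𝒢.homogeneous l X → (obj ⊗ X ⟶ q.pow (φ l) ⊗ (X ⊗ obj))
  naturality : ∀ {l : Λ} {X Y : 𝒯} (hX : 𝒢.homogeneous l X) (hY : 𝒢.homogeneous l Y) (f : X ⟶ Y),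
    (obj ◁ f) ≫ R Y hY = R X hX ≫ (q.pow (φ l) ◁ (f ▷ obj))
  tensor : ∀ {l m : Λ} {X Y : 𝒯} (hX : 𝒢.homogeneous l X) (hY : 𝒢.homogeneous m Y),
    R (X ⊗ Y) (𝒢.tensor_mem hX hY) =
      (α_ obj X Y).inv ≫ (R X hX ▷ Y) ≫ (α_ (q.pow (φ l)) (X ⊗ obj) Y).hom ≫
        (q.pow (φ l) ◁ ((α_ X obj Y).hom ≫ (X ◁ R Y hY) ≫
          (q.moveLeft (φ m) X (Y ⊗ obj)).hom ≫ (q.pow (φ m) ◁ (α_ X Y obj).inv))) ≫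
        (α_ (q.pow (φ l)) (q.pow (φ m)) ((X ⊗ Y) ⊗ obj)).inv ≫
        ((q.powAdd (φ l) (φ m) (φ (l + m)) (φ.map_add l m).symm).hom ▷ ((X ⊗ Y) ⊗ obj))
  unit : R (𝟙_ 𝒯) 𝒢.unit_mem =
    (ρ_ obj).hom ≫ (λ_ obj).inv ≫ (λ_ (𝟙_ 𝒯 ⊗ obj)).inv ≫
      ((q.powZero (φ 0) φ.map_zero.symm).hom ▷ (𝟙_ 𝒯 ⊗ obj))

section RealCommuting

variable (R : Type*) [CommRing R] {Λ : Type*} [AddCommGroup Λ] {𝒯 : Type*} [Category 𝒯]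
  [Preadditive 𝒯] [Linear R 𝒯] [MonoidalCategory 𝒯] {𝒢 : MonoidalGrading Λ 𝒯}
  {q : InvertibleCentralObject 𝒯} {I : Type*}

/-- `(C_i, R_{C_i}, φ_i)` is a real commuting family of graded braiders, with `C_i` of degree
`deg i`: `φ_i(deg i) = 0`, `φ_i(deg j) + φ_j(deg i) = 0`, and `R_{C_i}(C_i)` and
`R_{C_j}(C_i) ∘ R_{C_i}(C_j)` are identities up to units of `R` (where `q ^ 0` is identified with
`𝟙` and `q ^ a ⊗ q ^ b` with `q ^ 0` for `a + b = 0`). -/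
structure IsRealCommutingFamily (C : I → GradedBraider 𝒢 q) (deg : I → Λ) : Prop where
  homogeneous : ∀ i, 𝒢.homogeneous (deg i) (C i).obj
  φ_self : ∀ i, (C i).φ (deg i) = 0
  φ_add : ∀ i j, (C i).φ (deg j) + (C j).φ (deg i) = 0
  real : ∀ i, ∃ r : Rˣ, (C i).R (C i).obj (homogeneous i) =
    (r : R) • ((λ_ ((C i).obj ⊗ (C i).obj)).inv ≫
      ((q.powZero ((C i).φ (deg i)) (φ_self i).symm).hom ▷ ((C i).obj ⊗ (C i).obj)))
  commuting : ∀ i j, ∃ r : Rˣ,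
    (C i).R (C j).obj (homogeneous j) ≫
      (q.pow ((C i).φ (deg j)) ◁ (C j).R (C i).obj (homogeneous i)) =
    (r : R) • ((λ_ ((C i).obj ⊗ (C j).obj)).inv ≫
      ((q.powZero 0 rfl ≪≫ (q.powAdd ((C i).φ (deg j)) ((C j).φ (deg i)) 0 (φ_add i j)).symm).hom ▷
        ((C i).obj ⊗ (C j).obj)) ≫
      (α_ (q.pow ((C i).φ (deg j))) (q.pow ((C j).φ (deg i))) ((C i).obj ⊗ (C j).obj)).hom)

end RealCommuting

/-! ### Localization -/

section Localization

variable {Λ : Type*} [AddCommGroup Λ] {𝒯 : Type*} [Category 𝒯] [Preadditive 𝒯]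
  [MonoidalCategory 𝒯] {𝒢 : MonoidalGrading Λ 𝒯} {q : InvertibleCentralObject 𝒯} {I : Type*}

/-- The monoidal functor `F` makes all `C_i` invertible objects and all `R_{C_i}(X)`, for `X`
homogeneous, isomorphisms. -/
def InvertsBraiders (C : I → GradedBraider 𝒢 q) {𝒟 : Type*} [Category 𝒟] [MonoidalCategory 𝒟]
    (F : 𝒯 ⥤ 𝒟) : Prop :=
  (∀ i, IsInvertibleObj (F.obj (C i).obj)) ∧
    ∀ (i : I) (l : Λ) (X : 𝒯) (hX : 𝒢.homogeneous l X), IsIso (F.map ((C i).R X hX))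

/-- For `f : X ⟶ Y` with `Y` homogeneous: some iterate of the operation
`f ↦ R_{C_i}(Y) ∘ (C_i ⊗ f)` (with varying `i`) sends `f` to `0`. -/
inductive BraidsToZero (C : I → GradedBraider 𝒢 q) :
    ∀ {l : Λ} {X Y : 𝒯}, 𝒢.homogeneous l Y → (X ⟶ Y) → Prop
  | zero {l : Λ} {X Y : 𝒯} (hY : 𝒢.homogeneous l Y) : BraidsToZero C hY (0 : X ⟶ Y)
  | step {l m : Λ} {X Y : 𝒯} (hY : 𝒢.homogeneous l Y) (f : X ⟶ Y) (i : I)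
      (h : 𝒢.homogeneous m (q.pow ((C i).φ l) ⊗ (Y ⊗ (C i).obj)))
      (hf : BraidsToZero C h (((C i).obj ◁ f) ≫ (C i).R Y hY)) : BraidsToZero C hY f

/-- For `g : F(X) ⟶ F(Y)` with `Y` homogeneous: some iterate of the operation
`g ↦ F(R_{C_i}(Y)) ∘ (F(C_i) ⊗ g)` (with varying `i`) sends `g` to a morphism in the image of `F`. -/
inductive IsBraidedFraction (C : I → GradedBraider 𝒢 q) {𝒟 : Type*} [Category 𝒟]
    [MonoidalCategory 𝒟] (F : 𝒯 ⥤ 𝒟) [F.Monoidal] :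
    ∀ {l : Λ} {X Y : 𝒯}, 𝒢.homogeneous l Y → (F.obj X ⟶ F.obj Y) → Prop
  | of_map {l : Λ} {X Y : 𝒯} (hY : 𝒢.homogeneous l Y) (f : X ⟶ Y) :
      IsBraidedFraction C F hY (F.map f)
  | step {l m : Λ} {X Y : 𝒯} (hY : 𝒢.homogeneous l Y) (g : F.obj X ⟶ F.obj Y) (i : I)
      (h : 𝒢.homogeneous m (q.pow ((C i).φ l) ⊗ (Y ⊗ (C i).obj)))
      (hg : IsBraidedFraction C F h
        (Functor.OplaxMonoidal.δ F (C i).obj X ≫ (F.obj (C i).obj ◁ g) ≫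
          Functor.LaxMonoidal.μ F (C i).obj Y ≫ F.map ((C i).R Y hY))) :
      IsBraidedFraction C F hY g

/-- The tensor product `C_{i₁} ⊗ (C_{i₂} ⊗ ⋯)` along a word in `I`. -/
def wordObj (C : I → GradedBraider 𝒢 q) : List I → 𝒯
  | [] => 𝟙_ 𝒯
  | i :: w => (C i).obj ⊗ wordObj C w

/-- The target of `Υ` consists of formal fractions over `𝒯`: every object `Z` is of the form
`Υ(C_{i₁} ⊗ ⋯ ⊗ C_{iₙ})⁻¹ ⊗ Υ(X)`, and `Hom(Υ(X), Υ(Y))` is the inductive limit of the groups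
`Hom(C ⊗ X, q ^ c ⊗ Y ⊗ C)` over tensor products `C` of the `C_i`, along the maps
`f ↦ R_{C_i} ∘ (C_i ⊗ f)`. -/
structure IsFractionCategory (C : I → GradedBraider 𝒢 q) {𝒟 : Type*} [Category 𝒟] [Preadditive 𝒟]
    [MonoidalCategory 𝒟] (Υ : 𝒯 ⥤ 𝒟) [Υ.Monoidal] : Prop where
  exists_denominator : ∀ Z : 𝒟, ∃ (w : List I) (X : 𝒯),
    Nonempty (Υ.obj (wordObj C w) ⊗ Z ≅ Υ.obj X)
  isBraidedFraction : ∀ {l : Λ} {X Y : 𝒯} (hY : 𝒢.homogeneous l Y) (g : Υ.obj X ⟶ Υ.obj Y),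
    IsBraidedFraction C Υ hY g
  map_eq_zero_iff : ∀ {l : Λ} {X Y : 𝒯} (hY : 𝒢.homogeneous l Y) (f : X ⟶ Y),
    Υ.map f = 0 ↔ BraidsToZero C hY f

end Localization

section Universal

universe u' v' x

/-- The universal property of the localization: every `R`-linear monoidal functor `Υ'` that inverts
the `C_i` and the `R_{C_i}(X)` factors through `Υ`, and any two factorizations are isomorphic by a
unique monoidal isomorphism compatible with the factorizations. The target of `Υ'` ranges over the
`R`-linear monoidal categories in the universes `u'`, `v'`. -/
def HasUniversalProperty (R : Type x) [CommRing R] {Λ : Type*} [AddCommGroup Λ] {𝒯 : Type*}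
    [Category 𝒯] [Preadditive 𝒯] [Linear R 𝒯] [MonoidalCategory 𝒯] {𝒢 : MonoidalGrading Λ 𝒯}
    {q : InvertibleCentralObject 𝒯} {I : Type*} (C : I → GradedBraider 𝒢 q) {𝒟 : Type*}
    [Category 𝒟] [Preadditive 𝒟] [Linear R 𝒟] [MonoidalCategory 𝒟] (Υ : 𝒯 ⥤ 𝒟) [Υ.Monoidal] :
    Prop :=
  ∀ (𝒟' : Type u') [Category.{v'} 𝒟'] [Preadditive 𝒟'] [Linear R 𝒟'] [MonoidalCategory 𝒟']
    [MonoidalPreadditive 𝒟'] [MonoidalLinear R 𝒟'] (Υ' : 𝒯 ⥤ 𝒟') [Υ'.Monoidal] [Υ'.Additive]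
    [Υ'.Linear R], InvertsBraiders C Υ' →
    (∃ (F : 𝒟 ⥤ 𝒟') (_ : F.Monoidal) (_ : F.Additive) (_ : F.Linear R) (θ : Υ ⋙ F ≅ Υ'),
      NatTrans.IsMonoidal θ.hom) ∧
    ∀ (F₁ F₂ : 𝒟 ⥤ 𝒟') [F₁.Monoidal] [F₁.Additive] [F₁.Linear R] [F₂.Monoidal] [F₂.Additive]
      [F₂.Linear R] (θ₁ : Υ ⋙ F₁ ≅ Υ') (θ₂ : Υ ⋙ F₂ ≅ Υ'), NatTrans.IsMonoidal θ₁.hom →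
      NatTrans.IsMonoidal θ₂.hom →
      ∃! τ : F₁ ≅ F₂, NatTrans.IsMonoidal τ.hom ∧
        ∀ X : 𝒯, τ.hom.app (Υ.obj X) ≫ θ₂.hom.app X = θ₁.hom.app X

end Universal

/-- The preadditive category `𝒯` is abelian. -/
def IsAbelianCategory (𝒯 : Type*) [Category 𝒯] [P : Preadditive 𝒯] : Prop :=
  ∃ A : Abelian 𝒯, A.toPreadditive = P

/-- The functor `F` is exact. -/
def IsExactFunctor {𝒯 𝒟 : Type*} [Category 𝒯] [Category 𝒟] (F : 𝒯 ⥤ 𝒟) : Prop :=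
  PreservesFiniteLimits F ∧ PreservesFiniteColimits F

/-- The tensor product is exact in each variable. -/
def HasExactTensor (𝒯 : Type*) [Category 𝒯] [MonoidalCategory 𝒯] : Prop :=
  ∀ X : 𝒯, IsExactFunctor (tensorLeft X) ∧ IsExactFunctor (tensorRight X)

set_option linter.unusedSectionVars false

/-! ### Monoidal linear categories presented by formal inverses -/

section FreeLocalization

universe u v w x

variable (R : Type x) [CommRing R] {𝒯 : Type u} [Category.{v} 𝒯] [Preadditive 𝒯] [Linear R 𝒯]
  [MonoidalCategory 𝒯] {I : Type w} (C : I → 𝒯) (W : MorphismProperty 𝒯)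

/-- Objects of the monoidal category obtained from `𝒯` by adjoining inverses of the objects `C i`
and of the morphisms in `W`. -/
inductive FreeLoc (R : Type x) [CommRing R] {𝒯 : Type u} [Category.{v} 𝒯] [Preadditive 𝒯]
    [Linear R 𝒯] [MonoidalCategory 𝒯] {I : Type w} (C : I → 𝒯) (W : MorphismProperty 𝒯) :
    Type (max u w)
  | of (X : 𝒯)
  | inv (i : I)
  | unit
  | tensor (X Y : FreeLoc R C W)

namespace FreeLoc

/-- Terms for the morphisms of `FreeLoc R C W`. -/
inductive Tm : FreeLoc R C W → FreeLoc R C W → Type (max u v w x)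
  | id (X : FreeLoc R C W) : Tm X X
  | comp {X Y Z : FreeLoc R C W} (f : Tm X Y) (g : Tm Y Z) : Tm X Z
  | whiskerLeft (X : FreeLoc R C W) {Y Z : FreeLoc R C W} (f : Tm Y Z) : Tm (X.tensor Y) (X.tensor Z)
  | whiskerRight {X Y : FreeLoc R C W} (f : Tm X Y) (Z : FreeLoc R C W) : Tm (X.tensor Z) (Y.tensor Z)
  | αHom (X Y Z : FreeLoc R C W) : Tm ((X.tensor Y).tensor Z) (X.tensor (Y.tensor Z))
  | αInv (X Y Z : FreeLoc R C W) : Tm (X.tensor (Y.tensor Z)) ((X.tensor Y).tensor Z)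
  | lHom (X : FreeLoc R C W) : Tm (unit.tensor X) X
  | lInv (X : FreeLoc R C W) : Tm X (unit.tensor X)
  | rHom (X : FreeLoc R C W) : Tm (X.tensor unit) X
  | rInv (X : FreeLoc R C W) : Tm X (X.tensor unit)
  | of {X Y : 𝒯} (f : X ⟶ Y) : Tm (of X) (of Y)
  | ε : Tm unit (of (𝟙_ 𝒯))
  | η : Tm (of (𝟙_ 𝒯)) unit
  | μ (X Y : 𝒯) : Tm ((of X).tensor (of Y)) (of (X ⊗ Y))
  | δ (X Y : 𝒯) : Tm (of (X ⊗ Y)) ((of X).tensor (of Y))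
  | winv {X Y : 𝒯} (f : X ⟶ Y) (hf : W f) : Tm (of Y) (of X)
  | ev (i : I) : Tm ((inv i).tensor (of (C i))) unit
  | evInv (i : I) : Tm unit ((inv i).tensor (of (C i)))
  | coev (i : I) : Tm unit ((of (C i)).tensor (inv i))
  | coevInv (i : I) : Tm ((of (C i)).tensor (inv i)) unit
  | zero (X Y : FreeLoc R C W) : Tm X Y
  | add {X Y : FreeLoc R C W} (f g : Tm X Y) : Tm X Y
  | smul {X Y : FreeLoc R C W} (r : R) (f : Tm X Y) : Tm X Y

/-- The defining relations of `FreeLoc R C W`. -/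
inductive Rel : ∀ {X Y : FreeLoc R C W}, Tm R C W X Y → Tm R C W X Y → Prop
  | comp_left {X Y Z} {f f' : Tm R C W X Y} (g : Tm R C W Y Z) : Rel f f' →
      Rel (f.comp g) (f'.comp g)
  | comp_right {X Y Z} (f : Tm R C W X Y) {g g' : Tm R C W Y Z} : Rel g g' →
      Rel (f.comp g) (f.comp g')
  | wl (X) {Y Z} {f f' : Tm R C W Y Z} : Rel f f' → Rel (f.whiskerLeft X) (f'.whiskerLeft X)
  | wr {X Y} {f f' : Tm R C W X Y} (Z) : Rel f f' → Rel (f.whiskerRight Z) (f'.whiskerRight Z)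
  | add_left {X Y} {f f' : Tm R C W X Y} (g : Tm R C W X Y) : Rel f f' → Rel (f.add g) (f'.add g)
  | add_right {X Y} (f : Tm R C W X Y) {g g' : Tm R C W X Y} : Rel g g' → Rel (f.add g) (f.add g')
  | smul {X Y} (r : R) {f f' : Tm R C W X Y} : Rel f f' → Rel (f.smul r) (f'.smul r)
  | id_comp {X Y} (f : Tm R C W X Y) : Rel ((Tm.id X).comp f) f
  | comp_id {X Y} (f : Tm R C W X Y) : Rel (f.comp (Tm.id Y)) f
  | assoc {X Y Z V} (f : Tm R C W X Y) (g : Tm R C W Y Z) (h : Tm R C W Z V) :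
      Rel ((f.comp g).comp h) (f.comp (g.comp h))
  | wl_id (X Y) : Rel ((Tm.id Y).whiskerLeft X) (Tm.id (X.tensor Y))
  | wl_comp (X) {Y Z V} (f : Tm R C W Y Z) (g : Tm R C W Z V) :
      Rel ((f.comp g).whiskerLeft X) ((f.whiskerLeft X).comp (g.whiskerLeft X))
  | unit_wl {X Y} (f : Tm R C W X Y) :
      Rel ((f.whiskerLeft unit).comp (Tm.lHom Y)) ((Tm.lHom X).comp f)
  | tensor_wl (X Y) {Z Z'} (f : Tm R C W Z Z') :
      Rel ((f.whiskerLeft (X.tensor Y)).comp (Tm.αHom X Y Z'))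
        ((Tm.αHom X Y Z).comp ((f.whiskerLeft Y).whiskerLeft X))
  | wr_id (X Y) : Rel ((Tm.id X).whiskerRight Y) (Tm.id (X.tensor Y))
  | wr_comp {X Y Z} (f : Tm R C W X Y) (g : Tm R C W Y Z) (V) :
      Rel ((f.comp g).whiskerRight V) ((f.whiskerRight V).comp (g.whiskerRight V))
  | wr_unit {X Y} (f : Tm R C W X Y) :
      Rel ((f.whiskerRight unit).comp (Tm.rHom Y)) ((Tm.rHom X).comp f)
  | wr_tensor {X X'} (f : Tm R C W X X') (Y Z) :
      Rel (((f.whiskerRight Y).whiskerRight Z).comp (Tm.αHom X' Y Z))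
        ((Tm.αHom X Y Z).comp (f.whiskerRight (Y.tensor Z)))
  | wl_wr (X) {Y Y'} (f : Tm R C W Y Y') (Z) :
      Rel (((f.whiskerLeft X).whiskerRight Z).comp (Tm.αHom X Y' Z))
        ((Tm.αHom X Y Z).comp ((f.whiskerRight Z).whiskerLeft X))
  | exchange {X Y Z V} (f : Tm R C W X Y) (g : Tm R C W Z V) :
      Rel ((g.whiskerLeft X).comp (f.whiskerRight V)) ((f.whiskerRight Z).comp (g.whiskerLeft Y))
  | αHom_αInv (X Y Z) : Rel ((Tm.αHom X Y Z).comp (Tm.αInv X Y Z)) (Tm.id _)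
  | αInv_αHom (X Y Z) : Rel ((Tm.αInv X Y Z).comp (Tm.αHom X Y Z)) (Tm.id _)
  | lHom_lInv (X) : Rel ((Tm.lHom X).comp (Tm.lInv X)) (Tm.id _)
  | lInv_lHom (X) : Rel ((Tm.lInv X).comp (Tm.lHom X)) (Tm.id _)
  | rHom_rInv (X) : Rel ((Tm.rHom X).comp (Tm.rInv X)) (Tm.id _)
  | rInv_rHom (X) : Rel ((Tm.rInv X).comp (Tm.rHom X)) (Tm.id _)
  | pentagon (X Y Z V) : Rel (((Tm.αHom X Y Z).whiskerRight V).comp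
        ((Tm.αHom X (Y.tensor Z) V).comp ((Tm.αHom Y Z V).whiskerLeft X)))
      ((Tm.αHom (X.tensor Y) Z V).comp (Tm.αHom X Y (Z.tensor V)))
  | triangle (X Y) : Rel ((Tm.αHom X unit Y).comp ((Tm.lHom Y).whiskerLeft X))
      ((Tm.rHom X).whiskerRight Y)
  | of_id (X : 𝒯) : Rel (Tm.of (𝟙 X)) (Tm.id (of X))
  | of_comp {X Y Z : 𝒯} (f : X ⟶ Y) (g : Y ⟶ Z) : Rel (Tm.of (f ≫ g)) ((Tm.of f).comp (Tm.of g))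
  | ε_η : Rel (Tm.ε.comp Tm.η) (Tm.id _)
  | η_ε : Rel (Tm.η.comp Tm.ε) (Tm.id _)
  | μ_δ (X Y : 𝒯) : Rel ((Tm.μ X Y).comp (Tm.δ X Y)) (Tm.id _)
  | δ_μ (X Y : 𝒯) : Rel ((Tm.δ X Y).comp (Tm.μ X Y)) (Tm.id _)
  | μ_left {X Y : 𝒯} (f : X ⟶ Y) (Z : 𝒯) : Rel (((Tm.of f).whiskerRight (of Z)).comp (Tm.μ Y Z))
      ((Tm.μ X Z).comp (Tm.of (f ▷ Z)))
  | μ_right (Z : 𝒯) {X Y : 𝒯} (f : X ⟶ Y) : Rel (((Tm.of f).whiskerLeft (of Z)).comp (Tm.μ Z Y))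
      ((Tm.μ Z X).comp (Tm.of (Z ◁ f)))
  | μ_assoc (X Y Z : 𝒯) : Rel (((Tm.μ X Y).whiskerRight (of Z)).comp
        ((Tm.μ (X ⊗ Y) Z).comp (Tm.of (α_ X Y Z).hom)))
      ((Tm.αHom (of X) (of Y) (of Z)).comp
        (((Tm.μ Y Z).whiskerLeft (of X)).comp (Tm.μ X (Y ⊗ Z))))
  | μ_unit_left (X : 𝒯) : Rel (Tm.lHom (of X))
      ((Tm.ε.whiskerRight (of X)).comp ((Tm.μ (𝟙_ 𝒯) X).comp (Tm.of (λ_ X).hom)))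
  | μ_unit_right (X : 𝒯) : Rel (Tm.rHom (of X))
      ((Tm.ε.whiskerLeft (of X)).comp ((Tm.μ X (𝟙_ 𝒯)).comp (Tm.of (ρ_ X).hom)))
  | comp_winv {X Y : 𝒯} (f : X ⟶ Y) (hf : W f) : Rel ((Tm.of f).comp (Tm.winv f hf)) (Tm.id _)
  | winv_comp {X Y : 𝒯} (f : X ⟶ Y) (hf : W f) : Rel ((Tm.winv f hf).comp (Tm.of f)) (Tm.id _)
  | ev_evInv (i : I) : Rel ((Tm.ev i).comp (Tm.evInv i)) (Tm.id _)
  | evInv_ev (i : I) : Rel ((Tm.evInv i).comp (Tm.ev i)) (Tm.id _)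
  | coev_coevInv (i : I) : Rel ((Tm.coev i).comp (Tm.coevInv i)) (Tm.id _)
  | coevInv_coev (i : I) : Rel ((Tm.coevInv i).comp (Tm.coev i)) (Tm.id _)
  | zigzag (i : I) : Rel (((Tm.coev i).whiskerRight (of (C i))).comp
        ((Tm.αHom _ _ _).comp ((Tm.ev i).whiskerLeft (of (C i)))))
      ((Tm.lHom _).comp (Tm.rInv _))
  | add_assoc {X Y} (f g h : Tm R C W X Y) : Rel ((f.add g).add h) (f.add (g.add h))
  | add_comm {X Y} (f g : Tm R C W X Y) : Rel (f.add g) (g.add f)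
  | zero_add {X Y} (f : Tm R C W X Y) : Rel ((Tm.zero X Y).add f) f
  | one_smul {X Y} (f : Tm R C W X Y) : Rel (f.smul 1) f
  | mul_smul {X Y} (r s : R) (f : Tm R C W X Y) : Rel (f.smul (r * s)) ((f.smul s).smul r)
  | smul_add {X Y} (r : R) (f g : Tm R C W X Y) :
      Rel ((f.add g).smul r) ((f.smul r).add (g.smul r))
  | add_smul {X Y} (r s : R) (f : Tm R C W X Y) :
      Rel (f.smul (r + s)) ((f.smul r).add (f.smul s))
  | zero_smul {X Y} (f : Tm R C W X Y) : Rel (f.smul 0) (Tm.zero X Y)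
  | add_comp {X Y Z} (f f' : Tm R C W X Y) (g : Tm R C W Y Z) :
      Rel ((f.add f').comp g) ((f.comp g).add (f'.comp g))
  | comp_add {X Y Z} (f : Tm R C W X Y) (g g' : Tm R C W Y Z) :
      Rel (f.comp (g.add g')) ((f.comp g).add (f.comp g'))
  | smul_comp {X Y Z} (r : R) (f : Tm R C W X Y) (g : Tm R C W Y Z) :
      Rel ((f.smul r).comp g) ((f.comp g).smul r)
  | comp_smul {X Y Z} (f : Tm R C W X Y) (r : R) (g : Tm R C W Y Z) :
      Rel (f.comp (g.smul r)) ((f.comp g).smul r)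
  | wl_add (X) {Y Z} (f g : Tm R C W Y Z) :
      Rel ((f.add g).whiskerLeft X) ((f.whiskerLeft X).add (g.whiskerLeft X))
  | wr_add {X Y} (f g : Tm R C W X Y) (Z) :
      Rel ((f.add g).whiskerRight Z) ((f.whiskerRight Z).add (g.whiskerRight Z))
  | wl_smul (X) {Y Z} (r : R) (f : Tm R C W Y Z) :
      Rel ((f.smul r).whiskerLeft X) ((f.whiskerLeft X).smul r)
  | wr_smul {X Y} (r : R) (f : Tm R C W X Y) (Z) :
      Rel ((f.smul r).whiskerRight Z) ((f.whiskerRight Z).smul r)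
  | of_add {X Y : 𝒯} (f g : X ⟶ Y) : Rel (Tm.of (f + g)) ((Tm.of f).add (Tm.of g))
  | of_smul {X Y : 𝒯} (r : R) (f : X ⟶ Y) : Rel (Tm.of (r • f)) ((Tm.of f).smul r)

variable {R C W}

instance : Category (FreeLoc R C W) where
  Hom X Y := Quot (Rel R C W (X := X) (Y := Y))
  id X := Quot.mk _ (Tm.id X)
  comp := Quot.map₂ Tm.comp (fun f _ _ h => .comp_right f h) (fun _ _ g h => .comp_left g h)
  id_comp := by rintro X Y ⟨f⟩; exact Quot.sound (.id_comp f)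
  comp_id := by rintro X Y ⟨f⟩; exact Quot.sound (.comp_id f)
  assoc := by rintro X Y Z V ⟨f⟩ ⟨g⟩ ⟨h⟩; exact Quot.sound (.assoc f g h)

/-- The morphism represented by a term. -/
def mk {X Y : FreeLoc R C W} (f : Tm R C W X Y) : X ⟶ Y := Quot.mk _ f

instance (X Y : FreeLoc R C W) : Add (X ⟶ Y) :=
  ⟨Quot.map₂ Tm.add (fun f _ _ h => .add_right f h) (fun _ _ g h => .add_left g h)⟩

instance (X Y : FreeLoc R C W) : Zero (X ⟶ Y) := ⟨mk (Tm.zero X Y)⟩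

instance (X Y : FreeLoc R C W) : Neg (X ⟶ Y) :=
  ⟨Quot.map (Tm.smul (-1)) (fun _ _ h => .smul _ h)⟩

instance (X Y : FreeLoc R C W) : AddCommGroup (X ⟶ Y) where
  nsmul := nsmulRec
  zsmul := zsmulRec
  add_assoc := by rintro ⟨f⟩ ⟨g⟩ ⟨h⟩; exact Quot.sound (.add_assoc f g h)
  add_comm := by rintro ⟨f⟩ ⟨g⟩; exact Quot.sound (.add_comm f g)
  zero_add := by rintro ⟨f⟩; exact Quot.sound (.zero_add f)
  add_zero := by
    rintro ⟨f⟩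
    exact (Quot.sound (.add_comm f _)).trans (Quot.sound (.zero_add f))
  neg_add_cancel := by
    rintro ⟨f⟩
    refine Eq.trans ?_ (Quot.sound (.zero_smul f))
    rw [← neg_add_cancel (1 : R)]
    refine Eq.trans ?_ (Quot.sound (.add_smul _ _ f)).symm
    exact Quot.sound (.add_right _ (.one_smul f)) |>.symm

instance (X Y : FreeLoc R C W) : Module R (X ⟶ Y) where
  smul r := Quot.map (Tm.smul r) (fun _ _ h => .smul _ h)
  one_smul := by rintro ⟨f⟩; exact Quot.sound (.one_smul f)
  mul_smul := by rintro r s ⟨f⟩; exact Quot.sound (.mul_smul r s f)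
  smul_zero r := by
    refine Eq.trans ?_ (Quot.sound (.zero_smul (Tm.zero X Y)))
    have h : (r * 0 : R) = 0 := mul_zero r
    exact (Quot.sound (.smul r (.zero_smul (Tm.zero X Y)))).symm.trans
      ((Quot.sound (.mul_smul r 0 _)).symm.trans (by rw [h]))
  smul_add := by rintro r ⟨f⟩ ⟨g⟩; exact Quot.sound (.smul_add r f g)
  add_smul := by rintro r s ⟨f⟩; exact Quot.sound (.add_smul r s f)
  zero_smul := by rintro ⟨f⟩; exact Quot.sound (.zero_smul f)

instance : Preadditive (FreeLoc R C W) where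
  add_comp := by rintro X Y Z ⟨f⟩ ⟨f'⟩ ⟨g⟩; exact Quot.sound (.add_comp f f' g)
  comp_add := by rintro X Y Z ⟨f⟩ ⟨g⟩ ⟨g'⟩; exact Quot.sound (.comp_add f g g')

instance : Linear R (FreeLoc R C W) where
  smul_comp := by rintro X Y Z r ⟨f⟩ ⟨g⟩; exact Quot.sound (.smul_comp r f g)
  comp_smul := by rintro X Y Z ⟨f⟩ r ⟨g⟩; exact Quot.sound (.comp_smul f r g)

instance : MonoidalCategoryStruct (FreeLoc R C W) where
  tensorObj := tensor
  tensorUnit := unit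
  whiskerLeft X _ _ := Quot.map (Tm.whiskerLeft X) (fun _ _ h => .wl X h)
  whiskerRight f Z := Quot.map (Tm.whiskerRight · Z) (fun _ _ h => .wr Z h) f
  associator X Y Z := ⟨mk (Tm.αHom X Y Z), mk (Tm.αInv X Y Z), Quot.sound (.αHom_αInv X Y Z),
    Quot.sound (.αInv_αHom X Y Z)⟩
  leftUnitor X := ⟨mk (Tm.lHom X), mk (Tm.lInv X), Quot.sound (.lHom_lInv X),
    Quot.sound (.lInv_lHom X)⟩
  rightUnitor X := ⟨mk (Tm.rHom X), mk (Tm.rInv X), Quot.sound (.rHom_rInv X),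
    Quot.sound (.rInv_rHom X)⟩

instance : MonoidalCategory (FreeLoc R C W) :=
  have wl_comp : ∀ (X) {Y Z V : FreeLoc R C W} (f : Y ⟶ Z) (g : Z ⟶ V),
      X ◁ (f ≫ g) = X ◁ f ≫ X ◁ g := by
    rintro X Y Z V ⟨f⟩ ⟨g⟩; exact Quot.sound (.wl_comp X f g)
  have wr_comp : ∀ {X Y Z : FreeLoc R C W} (f : X ⟶ Y) (g : Y ⟶ Z) (V),
      (f ≫ g) ▷ V = f ▷ V ≫ g ▷ V := by
    rintro X Y Z ⟨f⟩ ⟨g⟩ V; exact Quot.sound (.wr_comp f g V)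
  have exchange : ∀ {X Y Z V : FreeLoc R C W} (f : X ⟶ Y) (g : Z ⟶ V),
      X ◁ g ≫ f ▷ V = f ▷ Z ≫ Y ◁ g := by
    rintro X Y Z V ⟨f⟩ ⟨g⟩; exact Quot.sound (.exchange f g)
  have αl : ∀ {X X' : FreeLoc R C W} (f : X ⟶ X') (Y Z),
      f ▷ Y ▷ Z ≫ (α_ X' Y Z).hom = (α_ X Y Z).hom ≫ f ▷ (Y ⊗ Z) := by
    rintro X X' ⟨f⟩ Y Z; exact Quot.sound (.wr_tensor f Y Z)
  have αm : ∀ (X) {Y Y' : FreeLoc R C W} (f : Y ⟶ Y') (Z),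
      (X ◁ f) ▷ Z ≫ (α_ X Y' Z).hom = (α_ X Y Z).hom ≫ X ◁ f ▷ Z := by
    rintro X Y Y' ⟨f⟩ Z; exact Quot.sound (.wl_wr X f Z)
  have αr : ∀ (X Y) {Z Z' : FreeLoc R C W} (f : Z ⟶ Z'),
      (X ⊗ Y) ◁ f ≫ (α_ X Y Z').hom = (α_ X Y Z).hom ≫ X ◁ Y ◁ f := by
    rintro X Y Z Z' ⟨f⟩; exact Quot.sound (.tensor_wl X Y f)
  { tensorHom_def := fun f g => rfl
    id_tensorHom_id := fun X Y => (Category.comp_id _).symm.trans (by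
      change (𝟙 X ▷ Y ≫ X ◁ 𝟙 Y) ≫ 𝟙 _ = _
      rw [Category.comp_id]
      exact (congrArg₂ (· ≫ ·) (Quot.sound (.wr_id X Y)) (Quot.sound (.wl_id X Y))).trans
        (Category.comp_id _))
    tensorHom_comp_tensorHom := fun {X₁ Y₁ Z₁ X₂ Y₂ Z₂} f₁ f₂ g₁ g₂ => by
      change (f₁ ▷ X₂ ≫ Y₁ ◁ f₂) ≫ (g₁ ▷ Y₂ ≫ Z₁ ◁ g₂) = (f₁ ≫ g₁) ▷ X₂ ≫ Z₁ ◁ (f₂ ≫ g₂)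
      rw [wl_comp, wr_comp, Category.assoc, ← Category.assoc (Y₁ ◁ f₂), exchange]
      simp only [Category.assoc]
    whiskerLeft_id := fun X Y => Quot.sound (.wl_id X Y)
    id_whiskerRight := fun X Y => Quot.sound (.wr_id X Y)
    associator_naturality := fun {X₁ X₂ X₃ Y₁ Y₂ Y₃} f₁ f₂ f₃ => by
      change ((f₁ ▷ X₂ ≫ Y₁ ◁ f₂) ▷ X₃ ≫ (Y₁ ⊗ Y₂) ◁ f₃) ≫ _ =
        _ ≫ (f₁ ▷ (X₂ ⊗ X₃) ≫ Y₁ ◁ (f₂ ▷ X₃ ≫ Y₂ ◁ f₃))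
      rw [wl_comp, wr_comp, Category.assoc, Category.assoc, αr, ← Category.assoc ((Y₁ ◁ f₂) ▷ X₃),
        αm, Category.assoc, ← Category.assoc (f₁ ▷ X₂ ▷ X₃), αl, Category.assoc]
    leftUnitor_naturality := by rintro X Y ⟨f⟩; exact Quot.sound (.unit_wl f)
    rightUnitor_naturality := by rintro X Y ⟨f⟩; exact Quot.sound (.wr_unit f)
    pentagon := fun X Y Z V => Quot.sound (.pentagon X Y Z V)
    triangle := fun X Y => Quot.sound (.triangle X Y) }

instance : MonoidalPreadditive (FreeLoc R C W) where
  whiskerLeft_zero {X Y Z} := (by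
    have h : X ◁ (0 : Y ⟶ Z) = X ◁ ((0 : R) • 0) := by rw [smul_zero]
    exact h.trans ((Quot.sound (.wl_smul X 0 _)).trans (Quot.sound (.zero_smul _))))
  zero_whiskerRight {X Y Z} := (by
    have h : (0 : Y ⟶ Z) ▷ X = ((0 : R) • 0) ▷ X := by rw [smul_zero]
    exact h.trans ((Quot.sound (.wr_smul 0 _ X)).trans (Quot.sound (.zero_smul _))))
  whiskerLeft_add := by rintro X Y Z ⟨f⟩ ⟨g⟩; exact Quot.sound (.wl_add X f g)
  add_whiskerRight := by rintro X Y Z ⟨f⟩ ⟨g⟩; exact Quot.sound (.wr_add f g X)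

instance : MonoidalLinear R (FreeLoc R C W) where
  whiskerLeft_smul := by rintro X Y Z r ⟨f⟩; exact Quot.sound (.wl_smul X r f)
  smul_whiskerRight := by rintro r Y Z ⟨f⟩ X; exact Quot.sound (.wr_smul r f X)

variable (R C W)

/-- The canonical functor from `𝒯`. -/
def ι : 𝒯 ⥤ FreeLoc R C W where
  obj := of
  map f := mk (Tm.of f)
  map_id X := Quot.sound (.of_id X)
  map_comp f g := Quot.sound (.of_comp f g)

/-- The monoidal structure of the canonical functor. -/
def ιCoreMonoidal : (ι R C W).CoreMonoidal where
  εIso := ⟨mk Tm.ε, mk Tm.η, Quot.sound .ε_η, Quot.sound .η_ε⟩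
  μIso X Y := ⟨mk (Tm.μ X Y), mk (Tm.δ X Y), Quot.sound (.μ_δ X Y), Quot.sound (.δ_μ X Y)⟩
  μIso_hom_natural_left f Z := Quot.sound (.μ_left f Z)
  μIso_hom_natural_right Z f := Quot.sound (.μ_right Z f)
  associativity X Y Z := Quot.sound (.μ_assoc X Y Z)
  left_unitality X := Quot.sound (.μ_unit_left X)
  right_unitality X := Quot.sound (.μ_unit_right X)

instance : (ι R C W).Monoidal := (ιCoreMonoidal R C W).toMonoidal

instance : (ι R C W).Additive where
  map_add := Quot.sound (.of_add _ _)

instance : (ι R C W).Linear R where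
  map_smul _ _ := Quot.sound (.of_smul _ _)

variable {R W}

/-- The inverse of `Υ(f)` for `f` in `W`. -/
def winv {X Y : 𝒯} (f : X ⟶ Y) (hf : W f) : (ι R C W).obj Y ⟶ (ι R C W).obj X :=
  mk (Tm.winv f hf)

lemma map_winv {X Y : 𝒯} (f : X ⟶ Y) (hf : W f) : (ι R C W).map f ≫ winv C f hf = 𝟙 _ :=
  Quot.sound (.comp_winv f hf)

lemma winv_map {X Y : 𝒯} (f : X ⟶ Y) (hf : W f) : winv C f hf ≫ (ι R C W).map f = 𝟙 _ :=
  Quot.sound (.winv_comp f hf)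

variable (R W)

/-- The evaluation of the inverse of `C i`. -/
def ev (i : I) : (inv i : FreeLoc R C W) ⊗ (ι R C W).obj (C i) ≅ 𝟙_ _ :=
  ⟨mk (Tm.ev i), mk (Tm.evInv i), Quot.sound (.ev_evInv i), Quot.sound (.evInv_ev i)⟩

/-- The coevaluation of the inverse of `C i`. -/
def coev (i : I) : 𝟙_ _ ≅ (ι R C W).obj (C i) ⊗ (inv i : FreeLoc R C W) :=
  ⟨mk (Tm.coev i), mk (Tm.coevInv i), Quot.sound (.coev_coevInv i), Quot.sound (.coevInv_coev i)⟩

lemma zigzag (i : I) : (coev R C W i).hom ▷ (ι R C W).obj (C i) ≫ (α_ _ _ _).hom ≫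
    (ι R C W).obj (C i) ◁ (ev R C W i).hom = (λ_ _).hom ≫ (ρ_ _).inv :=
  Quot.sound (.zigzag i)

variable {R C W}

open Functor.LaxMonoidal Functor.OplaxMonoidal in
/-- To prove a property of all morphisms of `FreeLoc R C W`, it is enough to treat the generators
and to show that the property is stable under the operations. -/
theorem hom_induction {P : ∀ {X Y : FreeLoc R C W}, (X ⟶ Y) → Prop}
    (id : ∀ X : FreeLoc R C W, P (𝟙 X))
    (comp : ∀ {X Y Z : FreeLoc R C W} (f : X ⟶ Y) (g : Y ⟶ Z), P f → P g → P (f ≫ g))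
    (wl : ∀ (X) {Y Z : FreeLoc R C W} (f : Y ⟶ Z), P f → P (X ◁ f))
    (wr : ∀ {Y Z : FreeLoc R C W} (f : Y ⟶ Z) (X), P f → P (f ▷ X))
    (αHom : ∀ X Y Z : FreeLoc R C W, P (α_ X Y Z).hom)
    (αInv : ∀ X Y Z : FreeLoc R C W, P (α_ X Y Z).inv)
    (lHom : ∀ X : FreeLoc R C W, P (λ_ X).hom) (lInv : ∀ X : FreeLoc R C W, P (λ_ X).inv)
    (rHom : ∀ X : FreeLoc R C W, P (ρ_ X).hom) (rInv : ∀ X : FreeLoc R C W, P (ρ_ X).inv)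
    (map : ∀ {X Y : 𝒯} (f : X ⟶ Y), P ((ι R C W).map f))
    (hε : P (ε (ι R C W))) (hη : P (η (ι R C W)))
    (hμ : ∀ X Y, P (μ (ι R C W) X Y)) (hδ : ∀ X Y, P (δ (ι R C W) X Y))
    (hwinv : ∀ {X Y : 𝒯} (f : X ⟶ Y) (hf : W f), P (winv (R := R) C f hf))
    (evHom : ∀ i, P (ev R C W i).hom) (evInv : ∀ i, P (ev R C W i).inv)
    (coevHom : ∀ i, P (coev R C W i).hom) (coevInv : ∀ i, P (coev R C W i).inv)
    (zero : ∀ X Y : FreeLoc R C W, P (0 : X ⟶ Y))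
    (add : ∀ {X Y : FreeLoc R C W} (f g : X ⟶ Y), P f → P g → P (f + g))
    (smul : ∀ {X Y : FreeLoc R C W} (r : R) (f : X ⟶ Y), P f → P (r • f))
    {X Y : FreeLoc R C W} (f : X ⟶ Y) : P f := by
  induction f using Quot.ind with
  | mk f =>
    induction f with
    | id X => exact id X
    | comp f g hf hg => exact comp _ _ hf hg
    | whiskerLeft X f hf => exact wl X _ hf
    | whiskerRight f X hf => exact wr _ X hf
    | αHom X Y Z => exact αHom X Y Z
    | αInv X Y Z => exact αInv X Y Z
    | lHom X => exact lHom X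
    | lInv X => exact lInv X
    | rHom X => exact rHom X
    | rInv X => exact rInv X
    | of f => exact map f
    | ε => exact hε
    | η => exact hη
    | μ X Y => exact hμ X Y
    | δ X Y => exact hδ X Y
    | winv f hf => exact hwinv f hf
    | ev i => exact evHom i
    | evInv i => exact evInv i
    | coev i => exact coevHom i
    | coevInv i => exact coevInv i
    | zero X Y => exact zero X Y
    | add f g hf hg => exact add _ _ hf hg
    | smul r f hf => exact smul r _ hf

end FreeLoc

end FreeLocalization

section InvertibleObjects

variable {𝒟 : Type*} [Category 𝒟] [MonoidalCategory 𝒟]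

/-- An invertible object has an inverse, with a zigzag identity. -/
lemma IsInvertibleObj.exists_inverse {X : 𝒟} (h : IsInvertibleObj X) :
    ∃ (D : 𝒟) (ev : D ⊗ X ≅ 𝟙_ 𝒟) (coev : 𝟙_ 𝒟 ≅ X ⊗ D),
      coev.hom ▷ X ≫ (α_ X D X).hom ≫ X ◁ ev.hom = (λ_ X).hom ≫ (ρ_ X).inv := by
  have := h.1
  let D := (tensorLeft X).objPreimage (𝟙_ 𝒟)
  let coev : X ⊗ D ≅ 𝟙_ 𝒟 := (tensorLeft X).objObjPreimageIso (𝟙_ 𝒟)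
  let e : (tensorLeft X).obj (D ⊗ X) ≅ (tensorLeft X).obj (𝟙_ 𝒟) :=
    (α_ X D X).symm ≪≫ whiskerRightIso coev X ≪≫ λ_ X ≪≫ (ρ_ X).symm
  refine ⟨D, (tensorLeft X).preimageIso e, coev.symm, ?_⟩
  have : X ◁ ((tensorLeft X).preimageIso e).hom = e.hom := (tensorLeft X).map_preimage e.hom
  rw [this]
  simp only [Iso.symm_hom, Iso.trans_hom, whiskerRightIso_hom, Iso.hom_inv_id_assoc, e]
  rw [← comp_whiskerRight_assoc, Iso.inv_hom_id, id_whiskerRight, Category.id_comp]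

/-- An object with a two-sided inverse is invertible. -/
lemma IsInvertibleObj.of_iso {X D : 𝒟} (e : D ⊗ X ≅ 𝟙_ 𝒟) (c : X ⊗ D ≅ 𝟙_ 𝒟) :
    IsInvertibleObj X := by
  have aux : ∀ {X D : 𝒟} (_ : D ⊗ X ≅ 𝟙_ 𝒟), tensorLeft X ⋙ tensorLeft D ≅ 𝟭 𝒟 := fun {X D} e =>
    NatIso.ofComponents (fun Y => (α_ D X Y).symm ≪≫ whiskerRightIso e Y ≪≫ λ_ Y) (by
      intro Y Z f
      change D ◁ X ◁ f ≫ ((α_ D X Z).inv ≫ e.hom ▷ Z ≫ (λ_ Z).hom) =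
        ((α_ D X Y).inv ≫ e.hom ▷ Y ≫ (λ_ Y).hom) ≫ f
      rw [associator_inv_naturality_right_assoc, whisker_exchange_assoc, leftUnitor_naturality]
      simp only [Category.assoc])
  have aux' : ∀ {X D : 𝒟} (_ : X ⊗ D ≅ 𝟙_ 𝒟), tensorRight X ⋙ tensorRight D ≅ 𝟭 𝒟 :=
    fun {X D} e =>
    NatIso.ofComponents (fun Y => (α_ Y X D) ≪≫ whiskerLeftIso Y e ≪≫ ρ_ Y) (by
      intro Y Z f
      change f ▷ X ▷ D ≫ ((α_ Z X D).hom ≫ Z ◁ e.hom ≫ (ρ_ Z).hom) =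
        ((α_ Y X D).hom ≫ Y ◁ e.hom ≫ (ρ_ Y).hom) ≫ f
      rw [associator_naturality_left_assoc, ← whisker_exchange_assoc, rightUnitor_naturality]
      simp only [Category.assoc])
  exact ⟨(CategoryTheory.Equivalence.mk (tensorLeft X) (tensorLeft D) (aux e).symm
    (aux c)).isEquivalence_functor, (CategoryTheory.Equivalence.mk (tensorRight X) (tensorRight D)
    (aux' c).symm (aux' e)).isEquivalence_functor⟩

lemma whiskerRight_cancel {X D : 𝒟} (c : X ⊗ D ≅ 𝟙_ 𝒟) {Y Z : 𝒟} {f g : Y ⟶ Z}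
    (h : f ▷ X = g ▷ X) : f = g := by
  have key : ∀ f : Y ⟶ Z, f = (ρ_ Y).inv ≫ Y ◁ c.inv ≫ (α_ Y X D).inv ≫ (f ▷ X) ▷ D ≫
      (α_ Z X D).hom ≫ Z ◁ c.hom ≫ (ρ_ Z).hom := by
    intro f
    rw [associator_naturality_left_assoc, ← whisker_exchange_assoc, rightUnitor_naturality,
      Iso.inv_hom_id_assoc, ← whiskerLeft_comp_assoc, c.inv_hom_id]
    simp
  rw [key f, key g, h]

lemma whiskerLeft_cancel {X D : 𝒟} (c : D ⊗ X ≅ 𝟙_ 𝒟) {Y Z : 𝒟} {f g : Y ⟶ Z}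
    (h : X ◁ f = X ◁ g) : f = g := by
  have key : ∀ f : Y ⟶ Z, f = (λ_ Y).inv ≫ c.inv ▷ Y ≫ (α_ D X Y).hom ≫ D ◁ (X ◁ f) ≫
      (α_ D X Z).inv ≫ c.hom ▷ Z ≫ (λ_ Z).hom := by
    intro f
    rw [associator_inv_naturality_right_assoc, whisker_exchange_assoc, leftUnitor_naturality,
      Iso.hom_inv_id_assoc, ← comp_whiskerRight_assoc, c.inv_hom_id]
    simp
  rw [key f, key g, h]

/-- An isomorphism between objects with inverses induces a morphism between the inverses. -/
def inverseMap {D₁ D₂ C₁ C₂ : 𝒟} (e₁ : D₁ ⊗ C₁ ≅ 𝟙_ 𝒟) (c₂ : 𝟙_ 𝒟 ≅ C₂ ⊗ D₂) (s : C₁ ≅ C₂) :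
    D₁ ≅ D₂ :=
  (ρ_ D₁).symm ≪≫ whiskerLeftIso D₁ c₂ ≪≫ whiskerLeftIso D₁ (whiskerRightIso s.symm D₂) ≪≫
    (α_ _ _ _).symm ≪≫ whiskerRightIso e₁ D₂ ≪≫ λ_ D₂

lemma inverseMap_ev {D₁ D₂ C₁ C₂ : 𝒟} (e₁ : D₁ ⊗ C₁ ≅ 𝟙_ 𝒟) (e₂ : D₂ ⊗ C₂ ≅ 𝟙_ 𝒟)
    (c₂ : 𝟙_ 𝒟 ≅ C₂ ⊗ D₂) (s : C₁ ≅ C₂)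
    (h₂ : c₂.hom ▷ C₂ ≫ (α_ C₂ D₂ C₂).hom ≫ C₂ ◁ e₂.hom = (λ_ C₂).hom ≫ (ρ_ C₂).inv) :
    ((inverseMap e₁ c₂ s).hom ⊗ₘ s.hom) ≫ e₂.hom = e₁.hom := by
  calc _ = 𝟙 _ ⊗≫ D₁ ◁ c₂.hom ▷ C₁ ⊗≫ D₁ ◁ s.inv ▷ (D₂ ⊗ C₁) ⊗≫
        (e₁.hom ▷ (D₂ ⊗ C₁) ≫ 𝟙_ 𝒟 ◁ (D₂ ◁ s.hom ≫ e₂.hom)) ⊗≫ 𝟙 _ := by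
        simp only [inverseMap, Iso.trans_hom, MonoidalCategory.tensorHom_def, Iso.symm_hom, whiskerLeftIso_hom,
          whiskerRightIso_hom]
        monoidal
    _ = 𝟙 _ ⊗≫ D₁ ◁ c₂.hom ▷ C₁ ⊗≫ D₁ ◁ (s.inv ▷ (D₂ ⊗ C₁) ≫ C₁ ◁ (D₂ ◁ s.hom ≫ e₂.hom)) ⊗≫
        e₁.hom ⊗≫ 𝟙 _ := by
        rw [← whisker_exchange]; monoidal
    _ = 𝟙 _ ⊗≫ D₁ ◁ (c₂.hom ▷ C₁ ≫ (C₂ ⊗ D₂) ◁ s.hom) ⊗≫ D₁ ◁ C₂ ◁ e₂.hom ⊗≫ D₁ ◁ s.inv ⊗≫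
        e₁.hom ⊗≫ 𝟙 _ := by
        rw [← whisker_exchange]; monoidal
    _ = 𝟙 _ ⊗≫ D₁ ◁ s.hom ⊗≫ D₁ ◁ (c₂.hom ▷ C₂ ≫ (α_ C₂ D₂ C₂).hom ≫ C₂ ◁ e₂.hom) ⊗≫
        D₁ ◁ s.inv ⊗≫ e₁.hom ⊗≫ 𝟙 _ := by
        rw [← whisker_exchange]; monoidal
    _ = D₁ ◁ (s.hom ≫ s.inv) ≫ e₁.hom := by
        rw [h₂]; monoidal
    _ = _ := by simp

lemma inverseMap_coev {D₁ D₂ C₁ C₂ : 𝒟} (e₁ : D₁ ⊗ C₁ ≅ 𝟙_ 𝒟) (c₁ : 𝟙_ 𝒟 ≅ C₁ ⊗ D₁)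
    (c₂ : 𝟙_ 𝒟 ≅ C₂ ⊗ D₂) (s : C₁ ≅ C₂)
    (h₁ : c₁.hom ▷ C₁ ≫ (α_ C₁ D₁ C₁).hom ≫ C₁ ◁ e₁.hom = (λ_ C₁).hom ≫ (ρ_ C₁).inv) :
    c₁.hom ≫ (s.hom ⊗ₘ (inverseMap e₁ c₂ s).hom) = c₂.hom := by
  calc _ = 𝟙 _ ⊗≫ (c₁.hom ▷ 𝟙_ 𝒟 ≫ (C₁ ⊗ D₁) ◁ (c₂.hom ≫ s.inv ▷ D₂)) ⊗≫
        C₁ ◁ e₁.hom ▷ D₂ ⊗≫ s.hom ▷ D₂ := by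
        simp only [inverseMap, Iso.trans_hom, MonoidalCategory.tensorHom_def', Iso.symm_hom, whiskerLeftIso_hom,
          whiskerRightIso_hom]
        monoidal
    _ = 𝟙 _ ⊗≫ (c₂.hom ≫ s.inv ▷ D₂) ⊗≫
        (c₁.hom ▷ C₁ ≫ (α_ C₁ D₁ C₁).hom ≫ C₁ ◁ e₁.hom) ▷ D₂ ⊗≫ s.hom ▷ D₂ := by
        rw [← whisker_exchange]; monoidal
    _ = c₂.hom ≫ (s.inv ≫ s.hom) ▷ D₂ := by
        rw [h₁]; monoidal
    _ = _ := by simp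

end InvertibleObjects

namespace FreeLoc

open Functor.LaxMonoidal Functor.OplaxMonoidal

universe u v w x u' v'

variable {R : Type x} [CommRing R] {𝒯 : Type u} [Category.{v} 𝒯] [Preadditive 𝒯] [Linear R 𝒯]
  [MonoidalCategory 𝒯] {I : Type w} {C : I → 𝒯} {W : MorphismProperty 𝒯}
  {𝒟 : Type u'} [Category.{v'} 𝒟] [Preadditive 𝒟] [Linear R 𝒟] [MonoidalCategory 𝒟]

section Lift

variable (G : 𝒯 ⥤ 𝒟) [G.Monoidal] (D : I → 𝒟)

/-- The object of `𝒟` represented by an object of `FreeLoc R C W`. -/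
def evalObj : FreeLoc R C W → 𝒟
  | of X => G.obj X
  | inv i => D i
  | unit => 𝟙_ 𝒟
  | tensor X Y => evalObj X ⊗ evalObj Y

variable {D}
variable (e : ∀ i, D i ⊗ G.obj (C i) ≅ 𝟙_ 𝒟) (c : ∀ i, 𝟙_ 𝒟 ≅ G.obj (C i) ⊗ D i)
  (hW : ∀ (X Y : 𝒯) (f : X ⟶ Y), W f → IsIso (G.map f))

/-- The morphism of `𝒟` represented by a term. -/
noncomputable def evalTm : ∀ {X Y : FreeLoc R C W}, Tm R C W X Y → (evalObj G D X ⟶ evalObj G D Y)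
  | _, _, .id X => 𝟙 (evalObj G D X)
  | _, _, .comp f g => evalTm f ≫ evalTm g
  | _, _, .whiskerLeft X f => evalObj G D X ◁ evalTm f
  | _, _, .whiskerRight f X => evalTm f ▷ evalObj G D X
  | _, _, .αHom X Y Z => (α_ (evalObj G D X) (evalObj G D Y) (evalObj G D Z)).hom
  | _, _, .αInv X Y Z => (α_ (evalObj G D X) (evalObj G D Y) (evalObj G D Z)).inv
  | _, _, .lHom X => (λ_ (evalObj G D X)).hom
  | _, _, .lInv X => (λ_ (evalObj G D X)).inv
  | _, _, .rHom X => (ρ_ (evalObj G D X)).hom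
  | _, _, .rInv X => (ρ_ (evalObj G D X)).inv
  | _, _, .of f => G.map f
  | _, _, .ε => ε G
  | _, _, .η => η G
  | _, _, .μ X Y => μ G X Y
  | _, _, .δ X Y => δ G X Y
  | _, _, .winv f hf => (@asIso _ _ _ _ (G.map f) (hW _ _ f hf)).inv
  | _, _, .ev i => (e i).hom
  | _, _, .evInv i => (e i).inv
  | _, _, .coev i => (c i).hom
  | _, _, .coevInv i => (c i).inv
  | _, _, .zero _ _ => 0
  | _, _, .add f g => evalTm f + evalTm g
  | _, _, .smul r f => r • evalTm f

variable [MonoidalPreadditive 𝒟] [MonoidalLinear R 𝒟] [G.Additive] [G.Linear R]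
  (hz : ∀ i, (c i).hom ▷ G.obj (C i) ≫ (α_ _ _ _).hom ≫ G.obj (C i) ◁ (e i).hom =
    (λ_ _).hom ≫ (ρ_ _).inv)

include hz in
lemma evalTm_eq {X Y : FreeLoc R C W} {f g : Tm R C W X Y} (h : Rel R C W f g) :
    evalTm G e c hW f = evalTm G e c hW g := by
  induction h with
  | comp_left g h ih => exact congrArg (· ≫ evalTm G e c hW g) ih
  | comp_right g h ih => exact congrArg (evalTm G e c hW g ≫ ·) ih
  | wl X h ih => exact congrArg (evalObj G D X ◁ ·) ih
  | wr X h ih => exact congrArg (· ▷ evalObj G D X) ih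
  | add_left g h ih => exact congrArg (· + evalTm G e c hW g) ih
  | add_right g h ih => exact congrArg (evalTm G e c hW g + ·) ih
  | smul r h ih => exact congrArg (r • ·) ih
  | zigzag i => exact hz i
  | exchange f g => exact whisker_exchange _ _
  | wl_id => exact whiskerLeft_id _ _
  | wr_id => exact id_whiskerRight _ _
  | tensor_wl => exact associator_naturality_right _ _ _
  | wr_tensor => exact associator_naturality_left _ _ _
  | wl_wr => exact associator_naturality_middle _ _ _
  | pentagon => exact MonoidalCategory.pentagon _ _ _ _
  | triangle => exact MonoidalCategory.triangle _ _
  | μ_assoc X Y Z => exact associativity G X Y Z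
  | μ_unit_left => exact left_unitality G _
  | μ_unit_right => exact right_unitality G _
  | ε_η => exact Functor.Monoidal.ε_η G
  | η_ε => exact Functor.Monoidal.η_ε G
  | μ_δ => exact Functor.Monoidal.μ_δ G _ _
  | δ_μ => exact Functor.Monoidal.δ_μ G _ _
  | αHom_αInv => exact Iso.hom_inv_id _
  | αInv_αHom => exact Iso.inv_hom_id _
  | lHom_lInv => exact Iso.hom_inv_id _
  | lInv_lHom => exact Iso.inv_hom_id _
  | rHom_rInv => exact Iso.hom_inv_id _
  | rInv_rHom => exact Iso.inv_hom_id _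
  | of_smul r f => exact G.map_smul r f
  | of_add f g => exact G.map_add
  | add_assoc => exact _root_.add_assoc _ _ _
  | add_comm => exact _root_.add_comm _ _
  | mul_smul => exact SemigroupAction.mul_smul _ _ _
  | smul_add => exact _root_.smul_add _ _ _
  | add_smul => exact _root_.add_smul _ _ _
  | wl_add => exact MonoidalPreadditive.whiskerLeft_add _ _
  | wr_add => exact MonoidalPreadditive.add_whiskerRight _ _
  | wl_smul => exact MonoidalLinear.whiskerLeft_smul _ _ _
  | wr_smul => exact MonoidalLinear.smul_whiskerRight _ _ _
  | _ => simp [evalTm, evalObj]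

/-- The functor to `𝒟` induced by `G` and inverses of the `G(C i)`. -/
noncomputable def lift : FreeLoc R C W ⥤ 𝒟 where
  obj := evalObj G D
  map := Quot.lift (evalTm G e c hW) (fun _ _ h => evalTm_eq G e c hW hz h)
  map_id _ := rfl
  map_comp := by rintro _ _ _ ⟨f⟩ ⟨g⟩; rfl

/-- The monoidal structure of `lift`. -/
noncomputable def liftCoreMonoidal : (lift G e c hW hz : FreeLoc R C W ⥤ 𝒟).CoreMonoidal where
  εIso := Iso.refl (𝟙_ 𝒟)
  μIso X Y := Iso.refl (evalObj G D X ⊗ evalObj G D Y)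
  μIso_hom_natural_left := by
    rintro X Y ⟨f⟩ Z; exact (Category.comp_id _).trans (Category.id_comp _).symm
  μIso_hom_natural_right := by
    rintro X Y Z ⟨f⟩; exact (Category.comp_id _).trans (Category.id_comp _).symm
  associativity X Y Z := by
    change 𝟙 (evalObj G D X ⊗ evalObj G D Y) ▷ evalObj G D Z ≫ 𝟙 _ ≫ (α_ _ _ _).hom =
      (α_ _ _ _).hom ≫ evalObj G D X ◁ 𝟙 (evalObj G D Y ⊗ evalObj G D Z) ≫ 𝟙 _
    simp
  left_unitality X := by
    change (λ_ (evalObj G D X)).hom = 𝟙 (𝟙_ 𝒟) ▷ _ ≫ 𝟙 _ ≫ (λ_ (evalObj G D X)).hom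
    simp
  right_unitality X := by
    change (ρ_ (evalObj G D X)).hom = _ ◁ 𝟙 (𝟙_ 𝒟) ≫ 𝟙 _ ≫ (ρ_ (evalObj G D X)).hom
    simp

noncomputable instance : (lift G e c hW hz : FreeLoc R C W ⥤ 𝒟).Monoidal := (liftCoreMonoidal G e c hW hz).toMonoidal

instance : (lift G e c hW hz : FreeLoc R C W ⥤ 𝒟).Additive where
  map_add := by rintro _ _ ⟨f⟩ ⟨g⟩; rfl

instance : (lift G e c hW hz : FreeLoc R C W ⥤ 𝒟).Linear R where
  map_smul := by rintro _ _ ⟨f⟩ r; rfl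

/-- The functor `lift` extends `G`. -/
noncomputable def ιLift : ι R C W ⋙ lift G e c hW hz ≅ G :=
  NatIso.ofComponents (fun X => Iso.refl (G.obj X)) (fun _ =>
    (Category.comp_id _).trans (Category.id_comp _).symm)

instance : NatTrans.IsMonoidal (ιLift (R := R) G e c hW hz).hom where
  unit := by
    change (𝟙 (𝟙_ 𝒟) ≫ ε G) ≫ 𝟙 _ = ε G
    simp
  tensor X Y := by
    change (𝟙 (G.obj X ⊗ G.obj Y) ≫ μ G X Y) ≫ 𝟙 _ = (𝟙 (G.obj X) ⊗ₘ 𝟙 (G.obj Y)) ≫ μ G X Y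
    simp

end Lift

section Uniqueness

lemma map_zigzag {𝒞 ℰ : Type*} [Category 𝒞] [Category ℰ] [MonoidalCategory 𝒞]
    [MonoidalCategory ℰ] (F : 𝒞 ⥤ ℰ) [F.Monoidal] {X D : 𝒞} (e : D ⊗ X ⟶ 𝟙_ 𝒞)
    (c : 𝟙_ 𝒞 ⟶ X ⊗ D) (h : c ▷ X ≫ (α_ X D X).hom ≫ X ◁ e = (λ_ X).hom ≫ (ρ_ X).inv) :
    (ε F ≫ F.map c ≫ δ F X D) ▷ F.obj X ≫ (α_ _ _ _).hom ≫ F.obj X ◁ (μ F D X ≫ F.map e ≫ η F) =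
      (λ_ _).hom ≫ (ρ_ _).inv := by
  have h' := congrArg F.map h
  simp only [Functor.map_comp, Functor.Monoidal.map_whiskerRight, Functor.Monoidal.map_whiskerLeft,
    Functor.Monoidal.map_associator, Functor.Monoidal.map_leftUnitor,
    Functor.Monoidal.map_rightUnitor_inv, Category.assoc, Functor.Monoidal.μ_δ_assoc] at h'
  have h'' := congrArg (fun f => ε F ▷ F.obj X ≫ μ F _ _ ≫ f ≫ δ F _ _ ≫ F.obj X ◁ η F) h'
  simp only [Category.assoc, Functor.Monoidal.μ_δ_assoc] at h''
  simp only [comp_whiskerRight, MonoidalCategory.whiskerLeft_comp, Category.assoc]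
  rw [h'']
  simp [← comp_whiskerRight_assoc, ← MonoidalCategory.whiskerLeft_comp]

variable {F₁ F₂ : FreeLoc R C W ⥤ 𝒟} [F₁.Monoidal] [F₂.Monoidal]

/-- The image of the evaluation under a monoidal functor. -/
def mapEv (F : FreeLoc R C W ⥤ 𝒟) [F.Monoidal] (i : I) :
    F.obj (inv i) ⊗ F.obj (of (C i)) ≅ 𝟙_ 𝒟 :=
  Functor.Monoidal.μIso F _ _ ≪≫ F.mapIso (ev R C W i) ≪≫ (Functor.Monoidal.εIso F).symm

/-- The image of the coevaluation under a monoidal functor. -/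
def mapCoev (F : FreeLoc R C W ⥤ 𝒟) [F.Monoidal] (i : I) :
    𝟙_ 𝒟 ≅ F.obj (of (C i)) ⊗ F.obj (inv i) :=
  Functor.Monoidal.εIso F ≪≫ F.mapIso (coev R C W i) ≪≫ (Functor.Monoidal.μIso F _ _).symm

lemma mapEv_mapCoev (F : FreeLoc R C W ⥤ 𝒟) [F.Monoidal] (i : I) :
    (mapCoev F i).hom ▷ F.obj (of (C i)) ≫ (α_ _ _ _).hom ≫ F.obj (of (C i)) ◁ (mapEv F i).hom =
      (λ_ _).hom ≫ (ρ_ _).inv :=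
  map_zigzag F _ _ (zigzag R C W i)

variable (σ : ι R C W ⋙ F₁ ≅ ι R C W ⋙ F₂)

/-- The components of the isomorphism between functors that agree on `𝒯`. -/
def compareApp : ∀ Z : FreeLoc R C W, F₁.obj Z ≅ F₂.obj Z
  | of X => σ.app X
  | inv i => inverseMap (mapEv F₁ i) (mapCoev F₂ i) (σ.app (C i))
  | unit => (Functor.Monoidal.εIso F₁).symm ≪≫ Functor.Monoidal.εIso F₂
  | tensor X Y => (Functor.Monoidal.μIso F₁ X Y).symm ≪≫ (compareApp X ⊗ᵢ compareApp Y) ≪≫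
      Functor.Monoidal.μIso F₂ X Y

lemma ε_compareApp : ε F₁ ≫ (compareApp σ (𝟙_ _)).hom = ε F₂ := by
  change ε F₁ ≫ η F₁ ≫ ε F₂ = _
  simp

lemma μ_compareApp (X Y : FreeLoc R C W) : μ F₁ X Y ≫ (compareApp σ (X ⊗ Y)).hom =
    ((compareApp σ X).hom ⊗ₘ (compareApp σ Y).hom) ≫ μ F₂ X Y := by
  change μ F₁ X Y ≫ δ F₁ X Y ≫ ((compareApp σ X).hom ⊗ₘ (compareApp σ Y).hom) ≫ μ F₂ X Y = _
  simp

lemma compareApp_tensor (X Y : FreeLoc R C W) : (compareApp σ (X ⊗ Y)).hom =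
    δ F₁ X Y ≫ ((compareApp σ X).hom ⊗ₘ (compareApp σ Y).hom) ≫ μ F₂ X Y := rfl

lemma compareApp_unit : (compareApp σ (𝟙_ _)).hom = η F₁ ≫ ε F₂ := rfl

variable [MonoidalPreadditive 𝒟] [MonoidalLinear R 𝒟] [F₁.Additive] [F₁.Linear R]
  [F₂.Additive] [F₂.Linear R] [NatTrans.IsMonoidal σ.hom]

lemma compareApp_natural {X Y : FreeLoc R C W} (f : X ⟶ Y) :
    F₁.map f ≫ (compareApp σ Y).hom = (compareApp σ X).hom ≫ F₂.map f := by
  have inverse : ∀ {X Y : FreeLoc R C W} (f : X ⟶ Y) (g : Y ⟶ X), f ≫ g = 𝟙 _ → g ≫ f = 𝟙 _ →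
      F₁.map f ≫ (compareApp σ Y).hom = (compareApp σ X).hom ≫ F₂.map f →
      F₁.map g ≫ (compareApp σ X).hom = (compareApp σ Y).hom ≫ F₂.map g := by
    intro X Y f g h h' H
    calc F₁.map g ≫ (compareApp σ X).hom
        = F₁.map g ≫ ((compareApp σ X).hom ≫ F₂.map f) ≫ F₂.map g := by
          rw [Category.assoc, ← F₂.map_comp, h, F₂.map_id, Category.comp_id]
      _ = _ := by rw [← H, Category.assoc, ← F₁.map_comp_assoc, h', F₁.map_id, Category.id_comp]
  have hα : ∀ X Y Z : FreeLoc R C W, F₁.map (α_ X Y Z).hom ≫ (compareApp σ _).hom =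
      (compareApp σ _).hom ≫ F₂.map (α_ X Y Z).hom := by
    intro X Y Z
    have h₁ : ∀ {A A' B B' : 𝒟} {Z Z' : 𝒟} (p : A ⟶ A') (f : A' ⟶ B') (q : B' ⟶ B) (g : Z ⟶ Z'),
        ((p ≫ f ≫ q) ⊗ₘ g) = p ▷ Z ≫ (f ⊗ₘ g) ≫ q ▷ Z' := by
      intros; simp [MonoidalCategory.tensorHom_def, whisker_exchange]
    have h₂ : ∀ {A A' B B' : 𝒟} {Z Z' : 𝒟} (p : A ⟶ A') (f : A' ⟶ B') (q : B' ⟶ B) (g : Z ⟶ Z'),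
        (g ⊗ₘ (p ≫ f ≫ q)) = Z ◁ p ≫ (g ⊗ₘ f) ≫ Z' ◁ q := by
      intros; simp [MonoidalCategory.tensorHom_def, whisker_exchange_assoc]
    simp only [compareApp_tensor, Functor.Monoidal.map_associator, Category.assoc,
      Functor.Monoidal.μ_δ_assoc, h₁, h₂]
    simp only [← MonoidalCategory.whiskerLeft_comp_assoc, Functor.Monoidal.μ_δ,
      ← comp_whiskerRight_assoc, MonoidalCategory.whiskerLeft_id, id_whiskerRight, Category.id_comp,
      associator_naturality_assoc]
  have hl : ∀ X : FreeLoc R C W, F₁.map (λ_ X).hom ≫ (compareApp σ _).hom =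
      (compareApp σ _).hom ≫ F₂.map (λ_ X).hom := by
    intro X
    simp only [compareApp_tensor, Functor.Monoidal.map_leftUnitor, Category.assoc,
      Functor.Monoidal.μ_δ_assoc, compareApp_unit]
    rw [MonoidalCategory.tensorHom_def, comp_whiskerRight]
    simp only [Category.assoc, whisker_exchange_assoc]
    rw [← leftUnitor_naturality]
    simp only [← comp_whiskerRight_assoc, Functor.Monoidal.ε_η, id_whiskerRight, Category.id_comp,
      whisker_exchange_assoc, Category.assoc]
  have hr : ∀ X : FreeLoc R C W, F₁.map (ρ_ X).hom ≫ (compareApp σ _).hom =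
      (compareApp σ _).hom ≫ F₂.map (ρ_ X).hom := by
    intro X
    simp only [compareApp_tensor, Functor.Monoidal.map_rightUnitor, Category.assoc,
      Functor.Monoidal.μ_δ_assoc, compareApp_unit]
    rw [MonoidalCategory.tensorHom_def', MonoidalCategory.whiskerLeft_comp]
    simp only [Category.assoc, ← whisker_exchange_assoc]
    rw [← rightUnitor_naturality]
    simp
  have hε : F₁.map (ε (ι R C W)) ≫ (compareApp σ _).hom =
      (compareApp σ _).hom ≫ F₂.map (ε (ι R C W)) := by
    have := NatTrans.IsMonoidal.unit (τ := σ.hom)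
    rw [compareApp_unit]
    simp only [Functor.LaxMonoidal.comp_ε, Category.assoc] at this
    change F₁.map (ε (ι R C W)) ≫ σ.hom.app _ = _
    rw [Category.assoc, ← this]
    simp
  have hμ : ∀ X Y, F₁.map (μ (ι R C W) X Y) ≫ (compareApp σ _).hom =
      (compareApp σ _).hom ≫ F₂.map (μ (ι R C W) X Y) := by
    intro X Y
    have := NatTrans.IsMonoidal.tensor (τ := σ.hom) X Y
    rw [compareApp_tensor]
    simp only [Functor.LaxMonoidal.comp_μ, Category.assoc] at this
    change F₁.map (μ (ι R C W) X Y) ≫ σ.hom.app _ =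
      (δ F₁ _ _ ≫ (σ.hom.app X ⊗ₘ σ.hom.app Y) ≫ μ F₂ _ _) ≫ F₂.map _
    rw [Category.assoc, Category.assoc, ← this]
    simp
  have hev : ∀ i, F₁.map (ev R C W i).hom ≫ (compareApp σ _).hom =
      (compareApp σ _).hom ≫ F₂.map (ev R C W i).hom := by
    intro i
    have := inverseMap_ev (mapEv F₁ i) (mapEv F₂ i) (mapCoev F₂ i) (σ.app (C i))
      (mapEv_mapCoev F₂ i)
    change (_ ⊗ₘ _) ≫ μ F₂ _ _ ≫ F₂.map _ ≫ η F₂ = μ F₁ _ _ ≫ F₁.map _ ≫ η F₁ at this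
    have h := congrArg (fun k => δ F₁ _ _ ≫ k ≫ ε F₂) this
    simp only [Category.assoc, Functor.Monoidal.δ_μ_assoc, Functor.Monoidal.η_ε,
      Category.comp_id] at h
    rw [compareApp_tensor, Category.assoc, Category.assoc]
    exact h.symm
  have hcoev : ∀ i, F₁.map (coev R C W i).hom ≫ (compareApp σ _).hom =
      (compareApp σ _).hom ≫ F₂.map (coev R C W i).hom := by
    intro i
    have := inverseMap_coev (mapEv F₁ i) (mapCoev F₁ i) (mapCoev F₂ i) (σ.app (C i))
      (mapEv_mapCoev F₁ i)
    change (ε F₁ ≫ F₁.map _ ≫ δ F₁ _ _) ≫ (_ ⊗ₘ _) = ε F₂ ≫ F₂.map _ ≫ δ F₂ _ _ at this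
    have h := congrArg (fun k => η F₁ ≫ k ≫ μ F₂ _ _) this
    simp only [Category.assoc, Functor.Monoidal.δ_μ, Functor.Monoidal.η_ε_assoc,
      Category.comp_id] at h
    rw [compareApp_unit, Category.assoc]
    exact h
  induction f using hom_induction with
  | id X => simp
  | comp f g hf hg => simp only [Functor.map_comp, Category.assoc, hg, reassoc_of% hf]
  | wl X f hf =>
    simp only [compareApp_tensor, Functor.Monoidal.map_whiskerLeft, Category.assoc,
      Functor.Monoidal.μ_δ_assoc, MonoidalCategory.tensorHom_def]
    simp only [← whisker_exchange_assoc, ← MonoidalCategory.whiskerLeft_comp_assoc, hf]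
  | wr f X hf =>
    simp only [compareApp_tensor, Functor.Monoidal.map_whiskerRight, Category.assoc,
      Functor.Monoidal.μ_δ_assoc, MonoidalCategory.tensorHom_def']
    simp only [whisker_exchange_assoc, ← comp_whiskerRight_assoc, hf]
  | αHom X Y Z => exact hα X Y Z
  | αInv X Y Z => exact inverse _ _ (Iso.hom_inv_id _) (Iso.inv_hom_id _) (hα X Y Z)
  | lHom X => exact hl X
  | lInv X => exact inverse _ _ (Iso.hom_inv_id _) (Iso.inv_hom_id _) (hl X)
  | rHom X => exact hr X
  | rInv X => exact inverse _ _ (Iso.hom_inv_id _) (Iso.inv_hom_id _) (hr X)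
  | map f => exact σ.hom.naturality f
  | hε => exact hε
  | hη => exact inverse _ _ (Functor.Monoidal.ε_η _) (Functor.Monoidal.η_ε _) hε
  | hμ X Y => exact hμ X Y
  | hδ X Y => exact inverse _ _ (Functor.Monoidal.μ_δ _ _ _) (Functor.Monoidal.δ_μ _ _ _) (hμ X Y)
  | hwinv f hf => exact inverse _ _ (map_winv C f hf) (winv_map C f hf) (σ.hom.naturality f)
  | evHom i => exact hev i
  | evInv i => exact inverse _ _ (Iso.hom_inv_id _) (Iso.inv_hom_id _) (hev i)
  | coevHom i => exact hcoev i
  | coevInv i => exact inverse _ _ (Iso.hom_inv_id _) (Iso.inv_hom_id _) (hcoev i)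
  | zero X Y => simp
  | add f g hf hg => simp only [Functor.map_add, Preadditive.add_comp, Preadditive.comp_add, hf, hg]
  | smul r f hf => simp only [Functor.map_smul, Linear.smul_comp, Linear.comp_smul, hf]

end Uniqueness

end FreeLoc

namespace FreeLoc

open Functor.LaxMonoidal Functor.OplaxMonoidal

universe u v w x u' v' y

section Uniqueness

variable {R : Type x} [CommRing R] {𝒯 : Type u} [Category.{v} 𝒯] [Preadditive 𝒯] [Linear R 𝒯]
  [MonoidalCategory 𝒯] {I : Type w} {C : I → 𝒯} {W : MorphismProperty 𝒯}
  {𝒟 : Type u'} [Category.{v'} 𝒟] [Preadditive 𝒟] [Linear R 𝒟] [MonoidalCategory 𝒟]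
  {F₁ F₂ : FreeLoc R C W ⥤ 𝒟} [F₁.Monoidal] [F₂.Monoidal]

variable (σ : ι R C W ⋙ F₁ ≅ ι R C W ⋙ F₂)

lemma app_eq_compareApp (τ : F₁ ≅ F₂) [NatTrans.IsMonoidal τ.hom]
    (h : ∀ X : 𝒯, τ.hom.app (of X) = σ.hom.app X) (Z : FreeLoc R C W) :
    τ.hom.app Z = (compareApp σ Z).hom := by
  have tensor : ∀ X Y, τ.hom.app (X ⊗ Y) =
      δ F₁ X Y ≫ (τ.hom.app X ⊗ₘ τ.hom.app Y) ≫ μ F₂ X Y := by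
    intro X Y
    rw [← NatTrans.IsMonoidal.tensor, Functor.Monoidal.δ_μ_assoc]
  have unit' : τ.hom.app (𝟙_ _) = η F₁ ≫ ε F₂ := by
    rw [← NatTrans.IsMonoidal.unit (τ := τ.hom), Functor.Monoidal.η_ε_assoc]
  induction Z with
  | of X => exact h X
  | unit => exact unit'
  | tensor X Y hX hY =>
    refine (tensor X Y).trans ?_
    rw [hX, hY]
    rfl
  | inv i =>
    have := inverseMap_ev (mapEv F₁ i) (mapEv F₂ i) (mapCoev F₂ i) (σ.app (C i))
      (mapEv_mapCoev F₂ i)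
    change ((compareApp σ (inv i)).hom ⊗ₘ σ.hom.app _) ≫ _ = _ at this
    have h' : (τ.hom.app (inv i) ⊗ₘ σ.hom.app (C i)) ≫ (mapEv F₂ i).hom = (mapEv F₁ i).hom := by
      change _ ≫ μ F₂ _ _ ≫ F₂.map _ ≫ η F₂ = μ F₁ _ _ ≫ F₁.map _ ≫ η F₁
      rw [← h]
      have h₁ := NatTrans.IsMonoidal.tensor (τ := τ.hom) (inv i) (of (C i))
      have h₂ := τ.hom.naturality (ev R C W i).hom
      rw [unit'] at h₂
      have h₃ : F₁.map (ev R C W i).hom ≫ η F₁ = τ.hom.app _ ≫ F₂.map (ev R C W i).hom ≫ η F₂ := by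
        rw [← reassoc_of% h₂]
        simp
      rw [h₃]
      exact ((reassoc_of% h₁) _).symm
    have h₄ := (cancel_mono (mapEv F₂ i).hom).1 (h'.trans this.symm)
    rw [MonoidalCategory.tensorHom_def, MonoidalCategory.tensorHom_def] at h₄
    exact whiskerRight_cancel (mapCoev F₁ i).symm
      ((cancel_mono (F₂.obj (inv i) ◁ (σ.app (C i)).hom)).1 h₄)

end Uniqueness

end FreeLoc

section

universe u v w x u' v' y

variable (R : Type x) [CommRing R] {Λ : Type y} [AddCommGroup Λ] {𝒯 : Type u} [Category.{v} 𝒯]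
  [Preadditive 𝒯] [Linear R 𝒯] [MonoidalCategory 𝒯] {𝒢 : MonoidalGrading Λ 𝒯}
  {q : InvertibleCentralObject 𝒯} {I : Type w}

/-- The class of the morphisms `R_{C_i}(X)`. -/
inductive braidings (C : I → GradedBraider 𝒢 q) : MorphismProperty 𝒯
  | mk (i : I) {l : Λ} (X : 𝒯) (hX : 𝒢.homogeneous l X) : braidings C ((C i).R X hX)

variable (C : I → GradedBraider 𝒢 q)

/-- The universal `R`-linear monoidal category in which the `C_i` and the `R_{C_i}(X)` are
invertible. -/
abbrev BraidLoc := FreeLoc R (fun i => (C i).obj) (braidings C)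

/-- The functor from `𝒯` to the localization. -/
abbrev toBraidLoc : 𝒯 ⥤ BraidLoc R C := FreeLoc.ι R (fun i => (C i).obj) (braidings C)

/-- The inverse of `Υ(R_{C_i}(X))`. -/
def braidIso (i : I) {l : Λ} (X : 𝒯) (hX : 𝒢.homogeneous l X) :
    (toBraidLoc R C).obj ((C i).obj ⊗ X) ≅
      (toBraidLoc R C).obj (q.pow ((C i).φ l) ⊗ (X ⊗ (C i).obj)) :=
  ⟨(toBraidLoc R C).map ((C i).R X hX), FreeLoc.winv _ _ (.mk i X hX), FreeLoc.map_winv _ _ _,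
    FreeLoc.winv_map _ _ _⟩

lemma invertsBraiders_toBraidLoc : InvertsBraiders C (toBraidLoc R C) :=
  ⟨fun i => IsInvertibleObj.of_iso (FreeLoc.ev R _ _ i) (FreeLoc.coev R _ _ i).symm,
    fun i _ X hX => (braidIso R C i X hX).isIso_hom⟩

theorem hasUniversalProperty_toBraidLoc :
    HasUniversalProperty.{u', v'} R C (toBraidLoc R C) := by
  intro 𝒟' _ _ _ _ _ _ G _ _ _ hG
  constructor
  · choose D e c hz using fun i => (hG.1 i).exists_inverse
    have hW : ∀ (X Y : 𝒯) (f : X ⟶ Y), braidings C f → IsIso (G.map f) := by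
      rintro _ _ _ ⟨i, X, hX⟩
      exact hG.2 i _ X hX
    exact ⟨FreeLoc.lift G e c hW hz, inferInstance, inferInstance, inferInstance,
      FreeLoc.ιLift G e c hW hz, inferInstance⟩
  · intro F₁ F₂ _ _ _ _ _ _ θ₁ θ₂ hθ₁ hθ₂
    let σ := θ₁ ≪≫ θ₂.symm
    have : NatTrans.IsMonoidal σ.hom := by
      change NatTrans.IsMonoidal (θ₁.hom ≫ θ₂.inv)
      infer_instance
    have hσ : ∀ X, σ.hom.app X ≫ θ₂.hom.app X = θ₁.hom.app X := fun X => by simp [σ]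
    refine ⟨NatIso.ofComponents (FreeLoc.compareApp σ) (FreeLoc.compareApp_natural σ),
      ⟨⟨?_, ?_⟩, hσ⟩, ?_⟩
    · exact FreeLoc.ε_compareApp σ
    · exact FreeLoc.μ_compareApp σ
    · rintro τ ⟨hτ, hτ'⟩
      ext Z
      exact FreeLoc.app_eq_compareApp σ τ (fun X => by
        exact (cancel_mono (θ₂.hom.app X)).1 ((hτ' X).trans (hσ X).symm)) Z

end

/-! ### Coherence of the powers of a central object -/

namespace InvertibleCentralObject

variable {𝒯 : Type*} [Category 𝒯] [MonoidalCategory 𝒯] (q : InvertibleCentralObject 𝒯)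

/-- The identification of equal powers. -/
def powCast {a b : ℤ} (h : a = b) : q.pow a ⟶ q.pow b :=
  (q.power.map (Discrete.eqToHom (X := ⟨a⟩) (Y := ⟨b⟩) h)).f

/-- The product of two powers. -/
def powMul (a b : ℤ) : q.pow a ⊗ q.pow b ⟶ q.pow (a + b) :=
  (Functor.LaxMonoidal.μ q.power ⟨a⟩ ⟨b⟩).f

lemma powCast_rfl (a : ℤ) : q.powCast (rfl : a = a) = 𝟙 (q.pow a) :=
  congrArg Center.Hom.f (q.power.map_id ⟨a⟩)

lemma powAdd_hom_eq (a b c : ℤ) (h : a + b = c) :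
    (q.powAdd a b c h).hom = q.powMul a b ≫ q.powCast h := rfl

lemma powAdd_hom_eq' (a b : ℤ) : (q.powAdd a b _ rfl).hom = q.powMul a b := by
  rw [powAdd_hom_eq, powCast_rfl, Category.comp_id]

lemma powCast_trans {a b c : ℤ} (h : a = b) (h' : b = c) :
    q.powCast h ≫ q.powCast h' = q.powCast (h.trans h') := by
  subst h
  subst h'
  rw [powCast_rfl, Category.comp_id]

lemma powMul_assoc (a b c : ℤ) :
    q.powMul a b ▷ q.pow c ≫ q.powMul (a + b) c ≫ q.powCast (add_assoc a b c) =
      (α_ _ _ _).hom ≫ q.pow a ◁ q.powMul b c ≫ q.powMul a (b + c) :=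
  congrArg Center.Hom.f (Functor.LaxMonoidal.associativity q.power ⟨a⟩ ⟨b⟩ ⟨c⟩)

lemma powAdd_assoc (a b c ab bc abc : ℤ) (h₁ : a + b = ab) (h₂ : ab + c = abc) (h₃ : b + c = bc)
    (h₄ : a + bc = abc) :
    (q.powAdd a b ab h₁).hom ▷ q.pow c ≫ (q.powAdd ab c abc h₂).hom =
      (α_ _ _ _).hom ≫ q.pow a ◁ (q.powAdd b c bc h₃).hom ≫ (q.powAdd a bc abc h₄).hom := by
  subst h₁ h₃ h₂
  rw [powAdd_hom_eq', powAdd_hom_eq', powAdd_hom_eq', powAdd_hom_eq]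
  have h := congrArg (· ≫ q.powCast (add_assoc a b c).symm) (q.powMul_assoc a b c)
  simp only [Category.assoc, powCast_trans] at h
  rw [powCast_rfl, Category.comp_id] at h
  exact h

lemma zero_powAdd (b : ℤ) : (q.powZero 0 rfl).hom ▷ q.pow b ≫
    (q.powAdd 0 b b (zero_add b)).hom = (λ_ (q.pow b)).hom := by
  have h : (λ_ (q.pow b)).hom = (Functor.LaxMonoidal.ε q.power).f ▷ q.pow b ≫
      q.powMul 0 b ≫ q.powCast (zero_add b) :=
    congrArg Center.Hom.f (Functor.LaxMonoidal.left_unitality q.power ⟨b⟩)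
  have h' : (q.powZero 0 rfl).hom =
      (show 𝟙_ 𝒯 ⟶ q.pow 0 from (Functor.LaxMonoidal.ε q.power).f) ≫ q.powCast rfl := rfl
  rw [h, h', powCast_rfl, Category.comp_id]
  rfl

lemma powAdd_zero (b : ℤ) : q.pow b ◁ (q.powZero 0 rfl).hom ≫
    (q.powAdd b 0 b (add_zero b)).hom = (ρ_ (q.pow b)).hom := by
  have h : (ρ_ (q.pow b)).hom = q.pow b ◁ (Functor.LaxMonoidal.ε q.power).f ≫
      q.powMul b 0 ≫ q.powCast (add_zero b) :=
    congrArg Center.Hom.f (Functor.LaxMonoidal.right_unitality q.power ⟨b⟩)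
  have h' : (q.powZero 0 rfl).hom =
      (show 𝟙_ 𝒯 ⟶ q.pow 0 from (Functor.LaxMonoidal.ε q.power).f) ≫ q.powCast rfl := rfl
  rw [h, h', powCast_rfl, Category.comp_id]
  rfl

lemma central_natural (n : ℤ) {X Y : 𝒯} (f : X ⟶ Y) :
    q.pow n ◁ f ≫ (q.central n Y).hom = (q.central n X).hom ≫ f ▷ q.pow n :=
  (q.power.obj ⟨n⟩).2.naturality f

lemma central_tensor (n : ℤ) (X Y : 𝒯) : (q.central n (X ⊗ Y)).hom =
    (α_ _ _ _).inv ≫ (q.central n X).hom ▷ Y ≫ (α_ _ _ _).hom ≫ X ◁ (q.central n Y).hom ≫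
      (α_ _ _ _).inv :=
  (q.power.obj ⟨n⟩).2.monoidal X Y

lemma powAdd_central (a b c : ℤ) (h : a + b = c) (X : 𝒯) :
    (q.powAdd a b c h).hom ▷ X ≫ (q.central c X).hom =
      (α_ _ _ _).hom ≫ q.pow a ◁ (q.central b X).hom ≫ (α_ _ _ _).inv ≫
        (q.central a X).hom ▷ q.pow b ≫ (α_ _ _ _).hom ≫ X ◁ (q.powAdd a b c h).hom := by
  have h₀ := Center.Hom.comm (Functor.Monoidal.μIso q.power ⟨a⟩ ⟨b⟩ ≪≫ q.power.mapIso
    (Discrete.eqToIso (X := (⟨a⟩ : Discrete ℤ) ⊗ ⟨b⟩) (Y := ⟨c⟩) h)).hom X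
  have h₁ : (q.powAdd a b c h).hom ▷ X ≫ (q.central c X).hom =
    ((α_ _ _ _).hom ≫ q.pow a ◁ (q.central b X).hom ≫ (α_ _ _ _).inv ≫
        (q.central a X).hom ▷ q.pow b ≫ (α_ _ _ _).hom) ≫ X ◁ (q.powAdd a b c h).hom := h₀
  rw [h₁]
  simp only [Category.assoc]

lemma powZero_central (X : 𝒯) : (q.powZero 0 rfl).hom ▷ X ≫ (q.central 0 X).hom =
    (λ_ X).hom ≫ (ρ_ X).inv ≫ X ◁ (q.powZero 0 rfl).hom := by
  have h₀ := Center.Hom.comm (Functor.Monoidal.εIso q.power ≪≫ q.power.mapIso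
    (Discrete.eqToIso (X := 𝟙_ (Discrete ℤ)) (Y := ⟨0⟩) rfl)).hom X
  have h₁ : (q.powZero 0 rfl).hom ▷ X ≫ (q.central 0 X).hom =
    ((λ_ X).hom ≫ (ρ_ X).inv) ≫ X ◁ (q.powZero 0 rfl).hom := h₀
  rw [h₁]
  simp only [Category.assoc]

/-- The isomorphism `q ^ a X ⊗ q ^ b Y ≅ q ^ c (X ⊗ Y)` for `c = a + b`. -/
noncomputable def powTensor (a b c : ℤ) (h : a + b = c) (X Y : 𝒯) :
    (q.pow a ⊗ X) ⊗ (q.pow b ⊗ Y) ≅ q.pow c ⊗ (X ⊗ Y) :=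
  α_ _ _ _ ≪≫ whiskerLeftIso _ (q.moveLeft b X Y) ≪≫ (α_ _ _ _).symm ≪≫
    whiskerRightIso (q.powAdd a b c h) _

lemma moveLeft_hom (n : ℤ) (X Z : 𝒯) : (q.moveLeft n X Z).hom =
    (α_ X (q.pow n) Z).inv ≫ (q.central n X).inv ▷ Z ≫ (α_ (q.pow n) X Z).hom := rfl

lemma central_inv_natural (n : ℤ) {X Y : 𝒯} (f : X ⟶ Y) :
    f ▷ q.pow n ≫ (q.central n Y).inv = (q.central n X).inv ≫ q.pow n ◁ f := by
  rw [Iso.comp_inv_eq, Category.assoc, central_natural, Iso.inv_hom_id_assoc]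

lemma moveLeft_natural_left (n : ℤ) {X Y : 𝒯} (f : X ⟶ Y) (Z : 𝒯) :
    f ▷ (q.pow n ⊗ Z) ≫ (q.moveLeft n Y Z).hom =
      (q.moveLeft n X Z).hom ≫ q.pow n ◁ (f ▷ Z) := by
  simp only [moveLeft_hom, Category.assoc, associator_inv_naturality_left_assoc,
    ← comp_whiskerRight_assoc, central_inv_natural]
  simp

lemma moveLeft_natural_right (n : ℤ) (X : 𝒯) {Y Z : 𝒯} (f : Y ⟶ Z) :
    X ◁ (q.pow n ◁ f) ≫ (q.moveLeft n X Z).hom =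
      (q.moveLeft n X Y).hom ≫ q.pow n ◁ (X ◁ f) := by
  simp only [moveLeft_hom, Category.assoc, associator_inv_naturality_right_assoc,
    whisker_exchange_assoc]
  simp

lemma moveLeft_tensor (n : ℤ) (X Y Z : 𝒯) : (q.moveLeft n (X ⊗ Y) Z).hom =
    (α_ _ _ _).hom ≫ X ◁ (q.moveLeft n Y Z).hom ≫ (q.moveLeft n X (Y ⊗ Z)).hom ≫
      q.pow n ◁ (α_ _ _ _).inv := by
  have h : (q.central n (X ⊗ Y)).inv = (α_ _ _ _).hom ≫ X ◁ (q.central n Y).inv ≫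
      (α_ _ _ _).inv ≫ (q.central n X).inv ▷ Y ≫ (α_ _ _ _).hom := by
    rw [← cancel_epi (q.central n (X ⊗ Y)).hom, Iso.hom_inv_id, central_tensor]
    simp
  simp only [moveLeft_hom, h]
  monoidal

lemma moveLeft_powAdd (a b c : ℤ) (h : a + b = c) (X Z : 𝒯) :
    X ◁ ((q.powAdd a b c h).hom ▷ Z) ≫ (q.moveLeft c X Z).hom =
      X ◁ (α_ _ _ _).hom ≫ (q.moveLeft a X _).hom ≫ q.pow a ◁ (q.moveLeft b X Z).hom ≫
        (α_ _ _ _).inv ≫ (q.powAdd a b c h).hom ▷ (X ⊗ Z) := by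
  have h' : X ◁ (q.powAdd a b c h).hom ≫ (q.central c X).inv = (α_ _ _ _).inv ≫
      (q.central a X).inv ▷ q.pow b ≫ (α_ _ _ _).hom ≫ q.pow a ◁ (q.central b X).inv ≫
        (α_ _ _ _).inv ≫ (q.powAdd a b c h).hom ▷ X := by
    rw [Iso.comp_inv_eq]
    simp only [Category.assoc, powAdd_central]
    simp
  calc _ = 𝟙 _ ⊗≫ (X ◁ (q.powAdd a b c h).hom ≫ (q.central c X).inv) ▷ Z ⊗≫ 𝟙 _ := by
        rw [moveLeft_hom]; monoidal
    _ = _ := by rw [h']; simp only [moveLeft_hom]; monoidal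

lemma moveLeft_powZero (X Z : 𝒯) :
    X ◁ ((q.powZero 0 rfl).hom ▷ Z) ≫ (q.moveLeft 0 X Z).hom =
      X ◁ (λ_ Z).hom ≫ (λ_ _).inv ≫ (q.powZero 0 rfl).hom ▷ (X ⊗ Z) := by
  have h' : X ◁ (q.powZero 0 rfl).hom ≫ (q.central 0 X).inv =
      (ρ_ X).hom ≫ (λ_ X).inv ≫ (q.powZero 0 rfl).hom ▷ X := by
    rw [Iso.comp_inv_eq]
    simp only [Category.assoc, powZero_central]
    simp
  calc _ = 𝟙 _ ⊗≫ (X ◁ (q.powZero 0 rfl).hom ≫ (q.central 0 X).inv) ▷ Z ⊗≫ 𝟙 _ := by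
        rw [moveLeft_hom]; monoidal
    _ = _ := by rw [h']; monoidal

lemma powTensor_hom (a b c : ℤ) (h : a + b = c) (X Y : 𝒯) : (q.powTensor a b c h X Y).hom =
    (α_ _ _ _).hom ≫ q.pow a ◁ (q.moveLeft b X Y).hom ≫ (α_ _ _ _).inv ≫
      (q.powAdd a b c h).hom ▷ (X ⊗ Y) := rfl

lemma powTensor_natural (a b c : ℤ) (h : a + b = c) {X X' Y Y' : 𝒯} (f : X ⟶ X') (g : Y ⟶ Y') :
    (q.pow a ◁ f ⊗ₘ q.pow b ◁ g) ≫ (q.powTensor a b c h X' Y').hom =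
      (q.powTensor a b c h X Y).hom ≫ q.pow c ◁ (f ⊗ₘ g) := by
  calc _ = 𝟙 _ ⊗≫ q.pow a ◁ (f ▷ (q.pow b ⊗ Y)) ⊗≫ q.pow a ◁ (X' ◁ (q.pow b ◁ g) ≫
        (q.moveLeft b X' Y').hom) ⊗≫ (q.powAdd a b c h).hom ▷ (X' ⊗ Y') := by
        rw [powTensor_hom, MonoidalCategory.tensorHom_def]; monoidal
    _ = 𝟙 _ ⊗≫ q.pow a ◁ (f ▷ (q.pow b ⊗ Y) ≫ (q.moveLeft b X' Y).hom) ⊗≫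
        ((q.pow a ⊗ q.pow b) ◁ (X' ◁ g) ≫ (q.powAdd a b c h).hom ▷ (X' ⊗ Y')) := by
        rw [moveLeft_natural_right]; monoidal
    _ = 𝟙 _ ⊗≫ q.pow a ◁ (q.moveLeft b X Y).hom ⊗≫
        ((q.pow a ⊗ q.pow b) ◁ (f ▷ Y) ≫ (q.powAdd a b c h).hom ▷ (X' ⊗ Y)) ≫
          q.pow c ◁ (X' ◁ g) := by
        rw [moveLeft_natural_left, whisker_exchange]; monoidal
    _ = _ := by
        rw [whisker_exchange, powTensor_hom, MonoidalCategory.tensorHom_def]; monoidal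

lemma powTensor_assoc (a b c ab bc abc : ℤ) (h₁ : a + b = ab) (h₂ : ab + c = abc) (h₃ : b + c = bc)
    (h₄ : a + bc = abc) (X Y Z : 𝒯) :
    (q.powTensor a b ab h₁ X Y).hom ▷ (q.pow c ⊗ Z) ≫ (q.powTensor ab c abc h₂ (X ⊗ Y) Z).hom ≫
        q.pow abc ◁ (α_ X Y Z).hom =
      (α_ _ _ _).hom ≫ (q.pow a ⊗ X) ◁ (q.powTensor b c bc h₃ Y Z).hom ≫
        (q.powTensor a bc abc h₄ X (Y ⊗ Z)).hom := by
  calc _ = 𝟙 _ ⊗≫ q.pow a ◁ ((q.moveLeft b X Y).hom ▷ (q.pow c ⊗ Z)) ⊗≫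
        ((q.powAdd a b ab h₁).hom ▷ ((X ⊗ Y) ⊗ q.pow c ⊗ Z) ≫
          q.pow ab ◁ (q.moveLeft c (X ⊗ Y) Z).hom) ⊗≫
        (q.powAdd ab c abc h₂).hom ▷ (X ⊗ (Y ⊗ Z)) := by
        simp only [powTensor_hom]; monoidal
    _ = 𝟙 _ ⊗≫ q.pow a ◁ ((q.moveLeft b X Y).hom ▷ (q.pow c ⊗ Z)) ⊗≫
        q.pow a ◁ q.pow b ◁ (q.moveLeft c (X ⊗ Y) Z).hom ⊗≫
        ((q.powAdd a b ab h₁).hom ▷ q.pow c ≫ (q.powAdd ab c abc h₂).hom) ▷ (X ⊗ (Y ⊗ Z)) := by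
        rw [← whisker_exchange]; monoidal
    _ = 𝟙 _ ⊗≫ q.pow a ◁ ((q.moveLeft b X (Y ⊗ (q.pow c ⊗ Z))).hom ≫
          q.pow b ◁ X ◁ (q.moveLeft c Y Z).hom) ⊗≫ q.pow a ◁ q.pow b ◁ (q.moveLeft c X (Y ⊗ Z)).hom ⊗≫
        (q.pow a ◁ (q.powAdd b c bc h₃).hom ≫ (q.powAdd a bc abc h₄).hom) ▷ (X ⊗ (Y ⊗ Z)) := by
        rw [powAdd_assoc q a b c ab bc abc h₁ h₂ h₃ h₄, moveLeft_tensor, moveLeft_hom,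
          moveLeft_hom q b X (Y ⊗ _)]
        monoidal
    _ = 𝟙 _ ⊗≫ q.pow a ◁ X ◁ q.pow b ◁ (q.moveLeft c Y Z).hom ⊗≫
        q.pow a ◁ (X ◁ (α_ _ _ _).inv ≫ (X ◁ (α_ _ _ _).hom ≫ (q.moveLeft b X _).hom ≫
          q.pow b ◁ (q.moveLeft c X (Y ⊗ Z)).hom ≫
        (α_ _ _ _).inv ≫ (q.powAdd b c bc h₃).hom ▷ (X ⊗ (Y ⊗ Z)))) ⊗≫
          (q.powAdd a bc abc h₄).hom ▷ (X ⊗ (Y ⊗ Z)) := by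
        rw [← moveLeft_natural_right]; monoidal
    _ = _ := by
        rw [← moveLeft_powAdd]; simp only [powTensor_hom]; monoidal

lemma powTensor_powZero_left (b : ℤ) (Y : 𝒯) :
    ((ρ_ (𝟙_ 𝒯)).inv ≫ (q.powZero 0 rfl).hom ▷ 𝟙_ 𝒯) ▷ (q.pow b ⊗ Y) ≫
      (q.powTensor 0 b b (zero_add b) (𝟙_ 𝒯) Y).hom ≫ q.pow b ◁ (λ_ Y).hom =
      (λ_ (q.pow b ⊗ Y)).hom := by
  have h₁ : (q.moveLeft b (𝟙_ 𝒯) Y).hom = (λ_ _).hom ≫ q.pow b ◁ (λ_ Y).inv := by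
    have h : (q.central b (𝟙_ 𝒯)).hom = (ρ_ _).hom ≫ (λ_ _).inv := by
      have h₁ := q.central_tensor b (𝟙_ 𝒯) (𝟙_ 𝒯)
      have h₂ := q.central_natural b (λ_ (𝟙_ 𝒯)).hom
      rw [h₁] at h₂
      let g : q.pow b ⟶ q.pow b := (ρ_ _).inv ≫ (q.central b (𝟙_ 𝒯)).hom ≫ (λ_ _).hom
      have hg : g ≫ g = g := by
        calc g ≫ g = (ρ_ _).inv ≫ q.pow b ◁ (λ_ _).inv ≫ ((α_ (q.pow b) (𝟙_ 𝒯) (𝟙_ 𝒯)).inv ≫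
              (q.central b (𝟙_ 𝒯)).hom ▷ 𝟙_ 𝒯 ≫ (α_ _ _ _).hom ≫
              𝟙_ 𝒯 ◁ (q.central b (𝟙_ 𝒯)).hom ≫ (α_ _ _ _).inv) ≫
              (λ_ (𝟙_ 𝒯)).hom ▷ q.pow b ≫ (λ_ _).hom := by
              dsimp only [g]; monoidal
          _ = g := by
              rw [← Category.assoc _ ((λ_ (𝟙_ 𝒯)).hom ▷ q.pow b), ← h₂, Category.assoc,
                ← MonoidalCategory.whiskerLeft_comp_assoc, Iso.inv_hom_id]
              simp [g]
      have : IsIso g := by dsimp only [g]; infer_instance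
      have hg' : g = 𝟙 _ := (cancel_epi g).1 (hg.trans (Category.comp_id g).symm)
      rw [← cancel_mono (λ_ _).hom, ← cancel_epi (ρ_ _).inv]
      simpa using hg'
    have h' : (q.central b (𝟙_ 𝒯)).inv = (λ_ _).hom ≫ (ρ_ _).inv := by
      rw [← cancel_epi (q.central b (𝟙_ 𝒯)).hom, Iso.hom_inv_id, h]
      simp
    rw [moveLeft_hom, h']
    monoidal
  calc _ = 𝟙 _ ⊗≫ ((q.powZero 0 rfl).hom ▷ q.pow b ≫ (q.powAdd 0 b b (zero_add b)).hom) ▷ Y := by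
        rw [powTensor_hom, h₁]; monoidal
    _ = _ := by rw [zero_powAdd]; monoidal

end InvertibleCentralObject

lemma MonoidalGrading.tensor_mem' {Λ : Type*} [AddCommGroup Λ] {𝒯 : Type*} [Category 𝒯]
    [Preadditive 𝒯] [MonoidalCategory 𝒯] (𝒢 : MonoidalGrading Λ 𝒯) {l m n : Λ} {X Y : 𝒯}
    (hX : 𝒢.homogeneous l X) (hY : 𝒢.homogeneous m Y) (h : l + m = n) :
    𝒢.homogeneous n (X ⊗ Y) :=
  h ▸ 𝒢.tensor_mem hX hY

lemma MonoidalGrading.of_iso {Λ : Type*} [AddCommGroup Λ] {𝒯 : Type*} [Category 𝒯]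
    [Preadditive 𝒯] [MonoidalCategory 𝒯] (𝒢 : MonoidalGrading Λ 𝒯) {l : Λ} {X Y : 𝒯} (e : X ≅ Y)
    (hX : 𝒢.homogeneous l X) : 𝒢.homogeneous l Y :=
  have := 𝒢.closedUnderIso l
  (𝒢.homogeneous l).prop_of_iso e hX

/-- An object that becomes homogeneous after tensoring with an invertible homogeneous object is
homogeneous or zero. -/
lemma MonoidalGrading.homogeneous_of_tensor {Λ : Type*} [AddCommGroup Λ] {𝒯 : Type*} [Category 𝒯]
    [Preadditive 𝒯] [MonoidalCategory 𝒯] [MonoidalPreadditive 𝒯] (𝒢 : MonoidalGrading Λ 𝒯)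
    {a l : Λ} {A B X : 𝒯} (c : B ⊗ A ≅ 𝟙_ 𝒯) (hA : 𝒢.homogeneous a A)
    (h : 𝒢.homogeneous (a + l) (A ⊗ X)) (h₀ : 𝟙 X = 0 → 𝒢.homogeneous l X) :
    𝒢.homogeneous l X := by
  obtain ⟨s, Y, hY, ι, π, h₁, h₂⟩ := 𝒢.exists_decomposition X
  have hι : ∀ m ∈ s, m ≠ l → ι m = 0 := fun m hm hml => whiskerLeft_cancel c (by
    rw [MonoidalPreadditive.whiskerLeft_zero]
    exact 𝒢.hom_eq_zero (𝒢.tensor_mem hA (hY m hm)) h (fun h => hml (add_left_cancel h)) _)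
  by_cases hl : l ∈ s
  · rw [Finset.sum_eq_single_of_mem l hl (fun m hm hml => by rw [hι m hm hml, comp_zero])] at h₂
    exact 𝒢.of_iso ⟨ι l, π l, h₁ l hl, h₂⟩ (hY l hl)
  · exact h₀ (h₂.symm.trans (Finset.sum_eq_zero fun m hm => by
      rw [hι m hm (fun h => hl (h ▸ hm)), comp_zero]))

/-- The powers of a central object of degree `0` have degree `0`. -/
lemma InvertibleCentralObject.homogeneous_pow {Λ : Type*} [AddCommGroup Λ] {𝒯 : Type*} [Category 𝒯]
    [Preadditive 𝒯] [MonoidalCategory 𝒯] [MonoidalPreadditive 𝒯] {𝒢 : MonoidalGrading Λ 𝒯}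
    {q : InvertibleCentralObject 𝒯} (hq : 𝒢.homogeneous 0 (q.pow 1)) (n : ℤ) :
    𝒢.homogeneous 0 (q.pow n) := by
  have h0 : 𝒢.homogeneous 0 (q.pow 0) := 𝒢.of_iso (q.powZero 0 rfl) 𝒢.unit_mem
  induction n with
  | zero => exact h0
  | succ n ih => exact 𝒢.of_iso (q.powAdd n 1 _ rfl) (𝒢.tensor_mem' ih hq (add_zero _))
  | pred n ih =>
    refine 𝒢.homogeneous_of_tensor (B := q.pow (-1))
      (q.powAdd (-1) 1 0 (by ring) ≪≫ (q.powZero 0 rfl).symm) hq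
      (𝒢.of_iso (q.powAdd 1 (-n - 1) (-n) (by ring)).symm (by rwa [add_zero])) (fun h => ?_)
    have h1 : 𝟙 (𝟙_ 𝒯) = 0 := by
      let e : q.pow (n + 1) ⊗ q.pow (-n - 1) ≅ 𝟙_ 𝒯 :=
        q.powAdd (n + 1) (-n - 1) 0 (by ring) ≪≫ (q.powZero 0 rfl).symm
      rw [← e.inv_hom_id, ← Category.id_comp e.hom, ← MonoidalCategory.whiskerLeft_id, h]
      simp
    exact 𝒢.of_iso ⟨0, 0, by rw [h1, comp_zero], by rw [h, comp_zero]⟩ 𝒢.unit_mem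

/-! ### Twisting by powers of the central object -/

section Twist

variable {Λ : Type*} [AddCommGroup Λ] {𝒯 : Type*} [Category 𝒯] [Preadditive 𝒯]
  [MonoidalCategory 𝒯] [MonoidalPreadditive 𝒯]

/-- A decomposition of an object into homogeneous components. -/
structure MonoidalGrading.Decomposition (𝒢 : MonoidalGrading Λ 𝒯) (X : 𝒯) where
  /-- the degrees of the components -/
  s : Finset Λ
  /-- the components -/
  Y : Λ → 𝒯
  /-- the inclusions -/
  ι : ∀ l, Y l ⟶ X
  /-- the projections -/
  π : ∀ l, X ⟶ Y l
  mem : ∀ l ∈ s, 𝒢.homogeneous l (Y l)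
  ι_π : ∀ l ∈ s, ι l ≫ π l = 𝟙 (Y l)
  sum : ∑ l ∈ s, π l ≫ ι l = 𝟙 X

namespace MonoidalGrading

lemma nonempty_decomposition (𝒢 : MonoidalGrading Λ 𝒯) (X : 𝒯) : Nonempty (𝒢.Decomposition X) := by
  obtain ⟨s, Y, hY, ι, π, h₁, h₂⟩ := 𝒢.exists_decomposition X
  exact ⟨⟨s, Y, ι, π, hY, h₁, h₂⟩⟩

/-- A chosen decomposition. -/
noncomputable def dec (𝒢 : MonoidalGrading Λ 𝒯) (X : 𝒯) : 𝒢.Decomposition X :=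
  (𝒢.nonempty_decomposition X).some

variable {𝒢 : MonoidalGrading Λ 𝒯}

namespace Decomposition

variable {X : 𝒯} (d : 𝒢.Decomposition X)

lemma eq_zero {l m : Λ} {W : 𝒯} (hW : 𝒢.homogeneous l W) (x : W ⟶ X) (hm : m ∈ d.s) (h : l ≠ m) :
    x ≫ d.π m = 0 := 𝒢.hom_eq_zero hW (d.mem m hm) h _

lemma comp_π_ι {l : Λ} {W : 𝒯} (hW : 𝒢.homogeneous l W) (x : W ⟶ X) (hl : l ∈ d.s) :
    x ≫ d.π l ≫ d.ι l = x := by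
  conv_rhs => rw [← Category.comp_id x, ← d.sum, Preadditive.comp_sum]
  rw [Finset.sum_eq_single_of_mem l hl]
  intro m hm hml
  rw [← Category.assoc, d.eq_zero hW x hm hml.symm, zero_comp]

lemma comp_eq_zero {l : Λ} {W : 𝒯} (hW : 𝒢.homogeneous l W) (x : W ⟶ X) (hl : l ∉ d.s) :
    x = 0 := by
  rw [← Category.comp_id x, ← d.sum, Preadditive.comp_sum]
  refine Finset.sum_eq_zero fun m hm => ?_
  rw [← Category.assoc, d.eq_zero hW x hm (fun h => hl (h ▸ hm)), zero_comp]

end Decomposition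

end MonoidalGrading

variable {𝒢 : MonoidalGrading Λ 𝒯} {q : InvertibleCentralObject 𝒯}

lemma InvertibleCentralObject.pow_tensor_mem (hq : 𝒢.homogeneous 0 (q.pow 1)) (n : ℤ) {l : Λ}
    {X : 𝒯} (hX : 𝒢.homogeneous l X) : 𝒢.homogeneous l (q.pow n ⊗ X) :=
  𝒢.tensor_mem' (q.homogeneous_pow hq n) hX (zero_add l)

variable (hq : 𝒢.homogeneous 0 (q.pow 1)) (φ : Λ →+ ℤ)

include hq in
lemma exists_twist (X : 𝒯) : ∃ S : 𝒯, IsDirectSum (𝒢.dec X).s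
    (fun l => q.pow (φ l) ⊗ (𝒢.dec X).Y l) S :=
  𝒢.exists_sum _ _ fun l hl => q.pow_tensor_mem hq _ ((𝒢.dec X).mem l hl)

namespace Twist

/-- The direct sum of the `q ^ φ(l) ⊗ X_l`, where `X_l` is the component of `X` of degree `l`. -/
noncomputable def obj (X : 𝒯) : 𝒯 := (exists_twist hq φ X).choose

/-- The inclusion of a component. -/
noncomputable def ι (X : 𝒯) (l : Λ) : q.pow (φ l) ⊗ (𝒢.dec X).Y l ⟶ obj hq φ X :=
  (exists_twist hq φ X).choose_spec.choose l

/-- The projection to a component. -/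
noncomputable def π (X : 𝒯) (l : Λ) : obj hq φ X ⟶ q.pow (φ l) ⊗ (𝒢.dec X).Y l :=
  (exists_twist hq φ X).choose_spec.choose_spec.choose l

/-- The decomposition of the twist of `X`. -/
noncomputable def dec (X : 𝒯) : 𝒢.Decomposition (obj hq φ X) where
  s := (𝒢.dec X).s
  Y l := q.pow (φ l) ⊗ (𝒢.dec X).Y l
  ι := ι hq φ X
  π := π hq φ X
  mem l hl := q.pow_tensor_mem hq _ ((𝒢.dec X).mem l hl)
  ι_π := (exists_twist hq φ X).choose_spec.choose_spec.choose_spec.1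
  sum := (exists_twist hq φ X).choose_spec.choose_spec.choose_spec.2

/-- The morphism to the twist of `X` induced by a morphism `x : W ⟶ X`, for `W` of degree `l`. -/
noncomputable def incl (l : Λ) {W X : 𝒯} (x : W ⟶ X) : q.pow (φ l) ⊗ W ⟶ obj hq φ X :=
  q.pow (φ l) ◁ (x ≫ (𝒢.dec X).π l) ≫ ι hq φ X l

/-- The morphism from the twist of `X` induced by a morphism `x : X ⟶ W`, for `W` of degree `l`. -/
noncomputable def proj (l : Λ) {W X : 𝒯} (x : X ⟶ W) : obj hq φ X ⟶ q.pow (φ l) ⊗ W :=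
  π hq φ X l ≫ q.pow (φ l) ◁ ((𝒢.dec X).ι l ≫ x)

lemma whiskerLeft_incl (l : Λ) {V W X : 𝒯} (w : V ⟶ W) (x : W ⟶ X) :
    q.pow (φ l) ◁ w ≫ incl hq φ l x = incl hq φ l (w ≫ x) := by
  simp [incl]

lemma incl_zero (l : Λ) (W X : 𝒯) : incl hq φ l (0 : W ⟶ X) = 0 := by
  simp [incl]

lemma incl_add (l : Λ) {W X : 𝒯} (x y : W ⟶ X) :
    incl hq φ l (x + y) = incl hq φ l x + incl hq φ l y := by
  simp [incl, Preadditive.add_comp]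

lemma incl_smul {R : Type*} [CommRing R] [Linear R 𝒯] [MonoidalLinear R 𝒯] (l : Λ) {W X : 𝒯}
    (r : R) (x : W ⟶ X) : incl hq φ l (r • x) = r • incl hq φ l x := by
  simp [incl]

variable {hq φ}

lemma incl_proj {l : Λ} {W V X : 𝒯} (hW : 𝒢.homogeneous l W) (x : W ⟶ X) (y : X ⟶ V) :
    incl hq φ l x ≫ proj hq φ l y = q.pow (φ l) ◁ (x ≫ y) := by
  by_cases hl : l ∈ (𝒢.dec X).s
  · have : ι hq φ X l ≫ π hq φ X l = 𝟙 _ := (dec hq φ X).ι_π l hl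
    rw [incl, proj, Category.assoc, reassoc_of% this, ← MonoidalCategory.whiskerLeft_comp,
      Category.assoc, reassoc_of% (𝒢.dec X).comp_π_ι hW x hl]
  · rw [(𝒢.dec X).comp_eq_zero hW x hl, incl_zero]
    simp

lemma incl_proj_eq_zero {l m : Λ} {W V X : 𝒯} (hW : 𝒢.homogeneous l W) (hV : 𝒢.homogeneous m V)
    (x : W ⟶ X) (y : X ⟶ V) (h : x ≫ y = 0) : incl hq φ l x ≫ proj hq φ m y = 0 := by
  by_cases hlm : l = m
  · subst hlm
    rw [incl_proj hW, h, MonoidalPreadditive.whiskerLeft_zero]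
  · exact 𝒢.hom_eq_zero (q.pow_tensor_mem hq _ hW) (q.pow_tensor_mem hq _ hV) hlm _

lemma sum_proj_incl (X : 𝒯) :
    ∑ l ∈ (𝒢.dec X).s, proj hq φ l ((𝒢.dec X).π l) ≫ incl hq φ l ((𝒢.dec X).ι l) =
      𝟙 (obj hq φ X) := by
  rw [← (dec hq φ X).sum]
  refine Finset.sum_congr rfl fun l hl => ?_
  rw [proj, incl, (𝒢.dec X).ι_π l hl]
  simp [dec]

lemma hom_ext {X Z : 𝒯} {f g : obj hq φ X ⟶ Z}
    (h : ∀ (l : Λ) (W : 𝒯), 𝒢.homogeneous l W → ∀ x : W ⟶ X,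
      incl hq φ l x ≫ f = incl hq φ l x ≫ g) : f = g := by
  rw [← Category.id_comp f, ← Category.id_comp g, ← sum_proj_incl, Preadditive.sum_comp,
    Preadditive.sum_comp]
  refine Finset.sum_congr rfl fun l hl => ?_
  rw [Category.assoc, Category.assoc, h l _ ((𝒢.dec X).mem l hl)]

/-- The action of twisting on morphisms. -/
noncomputable def map {X Y : 𝒯} (f : X ⟶ Y) : obj hq φ X ⟶ obj hq φ Y :=
  ∑ l ∈ (𝒢.dec X).s, proj hq φ l ((𝒢.dec X).π l) ≫ incl hq φ l ((𝒢.dec X).ι l ≫ f)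

lemma sum_incl_proj {Z : 𝒯} {l : Λ} {W X : 𝒯} (hW : 𝒢.homogeneous l W) (x : W ⟶ X)
    (p : q.pow (φ l) ⊗ W ⟶ Z) (F : ∀ l, q.pow (φ l) ⊗ (𝒢.dec X).Y l ⟶ Z)
    (hF : x ≫ (𝒢.dec X).π l ≫ (𝒢.dec X).ι l = x →
      q.pow (φ l) ◁ (x ≫ (𝒢.dec X).π l) ≫ F l = p) (hp : x = 0 → p = 0) :
    incl hq φ l x ≫ ∑ l ∈ (𝒢.dec X).s, proj hq φ l ((𝒢.dec X).π l) ≫ F l = p := by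
  rw [Preadditive.comp_sum]
  by_cases hl : l ∈ (𝒢.dec X).s
  · rw [Finset.sum_eq_single_of_mem l hl, reassoc_of% (incl_proj hW), hF ((𝒢.dec X).comp_π_ι hW x hl)]
    intro m hm hml
    rw [← Category.assoc, incl_proj_eq_zero hW ((𝒢.dec X).mem m hm), zero_comp]
    exact (𝒢.dec X).eq_zero hW x hm hml.symm
  · have hx := (𝒢.dec X).comp_eq_zero hW x hl
    rw [hp hx]
    refine Finset.sum_eq_zero fun m _ => ?_
    rw [hx, incl_zero, zero_comp]

lemma incl_map {l : Λ} {W X Y : 𝒯} (hW : 𝒢.homogeneous l W) (x : W ⟶ X) (f : X ⟶ Y) :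
    incl hq φ l x ≫ map f = incl hq φ l (x ≫ f) := by
  refine sum_incl_proj hW x _ _ (fun h => ?_) (fun h => ?_)
  · rw [whiskerLeft_incl, Category.assoc, reassoc_of% h]
  · rw [h, zero_comp, incl_zero]

lemma map_id (X : 𝒯) : map (𝟙 X) = 𝟙 (obj hq φ X) := hom_ext fun l W hW x => by
  rw [incl_map hW, Category.comp_id, Category.comp_id]

lemma map_comp {X Y Z : 𝒯} (f : X ⟶ Y) (g : Y ⟶ Z) :
    (map (f ≫ g) : obj hq φ X ⟶ obj hq φ Z) = map f ≫ map g := hom_ext fun l W hW x => by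
  rw [incl_map hW, reassoc_of% (incl_map hW), incl_map hW, Category.assoc]

lemma map_add {X Y : 𝒯} (f g : X ⟶ Y) :
    (map (f + g) : obj hq φ X ⟶ obj hq φ Y) = map f + map g := hom_ext fun l W hW x => by
  simp only [Preadditive.comp_add, incl_map hW, incl_add]

lemma map_smul {R : Type*} [CommRing R] [Linear R 𝒯] [MonoidalLinear R 𝒯] {X Y : 𝒯} (r : R)
    (f : X ⟶ Y) : (map (r • f) : obj hq φ X ⟶ obj hq φ Y) = r • map f :=
  hom_ext fun l W hW x => by
    simp only [Linear.comp_smul, incl_map hW, incl_smul]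

lemma tensor_hom_ext {X Y Z : 𝒯} {f g : obj hq φ X ⊗ obj hq φ Y ⟶ Z}
    (h : ∀ (l m : Λ) (W V : 𝒯), 𝒢.homogeneous l W → 𝒢.homogeneous m V → ∀ (x : W ⟶ X) (y : V ⟶ Y),
      (incl hq φ l x ⊗ₘ incl hq φ m y) ≫ f = (incl hq φ l x ⊗ₘ incl hq φ m y) ≫ g) : f = g := by
  rw [← Category.id_comp f, ← Category.id_comp g, ← id_tensorHom_id, ← sum_proj_incl,
    ← sum_proj_incl, sum_tensor, Preadditive.sum_comp, Preadditive.sum_comp]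
  refine Finset.sum_congr rfl fun l hl => ?_
  rw [tensor_sum, Preadditive.sum_comp, Preadditive.sum_comp]
  refine Finset.sum_congr rfl fun m hm => ?_
  rw [← MonoidalCategory.tensorHom_comp_tensorHom, Category.assoc, Category.assoc,
    h l m _ _ ((𝒢.dec X).mem l hl) ((𝒢.dec Y).mem m hm)]

/-- The comparison between tensor product and twist. -/
noncomputable def mu (X Y : 𝒯) : obj hq φ X ⊗ obj hq φ Y ⟶ obj hq φ (X ⊗ Y) :=
  ∑ l ∈ (𝒢.dec X).s, ∑ m ∈ (𝒢.dec Y).s,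
    (proj hq φ l ((𝒢.dec X).π l) ⊗ₘ proj hq φ m ((𝒢.dec Y).π m)) ≫
      (q.powTensor (φ l) (φ m) (φ (l + m)) (φ.map_add l m).symm _ _).hom ≫
        incl hq φ (l + m) ((𝒢.dec X).ι l ⊗ₘ (𝒢.dec Y).ι m)

/-- The inverse of `mu`. -/
noncomputable def delta (X Y : 𝒯) : obj hq φ (X ⊗ Y) ⟶ obj hq φ X ⊗ obj hq φ Y :=
  ∑ l ∈ (𝒢.dec X).s, ∑ m ∈ (𝒢.dec Y).s,
    proj hq φ (l + m) ((𝒢.dec X).π l ⊗ₘ (𝒢.dec Y).π m) ≫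
      (q.powTensor (φ l) (φ m) (φ (l + m)) (φ.map_add l m).symm _ _).inv ≫
    (incl hq φ l ((𝒢.dec X).ι l) ⊗ₘ incl hq φ m ((𝒢.dec Y).ι m))

lemma incl_tensor_mu' {l m : Λ} {W V X Y : 𝒯}
    (hW : 𝒢.homogeneous l W) (hV : 𝒢.homogeneous m V) (x : W ⟶ X) (y : V ⟶ Y) :
    (incl hq φ l x ⊗ₘ incl hq φ m y) ≫ mu X Y =
      (q.powTensor (φ l) (φ m) (φ (l + m)) (φ.map_add l m).symm W V).hom ≫
        incl hq φ (l + m) (x ⊗ₘ y) := by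
  by_cases hl : l ∈ (𝒢.dec X).s
  · by_cases hm : m ∈ (𝒢.dec Y).s
    · rw [mu, Preadditive.comp_sum, Finset.sum_eq_single_of_mem l hl, Preadditive.comp_sum,
        Finset.sum_eq_single_of_mem m hm, MonoidalCategory.tensorHom_comp_tensorHom_assoc,
        incl_proj hW, incl_proj hV, reassoc_of% InvertibleCentralObject.powTensor_natural,
        whiskerLeft_incl, MonoidalCategory.tensorHom_comp_tensorHom, Category.assoc, Category.assoc,
        (𝒢.dec X).comp_π_ι hW x hl, (𝒢.dec Y).comp_π_ι hV y hm]
      · intro m' hm' hmm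
        rw [MonoidalCategory.tensorHom_comp_tensorHom_assoc, incl_proj_eq_zero hV
          ((𝒢.dec Y).mem m' hm') _ _ ((𝒢.dec Y).eq_zero hV y hm' hmm.symm),
          MonoidalPreadditive.tensor_zero, zero_comp]
      · intro l' hl' hll
        rw [Preadditive.comp_sum]
        refine Finset.sum_eq_zero fun m' _ => ?_
        rw [MonoidalCategory.tensorHom_comp_tensorHom_assoc, incl_proj_eq_zero hW
          ((𝒢.dec X).mem l' hl') _ _ ((𝒢.dec X).eq_zero hW x hl' hll.symm),
          MonoidalPreadditive.zero_tensor, zero_comp]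
    · rw [(𝒢.dec Y).comp_eq_zero hV y hm]
      simp [incl_zero]
  · rw [(𝒢.dec X).comp_eq_zero hW x hl]
    simp [incl_zero]

lemma incl_tensor_mu {l m n : Λ} (h : l + m = n) {W V X Y : 𝒯}
    (hW : 𝒢.homogeneous l W) (hV : 𝒢.homogeneous m V) (x : W ⟶ X) (y : V ⟶ Y) :
    (incl hq φ l x ⊗ₘ incl hq φ m y) ≫ mu X Y =
      (q.powTensor (φ l) (φ m) (φ n) (by rw [← h, φ.map_add]) W V).hom ≫
        incl hq φ n (x ⊗ₘ y) := by
  subst h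
  exact incl_tensor_mu' hW hV x y

lemma delta_mu (X Y : 𝒯) : delta X Y ≫ mu X Y = 𝟙 (obj hq φ (X ⊗ Y)) := by
  refine hom_ext fun n W hW x => ?_
  have h₁ : ∀ l ∈ (𝒢.dec X).s, ∀ m ∈ (𝒢.dec Y).s,
      incl hq φ n x ≫ (proj hq φ (l + m) ((𝒢.dec X).π l ⊗ₘ (𝒢.dec Y).π m) ≫
      (q.powTensor (φ l) (φ m) (φ (l + m)) (φ.map_add l m).symm _ _).inv ≫
      (incl hq φ l ((𝒢.dec X).ι l) ⊗ₘ incl hq φ m ((𝒢.dec Y).ι m))) ≫ mu X Y =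
      incl hq φ n (x ≫ ((𝒢.dec X).π l ≫ (𝒢.dec X).ι l ⊗ₘ (𝒢.dec Y).π m ≫ (𝒢.dec Y).ι m)) := by
    intro l hl m hm
    simp only [Category.assoc]
    rw [incl_tensor_mu rfl ((𝒢.dec X).mem l hl) ((𝒢.dec Y).mem m hm), Iso.inv_hom_id_assoc]
    by_cases hn : n = l + m
    · subst hn
      rw [reassoc_of% (incl_proj hW), whiskerLeft_incl, Category.assoc,
        MonoidalCategory.tensorHom_comp_tensorHom]
    · have h₂ : x ≫ ((𝒢.dec X).π l ⊗ₘ (𝒢.dec Y).π m) = 0 :=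
        𝒢.hom_eq_zero hW (𝒢.tensor_mem ((𝒢.dec X).mem l hl) ((𝒢.dec Y).mem m hm)) hn _
      rw [← Category.assoc, incl_proj_eq_zero hW (𝒢.tensor_mem ((𝒢.dec X).mem l hl)
        ((𝒢.dec Y).mem m hm)) _ _ h₂, zero_comp, ← MonoidalCategory.tensorHom_comp_tensorHom,
        ← Category.assoc, h₂, zero_comp, incl_zero]
  have h₃ : ∀ {ι : Type _} (s : Finset ι) (f : ι → (W ⟶ X ⊗ Y)),
      incl hq φ n (∑ i ∈ s, f i) = ∑ i ∈ s, incl hq φ n (f i) := by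
    intro ι s f
    exact map_sum (AddMonoidHom.mk' (fun f => incl hq φ n f) (incl_add hq φ n)) f s
  calc incl hq φ n x ≫ delta X Y ≫ mu X Y
      = ∑ l ∈ (𝒢.dec X).s, ∑ m ∈ (𝒢.dec Y).s,
        incl hq φ n (x ≫ ((𝒢.dec X).π l ≫ (𝒢.dec X).ι l ⊗ₘ (𝒢.dec Y).π m ≫ (𝒢.dec Y).ι m)) := by
        rw [delta, Preadditive.sum_comp, Preadditive.comp_sum]
        refine Finset.sum_congr rfl fun l hl => ?_
        rw [Preadditive.sum_comp, Preadditive.comp_sum]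
        exact Finset.sum_congr rfl fun m hm => h₁ l hl m hm
    _ = incl hq φ n (x ≫ (𝟙 X ⊗ₘ 𝟙 Y)) := by
        rw [← (𝒢.dec X).sum, ← (𝒢.dec Y).sum, sum_tensor, Preadditive.comp_sum, h₃]
        refine Finset.sum_congr rfl fun l hl => ?_
        rw [tensor_sum, Preadditive.comp_sum, h₃]
    _ = _ := by simp

lemma mu_delta (X Y : 𝒯) : mu X Y ≫ delta X Y = 𝟙 (obj hq φ X ⊗ obj hq φ Y) := by
  refine tensor_hom_ext fun l m W V hW hV x y => ?_
  rw [reassoc_of% (incl_tensor_mu rfl hW hV)]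
  by_cases hl : l ∈ (𝒢.dec X).s
  · by_cases hm : m ∈ (𝒢.dec Y).s
    · have h0 : ∀ l' ∈ (𝒢.dec X).s, ∀ m' ∈ (𝒢.dec Y).s, (l' ≠ l ∨ m' ≠ m) →
          incl hq φ (l + m) (x ⊗ₘ y) ≫
            proj hq φ (l' + m') ((𝒢.dec X).π l' ⊗ₘ (𝒢.dec Y).π m') = 0 := by
        intro l' hl' m' hm' h
        refine incl_proj_eq_zero (𝒢.tensor_mem hW hV)
          (𝒢.tensor_mem ((𝒢.dec X).mem l' hl') ((𝒢.dec Y).mem m' hm')) _ _ ?_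
        rw [MonoidalCategory.tensorHom_comp_tensorHom]
        rcases h with h | h
        · rw [(𝒢.dec X).eq_zero hW x hl' h.symm, MonoidalPreadditive.zero_tensor]
        · rw [(𝒢.dec Y).eq_zero hV y hm' h.symm, MonoidalPreadditive.tensor_zero]
      rw [delta, Preadditive.comp_sum, Finset.sum_eq_single_of_mem l hl, Preadditive.comp_sum,
        Finset.sum_eq_single_of_mem m hm, reassoc_of% (incl_proj (𝒢.tensor_mem hW hV)),
        MonoidalCategory.tensorHom_comp_tensorHom, ← reassoc_of% InvertibleCentralObject.powTensor_natural,
        Iso.hom_inv_id_assoc, MonoidalCategory.tensorHom_comp_tensorHom, whiskerLeft_incl,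
        whiskerLeft_incl, Category.assoc, Category.assoc, (𝒢.dec X).comp_π_ι hW x hl,
        (𝒢.dec Y).comp_π_ι hV y hm, Category.comp_id]
      · intro m' hm' hmm
        rw [← Category.assoc, h0 l hl m' hm' (Or.inr hmm), zero_comp]
      · intro l' hl' hll
        rw [Preadditive.comp_sum]
        refine Finset.sum_eq_zero fun m' hm' => ?_
        rw [← Category.assoc, h0 l' hl' m' hm' (Or.inl hll), zero_comp]
    · rw [(𝒢.dec Y).comp_eq_zero hV y hm]
      simp [incl_zero]
  · rw [(𝒢.dec X).comp_eq_zero hW x hl]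
    simp [incl_zero]

end Twist

end Twist

namespace InvertibleCentralObject

variable {𝒯 : Type*} [Category 𝒯] [MonoidalCategory 𝒯] (q : InvertibleCentralObject 𝒯)

lemma powTensor_unit_right (a z c : ℤ) (hz : 0 = z) (h : a + z = c) (W C : 𝒯) :
    (q.pow a ⊗ W) ◁ ((λ_ C).inv ≫ (q.powZero z hz).hom ▷ C) ≫ (q.powTensor a z c h W C).hom =
      (α_ _ _ _).hom ≫ q.powCast (by omega : a = c) ▷ (W ⊗ C) := by
  subst hz
  have h' : c = a := by omega
  subst h'
  rw [powCast_rfl]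
  calc _ = 𝟙 _ ⊗≫ q.pow c ◁ (W ◁ ((q.powZero 0 rfl).hom ▷ C) ≫ (q.moveLeft 0 W C).hom) ⊗≫
        (q.powAdd c 0 c (add_zero c)).hom ▷ (W ⊗ C) ⊗≫ 𝟙 _ := by
        rw [powTensor_hom]; monoidal
    _ = 𝟙 _ ⊗≫ (q.pow c ◁ (q.powZero 0 rfl).hom ≫ (q.powAdd c 0 c (add_zero c)).hom) ▷ (W ⊗ C) ⊗≫
        𝟙 _ := by
        rw [moveLeft_powZero]; monoidal
    _ = _ := by rw [powAdd_zero]; monoidal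

lemma powTensor_unit_left (z a c : ℤ) (hz : 0 = z) (h : z + a = c) (C Z : 𝒯) :
    ((λ_ C).inv ≫ (q.powZero z hz).hom ▷ C) ▷ (q.pow a ⊗ Z) ≫ (q.powTensor z a c h C Z).hom =
      (q.moveLeft a C Z).hom ≫ q.powCast (by omega : a = c) ▷ (C ⊗ Z) := by
  subst hz
  have h' : c = a := by omega
  subst h'
  rw [powCast_rfl]
  calc _ = 𝟙 _ ⊗≫ ((q.powZero 0 rfl).hom ▷ (C ⊗ (q.pow c ⊗ Z)) ≫
        q.pow 0 ◁ (q.moveLeft c C Z).hom) ⊗≫ (q.powAdd 0 c c (zero_add c)).hom ▷ (C ⊗ Z) := by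
        rw [powTensor_hom]; monoidal
    _ = 𝟙 _ ⊗≫ (q.moveLeft c C Z).hom ⊗≫ ((q.powZero 0 rfl).hom ▷ q.pow c ≫
        (q.powAdd 0 c c (zero_add c)).hom) ▷ (C ⊗ Z) := by
        rw [← whisker_exchange]; monoidal
    _ = _ := by rw [zero_powAdd]; monoidal

lemma powTensor_powZero_left' (z b : ℤ) (hz : 0 = z) (h : z + b = b) (Y : 𝒯) :
    ((ρ_ (𝟙_ 𝒯)).inv ≫ (q.powZero z hz).hom ▷ 𝟙_ 𝒯) ▷ (q.pow b ⊗ Y) ≫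
      (q.powTensor z b b h (𝟙_ 𝒯) Y).hom ≫ q.pow b ◁ (λ_ Y).hom =
      (λ_ (q.pow b ⊗ Y)).hom := by
  subst hz
  exact q.powTensor_powZero_left b Y

end InvertibleCentralObject

section Twist

variable {Λ : Type*} [AddCommGroup Λ] {𝒯 : Type*} [Category 𝒯] [Preadditive 𝒯]
  [MonoidalCategory 𝒯] [MonoidalPreadditive 𝒯]
  {𝒢 : MonoidalGrading Λ 𝒯} {q : InvertibleCentralObject 𝒯}
  {hq : 𝒢.homogeneous 0 (q.pow 1)} {φ : Λ →+ ℤ}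

namespace Twist

lemma isIso_incl {l : Λ} {W X : 𝒯} (x : W ⟶ X) [IsIso x] (hW : 𝒢.homogeneous l W) :
    IsIso (incl hq φ l x) := by
  refine ⟨proj hq φ l (inv x), ?_, hom_ext fun m V hV v => ?_⟩
  · rw [incl_proj hW]
    simp
  · have : v = (v ≫ inv x) ≫ x := by simp
    by_cases h : m = l
    · subst h
      rw [reassoc_of% (incl_proj hV), whiskerLeft_incl, ← this, Category.comp_id]
    · rw [this, 𝒢.hom_eq_zero hV hW h (v ≫ inv x), zero_comp, incl_zero, zero_comp, zero_comp]

lemma tensor_tensor_hom_ext {X Y Q Z : 𝒯} {f g : (obj hq φ X ⊗ obj hq φ Y) ⊗ obj hq φ Q ⟶ Z}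
    (h : ∀ (l m n : Λ) (W V U : 𝒯), 𝒢.homogeneous l W → 𝒢.homogeneous m V → 𝒢.homogeneous n U →
      ∀ (x : W ⟶ X) (y : V ⟶ Y) (z : U ⟶ Q),
      ((incl hq φ l x ⊗ₘ incl hq φ m y) ⊗ₘ incl hq φ n z) ≫ f =
        ((incl hq φ l x ⊗ₘ incl hq φ m y) ⊗ₘ incl hq φ n z) ≫ g) : f = g := by
  rw [← Category.id_comp f, ← Category.id_comp g, ← id_tensorHom_id, ← id_tensorHom_id,
    ← sum_proj_incl, ← sum_proj_incl, ← sum_proj_incl, sum_tensor, sum_tensor,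
    Preadditive.sum_comp, Preadditive.sum_comp]
  refine Finset.sum_congr rfl fun l hl => ?_
  rw [tensor_sum, Preadditive.sum_comp, Preadditive.sum_comp]
  refine Finset.sum_congr rfl fun n hn => ?_
  rw [tensor_sum, sum_tensor, Preadditive.sum_comp, Preadditive.sum_comp]
  refine Finset.sum_congr rfl fun m hm => ?_
  rw [← MonoidalCategory.tensorHom_comp_tensorHom, ← MonoidalCategory.tensorHom_comp_tensorHom,
    Category.assoc, Category.assoc,
    h l m n _ _ _ ((𝒢.dec X).mem l hl) ((𝒢.dec Y).mem m hm) ((𝒢.dec Q).mem n hn)]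

lemma mu_natural {X X' Y Y' : 𝒯} (f : X ⟶ X') (g : Y ⟶ Y') :
    (map f ⊗ₘ map g) ≫ mu X' Y' = mu X Y ≫ (map (f ⊗ₘ g) : obj hq φ _ ⟶ obj hq φ _) :=
  tensor_hom_ext fun l m W V hW hV x y => by
    rw [MonoidalCategory.tensorHom_comp_tensorHom_assoc, incl_map hW, incl_map hV,
      incl_tensor_mu rfl hW hV, reassoc_of% (incl_tensor_mu rfl hW hV),
      incl_map (𝒢.tensor_mem hW hV), MonoidalCategory.tensorHom_comp_tensorHom]

lemma mu_assoc (X Y Z : 𝒯) :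
    mu X Y ▷ obj hq φ Z ≫ mu (X ⊗ Y) Z ≫ map (α_ X Y Z).hom =
      (α_ _ _ _).hom ≫ obj hq φ X ◁ mu Y Z ≫ mu X (Y ⊗ Z) :=
  tensor_tensor_hom_ext fun l m n W V U hW hV hU x y z => by
    have h₁ : ((incl hq φ l x ⊗ₘ incl hq φ m y) ⊗ₘ incl hq φ n z) ≫ mu X Y ▷ obj hq φ Z =
        (q.powTensor (φ l) (φ m) (φ (l + m)) (φ.map_add l m).symm W V).hom ▷ _ ≫
          (incl hq φ (l + m) (x ⊗ₘ y) ⊗ₘ incl hq φ n z) := by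
      rw [← tensorHom_id, MonoidalCategory.tensorHom_comp_tensorHom, incl_tensor_mu rfl hW hV,
        Category.comp_id, ← MonoidalCategory.tensorHom_id, MonoidalCategory.tensorHom_comp_tensorHom,
        Category.id_comp]
    have h₂ : (incl hq φ l x ⊗ₘ (incl hq φ m y ⊗ₘ incl hq φ n z)) ≫ obj hq φ X ◁ mu Y Z =
        _ ◁ (q.powTensor (φ m) (φ n) (φ (m + n)) (φ.map_add m n).symm V U).hom ≫
          (incl hq φ l x ⊗ₘ incl hq φ (m + n) (y ⊗ₘ z)) := by
      rw [← MonoidalCategory.id_tensorHom, MonoidalCategory.tensorHom_comp_tensorHom,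
        incl_tensor_mu rfl hV hU, Category.comp_id, ← MonoidalCategory.id_tensorHom,
        MonoidalCategory.tensorHom_comp_tensorHom, Category.id_comp]
    rw [reassoc_of% h₁, MonoidalCategory.associator_naturality_assoc, reassoc_of% h₂,
      incl_tensor_mu rfl hW (𝒢.tensor_mem hV hU),
      reassoc_of% (incl_tensor_mu (add_assoc l m n) (𝒢.tensor_mem hW hV) hU),
      incl_map (𝒢.tensor_mem' (𝒢.tensor_mem hW hV) hU (add_assoc l m n)),
      MonoidalCategory.associator_naturality, ← whiskerLeft_incl]
    have h₃ := q.powTensor_assoc (φ l) (φ m) (φ n) (φ (l + m)) (φ (m + n)) (φ (l + (m + n)))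
      (φ.map_add l m).symm (by rw [← φ.map_add, add_assoc]) (φ.map_add m n).symm
      (φ.map_add l _).symm W V U
    rw [reassoc_of% h₃]

variable (hq φ) in
/-- The unit comparison of the twist. -/
noncomputable def eps : 𝟙_ 𝒯 ⟶ obj hq φ (𝟙_ 𝒯) :=
  ((ρ_ (𝟙_ 𝒯)).inv ≫ (q.powZero (φ 0) φ.map_zero.symm).hom ▷ 𝟙_ 𝒯) ≫ incl hq φ 0 (𝟙 (𝟙_ 𝒯))

lemma eps_mu (Y : 𝒯) : eps hq φ ▷ obj hq φ Y ≫ mu (𝟙_ 𝒯) Y ≫ map (λ_ Y).hom = (λ_ _).hom := by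
  rw [← cancel_epi (λ_ _).inv]
  refine hom_ext fun m W hW y => ?_
  have h₁ : 𝟙_ 𝒯 ◁ incl hq φ m y ≫ eps hq φ ▷ obj hq φ Y =
      ((ρ_ (𝟙_ 𝒯)).inv ≫ (q.powZero (φ 0) φ.map_zero.symm).hom ▷ 𝟙_ 𝒯) ▷ _ ≫
      (incl hq φ 0 (𝟙 (𝟙_ 𝒯)) ⊗ₘ incl hq φ m y) := by
    rw [whisker_exchange, eps, comp_whiskerRight, Category.assoc, ← MonoidalCategory.tensorHom_def]
  rw [leftUnitor_inv_naturality_assoc, reassoc_of% h₁,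
    reassoc_of% (incl_tensor_mu (zero_add m) 𝒢.unit_mem hW),
    incl_map (𝒢.tensor_mem' 𝒢.unit_mem hW (zero_add m)), id_tensorHom, leftUnitor_naturality,
    ← whiskerLeft_incl]
  have h₂ := q.powTensor_powZero_left' (φ 0) (φ m) φ.map_zero.symm (by simp) W
  rw [reassoc_of% h₂]
  simp

end Twist

end Twist

/-! ### Graded braiders as honest natural transformations -/

section Braider

variable {Λ : Type*} [AddCommGroup Λ] {𝒯 : Type*} [Category 𝒯] [Preadditive 𝒯]
  [MonoidalCategory 𝒯] [MonoidalPreadditive 𝒯]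
  {𝒢 : MonoidalGrading Λ 𝒯} {q : InvertibleCentralObject 𝒯}

lemma MonoidalGrading.whiskerLeft_hom_ext {𝒢 : MonoidalGrading Λ 𝒯} {B X Z : 𝒯} {f g : B ⊗ X ⟶ Z}
    (h : ∀ (l : Λ) (W : 𝒯), 𝒢.homogeneous l W → ∀ x : W ⟶ X, B ◁ x ≫ f = B ◁ x ≫ g) : f = g := by
  rw [← Category.id_comp f, ← Category.id_comp g, ← MonoidalCategory.whiskerLeft_id,
    ← (𝒢.dec X).sum, whiskerLeft_sum, Preadditive.sum_comp, Preadditive.sum_comp]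
  refine Finset.sum_congr rfl fun l hl => ?_
  rw [MonoidalCategory.whiskerLeft_comp, Category.assoc, Category.assoc, h l _ ((𝒢.dec X).mem l hl)]

lemma MonoidalGrading.whiskerLeft_tensor_hom_ext {𝒢 : MonoidalGrading Λ 𝒯} {B X Y Z : 𝒯}
    {f g : B ⊗ (X ⊗ Y) ⟶ Z}
    (h : ∀ (l m : Λ) (W V : 𝒯), 𝒢.homogeneous l W → 𝒢.homogeneous m V → ∀ (x : W ⟶ X) (y : V ⟶ Y),
      B ◁ (x ⊗ₘ y) ≫ f = B ◁ (x ⊗ₘ y) ≫ g) : f = g := by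
  rw [← Category.id_comp f, ← Category.id_comp g, ← MonoidalCategory.whiskerLeft_id,
    ← id_tensorHom_id, ← (𝒢.dec X).sum, ← (𝒢.dec Y).sum, tensor_sum, whiskerLeft_sum,
    Preadditive.sum_comp, Preadditive.sum_comp]
  refine Finset.sum_congr rfl fun m hm => ?_
  rw [sum_tensor, whiskerLeft_sum, Preadditive.sum_comp, Preadditive.sum_comp]
  refine Finset.sum_congr rfl fun l hl => ?_
  rw [← MonoidalCategory.tensorHom_comp_tensorHom, MonoidalCategory.whiskerLeft_comp,
    Category.assoc, Category.assoc, h l m _ _ ((𝒢.dec X).mem l hl) ((𝒢.dec Y).mem m hm)]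

namespace GradedBraider

lemma R_cast (C : GradedBraider 𝒢 q) {l m : Λ} (h : l = m) {X : 𝒯} (hX : 𝒢.homogeneous l X)
    (hX' : 𝒢.homogeneous m X) :
    C.R X hX' = C.R X hX ≫ q.powCast (congrArg C.φ h) ▷ (X ⊗ C.obj) := by
  subst h
  rw [InvertibleCentralObject.powCast_rfl]
  simp

lemma R_natural (C : GradedBraider 𝒢 q) {l : Λ} {X Y : 𝒯} (hX : 𝒢.homogeneous l X)
    (hY : 𝒢.homogeneous l Y) (f : X ⟶ Y) :
    C.obj ◁ f ≫ C.R Y hY = C.R X hX ≫ q.pow (C.φ l) ◁ (f ▷ C.obj) :=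
  C.naturality hX hY f

variable (hq : 𝒢.homogeneous 0 (q.pow 1)) (C : GradedBraider 𝒢 q)

/-- The twist of `X` by the additive map of `C`. -/
noncomputable abbrev tw (X : 𝒯) : 𝒯 := Twist.obj hq C.φ X

/-- The morphism `C ⊗ X ⟶ σ(X) ⊗ C` on all objects `X` given by the `R_C(X)` for homogeneous `X`. -/
noncomputable def braid (X : 𝒯) : C.obj ⊗ X ⟶ C.tw hq X ⊗ C.obj :=
  ∑ l ∈ (𝒢.dec X).s.attach, C.obj ◁ (𝒢.dec X).π l ≫ C.R _ ((𝒢.dec X).mem l l.2) ≫ (α_ _ _ _).inv ≫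
    Twist.incl hq C.φ l ((𝒢.dec X).ι l) ▷ C.obj

lemma whiskerLeft_braid {l : Λ} {W X : 𝒯} (hW : 𝒢.homogeneous l W) (x : W ⟶ X) :
    C.obj ◁ x ≫ C.braid hq X =
      C.R W hW ≫ (α_ _ _ _).inv ≫ Twist.incl hq C.φ l x ▷ C.obj := by
  by_cases hl : l ∈ (𝒢.dec X).s
  · rw [braid, Preadditive.comp_sum, Finset.sum_eq_single_of_mem ⟨l, hl⟩ (Finset.mem_attach _ _),
      ← MonoidalCategory.whiskerLeft_comp_assoc,
      reassoc_of% C.R_natural hW ((𝒢.dec X).mem l hl) (x ≫ (𝒢.dec X).π l),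
      associator_inv_naturality_middle_assoc, ← comp_whiskerRight, Twist.whiskerLeft_incl,
      Category.assoc, (𝒢.dec X).comp_π_ι hW x hl]
    intro m _ hm
    rw [← MonoidalCategory.whiskerLeft_comp_assoc,
      (𝒢.dec X).eq_zero hW x m.2 (fun h => hm (Subtype.ext h.symm))]
    simp
  · rw [(𝒢.dec X).comp_eq_zero hW x hl]
    simp [Twist.incl_zero]

lemma braid_natural {X Y : 𝒯} (f : X ⟶ Y) :
    C.obj ◁ f ≫ C.braid hq Y = C.braid hq X ≫ Twist.map f ▷ C.obj :=
  𝒢.whiskerLeft_hom_ext fun l W hW x => by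
    rw [← MonoidalCategory.whiskerLeft_comp_assoc, whiskerLeft_braid hq C hW,
      reassoc_of% (whiskerLeft_braid hq C hW), ← comp_whiskerRight, Twist.incl_map hW]

lemma braid_tensor (X Y : 𝒯) : C.braid hq (X ⊗ Y) = (α_ _ _ _).inv ≫ C.braid hq X ▷ Y ≫
    (α_ _ _ _).hom ≫ C.tw hq X ◁ C.braid hq Y ≫ (α_ _ _ _).inv ≫ Twist.mu X Y ▷ C.obj :=
  𝒢.whiskerLeft_tensor_hom_ext fun l m W V hW hV x y => by
    rw [whiskerLeft_braid hq C (𝒢.tensor_mem hW hV), C.tensor hW hV]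
    have h₁ : C.obj ◁ (x ⊗ₘ y) ≫ (α_ _ _ _).inv ≫ C.braid hq X ▷ Y ≫
        (α_ _ _ _).hom ≫ C.tw hq X ◁ C.braid hq Y ≫ (α_ _ _ _).inv ≫ Twist.mu X Y ▷ C.obj =
        (α_ _ _ _).inv ≫ (C.obj ◁ x ≫ C.braid hq X) ▷ V ≫ (α_ _ _ _).hom ≫
          C.tw hq X ◁ (C.obj ◁ y ≫ C.braid hq Y) ≫ (α_ _ _ _).inv ≫ Twist.mu X Y ▷ C.obj := by
      calc _ = 𝟙 _ ⊗≫ (C.obj ◁ x) ▷ V ⊗≫ ((C.obj ⊗ X) ◁ y ≫ C.braid hq X ▷ Y) ⊗≫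
            C.tw hq X ◁ C.braid hq Y ⊗≫ Twist.mu X Y ▷ C.obj := by
            rw [MonoidalCategory.tensorHom_def]; monoidal
        _ = _ := by rw [whisker_exchange]; monoidal
    have h₂ : (Twist.incl hq C.φ l x ⊗ₘ Twist.incl hq C.φ m y) ≫ Twist.mu X Y = _ :=
      Twist.incl_tensor_mu rfl hW hV x y
    rw [h₁, whiskerLeft_braid hq C hW, whiskerLeft_braid hq C hV]
    calc _ = 𝟙 _ ⊗≫ C.R W hW ▷ V ⊗≫ q.pow (C.φ l) ◁ W ◁ C.R V hV ⊗≫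
          (q.powTensor (C.φ l) (C.φ m) (C.φ (l + m)) (C.φ.map_add l m).symm W V).hom ▷ C.obj ⊗≫
          Twist.incl hq C.φ (l + m) (x ⊗ₘ y) ▷ C.obj := by
          rw [InvertibleCentralObject.powTensor_hom, InvertibleCentralObject.moveLeft_hom,
            InvertibleCentralObject.moveLeft_hom]
          monoidal
      _ = 𝟙 _ ⊗≫ C.R W hW ▷ V ⊗≫ q.pow (C.φ l) ◁ W ◁ C.R V hV ⊗≫
          ((Twist.incl hq C.φ l x ⊗ₘ Twist.incl hq C.φ m y) ≫ Twist.mu X Y) ▷ C.obj := by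
          rw [h₂]; monoidal
      _ = _ := by
          have h₃ : (C.tw hq X) ◁ (C.R V hV ≫ (α_ _ _ _).inv ≫ Twist.incl hq C.φ m y ▷ C.obj) =
            (C.tw hq X) ◁ C.R V hV ≫ (C.tw hq X) ◁ ((α_ _ _ _).inv ≫
              Twist.incl hq C.φ m y ▷ C.obj) := by rw [← MonoidalCategory.whiskerLeft_comp]
          have h₄ := (whisker_exchange (Twist.incl hq C.φ l x) (C.R V hV)).symm
          rw [h₃]
          calc _ = 𝟙 _ ⊗≫ C.R W hW ▷ V ⊗≫ ((q.pow (C.φ l) ⊗ W) ◁ C.R V hV ≫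
                Twist.incl hq C.φ l x ▷ _) ⊗≫ ((C.tw hq X) ◁ Twist.incl hq C.φ m y ≫
                  Twist.mu X Y) ▷ C.obj := by
                rw [MonoidalCategory.tensorHom_def]; monoidal
            _ = _ := by rw [whisker_exchange]; monoidal

lemma braid_unit : C.braid hq (𝟙_ 𝒯) =
    (ρ_ _).hom ≫ (λ_ _).inv ≫ Twist.eps hq C.φ ▷ C.obj := by
  have h := whiskerLeft_braid hq C 𝒢.unit_mem (𝟙 (𝟙_ 𝒯))
  rw [MonoidalCategory.whiskerLeft_id, Category.id_comp, C.unit] at h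
  rw [h, Twist.eps]
  monoidal

end GradedBraider

end Braider

/-! ### Consequences of reality and commutation -/

section Invertible

variable {𝒟 : Type*} [Category 𝒟] [MonoidalCategory 𝒟]

lemma IsInvertibleObj.exists_whiskerRight {X : 𝒟} (h : IsInvertibleObj X) {A B : 𝒟}
    (f : A ⊗ X ⟶ B ⊗ X) : ∃ g : A ⟶ B, f = g ▷ X := by
  have := h.2
  exact ⟨(tensorRight X).preimage f, ((tensorRight X).map_preimage f).symm⟩

lemma IsInvertibleObj.isIso_of_whiskerLeft {X : 𝒟} (h : IsInvertibleObj X) {A B : 𝒟}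
    (f : A ⟶ B) [hf : IsIso (X ◁ f)] : IsIso f := by
  have := h.1
  have : IsIso ((tensorLeft X).map f) := hf
  exact isIso_of_reflects_iso f (tensorLeft X)

namespace InvertibleCentralObject

variable (q : InvertibleCentralObject 𝒟)

/-- The cancellation of inverse powers. -/
noncomputable def powInv (a b : ℤ) (h : a + b = 0) : q.pow a ⊗ q.pow b ≅ 𝟙_ 𝒟 :=
  q.powAdd a b 0 h ≪≫ (q.powZero 0 rfl).symm

lemma isInvertibleObj_pow (n : ℤ) : IsInvertibleObj (q.pow n) :=
  IsInvertibleObj.of_iso (q.powInv (-n) n (by ring)) (q.powInv n (-n) (by ring))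

/-- The self-braiding of a power is given by the action of an endomorphism of the unit. -/
lemma exists_self_central (n : ℤ) : ∃ e : 𝟙_ 𝒟 ⟶ 𝟙_ 𝒟,
    (q.central n (q.pow n)).inv = (λ_ _).inv ≫ e ▷ _ ≫ (λ_ _).hom := by
  obtain ⟨e, he⟩ := (q.isInvertibleObj_pow (n + n)).exists_whiskerRight
    ((λ_ _).hom ≫ (q.powAdd n n _ rfl).inv ≫ (q.central n (q.pow n)).inv ≫
      (q.powAdd n n _ rfl).hom ≫ (λ_ _).inv)
  refine ⟨e, ?_⟩
  rw [← cancel_mono (q.powAdd n n _ rfl).hom, Category.assoc, Category.assoc,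
    ← leftUnitor_naturality, ← whisker_exchange_assoc, ← he]
  simp

lemma moveLeft_self {n : ℤ} {e : 𝟙_ 𝒟 ⟶ 𝟙_ 𝒟}
    (he : (q.central n (q.pow n)).inv = (λ_ _).inv ≫ e ▷ _ ≫ (λ_ _).hom) (Y : 𝒟) :
    (q.moveLeft n (q.pow n) Y).hom = (λ_ _).inv ≫ e ▷ _ ≫ (λ_ _).hom := by
  rw [moveLeft_hom, he]
  monoidal

lemma powZero_powAdd_powCast (z b c : ℤ) (hz : 0 = z) (h : z + b = c) (h' : c = b) :
    (q.powZero z hz).hom ▷ q.pow b ≫ (q.powAdd z b c h).hom ≫ q.powCast h' = (λ_ _).hom := by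
  subst hz h'
  rw [powCast_rfl, Category.comp_id, zero_powAdd]

end InvertibleCentralObject

end Invertible

section RealCommuting

variable {R : Type*} [CommRing R] {Λ : Type*} [AddCommGroup Λ] {𝒯 : Type*} [Category 𝒯]
  [Preadditive 𝒯] [Linear R 𝒯] [MonoidalCategory 𝒯] [MonoidalPreadditive 𝒯] [MonoidalLinear R 𝒯]
  {𝒢 : MonoidalGrading Λ 𝒯} {q : InvertibleCentralObject 𝒯} {I : Type*}

lemma isIso_units_smul {X Y : 𝒯} (f : X ⟶ Y) [IsIso f] (r : Rˣ) : IsIso ((r : R) • f) :=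
  ⟨((r⁻¹ : Rˣ) : R) • inv f, by simp [smul_smul], by simp [smul_smul]⟩

namespace IsRealCommutingFamily

variable {C : I → GradedBraider 𝒢 q} {deg : I → Λ} (hC : IsRealCommutingFamily R C deg)

include hC

lemma isIso_R (i j : I) : IsIso ((C i).R (C j).obj (hC.homogeneous j)) := by
  obtain ⟨r, hr⟩ := hC.commuting i j
  obtain ⟨r', hr'⟩ := hC.commuting j i
  have h₁ := isIso_units_smul (R := R) ((λ_ ((C i).obj ⊗ (C j).obj)).inv ≫
      ((q.powZero 0 rfl ≪≫ (q.powAdd ((C i).φ (deg j)) ((C j).φ (deg i)) 0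
        (hC.φ_add i j)).symm).hom ▷ ((C i).obj ⊗ (C j).obj)) ≫
      (α_ (q.pow ((C i).φ (deg j))) (q.pow ((C j).φ (deg i))) ((C i).obj ⊗ (C j).obj)).hom) r
  have h₂ := isIso_units_smul (R := R) ((λ_ ((C j).obj ⊗ (C i).obj)).inv ≫
      ((q.powZero 0 rfl ≪≫ (q.powAdd ((C j).φ (deg i)) ((C i).φ (deg j)) 0
        (hC.φ_add j i)).symm).hom ▷ ((C j).obj ⊗ (C i).obj)) ≫
      (α_ (q.pow ((C j).φ (deg i))) (q.pow ((C i).φ (deg j))) ((C j).obj ⊗ (C i).obj)).hom) r'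
  rw [← hr] at h₁
  rw [← hr'] at h₂
  have hmono : Mono ((C i).R (C j).obj (hC.homogeneous j)) :=
    mono_of_mono _ (q.pow ((C i).φ (deg j)) ◁ (C j).R (C i).obj (hC.homogeneous i))
  have hinv := q.isInvertibleObj_pow ((C j).φ (deg i))
  have := hinv.1
  have hmono' : Mono (q.pow ((C j).φ (deg i)) ◁ (C i).R (C j).obj (hC.homogeneous j)) :=
    (inferInstance : Mono ((tensorLeft (q.pow ((C j).φ (deg i)))).map
      ((C i).R (C j).obj (hC.homogeneous j))))
  have hepi : IsSplitEpi (q.pow ((C j).φ (deg i)) ◁ (C i).R (C j).obj (hC.homogeneous j)) :=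
    IsSplitEpi.mk' ⟨inv ((C j).R (C i).obj (hC.homogeneous i) ≫
      q.pow ((C j).φ (deg i)) ◁ (C i).R (C j).obj (hC.homogeneous j)) ≫
        (C j).R (C i).obj (hC.homogeneous i), by simp⟩
  have := isIso_of_mono_of_isSplitEpi
    (q.pow ((C j).φ (deg i)) ◁ (C i).R (C j).obj (hC.homogeneous j))
  exact hinv.isIso_of_whiskerLeft _

lemma whiskerLeft_self (i : I) (f : (C i).obj ⟶ (C i).obj) :
    (C i).obj ◁ f = f ▷ (C i).obj := by
  obtain ⟨r, hr⟩ := hC.real i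
  have h := (C i).R_natural (hC.homogeneous i) (hC.homogeneous i) f
  rw [hr, Linear.comp_smul, Linear.smul_comp, Category.assoc, ← whisker_exchange,
    ← leftUnitor_inv_naturality_assoc] at h
  have h' := congrArg (fun g => ((r⁻¹ : Rˣ) : R) • g) h
  simpa [smul_smul, cancel_mono] using h'

variable (hq : 𝒢.homogeneous 0 (q.pow 1))

/-- The isomorphism of `C_i` with its twist. -/
noncomputable def selfTwist (i : I) : (C i).obj ⟶ (C i).tw hq (C i).obj :=
  ((λ_ (C i).obj).inv ≫ (q.powZero ((C i).φ (deg i)) (hC.φ_self i).symm).hom ▷ (C i).obj) ≫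
    Twist.incl hq (C i).φ (deg i) (𝟙 (C i).obj)

lemma isIso_selfTwist (i : I) : IsIso (hC.selfTwist hq i) := by
  have := Twist.isIso_incl (hq := hq) (φ := (C i).φ) (𝟙 (C i).obj) (hC.homogeneous i)
  dsimp only [selfTwist]
  infer_instance

lemma braid_self (i : I) : ∃ r : Rˣ,
    (C i).braid hq (C i).obj = (r : R) • (hC.selfTwist hq i ▷ (C i).obj) := by
  obtain ⟨r, hr⟩ := hC.real i
  refine ⟨r, ?_⟩
  have h := (C i).whiskerLeft_braid hq (hC.homogeneous i) (𝟙 (C i).obj)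
  rw [MonoidalCategory.whiskerLeft_id, Category.id_comp, hr] at h
  rw [h, selfTwist, Linear.smul_comp]
  congr 1
  monoidal

/-- The braider of `C_i` on a power of `q` is the centrality isomorphism up to an endomorphism. -/
lemma exists_R_pow (i : I) (n : ℤ) : ∃ χ : (C i).obj ⟶ (C i).obj,
    (C i).R (q.pow n) (q.homogeneous_pow hq n) = χ ▷ q.pow n ≫ (q.central n (C i).obj).inv ≫
      (λ_ _).inv ≫ (q.powZero ((C i).φ 0) (C i).φ.map_zero.symm).hom ▷ _ := by
  obtain ⟨χ, hχ⟩ := (q.isInvertibleObj_pow n).exists_whiskerRight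
    ((C i).R (q.pow n) (q.homogeneous_pow hq n) ≫
      (q.powZero ((C i).φ 0) (C i).φ.map_zero.symm).inv ▷ _ ≫ (λ_ _).hom ≫
        (q.central n (C i).obj).hom)
  refine ⟨χ, ?_⟩
  rw [← hχ]
  simp

lemma exists_R_pow_tensor (i : I) {l : Λ} {Z : 𝒯} (hZ : 𝒢.homogeneous l Z) :
    ∃ χ : (C i).obj ⟶ (C i).obj,
      (C i).R (q.pow ((C i).φ l) ⊗ Z) (q.pow_tensor_mem hq _ hZ) =
        χ ▷ (q.pow ((C i).φ l) ⊗ Z) ≫ (q.moveLeft ((C i).φ l) (C i).obj Z).hom ≫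
          q.pow ((C i).φ l) ◁ ((C i).R Z hZ ≫ (α_ _ _ _).inv) := by
  obtain ⟨χ, hχ⟩ := hC.exists_R_pow hq i ((C i).φ l)
  obtain ⟨e, he⟩ := q.exists_self_central ((C i).φ l)
  refine ⟨((λ_ _).inv ≫ e ▷ _ ≫ (λ_ _).hom) ≫ χ, ?_⟩
  rw [(C i).R_cast (zero_add l) (𝒢.tensor_mem (q.homogeneous_pow hq ((C i).φ l)) hZ),
    (C i).tensor (q.homogeneous_pow hq ((C i).φ l)) hZ, hχ, q.moveLeft_self he]
  calc _ = 𝟙 _ ⊗≫ χ ▷ (q.pow ((C i).φ l) ⊗ Z) ⊗≫ (q.central ((C i).φ l) (C i).obj).inv ▷ Z ⊗≫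
        ((q.powZero ((C i).φ 0) (C i).φ.map_zero.symm).hom ▷ _ ≫ q.pow ((C i).φ 0) ◁
          (𝟙 (q.pow ((C i).φ l) ⊗ (C i).obj ⊗ Z) ⊗≫ q.pow ((C i).φ l) ◁ (C i).R Z hZ ⊗≫
            e ▷ (q.pow ((C i).φ l) ⊗ (q.pow ((C i).φ l) ⊗ (Z ⊗ (C i).obj))))) ⊗≫
        ((q.powAdd ((C i).φ 0) ((C i).φ l) ((C i).φ (0 + l)) ((C i).φ.map_add 0 l).symm).hom ≫
          q.powCast (congrArg (C i).φ (zero_add l))) ▷ (q.pow ((C i).φ l) ⊗ (Z ⊗ (C i).obj)) ⊗≫ 𝟙 _ := by monoidal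
    _ = 𝟙 _ ⊗≫ χ ▷ (q.pow ((C i).φ l) ⊗ Z) ⊗≫ (q.central ((C i).φ l) (C i).obj).inv ▷ Z ⊗≫
          (𝟙_ 𝒯 ◁ (𝟙 (q.pow ((C i).φ l) ⊗ (C i).obj ⊗ Z) ⊗≫ q.pow ((C i).φ l) ◁ (C i).R Z hZ) ≫
            e ▷ (q.pow ((C i).φ l) ⊗ (q.pow ((C i).φ l) ⊗ (Z ⊗ (C i).obj)))) ⊗≫
        ((q.powZero ((C i).φ 0) (C i).φ.map_zero.symm).hom ▷ _ ≫
          (q.powAdd ((C i).φ 0) ((C i).φ l) ((C i).φ (0 + l)) ((C i).φ.map_add 0 l).symm).hom ≫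
          q.powCast (congrArg (C i).φ (zero_add l))) ▷ (q.pow ((C i).φ l) ⊗ (Z ⊗ (C i).obj)) ⊗≫ 𝟙 _ := by
        rw [← whisker_exchange]; monoidal
    _ = 𝟙 _ ⊗≫ (𝟙_ 𝒯 ◁ (𝟙 ((C i).obj ⊗ q.pow ((C i).φ l) ⊗ Z) ⊗≫ χ ▷ (q.pow ((C i).φ l) ⊗ Z) ⊗≫
          (q.central ((C i).φ l) (C i).obj).inv ▷ Z ⊗≫
            𝟙 (q.pow ((C i).φ l) ⊗ ((C i).obj ⊗ Z))) ≫
            e ▷ (q.pow ((C i).φ l) ⊗ ((C i).obj ⊗ Z))) ⊗≫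
          q.pow ((C i).φ l) ◁ (C i).R Z hZ ⊗≫ 𝟙 _ := by
        rw [InvertibleCentralObject.powZero_powAdd_powCast, whisker_exchange]; monoidal
    _ = _ := by
        rw [whisker_exchange, InvertibleCentralObject.moveLeft_hom]; monoidal

/-- The square of the braider of `C_i`, up to an endomorphism of `C_i`. -/
lemma exists_braid_tw (i : I) {l : Λ} {Z : 𝒯} (hZ : 𝒢.homogeneous l Z) :
    ∃ χ : (C i).obj ⟶ (C i).obj,
      (C i).braid hq ((C i).tw hq Z) ≫ (C i).tw hq ((C i).tw hq Z) ◁ hC.selfTwist hq i ≫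
          Twist.mu ((C i).tw hq Z) (C i).obj =
        χ ▷ (C i).tw hq Z ≫ hC.selfTwist hq i ▷ (C i).tw hq Z ≫ Twist.mu (C i).obj Z ≫
          Twist.map ((C i).braid hq Z) := by
  obtain ⟨χ, hχ⟩ := hC.exists_R_pow_tensor hq i hZ
  refine ⟨χ, ?_⟩
  have hW := q.pow_tensor_mem hq ((C i).φ l) hZ
  have hi := Twist.isIso_incl (hq := hq) (φ := (C i).φ) (𝟙 Z) hZ
  have hi' : IsIso ((C i).obj ◁ Twist.incl hq (C i).φ l (𝟙 Z)) := inferInstance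
  rw [← cancel_epi ((C i).obj ◁ Twist.incl hq (C i).φ l (𝟙 Z))]
  have hdeg : deg i + l = l + deg i := add_comm _ _
  have hφ : (C i).φ l = (C i).φ (l + deg i) := by rw [map_add, hC.φ_self, add_zero]
  have h₁ := q.powTensor_unit_right ((C i).φ l) ((C i).φ (deg i)) ((C i).φ (l + deg i))
    (hC.φ_self i).symm ((C i).φ.map_add _ _).symm (q.pow ((C i).φ l) ⊗ Z) (C i).obj
  have h₂ := q.powTensor_unit_left ((C i).φ (deg i)) ((C i).φ l) ((C i).φ (l + deg i))
    (hC.φ_self i).symm (by rw [← map_add, hdeg]) (C i).obj Z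
  have h₃ := Twist.incl_tensor_mu (hq := hq) (φ := (C i).φ) (rfl : l + deg i = l + deg i) hW
    (hC.homogeneous i) (Twist.incl hq (C i).φ l (𝟙 Z)) (𝟙 (C i).obj)
  have h₄ := Twist.incl_tensor_mu (hq := hq) (φ := (C i).φ) hdeg (hC.homogeneous i) hZ
    (𝟙 (C i).obj) (𝟙 Z)
  have hL : (C i).obj ◁ Twist.incl hq (C i).φ l (𝟙 Z) ≫
      (C i).braid hq ((C i).tw hq Z) ≫ (C i).tw hq ((C i).tw hq Z) ◁ hC.selfTwist hq i ≫
          Twist.mu ((C i).tw hq Z) (C i).obj =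
      (C i).R _ hW ≫ q.powCast hφ ▷ _ ≫ Twist.incl hq (C i).φ (l + deg i)
        (Twist.incl hq (C i).φ l (𝟙 Z) ▷ (C i).obj) := by
    calc _ = (C i).R _ hW ≫ (α_ _ _ _).inv ≫ (Twist.incl hq (C i).φ l
          (Twist.incl hq (C i).φ l (𝟙 Z)) ▷ (C i).obj ≫ _ ◁ ((λ_ (C i).obj).inv ≫
            (q.powZero ((C i).φ (deg i)) (hC.φ_self i).symm).hom ▷ (C i).obj)) ≫ _ ◁
            Twist.incl hq (C i).φ (deg i) (𝟙 (C i).obj) ≫ Twist.mu ((C i).tw hq Z) (C i).obj := by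
          rw [reassoc_of% ((C i).whiskerLeft_braid hq hW (Twist.incl hq (C i).φ l (𝟙 Z))),
            selfTwist, MonoidalCategory.whiskerLeft_comp]
          simp only [Category.assoc]
      _ = (C i).R _ hW ≫ (α_ _ _ _).inv ≫ (_ ◁ ((λ_ (C i).obj).inv ≫
            (q.powZero ((C i).φ (deg i)) (hC.φ_self i).symm).hom ▷ (C i).obj) ≫
            (q.powTensor ((C i).φ l) ((C i).φ (deg i)) ((C i).φ (l + deg i))
              ((C i).φ.map_add _ _).symm (q.pow ((C i).φ l) ⊗ Z) (C i).obj).hom) ≫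
            Twist.incl hq (C i).φ (l + deg i)
              (Twist.incl hq (C i).φ l (𝟙 Z) ⊗ₘ 𝟙 (C i).obj) := by
          rw [← whisker_exchange]
          simp only [Category.assoc]
          rw [← h₃, MonoidalCategory.tensorHom_def, Category.assoc]
      _ = _ := by
          rw [h₁, tensorHom_id]
          simp
  have hR : (C i).obj ◁ Twist.incl hq (C i).φ l (𝟙 Z) ≫ χ ▷ (C i).tw hq Z ≫
      hC.selfTwist hq i ▷ (C i).tw hq Z ≫ Twist.mu (C i).obj Z ≫ Twist.map ((C i).braid hq Z) =
      χ ▷ _ ≫ (q.moveLeft ((C i).φ l) (C i).obj Z).hom ≫ q.powCast hφ ▷ _ ≫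
        q.pow ((C i).φ (l + deg i)) ◁ ((C i).R Z hZ ≫ (α_ _ _ _).inv) ≫
        Twist.incl hq (C i).φ (l + deg i) (Twist.incl hq (C i).φ l (𝟙 Z) ▷ (C i).obj) := by
    calc _ = χ ▷ _ ≫ (((λ_ (C i).obj).inv ≫ (q.powZero ((C i).φ (deg i))
            (hC.φ_self i).symm).hom ▷ (C i).obj) ▷ _ ≫
          (Twist.incl hq (C i).φ (deg i) (𝟙 (C i).obj) ⊗ₘ Twist.incl hq (C i).φ l (𝟙 Z))) ≫
          Twist.mu (C i).obj Z ≫ Twist.map ((C i).braid hq Z) := by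
          rw [whisker_exchange_assoc, whisker_exchange_assoc, selfTwist, comp_whiskerRight,
            MonoidalCategory.tensorHom_def]
          simp only [Category.assoc]
      _ = _ := by
          simp only [Category.assoc]
          rw [reassoc_of% h₄, reassoc_of% h₂, Twist.incl_map
            (𝒢.tensor_mem' (hC.homogeneous i) hZ hdeg), id_tensorHom,
            (C i).whiskerLeft_braid hq hZ, Twist.whiskerLeft_incl, Category.assoc]
  rw [hL, hR, hχ]
  simp only [Category.assoc]
  rw [whisker_exchange_assoc]

end IsRealCommutingFamily

end RealCommuting

/-! ### A category of formal left fractions -/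

section Frac

universe u v x u' v'

/-- A formal left fraction `den⁻¹ ⊗ num`. -/
structure Frac (R : Type x) (𝒯 : Type u) where
  /-- the denominator -/
  den : 𝒯
  /-- the numerator -/
  num : 𝒯

namespace Frac

variable (R : Type x) [CommRing R] {𝒯 : Type u} [Category.{v} 𝒯] [Preadditive 𝒯] [Linear R 𝒯]
  [MonoidalCategory 𝒯]

/-- Terms for the morphisms between formal fractions. -/
inductive Tm : Frac R 𝒯 → Frac R 𝒯 → Type (max u v x)
  | id (X : Frac R 𝒯) : Tm X X
  | comp {X Y Z : Frac R 𝒯} (f : Tm X Y) (g : Tm Y Z) : Tm X Z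
  | left {A A' : 𝒯} (a : A' ⟶ A) (Z : 𝒯) : Tm ⟨A, Z⟩ ⟨A', Z⟩
  | right (A : 𝒯) {Z Z' : 𝒯} (z : Z ⟶ Z') : Tm ⟨A, Z⟩ ⟨A, Z'⟩
  | e (B A Z : 𝒯) : Tm ⟨A, Z⟩ ⟨B ⊗ A, B ⊗ Z⟩
  | zero (X Y : Frac R 𝒯) : Tm X Y
  | add {X Y : Frac R 𝒯} (f g : Tm X Y) : Tm X Y
  | smul {X Y : Frac R 𝒯} (r : R) (f : Tm X Y) : Tm X Y

/-- The defining relations of the category of formal fractions. -/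
inductive Rel : ∀ {X Y : Frac R 𝒯}, Tm R X Y → Tm R X Y → Prop
  | comp_left {X Y Z : Frac R 𝒯} {f f' : Tm R X Y} (g : Tm R Y Z) : Rel f f' →
      Rel (f.comp g) (f'.comp g)
  | comp_right {X Y Z : Frac R 𝒯} (f : Tm R X Y) {g g' : Tm R Y Z} : Rel g g' →
      Rel (f.comp g) (f.comp g')
  | add_left {X Y : Frac R 𝒯} {f f' : Tm R X Y} (g : Tm R X Y) : Rel f f' → Rel (f.add g) (f'.add g)
  | add_right {X Y : Frac R 𝒯} (f : Tm R X Y) {g g' : Tm R X Y} : Rel g g' → Rel (f.add g) (f.add g')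
  | smul {X Y : Frac R 𝒯} (r : R) {f f' : Tm R X Y} : Rel f f' → Rel (f.smul r) (f'.smul r)
  | id_comp {X Y : Frac R 𝒯} (f : Tm R X Y) : Rel ((Tm.id X).comp f) f
  | comp_id {X Y : Frac R 𝒯} (f : Tm R X Y) : Rel (f.comp (Tm.id Y)) f
  | assoc {X Y Z V : Frac R 𝒯} (f : Tm R X Y) (g : Tm R Y Z) (h : Tm R Z V) :
      Rel ((f.comp g).comp h) (f.comp (g.comp h))
  | left_id (A Z : 𝒯) : Rel (Tm.left (𝟙 A) Z) (Tm.id _)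
  | left_comp {A A' A'' : 𝒯} (b : A'' ⟶ A') (a : A' ⟶ A) (Z : 𝒯) :
      Rel (Tm.left (b ≫ a) Z) ((Tm.left a Z).comp (Tm.left b Z))
  | left_add {A A' : 𝒯} (a b : A' ⟶ A) (Z : 𝒯) :
      Rel (Tm.left (a + b) Z) ((Tm.left a Z).add (Tm.left b Z))
  | left_smul {A A' : 𝒯} (r : R) (a : A' ⟶ A) (Z : 𝒯) :
      Rel (Tm.left (r • a) Z) ((Tm.left a Z).smul r)
  | right_id (A Z : 𝒯) : Rel (Tm.right A (𝟙 Z)) (Tm.id _)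
  | right_comp (A : 𝒯) {Z Z' Z'' : 𝒯} (z : Z ⟶ Z') (z' : Z' ⟶ Z'') :
      Rel (Tm.right A (z ≫ z')) ((Tm.right A z).comp (Tm.right A z'))
  | right_add (A : 𝒯) {Z Z' : 𝒯} (z z' : Z ⟶ Z') :
      Rel (Tm.right A (z + z')) ((Tm.right A z).add (Tm.right A z'))
  | right_smul (A : 𝒯) {Z Z' : 𝒯} (r : R) (z : Z ⟶ Z') :
      Rel (Tm.right A (r • z)) ((Tm.right A z).smul r)
  | left_right {A A' Z Z' : 𝒯} (a : A' ⟶ A) (z : Z ⟶ Z') :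
      Rel ((Tm.left a Z).comp (Tm.right A' z)) ((Tm.right A z).comp (Tm.left a Z'))
  | left_e (B : 𝒯) {A A' : 𝒯} (a : A' ⟶ A) (Z : 𝒯) :
      Rel ((Tm.left a Z).comp (Tm.e B A' Z)) ((Tm.e B A Z).comp (Tm.left (B ◁ a) _))
  | right_e (B A : 𝒯) {Z Z' : 𝒯} (z : Z ⟶ Z') :
      Rel ((Tm.right A z).comp (Tm.e B A Z')) ((Tm.e B A Z).comp (Tm.right _ (B ◁ z)))
  | dinat {B B' : 𝒯} (b : B ⟶ B') (A Z : 𝒯) :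
      Rel ((Tm.e B A Z).comp (Tm.right _ (b ▷ Z))) ((Tm.e B' A Z).comp (Tm.left (b ▷ A) _))
  | e_tensor (B B' A Z : 𝒯) : Rel ((Tm.e B A Z).comp (Tm.e B' _ _))
      ((Tm.e (B' ⊗ B) A Z).comp ((Tm.left (α_ B' B A).inv _).comp (Tm.right _ (α_ B' B Z).hom)))
  | e_unit (A Z : 𝒯) : Rel ((Tm.e (𝟙_ 𝒯) A Z).comp
      ((Tm.left (λ_ A).inv _).comp (Tm.right _ (λ_ Z).hom))) (Tm.id _)
  | add_assoc {X Y : Frac R 𝒯} (f g h : Tm R X Y) : Rel ((f.add g).add h) (f.add (g.add h))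
  | add_comm {X Y : Frac R 𝒯} (f g : Tm R X Y) : Rel (f.add g) (g.add f)
  | zero_add {X Y : Frac R 𝒯} (f : Tm R X Y) : Rel ((Tm.zero X Y).add f) f
  | one_smul {X Y : Frac R 𝒯} (f : Tm R X Y) : Rel (f.smul 1) f
  | mul_smul {X Y : Frac R 𝒯} (r s : R) (f : Tm R X Y) : Rel (f.smul (r * s)) ((f.smul s).smul r)
  | smul_add {X Y : Frac R 𝒯} (r : R) (f g : Tm R X Y) :
      Rel ((f.add g).smul r) ((f.smul r).add (g.smul r))
  | add_smul {X Y : Frac R 𝒯} (r s : R) (f : Tm R X Y) :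
      Rel (f.smul (r + s)) ((f.smul r).add (f.smul s))
  | zero_smul {X Y : Frac R 𝒯} (f : Tm R X Y) : Rel (f.smul 0) (Tm.zero X Y)
  | add_comp {X Y Z : Frac R 𝒯} (f f' : Tm R X Y) (g : Tm R Y Z) :
      Rel ((f.add f').comp g) ((f.comp g).add (f'.comp g))
  | comp_add {X Y Z : Frac R 𝒯} (f : Tm R X Y) (g g' : Tm R Y Z) :
      Rel (f.comp (g.add g')) ((f.comp g).add (f.comp g'))
  | smul_comp {X Y Z : Frac R 𝒯} (r : R) (f : Tm R X Y) (g : Tm R Y Z) :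
      Rel ((f.smul r).comp g) ((f.comp g).smul r)
  | comp_smul {X Y Z : Frac R 𝒯} (f : Tm R X Y) (r : R) (g : Tm R Y Z) :
      Rel (f.comp (g.smul r)) ((f.comp g).smul r)

instance : Category (Frac R 𝒯) where
  Hom X Y := Quot (Rel R (X := X) (Y := Y))
  id X := Quot.mk _ (Tm.id X)
  comp := Quot.map₂ Tm.comp (fun f _ _ h => .comp_right f h) (fun _ _ g h => .comp_left g h)
  id_comp := by rintro X Y ⟨f⟩; exact Quot.sound (.id_comp f)
  comp_id := by rintro X Y ⟨f⟩; exact Quot.sound (.comp_id f)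
  assoc := by rintro X Y Z V ⟨f⟩ ⟨g⟩ ⟨h⟩; exact Quot.sound (.assoc f g h)

/-- The morphism represented by a term. -/
def ofTm {X Y : Frac R 𝒯} (f : Tm R X Y) : X ⟶ Y := Quot.mk _ f

instance (X Y : Frac R 𝒯) : Add (X ⟶ Y) :=
  ⟨Quot.map₂ Tm.add (fun f _ _ h => .add_right f h) (fun _ _ g h => .add_left g h)⟩

instance (X Y : Frac R 𝒯) : Zero (X ⟶ Y) := ⟨ofTm R (Tm.zero X Y)⟩

instance (X Y : Frac R 𝒯) : Neg (X ⟶ Y) :=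
  ⟨Quot.map (Tm.smul (-1)) (fun _ _ h => .smul _ h)⟩

instance (X Y : Frac R 𝒯) : AddCommGroup (X ⟶ Y) where
  nsmul := nsmulRec
  zsmul := zsmulRec
  add_assoc := by rintro ⟨f⟩ ⟨g⟩ ⟨h⟩; exact Quot.sound (.add_assoc f g h)
  add_comm := by rintro ⟨f⟩ ⟨g⟩; exact Quot.sound (.add_comm f g)
  zero_add := by rintro ⟨f⟩; exact Quot.sound (.zero_add f)
  add_zero := by
    rintro ⟨f⟩
    exact (Quot.sound (.add_comm f _)).trans (Quot.sound (.zero_add f))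
  neg_add_cancel := by
    rintro ⟨f⟩
    refine Eq.trans ?_ (Quot.sound (.zero_smul f))
    rw [← neg_add_cancel (1 : R)]
    refine Eq.trans ?_ (Quot.sound (.add_smul _ _ f)).symm
    exact Quot.sound (.add_right _ (.one_smul f)) |>.symm

instance (X Y : Frac R 𝒯) : Module R (X ⟶ Y) where
  smul r := Quot.map (Tm.smul r) (fun _ _ h => .smul _ h)
  one_smul := by rintro ⟨f⟩; exact Quot.sound (.one_smul f)
  mul_smul := by rintro r s ⟨f⟩; exact Quot.sound (.mul_smul r s f)
  smul_zero r := by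
    refine Eq.trans ?_ (Quot.sound (.zero_smul (Tm.zero X Y)))
    have h : (r * 0 : R) = 0 := mul_zero r
    exact (Quot.sound (.smul r (.zero_smul (Tm.zero X Y)))).symm.trans
      ((Quot.sound (.mul_smul r 0 _)).symm.trans (by rw [h]))
  smul_add := by rintro r ⟨f⟩ ⟨g⟩; exact Quot.sound (.smul_add r f g)
  add_smul := by rintro r s ⟨f⟩; exact Quot.sound (.add_smul r s f)
  zero_smul := by rintro ⟨f⟩; exact Quot.sound (.zero_smul f)

instance : Preadditive (Frac R 𝒯) where
  add_comp := by rintro X Y Z ⟨f⟩ ⟨f'⟩ ⟨g⟩; exact Quot.sound (.add_comp f f' g)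
  comp_add := by rintro X Y Z ⟨f⟩ ⟨g⟩ ⟨g'⟩; exact Quot.sound (.comp_add f g g')

instance : Linear R (Frac R 𝒯) where
  smul_comp := by rintro X Y Z r ⟨f⟩ ⟨g⟩; exact Quot.sound (.smul_comp r f g)
  comp_smul := by rintro X Y Z ⟨f⟩ r ⟨g⟩; exact Quot.sound (.comp_smul f r g)

/-- The action of a morphism on the denominator. -/
def left {A A' : 𝒯} (a : A' ⟶ A) (Z : 𝒯) : (⟨A, Z⟩ : Frac R 𝒯) ⟶ ⟨A', Z⟩ := ofTm R (Tm.left a Z)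

/-- The action of a morphism on the numerator. -/
def right (A : 𝒯) {Z Z' : 𝒯} (z : Z ⟶ Z') : (⟨A, Z⟩ : Frac R 𝒯) ⟶ ⟨A, Z'⟩ := ofTm R (Tm.right A z)

/-- The expansion of a fraction. -/
def e (B A Z : 𝒯) : (⟨A, Z⟩ : Frac R 𝒯) ⟶ ⟨B ⊗ A, B ⊗ Z⟩ := ofTm R (Tm.e B A Z)

lemma left_id (A Z : 𝒯) : left R (𝟙 A) Z = 𝟙 _ := Quot.sound (.left_id A Z)

lemma left_comp {A A' A'' : 𝒯} (b : A'' ⟶ A') (a : A' ⟶ A) (Z : 𝒯) :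
    left R (b ≫ a) Z = left R a Z ≫ left R b Z := Quot.sound (.left_comp b a Z)

lemma left_add {A A' : 𝒯} (a b : A' ⟶ A) (Z : 𝒯) :
    left R (a + b) Z = left R a Z + left R b Z := Quot.sound (.left_add a b Z)

lemma left_smul {A A' : 𝒯} (r : R) (a : A' ⟶ A) (Z : 𝒯) :
    left R (r • a) Z = r • left R a Z := Quot.sound (.left_smul r a Z)

lemma right_id (A Z : 𝒯) : right R A (𝟙 Z) = 𝟙 _ := Quot.sound (.right_id A Z)

lemma right_comp (A : 𝒯) {Z Z' Z'' : 𝒯} (z : Z ⟶ Z') (z' : Z' ⟶ Z'') :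
    right R A (z ≫ z') = right R A z ≫ right R A z' := Quot.sound (.right_comp A z z')

lemma right_add (A : 𝒯) {Z Z' : 𝒯} (z z' : Z ⟶ Z') :
    right R A (z + z') = right R A z + right R A z' := Quot.sound (.right_add A z z')

lemma right_smul (A : 𝒯) {Z Z' : 𝒯} (r : R) (z : Z ⟶ Z') :
    right R A (r • z) = r • right R A z := Quot.sound (.right_smul A r z)

lemma left_right {A A' Z Z' : 𝒯} (a : A' ⟶ A) (z : Z ⟶ Z') :
    left R a Z ≫ right R A' z = right R A z ≫ left R a Z' := Quot.sound (.left_right a z)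

lemma left_e (B : 𝒯) {A A' : 𝒯} (a : A' ⟶ A) (Z : 𝒯) :
    left R a Z ≫ e R B A' Z = e R B A Z ≫ left R (B ◁ a) _ := Quot.sound (.left_e B a Z)

lemma right_e (B A : 𝒯) {Z Z' : 𝒯} (z : Z ⟶ Z') :
    right R A z ≫ e R B A Z' = e R B A Z ≫ right R _ (B ◁ z) := Quot.sound (.right_e B A z)

lemma dinat {B B' : 𝒯} (b : B ⟶ B') (A Z : 𝒯) :
    e R B A Z ≫ right R _ (b ▷ Z) = e R B' A Z ≫ left R (b ▷ A) _ := Quot.sound (.dinat b A Z)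

lemma e_tensor (B B' A Z : 𝒯) : e R B A Z ≫ e R B' _ _ =
    e R (B' ⊗ B) A Z ≫ left R (α_ B' B A).inv _ ≫ right R _ (α_ B' B Z).hom :=
  Quot.sound (.e_tensor B B' A Z)

lemma e_unit (A Z : 𝒯) :
    e R (𝟙_ 𝒯) A Z ≫ left R (λ_ A).inv _ ≫ right R _ (λ_ Z).hom = 𝟙 _ :=
  Quot.sound (.e_unit A Z)

variable {R}

theorem hom_induction {P : ∀ {X Y : Frac R 𝒯}, (X ⟶ Y) → Prop}
    (id : ∀ X : Frac R 𝒯, P (𝟙 X))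
    (comp : ∀ {X Y Z : Frac R 𝒯} (f : X ⟶ Y) (g : Y ⟶ Z), P f → P g → P (f ≫ g))
    (hleft : ∀ {A A' : 𝒯} (a : A' ⟶ A) (Z : 𝒯), P (left R a Z))
    (hright : ∀ (A : 𝒯) {Z Z' : 𝒯} (z : Z ⟶ Z'), P (right R A z))
    (he : ∀ B A Z : 𝒯, P (e R B A Z))
    (zero : ∀ X Y : Frac R 𝒯, P (0 : X ⟶ Y))
    (add : ∀ {X Y : Frac R 𝒯} (f g : X ⟶ Y), P f → P g → P (f + g))
    (smul : ∀ {X Y : Frac R 𝒯} (r : R) (f : X ⟶ Y), P f → P (r • f))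
    {X Y : Frac R 𝒯} (f : X ⟶ Y) : P f := by
  induction f using Quot.ind with
  | mk f =>
    induction f with
    | id X => exact id X
    | comp f g hf hg => exact comp _ _ hf hg
    | left a Z => exact hleft a Z
    | right A z => exact hright A z
    | e B A Z => exact he B A Z
    | zero X Y => exact zero X Y
    | add f g hf hg => exact add _ _ hf hg
    | smul r f hf => exact smul r _ hf

variable (R 𝒯) in
/-- The data for a linear functor from formal fractions to a linear category `𝒟`. -/
structure Rep (𝒟 : Type u') [Category.{v'} 𝒟] [Preadditive 𝒟] [Linear R 𝒟] where
  /-- the functor on objects -/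
  obj : Frac R 𝒯 → 𝒟
  /-- the action on denominators -/
  left {A A' : 𝒯} (a : A' ⟶ A) (Z : 𝒯) : obj ⟨A, Z⟩ ⟶ obj ⟨A', Z⟩
  /-- the action on numerators -/
  right (A : 𝒯) {Z Z' : 𝒯} (z : Z ⟶ Z') : obj ⟨A, Z⟩ ⟶ obj ⟨A, Z'⟩
  /-- the action of expansion -/
  e (B A Z : 𝒯) : obj ⟨A, Z⟩ ⟶ obj ⟨B ⊗ A, B ⊗ Z⟩
  left_id (A Z : 𝒯) : left (𝟙 A) Z = 𝟙 _
  left_comp {A A' A'' : 𝒯} (b : A'' ⟶ A') (a : A' ⟶ A) (Z : 𝒯) : left (b ≫ a) Z = left a Z ≫ left b Z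
  left_add {A A' : 𝒯} (a b : A' ⟶ A) (Z : 𝒯) : left (a + b) Z = left a Z + left b Z
  left_smul {A A' : 𝒯} (r : R) (a : A' ⟶ A) (Z : 𝒯) : left (r • a) Z = r • left a Z
  right_id (A Z : 𝒯) : right A (𝟙 Z) = 𝟙 _
  right_comp (A : 𝒯) {Z Z' Z'' : 𝒯} (z : Z ⟶ Z') (z' : Z' ⟶ Z'') :
    right A (z ≫ z') = right A z ≫ right A z'
  right_add (A : 𝒯) {Z Z' : 𝒯} (z z' : Z ⟶ Z') : right A (z + z') = right A z + right A z'
  right_smul (A : 𝒯) {Z Z' : 𝒯} (r : R) (z : Z ⟶ Z') : right A (r • z) = r • right A z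
  left_right {A A' Z Z' : 𝒯} (a : A' ⟶ A) (z : Z ⟶ Z') :
    left a Z ≫ right A' z = right A z ≫ left a Z'
  left_e (B : 𝒯) {A A' : 𝒯} (a : A' ⟶ A) (Z : 𝒯) :
    left a Z ≫ e B A' Z = e B A Z ≫ left (B ◁ a) _
  right_e (B A : 𝒯) {Z Z' : 𝒯} (z : Z ⟶ Z') :
    right A z ≫ e B A Z' = e B A Z ≫ right _ (B ◁ z)
  dinat {B B' : 𝒯} (b : B ⟶ B') (A Z : 𝒯) :
    e B A Z ≫ right _ (b ▷ Z) = e B' A Z ≫ left (b ▷ A) _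
  e_tensor (B B' A Z : 𝒯) : e B A Z ≫ e B' _ _ =
    e (B' ⊗ B) A Z ≫ left (α_ B' B A).inv _ ≫ right _ (α_ B' B Z).hom
  e_unit (A Z : 𝒯) : e (𝟙_ 𝒯) A Z ≫ left (λ_ A).inv _ ≫ right _ (λ_ Z).hom = 𝟙 _

namespace Rep

variable {𝒟 : Type u'} [Category.{v'} 𝒟] [Preadditive 𝒟] [Linear R 𝒟] (G : Rep R 𝒯 𝒟)

/-- The morphism represented by a term. -/
def eval : ∀ {X Y : Frac R 𝒯}, Tm R X Y → (G.obj X ⟶ G.obj Y)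
  | _, _, .id X => 𝟙 (G.obj X)
  | _, _, .comp f g => eval f ≫ eval g
  | _, _, .left a Z => G.left a Z
  | _, _, .right A z => G.right A z
  | _, _, .e B A Z => G.e B A Z
  | _, _, .zero _ _ => 0
  | _, _, .add f g => eval f + eval g
  | _, _, .smul r f => r • eval f

lemma eval_eq {X Y : Frac R 𝒯} {f g : Tm R X Y} (h : Rel R f g) : G.eval f = G.eval g := by
  induction h with
  | comp_left g h ih => exact congrArg (· ≫ G.eval g) ih
  | comp_right g h ih => exact congrArg (G.eval g ≫ ·) ih
  | add_left g h ih => exact congrArg (· + G.eval g) ih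
  | add_right g h ih => exact congrArg (G.eval g + ·) ih
  | smul r h ih => exact congrArg (r • ·) ih
  | left_id => exact G.left_id _ _
  | left_comp => exact G.left_comp _ _ _
  | left_add => exact G.left_add _ _ _
  | left_smul => exact G.left_smul _ _ _
  | right_id => exact G.right_id _ _
  | right_comp => exact G.right_comp _ _ _
  | right_add => exact G.right_add _ _ _
  | right_smul => exact G.right_smul _ _ _
  | left_right => exact G.left_right _ _
  | left_e => exact G.left_e _ _ _
  | right_e => exact G.right_e _ _ _
  | dinat => exact G.dinat _ _ _
  | e_tensor => exact G.e_tensor _ _ _ _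
  | e_unit => exact G.e_unit _ _
  | add_assoc => exact _root_.add_assoc _ _ _
  | add_comm => exact _root_.add_comm _ _
  | mul_smul => exact SemigroupAction.mul_smul _ _ _
  | smul_add => exact _root_.smul_add _ _ _
  | add_smul => exact _root_.add_smul _ _ _
  | _ => simp [eval]

/-- The functor determined by the data. -/
def functor : Frac R 𝒯 ⥤ 𝒟 where
  obj := G.obj
  map := Quot.lift G.eval (fun _ _ h => G.eval_eq h)
  map_id _ := rfl
  map_comp := by rintro _ _ _ ⟨f⟩ ⟨g⟩; rfl

instance : G.functor.Additive where
  map_add := by rintro _ _ ⟨f⟩ ⟨g⟩; rfl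

instance : G.functor.Linear R where
  map_smul := by rintro _ _ ⟨f⟩ r; rfl

end Rep

/-- Naturality between linear functors on formal fractions can be checked on generators. -/
lemma naturality_of_generators {𝒟 : Type u'} [Category.{v'} 𝒟] [Preadditive 𝒟] [Linear R 𝒟]
    {F G : Frac R 𝒯 ⥤ 𝒟} [F.Additive] [G.Additive] [F.Linear R] [G.Linear R]
    (τ : ∀ X, F.obj X ⟶ G.obj X)
    (hleft : ∀ {A A' : 𝒯} (a : A' ⟶ A) (Z : 𝒯),
      F.map (left R a Z) ≫ τ _ = τ _ ≫ G.map (left R a Z))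
    (hright : ∀ (A : 𝒯) {Z Z' : 𝒯} (z : Z ⟶ Z'),
      F.map (right R A z) ≫ τ _ = τ _ ≫ G.map (right R A z))
    (he : ∀ B A Z : 𝒯, F.map (e R B A Z) ≫ τ _ = τ _ ≫ G.map (e R B A Z))
    {X Y : Frac R 𝒯} (f : X ⟶ Y) : F.map f ≫ τ Y = τ X ≫ G.map f := by
  induction f using hom_induction with
  | id X => simp
  | comp f g hf hg => rw [F.map_comp, G.map_comp, Category.assoc, hg, reassoc_of% hf]
  | hleft a Z => exact hleft a Z
  | hright A z => exact hright A z
  | he B A Z => exact he B A Z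
  | zero X Y => simp
  | add f g hf hg => rw [F.map_add, G.map_add, Preadditive.add_comp, Preadditive.comp_add, hf, hg]
  | smul r f hf => rw [F.map_smul, G.map_smul, Linear.smul_comp, Linear.comp_smul, hf]

section NormalForm

variable (R)

lemma right_left {A A' Z Z' : 𝒯} (a : A' ⟶ A) (z : Z ⟶ Z') :
    right R A z ≫ left R a Z' = left R a Z ≫ right R A' z := (left_right R a z).symm

lemma right_left_comp {A A' Z Z' : 𝒯} (a : A' ⟶ A) (z : Z ⟶ Z') {X : Frac R 𝒯} (h : _ ⟶ X) :
    right R A z ≫ left R a Z' ≫ h = left R a Z ≫ right R A' z ≫ h := by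
  rw [← Category.assoc, ← left_right, Category.assoc]

lemma left_e_comp (B : 𝒯) {A A' : 𝒯} (a : A' ⟶ A) (Z : 𝒯) {X : Frac R 𝒯} (h : _ ⟶ X) :
    left R a Z ≫ e R B A' Z ≫ h = e R B A Z ≫ left R (B ◁ a) _ ≫ h := by
  rw [← Category.assoc, left_e, Category.assoc]

lemma right_e_comp (B A : 𝒯) {Z Z' : 𝒯} (z : Z ⟶ Z') {X : Frac R 𝒯} (h : _ ⟶ X) :
    right R A z ≫ e R B A Z' ≫ h = e R B A Z ≫ right R _ (B ◁ z) ≫ h := by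
  rw [← Category.assoc, right_e, Category.assoc]

lemma e_tensor_comp (B B' A Z : 𝒯) {X : Frac R 𝒯} (h : _ ⟶ X) : e R B A Z ≫ e R B' _ _ ≫ h =
    e R (B' ⊗ B) A Z ≫ left R (α_ B' B A).inv _ ≫ right R _ (α_ B' B Z).hom ≫ h := by
  rw [← Category.assoc, e_tensor, Category.assoc, Category.assoc]

lemma left_left {A A' A'' : 𝒯} (b : A'' ⟶ A') (a : A' ⟶ A) (Z : 𝒯) :
    left R a Z ≫ left R b Z = left R (b ≫ a) Z := (left_comp R b a Z).symm

lemma left_left_comp {A A' A'' : 𝒯} (b : A'' ⟶ A') (a : A' ⟶ A) (Z : 𝒯) {X : Frac R 𝒯}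
    (h : _ ⟶ X) : left R a Z ≫ left R b Z ≫ h = left R (b ≫ a) Z ≫ h := by
  rw [← Category.assoc, ← left_comp]

lemma right_right (A : 𝒯) {Z Z' Z'' : 𝒯} (z : Z ⟶ Z') (z' : Z' ⟶ Z'') :
    right R A z ≫ right R A z' = right R A (z ≫ z') := (right_comp R A z z').symm

lemma dinat_comp {B B' : 𝒯} (b : B ⟶ B') {A A' Z : 𝒯} (a : A' ⟶ B ⊗ A) {X : Frac R 𝒯}
    (h : _ ⟶ X) : e R B' A Z ≫ left R (a ≫ b ▷ A) _ ≫ h =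
      e R B A Z ≫ left R a _ ≫ right R _ (b ▷ Z) ≫ h := by
  rw [left_comp, Category.assoc, ← reassoc_of% (dinat (R := R)), right_left_comp]

end NormalForm

end Frac

end Frac

/-! ### Functors on formal fractions -/

section FracFunctors

universe u v x y w

variable (R : Type x) [CommRing R] {𝒯 : Type u} [Category.{v} 𝒯] [Preadditive 𝒯] [Linear R 𝒯]
  [MonoidalCategory 𝒯] [MonoidalPreadditive 𝒯] [MonoidalLinear R 𝒯]

namespace Frac

variable (𝒯) in
/-- The data of the functor `(A, Z) ↦ Hom(A, Z)`. -/
def homRep : Rep R 𝒯 (ModuleCat.{v} R) where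
  obj X := ModuleCat.of R (X.den ⟶ X.num)
  left a Z := ModuleCat.ofHom (Linear.leftComp R Z a)
  right A _ _ z := ModuleCat.ofHom (Linear.rightComp R A z)
  e B A Z := ModuleCat.ofHom
    { toFun := fun f : A ⟶ Z => B ◁ f
      map_add' := fun f g => MonoidalPreadditive.whiskerLeft_add f g
      map_smul' := fun r f => MonoidalLinear.whiskerLeft_smul B r f }
  left_id A Z := by ext (f : A ⟶ Z); exact Category.id_comp f
  left_comp b a Z := by ext (f : _ ⟶ Z); exact Category.assoc b a f
  left_add a b Z := by ext (f : _ ⟶ Z); exact Preadditive.add_comp _ _ _ a b f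
  left_smul r a Z := by ext (f : _ ⟶ Z); exact Linear.smul_comp _ _ _ r a f
  right_id A Z := by ext (f : A ⟶ Z); exact Category.comp_id f
  right_comp A _ _ _ z z' := by ext (f : A ⟶ _); exact (Category.assoc f z z').symm
  right_add A _ _ z z' := by ext (f : A ⟶ _); exact Preadditive.comp_add _ _ _ f z z'
  right_smul A _ _ r z := by ext (f : A ⟶ _); exact Linear.comp_smul _ _ _ f r z
  left_right {A A' Z Z'} a z := by ext (f : A ⟶ Z); exact Category.assoc a f z
  left_e B {A A'} a Z := by ext (f : A ⟶ Z); exact MonoidalCategory.whiskerLeft_comp B a f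
  right_e B A {Z Z'} z := by ext (f : A ⟶ Z); exact MonoidalCategory.whiskerLeft_comp B f z
  dinat b A Z := by ext (f : A ⟶ Z); exact whisker_exchange b f
  e_tensor B B' A Z := by
    ext (f : A ⟶ Z)
    change B' ◁ B ◁ f = ((α_ B' B A).inv ≫ (B' ⊗ B) ◁ f) ≫ (α_ B' B Z).hom
    simp
  e_unit A Z := by
    ext (f : A ⟶ Z)
    change ((λ_ A).inv ≫ 𝟙_ 𝒯 ◁ f) ≫ (λ_ Z).hom = f
    simp

/-- The data of the functor `(A, Z) ↦ (A, Z ⊗ V)`. -/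
def mulRightRep (V : 𝒯) : Rep R 𝒯 (Frac R 𝒯) where
  obj X := ⟨X.den, X.num ⊗ V⟩
  left a Z := left R a (Z ⊗ V)
  right A _ _ z := right R A (z ▷ V)
  e B A Z := e R B A (Z ⊗ V) ≫ right R _ (α_ B Z V).inv
  left_id A Z := left_id R A _
  left_comp b a Z := left_comp R b a _
  left_add a b Z := left_add R a b _
  left_smul r a Z := left_smul R r a _
  right_id A Z := by rw [id_whiskerRight, right_id]
  right_comp A _ _ _ z z' := by rw [comp_whiskerRight, right_comp]
  right_add A _ _ z z' := by rw [MonoidalPreadditive.add_whiskerRight, right_add]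
  right_smul A _ _ r z := by rw [MonoidalLinear.smul_whiskerRight, right_smul]
  left_right a z := left_right R a _
  left_e B _ _ a Z := by
    rw [Category.assoc, ← left_right, ← Category.assoc, left_e, Category.assoc]
  right_e B A _ _ z := by
    rw [Category.assoc, ← Category.assoc, right_e, Category.assoc, ← right_comp, ← right_comp]
    simp
  dinat b A Z := by
    rw [Category.assoc, Category.assoc, ← left_right, ← reassoc_of% dinat, ← right_comp,
      ← right_comp]
    simp
  e_tensor B B' A Z := by
    rw [Category.assoc, Category.assoc, reassoc_of% (right_e (R := R) B'), reassoc_of% (e_tensor R B),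
      ← reassoc_of% (left_right (R := R) (α_ B' B A).inv), ← right_comp, ← right_comp, ← right_comp]
    congr 3
    monoidal
  e_unit A Z := by
    rw [Category.assoc, ← reassoc_of% (left_right (R := R) (λ_ A).inv), ← right_comp,
      ← e_unit R A (Z ⊗ V)]
    congr 3
    monoidal

/-- The functor `(A, Z) ↦ (A, Z ⊗ V)`. -/
def mulRight (V : 𝒯) : Frac R 𝒯 ⥤ Frac R 𝒯 := (mulRightRep R V).functor

instance (V : 𝒯) : (mulRight R V).Additive := inferInstanceAs (mulRightRep R V).functor.Additive

instance (V : 𝒯) : (mulRight R V).Linear R := inferInstanceAs ((mulRightRep R V).functor.Linear R)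

section

variable {R}

/-- Morphisms of functors induced by natural transformations of numerators. -/
def natTransOfRight {F G : Frac R 𝒯 ⥤ Frac R 𝒯} [F.Additive] [G.Additive] [F.Linear R] [G.Linear R]
    (τ : ∀ X, F.obj X ⟶ G.obj X)
    (hleft : ∀ {A A' : 𝒯} (a : A' ⟶ A) (Z : 𝒯),
      F.map (left R a Z) ≫ τ _ = τ _ ≫ G.map (left R a Z))
    (hright : ∀ (A : 𝒯) {Z Z' : 𝒯} (z : Z ⟶ Z'),
      F.map (right R A z) ≫ τ _ = τ _ ≫ G.map (right R A z))
    (he : ∀ B A Z : 𝒯, F.map (e R B A Z) ≫ τ _ = τ _ ≫ G.map (e R B A Z)) : F ⟶ G where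
  app := τ
  naturality _ _ f := naturality_of_generators τ hleft hright he f

end

/-- The transformation induced by a morphism `f : V ⟶ V'`. -/
def mulRightMap {V V' : 𝒯} (f : V ⟶ V') : mulRight R V ⟶ mulRight R V' :=
  natTransOfRight (fun X => right R X.den (X.num ◁ f))
    (fun a Z => left_right R a (Z ◁ f))
    (fun A Z Z' z => by
      change right R A (z ▷ V) ≫ right R A (Z' ◁ f) = right R A (Z ◁ f) ≫ right R A (z ▷ V')
      rw [← right_comp, ← right_comp, whisker_exchange])
    (fun B A Z => by
      change (e R B A (Z ⊗ V) ≫ right R _ (α_ B Z V).inv) ≫ right R _ ((B ⊗ Z) ◁ f) =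
        right R A (Z ◁ f) ≫ e R B A (Z ⊗ V') ≫ right R _ (α_ B Z V').inv
      rw [reassoc_of% (right_e (R := R) B A (Z ◁ f)), Category.assoc, ← right_comp, ← right_comp]
      simp)

end Frac

variable {Λ : Type y} [AddCommGroup Λ] {𝒢 : MonoidalGrading Λ 𝒯} {q : InvertibleCentralObject 𝒯}
  (hq : 𝒢.homogeneous 0 (q.pow 1)) (C : GradedBraider 𝒢 q)

namespace GradedBraider

open Frac

/-- The action of the braider on a denominator. -/
noncomputable def denMap (B A : 𝒯) : C.obj ⊗ (B ⊗ A) ⟶ C.tw hq B ⊗ (C.obj ⊗ A) :=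
  (α_ _ _ _).inv ≫ C.braid hq B ▷ A ≫ (α_ _ _ _).hom

/-- The data of the functor `(A, Z) ↦ (C ⊗ A, σ(Z))`. -/
noncomputable def actRep : Rep R 𝒯 (Frac R 𝒯) where
  obj X := ⟨C.obj ⊗ X.den, C.tw hq X.num⟩
  left a Z := left R (C.obj ◁ a) (C.tw hq Z)
  right A _ _ z := right R (C.obj ⊗ A) (Twist.map z)
  e B A Z := e R (C.tw hq B) (C.obj ⊗ A) (C.tw hq Z) ≫ left R (C.denMap hq B A) _ ≫
    right R _ (Twist.mu B Z)
  left_id A Z := by rw [MonoidalCategory.whiskerLeft_id, left_id]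
  left_comp b a Z := by rw [MonoidalCategory.whiskerLeft_comp, left_comp]
  left_add a b Z := by rw [MonoidalPreadditive.whiskerLeft_add, left_add]
  left_smul r a Z := by rw [MonoidalLinear.whiskerLeft_smul, left_smul]
  right_id A Z := by rw [Twist.map_id, right_id]
  right_comp A _ _ _ z z' := by rw [Twist.map_comp, right_comp]
  right_add A _ _ z z' := by rw [Twist.map_add, right_add]
  right_smul A _ _ r z := by rw [Twist.map_smul, right_smul]
  left_right a z := left_right R _ _
  left_e B A A' a Z := by
    simp only [Category.assoc, left_e_comp, left_left_comp, right_left_comp, right_left]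
    congr 3
    simp only [denMap, Category.assoc]
    rw [associator_inv_naturality_right_assoc, whisker_exchange_assoc]
    simp
  right_e B A Z Z' z := by
    simp only [Category.assoc, right_e_comp, right_left_comp, right_left, right_right]
    congr 3
    have h := Twist.mu_natural (hq := hq) (φ := C.φ) (𝟙 B) z
    rw [Twist.map_id, id_tensorHom, id_tensorHom] at h
    exact h
  dinat {B B'} b A Z := by
    have h := Twist.mu_natural (hq := hq) (φ := C.φ) b (𝟙 Z)
    rw [Twist.map_id, tensorHom_id, tensorHom_id] at h
    have h₁ : C.denMap hq B A ≫ Twist.map b ▷ _ = C.obj ◁ b ▷ A ≫ C.denMap hq B' A := by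
      have h₂ := C.braid_natural hq b
      simp only [denMap]
      calc _ = 𝟙 _ ⊗≫ (C.braid hq B ≫ Twist.map b ▷ C.obj) ▷ A ⊗≫ 𝟙 _ := by monoidal
        _ = _ := by rw [← h₂]; monoidal
    simp only [Category.assoc, right_right, right_left, left_left_comp]
    rw [← h, ← h₁, dinat_comp, right_right]
  e_tensor B B' A Z := by
    have h := Twist.mu_assoc (hq := hq) (φ := C.φ) B' B Z
    have h₁ : C.obj ◁ (α_ B' B A).inv ≫ C.denMap hq (B' ⊗ B) A = ((C.denMap hq B' (B ⊗ A) ≫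
        C.tw hq B' ◁ C.denMap hq B A) ≫ (α_ _ _ _).inv) ≫ Twist.mu B' B ▷ _ := by
      simp only [denMap, braid_tensor]
      monoidal
    simp only [Category.assoc, e_tensor_comp, left_e_comp, right_e_comp, right_left_comp, right_left,
      right_right, left_left_comp]
    rw [← h, h₁, dinat_comp, right_right]
    simp only [Category.assoc]
  e_unit A Z := by
    have h := Twist.eps_mu (hq := hq) (φ := C.φ) Z
    have h₁ : C.obj ◁ (λ_ A).inv ≫ C.denMap hq (𝟙_ 𝒯) A = (λ_ _).inv ≫ Twist.eps hq C.φ ▷ _ := by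
      simp only [denMap, braid_unit]
      monoidal
    simp only [Category.assoc, right_left_comp, right_left, right_right, left_left_comp]
    rw [h₁, dinat_comp, right_right, h, e_unit]

end GradedBraider

end FracFunctors

section FracFunctors

universe u v x y w

variable (R : Type x) [CommRing R] {𝒯 : Type u} [Category.{v} 𝒯] [Preadditive 𝒯] [Linear R 𝒯]
  [MonoidalCategory 𝒯] [MonoidalPreadditive 𝒯] [MonoidalLinear R 𝒯]
  {Λ : Type y} [AddCommGroup Λ] {𝒢 : MonoidalGrading Λ 𝒯} {q : InvertibleCentralObject 𝒯}
  (hq : 𝒢.homogeneous 0 (q.pow 1)) (C : GradedBraider 𝒢 q)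

namespace GradedBraider

open Frac

/-- The functor `(A, Z) ↦ (C ⊗ A, σ(Z))`. -/
noncomputable def act : Frac R 𝒯 ⥤ Frac R 𝒯 := (C.actRep R hq).functor

instance : (C.act R hq).Additive := inferInstanceAs (C.actRep R hq).functor.Additive

instance : (C.act R hq).Linear R := inferInstanceAs ((C.actRep R hq).functor.Linear R)

/-- The functor `(A, Z) ↦ (C ⊗ A, σ(Z) ⊗ C)`. -/
noncomputable def shift : Frac R 𝒯 ⥤ Frac R 𝒯 := C.act R hq ⋙ mulRight R C.obj

instance : (C.shift R hq).Additive := inferInstanceAs (C.act R hq ⋙ mulRight R C.obj).Additive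

instance : (C.shift R hq).Linear R := inferInstanceAs ((C.act R hq ⋙ mulRight R C.obj).Linear R)

lemma shift_map_e (B A Z : 𝒯) : (C.shift R hq).map (e R B A Z) =
    e R (C.tw hq B) (C.obj ⊗ A) (C.tw hq Z ⊗ C.obj) ≫ left R (C.denMap hq B A) _ ≫
      right R _ ((α_ _ _ _).inv ≫ Twist.mu B Z ▷ C.obj) := by
  have h : (C.shift R hq).map (e R B A Z) =
      (e R (C.tw hq B) (C.obj ⊗ A) (C.tw hq Z ⊗ C.obj) ≫ right R _ (α_ _ _ _).inv) ≫
      left R (C.denMap hq B A) _ ≫ right R _ (Twist.mu B Z ▷ C.obj) := rfl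
  rw [h]
  simp only [Category.assoc, right_left_comp, right_right]
  rfl

/-- The transformation from a fraction to its expansion by `C`. -/
noncomputable def expand : 𝟭 (Frac R 𝒯) ⟶ C.shift R hq :=
  natTransOfRight (fun X => e R C.obj X.den X.num ≫ right R _ (C.braid hq X.num))
    (fun {A A'} a Z => by
      change left R a Z ≫ e R C.obj A' Z ≫ right R (C.obj ⊗ A') (C.braid hq Z) =
        (e R C.obj A Z ≫ right R (C.obj ⊗ A) (C.braid hq Z)) ≫
          left R (C.obj ◁ a) (C.tw hq Z ⊗ C.obj)
      rw [left_e_comp, Category.assoc, right_left])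
    (fun A Z Z' z => by
      change right R A z ≫ e R C.obj A Z' ≫ right R (C.obj ⊗ A) (C.braid hq Z') =
        (e R C.obj A Z ≫ right R (C.obj ⊗ A) (C.braid hq Z)) ≫
          right R (C.obj ⊗ A) ((Twist.map z : C.tw hq Z ⟶ C.tw hq Z') ▷ C.obj)
      rw [right_e_comp, Category.assoc, right_right, right_right, braid_natural])
    (fun B A Z => by
      rw [shift_map_e]
      change e R B A Z ≫ e R C.obj (B ⊗ A) (B ⊗ Z) ≫ right R (C.obj ⊗ (B ⊗ A)) (C.braid hq (B ⊗ Z)) =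
        (e R C.obj A Z ≫ right R (C.obj ⊗ A) (C.braid hq Z)) ≫
        e R (C.tw hq B) (C.obj ⊗ A) (C.tw hq Z ⊗ C.obj) ≫
        left R (C.denMap hq B A) (C.tw hq B ⊗ (C.tw hq Z ⊗ C.obj)) ≫
        right R (C.obj ⊗ (B ⊗ A)) ((α_ _ _ _).inv ≫ Twist.mu B Z ▷ C.obj)
      have h : C.denMap hq B A ≫ (α_ _ _ _).inv = (α_ _ _ _).inv ≫ C.braid hq B ▷ A := by
        simp [denMap]
      have h' : (α_ _ _ _).hom ≫ C.braid hq (B ⊗ Z) = C.braid hq B ▷ Z ≫ (α_ _ _ _).hom ≫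
          C.tw hq B ◁ C.braid hq Z ≫ (α_ _ _ _).inv ≫ Twist.mu B Z ▷ C.obj := by
        rw [braid_tensor]
        simp
      simp only [Category.assoc, right_e_comp, e_tensor_comp, right_left_comp, right_right,
        left_left_comp, h, h', dinat_comp])

lemma expand_app (A Z : 𝒯) : (C.expand R hq).app ⟨A, Z⟩ =
    e R C.obj A Z ≫ right R _ (C.braid hq Z) := rfl

/-- The commutation of expansion with the action of an object `V`. -/
noncomputable def shiftTensor (V : 𝒯) : C.shift R hq ⋙ mulRight R V ⟶ mulRight R V ⋙ C.shift R hq :=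
  natTransOfRight (fun X => right R (C.obj ⊗ X.den) ((α_ _ _ _).hom ≫
      C.tw hq X.num ◁ C.braid hq V ≫ (α_ _ _ _).inv ≫ Twist.mu X.num V ▷ C.obj))
    (fun {A A'} a Z => by
      change left R (C.obj ◁ a) ((C.tw hq Z ⊗ C.obj) ⊗ V) ≫ right R (C.obj ⊗ A') ((α_ _ _ _).hom ≫
          C.tw hq Z ◁ C.braid hq V ≫ (α_ _ _ _).inv ≫ Twist.mu Z V ▷ C.obj) =
        right R (C.obj ⊗ A) ((α_ _ _ _).hom ≫
          C.tw hq Z ◁ C.braid hq V ≫ (α_ _ _ _).inv ≫ Twist.mu Z V ▷ C.obj) ≫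
        left R (C.obj ◁ a) (C.tw hq (Z ⊗ V) ⊗ C.obj)
      rw [right_left])
    (fun A Z Z' z => by
      change right R (C.obj ⊗ A) ((Twist.map z : C.tw hq Z ⟶ C.tw hq Z') ▷ C.obj ▷ V) ≫
        right R (C.obj ⊗ A) ((α_ _ _ _).hom ≫
          C.tw hq Z' ◁ C.braid hq V ≫ (α_ _ _ _).inv ≫ Twist.mu Z' V ▷ C.obj) =
        right R (C.obj ⊗ A) ((α_ _ _ _).hom ≫
          C.tw hq Z ◁ C.braid hq V ≫ (α_ _ _ _).inv ≫ Twist.mu Z V ▷ C.obj) ≫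
        right R (C.obj ⊗ A) ((Twist.map (z ▷ V) : C.tw hq (Z ⊗ V) ⟶ C.tw hq (Z' ⊗ V)) ▷ C.obj)
      have h := Twist.mu_natural (hq := hq) (φ := C.φ) z (𝟙 V)
      rw [Twist.map_id, tensorHom_id, tensorHom_id] at h
      rw [right_right, right_right]
      congr 1
      simp only [Category.assoc, ← comp_whiskerRight, ← h]
      rw [associator_naturality_left_assoc, ← whisker_exchange_assoc]
      monoidal)
    (fun B A Z => by
      have h := Twist.mu_assoc (hq := hq) (φ := C.φ) B Z V
      have h' : Twist.mu (hq := hq) (φ := C.φ) B Z ▷ _ ≫ Twist.mu (B ⊗ Z) V =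
          (α_ _ _ _).hom ≫ _ ◁ Twist.mu Z V ≫ Twist.mu B (Z ⊗ V) ≫ Twist.map (α_ B Z V).inv := by
        rw [← reassoc_of% h, ← Twist.map_comp, Iso.hom_inv_id, Twist.map_id, Category.comp_id]
      have h₁ : (C.shift R hq ⋙ mulRight R V).map (e R B A Z) =
          (e R (C.tw hq B) (C.obj ⊗ A) ((C.tw hq Z ⊗ C.obj) ⊗ V) ≫ right R _ (α_ _ _ _).inv) ≫
          left R (C.denMap hq B A) _ ≫
          right R _ (((α_ _ _ _).inv ≫ Twist.mu B Z ▷ C.obj) ▷ V) :=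
        congrArg (mulRight R V).map (C.shift_map_e R hq B A Z)
      have h₂ : (mulRight R V ⋙ C.shift R hq).map (e R B A Z) =
          (e R (C.tw hq B) (C.obj ⊗ A) (C.tw hq (Z ⊗ V) ⊗ C.obj) ≫ left R (C.denMap hq B A) _ ≫
          right R _ ((α_ _ _ _).inv ≫ Twist.mu B (Z ⊗ V) ▷ C.obj)) ≫
          right R _ (Twist.map (α_ B Z V).inv ▷ C.obj) :=
        congrArg (· ≫ right R _ (Twist.map (α_ B Z V).inv ▷ C.obj)) (C.shift_map_e R hq B A (Z ⊗ V))
      have h₃ : ((e R (C.tw hq B) (C.obj ⊗ A) ((C.tw hq Z ⊗ C.obj) ⊗ V) ≫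
          right R _ (α_ _ _ _).inv) ≫ left R (C.denMap hq B A) _ ≫
          right R _ (((α_ _ _ _).inv ≫ Twist.mu B Z ▷ C.obj) ▷ V)) ≫
          right R (C.obj ⊗ (B ⊗ A)) ((α_ _ _ _).hom ≫
          C.tw hq (B ⊗ Z) ◁ C.braid hq V ≫ (α_ _ _ _).inv ≫ Twist.mu (B ⊗ Z) V ▷ C.obj) =
          right R (C.obj ⊗ A) ((α_ _ _ _).hom ≫
          C.tw hq Z ◁ C.braid hq V ≫ (α_ _ _ _).inv ≫ Twist.mu Z V ▷ C.obj) ≫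
          (e R (C.tw hq B) (C.obj ⊗ A) (C.tw hq (Z ⊗ V) ⊗ C.obj) ≫ left R (C.denMap hq B A) _ ≫
          right R _ ((α_ _ _ _).inv ≫ Twist.mu B (Z ⊗ V) ▷ C.obj)) ≫
          right R _ (Twist.map (α_ B Z V).inv ▷ C.obj) := by
        simp only [Category.assoc, right_e_comp, right_left_comp, right_right]
        congr 3
        calc _ = 𝟙 _ ⊗≫ (Twist.mu (hq := hq) (φ := C.φ) B Z ▷ (C.obj ⊗ V) ≫
              C.tw hq (B ⊗ Z) ◁ C.braid hq V) ⊗≫ Twist.mu (B ⊗ Z) V ▷ C.obj := by monoidal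
          _ = 𝟙 _ ⊗≫ (C.tw hq B ⊗ C.tw hq Z) ◁ C.braid hq V ⊗≫
              (Twist.mu B Z ▷ C.tw hq V ≫ Twist.mu (B ⊗ Z) V) ▷ C.obj := by
              rw [← whisker_exchange]; monoidal
          _ = _ := by rw [h']; monoidal
      exact (congrArg (· ≫ _) h₁).trans (h₃.trans (congrArg (_ ≫ ·) h₂.symm)))

lemma mulRight_map_expand (V : 𝒯) (X : Frac R 𝒯) :
    (mulRight R V).map ((C.expand R hq).app X) ≫ (C.shiftTensor R hq V).app X =
      (C.expand R hq).app ((mulRight R V).obj X) := by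
  obtain ⟨A, Z⟩ := X
  change ((e R C.obj A (Z ⊗ V) ≫ right R _ (α_ _ _ _).inv) ≫ right R _ (C.braid hq Z ▷ V)) ≫
    right R (C.obj ⊗ A) ((α_ _ _ _).hom ≫
      C.tw hq Z ◁ C.braid hq V ≫ (α_ _ _ _).inv ≫ Twist.mu Z V ▷ C.obj) =
    e R C.obj A (Z ⊗ V) ≫ right R _ (C.braid hq (Z ⊗ V))
  rw [braid_tensor]
  simp only [Category.assoc, right_right]

end GradedBraider

variable {R}

namespace Frac

lemma isIso_right {A Z Z' : 𝒯} (z : Z ⟶ Z') [IsIso z] : IsIso (right R A z) :=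
  ⟨right R A (inv z), by rw [right_right, IsIso.hom_inv_id, right_id],
    by rw [right_right, IsIso.inv_hom_id, right_id]⟩

lemma isIso_left {A A' Z : 𝒯} (a : A' ⟶ A) [IsIso a] : IsIso (left R a Z) :=
  ⟨left R (inv a) Z, by rw [left_left, IsIso.inv_hom_id, left_id],
    by rw [left_left, IsIso.hom_inv_id, left_id]⟩

end Frac

lemma Twist.isIso_mu (φ : Λ →+ ℤ) (X Y : 𝒯) : IsIso (Twist.mu (hq := hq) (φ := φ) X Y) :=
  ⟨Twist.delta X Y, Twist.mu_delta X Y, Twist.delta_mu X Y⟩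

variable {I : Type w} {C : I → GradedBraider 𝒢 q} {deg : I → Λ}
  (hC : IsRealCommutingFamily R C deg)

namespace IsRealCommutingFamily

open Frac GradedBraider

/-- The comparison of the two orders of acting by `C i` on both sides. -/
noncomputable def shiftSelf (i : I) : (C i).shift R hq ⟶ mulRight R (C i).obj ⋙ (C i).act R hq :=
  natTransOfRight (fun X => right R ((C i).obj ⊗ X.den)
      ((C i).tw hq X.num ◁ hC.selfTwist hq i ≫ Twist.mu X.num (C i).obj))
    (fun {A A'} a Z => by
      change left R ((C i).obj ◁ a) ((C i).tw hq Z ⊗ (C i).obj) ≫ right R ((C i).obj ⊗ A')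
          ((C i).tw hq Z ◁ hC.selfTwist hq i ≫ Twist.mu Z (C i).obj) =
        right R ((C i).obj ⊗ A) ((C i).tw hq Z ◁ hC.selfTwist hq i ≫ Twist.mu Z (C i).obj) ≫
          left R ((C i).obj ◁ a) ((C i).tw hq (Z ⊗ (C i).obj))
      rw [right_left])
    (fun A Z Z' z => by
      change right R ((C i).obj ⊗ A) ((Twist.map z : (C i).tw hq Z ⟶ (C i).tw hq Z') ▷ (C i).obj) ≫
          right R ((C i).obj ⊗ A)
          ((C i).tw hq Z' ◁ hC.selfTwist hq i ≫ Twist.mu Z' (C i).obj) =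
        right R ((C i).obj ⊗ A) ((C i).tw hq Z ◁ hC.selfTwist hq i ≫ Twist.mu Z (C i).obj) ≫
          right R ((C i).obj ⊗ A)
            (Twist.map (z ▷ (C i).obj) : (C i).tw hq (Z ⊗ (C i).obj) ⟶ (C i).tw hq (Z' ⊗ (C i).obj))
      have h := Twist.mu_natural (hq := hq) (φ := (C i).φ) z (𝟙 (C i).obj)
      rw [Twist.map_id, tensorHom_id, tensorHom_id] at h
      rw [right_right, right_right, Category.assoc, ← h, whisker_exchange_assoc])
    (fun B A Z => by
      have h := Twist.mu_assoc (hq := hq) (φ := (C i).φ) B Z (C i).obj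
      have h' : Twist.mu (hq := hq) (φ := (C i).φ) B Z ▷ _ ≫ Twist.mu (B ⊗ Z) (C i).obj =
          (α_ _ _ _).hom ≫ _ ◁ Twist.mu Z (C i).obj ≫ Twist.mu B (Z ⊗ (C i).obj) ≫
            Twist.map (α_ B Z (C i).obj).inv := by
        rw [← reassoc_of% h, ← Twist.map_comp, Iso.hom_inv_id, Twist.map_id, Category.comp_id]
      have h₂ : (mulRight R (C i).obj ⋙ (C i).act R hq).map (e R B A Z) =
          (e R ((C i).tw hq B) ((C i).obj ⊗ A) ((C i).tw hq (Z ⊗ (C i).obj)) ≫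
          left R ((C i).denMap hq B A) _ ≫ right R _ (Twist.mu B (Z ⊗ (C i).obj))) ≫
          right R _ (Twist.map (α_ B Z (C i).obj).inv) := rfl
      have h₃ : (e R ((C i).tw hq B) ((C i).obj ⊗ A) ((C i).tw hq Z ⊗ (C i).obj) ≫
          left R ((C i).denMap hq B A) _ ≫
          right R _ ((α_ _ _ _).inv ≫ Twist.mu B Z ▷ (C i).obj)) ≫
          right R ((C i).obj ⊗ (B ⊗ A))
            ((C i).tw hq (B ⊗ Z) ◁ hC.selfTwist hq i ≫ Twist.mu (B ⊗ Z) (C i).obj) =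
          right R ((C i).obj ⊗ A) ((C i).tw hq Z ◁ hC.selfTwist hq i ≫ Twist.mu Z (C i).obj) ≫
          (e R ((C i).tw hq B) ((C i).obj ⊗ A) ((C i).tw hq (Z ⊗ (C i).obj)) ≫
          left R ((C i).denMap hq B A) _ ≫ right R _ (Twist.mu B (Z ⊗ (C i).obj))) ≫
          right R _ (Twist.map (α_ B Z (C i).obj).inv) := by
        simp only [Category.assoc, right_e_comp, right_left_comp, right_right]
        congr 3
        rw [← whisker_exchange_assoc, h']
        monoidal
      exact (congrArg (· ≫ _) ((C i).shift_map_e R hq B A Z)).trans (h₃.trans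
        (congrArg (_ ≫ ·) h₂.symm)))

lemma shiftSelf_app (i : I) (X : Frac R 𝒯) : (hC.shiftSelf hq i).app X =
    right R ((C i).obj ⊗ X.den)
      ((C i).tw hq X.num ◁ hC.selfTwist hq i ≫ Twist.mu X.num (C i).obj) := rfl

lemma isIso_shiftSelf_app (i : I) (X : Frac R 𝒯) : IsIso ((hC.shiftSelf hq i).app X) := by
  have := hC.isIso_selfTwist hq i
  have := Twist.isIso_mu hq (C i).φ X.num (C i).obj
  rw [shiftSelf_app]
  exact isIso_right _

end IsRealCommutingFamily

end FracFunctors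

section FracFunctors

universe u v x y w u' v'

variable {R : Type x} [CommRing R] {𝒯 : Type u} [Category.{v} 𝒯] [Preadditive 𝒯] [Linear R 𝒯]
  [MonoidalCategory 𝒯] [MonoidalPreadditive 𝒯] [MonoidalLinear R 𝒯]
  {Λ : Type y} [AddCommGroup Λ] {𝒢 : MonoidalGrading Λ 𝒯} {q : InvertibleCentralObject 𝒯}
  (hq : 𝒢.homogeneous 0 (q.pow 1))

lemma Twist.homogeneous_obj {φ : Λ →+ ℤ} {l : Λ} {Z : 𝒯} (hZ : 𝒢.homogeneous l Z) :
    𝒢.homogeneous l (Twist.obj hq φ Z) :=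
  have := Twist.isIso_incl (hq := hq) (φ := φ) (𝟙 Z) hZ
  𝒢.of_iso (asIso (Twist.incl hq φ l (𝟙 Z))) (q.pow_tensor_mem hq _ hZ)

namespace Frac

lemma isIso_e_of_iso {B : 𝒯} (b : B ≅ 𝟙_ 𝒯) (A Z : 𝒯) : IsIso (e R B A Z) := by
  have h₁ := isIso_left (R := R) (Z := 𝟙_ 𝒯 ⊗ Z) (λ_ A).inv
  have h₂ := isIso_right (R := R) (A := A) (λ_ Z).hom
  have h₃ := isIso_right (R := R) (A := B ⊗ A) (b.hom ▷ Z)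
  have h₄ := isIso_left (R := R) (Z := 𝟙_ 𝒯 ⊗ Z) (b.hom ▷ A)
  have h₅ : IsIso (e R (𝟙_ 𝒯) A Z) := by
    have h := e_unit R A Z
    have h' : IsIso (e R (𝟙_ 𝒯) A Z ≫ left R (λ_ A).inv (𝟙_ 𝒯 ⊗ Z) ≫ right R A (λ_ Z).hom) := by
      rw [h]; infer_instance
    exact IsIso.of_isIso_comp_right _ (left R (λ_ A).inv (𝟙_ 𝒯 ⊗ Z) ≫ right R A (λ_ Z).hom)
  have h₆ : IsIso (e R B A Z ≫ right R _ (b.hom ▷ Z)) := by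
    rw [dinat]; infer_instance
  exact IsIso.of_isIso_comp_right _ (right R _ (b.hom ▷ Z))

lemma isIso_e {B D : 𝒯} (b : B ⊗ D ≅ 𝟙_ 𝒯) (d : D ⊗ B ≅ 𝟙_ 𝒯) (A Z : 𝒯) :
    IsIso (e R B A Z) := by
  have h (B B' : 𝒯) (b : B' ⊗ B ≅ 𝟙_ 𝒯) (A Z : 𝒯) : IsIso (e R B A Z ≫ e R B' _ _) := by
    have := isIso_e_of_iso (R := R) b A Z
    have := isIso_left (R := R) (Z := (B' ⊗ B) ⊗ Z) (α_ B' B A).inv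
    have := isIso_right (R := R) (A := B' ⊗ (B ⊗ A)) (α_ B' B Z).hom
    rw [e_tensor]
    infer_instance
  have h₁ := h B D d A Z
  have h₂ := h D B b (B ⊗ A) (B ⊗ Z)
  have h₃ : IsIso (e R D (B ⊗ A) (B ⊗ Z)) := by
    have : IsSplitEpi (e R D (B ⊗ A) (B ⊗ Z)) :=
      ⟨⟨inv (e R B A Z ≫ e R D _ _) ≫ e R B A Z, by simp⟩⟩
    have : Mono (e R D (B ⊗ A) (B ⊗ Z)) := mono_of_mono _ (e R B _ _)
    exact isIso_of_mono_of_isSplitEpi _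
  exact IsIso.of_isIso_comp_right _ (e R D (B ⊗ A) (B ⊗ Z))

end Frac

variable {I : Type w} {C : I → GradedBraider 𝒢 q} {deg : I → Λ}

open Frac GradedBraider

namespace IsRealCommutingFamily

variable (hC : IsRealCommutingFamily R C deg)
include hC

lemma exists_comp_shift_expand_of_homogeneous (i : I) (A : 𝒯) {m : Λ} {Z : 𝒯}
    (hZ : 𝒢.homogeneous m Z) :
    ∃ l : ((C i).shift R hq).obj ⟨A, Z⟩ ⟶ ((C i).shift R hq).obj ⟨A, Z⟩,
      l ≫ ((C i).shift R hq).map (((C i).expand R hq).app ⟨A, Z⟩) =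
        ((C i).expand R hq).app (((C i).shift R hq).obj ⟨A, Z⟩) := by
  obtain ⟨χ, hχ⟩ := hC.exists_braid_tw hq i hZ
  obtain ⟨r, hr⟩ := hC.braid_self hq i
  refine ⟨left R (χ ▷ A) ((C i).tw hq Z ⊗ (C i).obj), ?_⟩
  have h₁ : ((C i).shift R hq).map (((C i).expand R hq).app ⟨A, Z⟩) =
      (e R ((C i).tw hq (C i).obj) ((C i).obj ⊗ A) ((C i).tw hq Z ⊗ (C i).obj) ≫
        left R ((C i).denMap hq (C i).obj A) _ ≫
        right R _ ((α_ _ _ _).inv ≫ Twist.mu (C i).obj Z ▷ (C i).obj)) ≫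
      right R _ (Twist.map ((C i).braid hq Z) ▷ (C i).obj) := by
    rw [← (C i).shift_map_e R hq]
    exact Functor.map_comp _ _ _
  have h₂ : (C i).denMap hq (C i).obj A =
      (r : R) • hC.selfTwist hq i ▷ ((C i).obj ⊗ A) := by
    rw [denMap, hr, MonoidalLinear.smul_whiskerRight, Linear.smul_comp, Linear.comp_smul]
    congr 1
    monoidal
  have h₃ : (C i).braid hq ((C i).tw hq Z ⊗ (C i).obj) = (r : R) • ((α_ _ _ _).inv ≫
      (χ ▷ (C i).tw hq Z ≫ hC.selfTwist hq i ▷ (C i).tw hq Z ≫ Twist.mu (C i).obj Z ≫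
          Twist.map ((C i).braid hq Z)) ▷ (C i).obj) := by
    rw [← hχ, braid_tensor, hr, MonoidalLinear.whiskerLeft_smul, Linear.smul_comp]
    simp only [Linear.comp_smul]
    congr 1
    monoidal
  have h₄ : (C i).obj ◁ (χ ▷ A) = χ ▷ ((C i).obj ⊗ A) := by
    have h := congrArg (· ▷ A) (hC.whiskerLeft_self i χ)
    calc _ = 𝟙 _ ⊗≫ ((C i).obj ◁ χ) ▷ A ⊗≫ 𝟙 _ := by monoidal
      _ = _ := by rw [h]; monoidal
  have h₅ : ((C i).expand R hq).app (((C i).shift R hq).obj ⟨A, Z⟩) =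
      e R (C i).obj ((C i).obj ⊗ A) ((C i).tw hq Z ⊗ (C i).obj) ≫
        right R _ ((C i).braid hq ((C i).tw hq Z ⊗ (C i).obj)) := rfl
  have h₆ : left R (χ ▷ A) ((C i).tw hq Z ⊗ (C i).obj) ≫
      (e R ((C i).tw hq (C i).obj) ((C i).obj ⊗ A) ((C i).tw hq Z ⊗ (C i).obj) ≫
        left R ((C i).denMap hq (C i).obj A) _ ≫
        right R _ ((α_ _ _ _).inv ≫ Twist.mu (C i).obj Z ▷ (C i).obj)) ≫
      right R _ (Twist.map ((C i).braid hq Z) ▷ (C i).obj) =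
      e R (C i).obj ((C i).obj ⊗ A) ((C i).tw hq Z ⊗ (C i).obj) ≫
        right R _ ((C i).braid hq ((C i).tw hq Z ⊗ (C i).obj)) := by
    rw [h₂, h₃, left_smul, right_smul]
    simp only [Linear.smul_comp, Linear.comp_smul, Category.assoc]
    congr 1
    rw [← reassoc_of% (dinat (R := R) (hC.selfTwist hq i)), left_e_comp, h₄,
      ← reassoc_of% (dinat (R := R) χ)]
    simp only [right_right]
    congr 2
    monoidal
  rw [h₁, h₅]
  exact h₆

lemma exists_comp_shift_expand (i : I) (X : Frac R 𝒯) :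
    ∃ l : ((C i).shift R hq).obj X ⟶ ((C i).shift R hq).obj X,
      l ≫ ((C i).shift R hq).map (((C i).expand R hq).app X) =
        ((C i).expand R hq).app (((C i).shift R hq).obj X) := by
  obtain ⟨A, Z⟩ := X
  have h (m) (hm : m ∈ (𝒢.dec Z).s) := hC.exists_comp_shift_expand_of_homogeneous hq i A
    ((𝒢.dec Z).mem m hm)
  choose! l hl using h
  refine ⟨∑ m ∈ (𝒢.dec Z).s, ((C i).shift R hq).map (right R A ((𝒢.dec Z).π m)) ≫ l m ≫
    ((C i).shift R hq).map (right R A ((𝒢.dec Z).ι m)), ?_⟩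
  rw [Preadditive.sum_comp, Finset.sum_congr rfl (g := fun m =>
    ((C i).expand R hq).app (((C i).shift R hq).obj ⟨A, Z⟩) ≫ ((C i).shift R hq).map
      (((C i).shift R hq).map (right R A ((𝒢.dec Z).π m ≫ (𝒢.dec Z).ι m)))) (fun m hm => by
    have h₁ := ((C i).expand R hq).naturality (right R A ((𝒢.dec Z).ι m))
    have h₂ := ((C i).expand R hq).naturality (((C i).shift R hq).map (right R A ((𝒢.dec Z).π m)))
    rw [Functor.id_map] at h₁ h₂
    rw [Category.assoc, Category.assoc, ← Functor.map_comp, h₁, Functor.map_comp,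
      reassoc_of% (hl m hm), reassoc_of% h₂, ← Functor.map_comp, ← Functor.map_comp, right_right]),
    ← Preadditive.comp_sum, ← Functor.map_sum, ← Functor.map_sum]
  have h : ∑ m ∈ (𝒢.dec Z).s, right R A ((𝒢.dec Z).π m ≫ (𝒢.dec Z).ι m) = 𝟙 _ := by
    have h' := congrArg (right R A) (𝒢.dec Z).sum
    rw [right_id] at h'
    rw [← h']
    exact (map_sum (AddMonoidHom.mk' (fun z : Z ⟶ Z => right R A z)
      (fun z z' => right_add R A z z')) _ _).symm
  rw [h, CategoryTheory.Functor.map_id, CategoryTheory.Functor.map_id, Category.comp_id]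

end IsRealCommutingFamily

end FracFunctors

section FracFunctors

universe u v x y w u' v'

variable (R : Type x) [CommRing R] {𝒯 : Type u} [Category.{v} 𝒯] [Preadditive 𝒯] [Linear R 𝒯]
  [MonoidalCategory 𝒯] [MonoidalPreadditive 𝒯] [MonoidalLinear R 𝒯]
  {Λ : Type y} [AddCommGroup Λ] {𝒢 : MonoidalGrading Λ 𝒯} {q : InvertibleCentralObject 𝒯}
  (hq : 𝒢.homogeneous 0 (q.pow 1))

open Frac GradedBraider

namespace GradedBraider

variable (C : GradedBraider 𝒢 q)

/-- On numerators of degree `l`, acting by `C` is the same as removing `C` from the denominator. -/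
noncomputable def toAct (l : Λ) {A A' : 𝒯} (t : C.obj ⊗ A ⟶ q.pow (C.φ l) ⊗ A') (Z : 𝒯) :
    (⟨A', Z⟩ : Frac R 𝒯) ⟶ (C.act R hq).obj ⟨A, Z⟩ :=
  e R (q.pow (C.φ l)) A' Z ≫ left R t _ ≫ right R (C.obj ⊗ A) (Twist.incl hq C.φ l (𝟙 Z))

lemma isIso_toAct {l : Λ} {A A' : 𝒯} (t : C.obj ⊗ A ⟶ q.pow (C.φ l) ⊗ A') [IsIso t] {Z : 𝒯}
    (hZ : 𝒢.homogeneous l Z) : IsIso (C.toAct R hq l t Z) := by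
  have h₁ := isIso_e (R := R) (q.powInv (C.φ l) (-C.φ l) (by ring))
    (q.powInv (-C.φ l) (C.φ l) (by ring)) A' Z
  have h₂ := isIso_left (R := R) (Z := q.pow (C.φ l) ⊗ Z) t
  have := Twist.isIso_incl (hq := hq) (φ := C.φ) (𝟙 Z) hZ
  have h₃ := isIso_right (R := R) (A := C.obj ⊗ A) (Twist.incl hq C.φ l (𝟙 Z))
  exact @IsIso.comp_isIso _ _ _ _ _ _ _ h₁ (@IsIso.comp_isIso _ _ _ _ _ _ _ h₂ h₃)

lemma toAct_natural {l : Λ} {A A' : 𝒯} (t : C.obj ⊗ A ⟶ q.pow (C.φ l) ⊗ A') {Z Z' : 𝒯}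
    (hZ : 𝒢.homogeneous l Z) (z : Z ⟶ Z') :
    right R A' z ≫ C.toAct R hq l t Z' = C.toAct R hq l t Z ≫ (C.act R hq).map (right R A z) := by
  have h : right R A' z ≫ e R (q.pow (C.φ l)) A' Z' ≫ left R t _ ≫
        right R (C.obj ⊗ A) (Twist.incl hq C.φ l (𝟙 Z')) =
      (e R (q.pow (C.φ l)) A' Z ≫ left R t _ ≫ right R (C.obj ⊗ A) (Twist.incl hq C.φ l (𝟙 Z))) ≫
        right R (C.obj ⊗ A) (Twist.map z) := by
    simp only [Category.assoc, right_e_comp, right_left_comp, right_right, Twist.whiskerLeft_incl,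
      Twist.incl_map hZ, Category.id_comp, Category.comp_id]
  exact h

/-- The morphism `(q ^ b ⊗ D) ⊗ q ^ a ⟶ q ^ n ⊗ D` for `n = b + a`. -/
noncomputable def _root_.InvertibleCentralObject.collect (b a n : ℤ) (h : b + a = n) (D : 𝒯) :
    (q.pow b ⊗ D) ⊗ q.pow a ≅ q.pow n ⊗ D :=
  α_ _ _ _ ≪≫ whiskerLeftIso _ (q.central a D).symm ≪≫ (α_ _ _ _).symm ≪≫
    whiskerRightIso (q.powAdd b a n h) D

lemma _root_.InvertibleCentralObject.collect_whiskerRight (b a n : ℤ) (h : b + a = n) (D Z : 𝒯) :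
    (q.collect b a n h D).hom ▷ Z ≫ (α_ _ _ _).hom =
      (α_ _ _ _).hom ≫ (q.powTensor b a n h D Z).hom := by
  simp only [InvertibleCentralObject.collect, InvertibleCentralObject.powTensor_hom,
    InvertibleCentralObject.moveLeft_hom, Iso.trans_hom, whiskerLeftIso_hom, Iso.symm_hom,
    whiskerRightIso_hom]
  monoidal

/-- The denominators in `toAct_e`. -/
noncomputable def expandDen {D : 𝒯} {m : Λ} (hD : 𝒢.homogeneous m D) (l : Λ) {A A' : 𝒯}
    (t : C.obj ⊗ A ⟶ q.pow (C.φ l) ⊗ A') :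
    C.obj ⊗ (D ⊗ A) ⟶ q.pow (C.φ (m + l)) ⊗ (D ⊗ A') :=
  (((α_ _ _ _).inv ≫ (C.R D hD ≫ (α_ _ _ _).inv) ▷ A ≫ (α_ _ _ _).hom) ≫
    (q.pow (C.φ m) ⊗ D) ◁ t ≫ (α_ _ _ _).inv) ≫
      (q.collect _ _ _ (C.φ.map_add m l).symm D).hom ▷ A' ≫ (α_ _ _ _).hom

lemma isIso_expandDen {D : 𝒯} {m : Λ} (hD : 𝒢.homogeneous m D) [IsIso (C.R D hD)] (l : Λ) {A A' : 𝒯}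
    (t : C.obj ⊗ A ⟶ q.pow (C.φ l) ⊗ A') [IsIso t] : IsIso (C.expandDen hD l t) := by
  unfold expandDen
  infer_instance

lemma toAct_e {D : 𝒯} {m : Λ} (hD : 𝒢.homogeneous m D) {l : Λ} {A A' : 𝒯}
    (t : C.obj ⊗ A ⟶ q.pow (C.φ l) ⊗ A') {Z : 𝒯} (hZ : 𝒢.homogeneous l Z) :
    C.toAct R hq l t Z ≫ (C.act R hq).map (e R D A Z) =
      e R D A' Z ≫ C.toAct R hq (m + l) (C.expandDen hD l t) (D ⊗ Z) := by
  have h₀ := C.whiskerLeft_braid hq hD (𝟙 D)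
  rw [MonoidalCategory.whiskerLeft_id, Category.id_comp] at h₀
  have h₁ : C.denMap hq D A ≫ C.tw hq D ◁ t ≫ (α_ _ _ _).inv =
      (((α_ _ _ _).inv ≫ (C.R D hD ≫ (α_ _ _ _).inv) ▷ A ≫ (α_ _ _ _).hom) ≫
        (q.pow (C.φ m) ⊗ D) ◁ t ≫ (α_ _ _ _).inv) ≫
        (Twist.incl hq C.φ m (𝟙 D) ▷ q.pow (C.φ l)) ▷ A' := by
    rw [denMap, h₀]
    calc _ = 𝟙 _ ⊗≫ C.R D hD ▷ A ⊗≫ (Twist.incl hq C.φ m (𝟙 D) ▷ (C.obj ⊗ A) ≫ C.tw hq D ◁ t) ⊗≫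
          𝟙 _ := by monoidal
      _ = _ := by rw [← whisker_exchange]; monoidal
  have h₂ := Twist.incl_tensor_mu (hq := hq) (φ := C.φ) rfl hD hZ (𝟙 D) (𝟙 Z)
  have h₃ : (Twist.incl hq C.φ m (𝟙 D) ▷ q.pow (C.φ l)) ▷ Z ≫ (α_ _ _ _).hom ≫
      C.tw hq D ◁ Twist.incl hq C.φ l (𝟙 Z) ≫ Twist.mu D Z =
      (q.collect _ _ _ (C.φ.map_add m l).symm D).hom ▷ Z ≫ (α_ _ _ _).hom ≫
        Twist.incl hq C.φ (m + l) (𝟙 (D ⊗ Z)) := by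
    rw [reassoc_of% (q.collect_whiskerRight _ _ _ (C.φ.map_add m l).symm D Z),
      ← id_tensorHom_id, ← h₂, MonoidalCategory.tensorHom_def]
    simp
  have h : (e R (q.pow (C.φ l)) A' Z ≫ left R t _ ≫
        right R (C.obj ⊗ A) (Twist.incl hq C.φ l (𝟙 Z))) ≫
      e R (C.tw hq D) (C.obj ⊗ A) (C.tw hq Z) ≫ left R (C.denMap hq D A) _ ≫
        right R _ (Twist.mu D Z) =
      e R D A' Z ≫ e R (q.pow (C.φ (m + l))) (D ⊗ A') (D ⊗ Z) ≫ left R (C.expandDen hD l t) _ ≫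
        right R (C.obj ⊗ (D ⊗ A)) (Twist.incl hq C.φ (m + l) (𝟙 (D ⊗ Z))) := by
    have h₄ : C.expandDen hD l t ≫ (α_ _ _ _).inv =
      (((α_ _ _ _).inv ≫ (C.R D hD ≫ (α_ _ _ _).inv) ▷ A ≫ (α_ _ _ _).hom) ≫
      (q.pow (C.φ m) ⊗ D) ◁ t ≫ (α_ _ _ _).inv) ≫
      (q.collect _ _ _ (C.φ.map_add m l).symm D).hom ▷ A' := by simp [expandDen]
    simp only [Category.assoc, right_e_comp, left_e_comp, right_left_comp, left_left_comp,
      e_tensor_comp, right_right]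
    have h₁' := h₁
    have h₄' := h₄
    simp only [Category.assoc] at h₁' h₄'
    rw [h₁', h₄']
    have h₅ := dinat_comp R (Twist.incl hq C.φ m (𝟙 D) ▷ q.pow (C.φ l)) (Z := Z)
      (((α_ _ _ _).inv ≫ (C.R D hD ≫ (α_ _ _ _).inv) ▷ A ≫ (α_ _ _ _).hom) ≫
      (q.pow (C.φ m) ⊗ D) ◁ t ≫ (α_ _ _ A').inv) (right R _ ((α_ _ _ _).hom ≫
      C.tw hq D ◁ Twist.incl hq C.φ l (𝟙 Z) ≫ Twist.mu D Z))
    have h₆ := dinat_comp R (q.collect _ _ _ (C.φ.map_add m l).symm D).hom (Z := Z)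
      (((α_ _ _ _).inv ≫ (C.R D hD ≫ (α_ _ _ _).inv) ▷ A ≫ (α_ _ _ _).hom) ≫
      (q.pow (C.φ m) ⊗ D) ◁ t ≫ (α_ _ _ A').inv) (right R _ ((α_ _ _ _).hom ≫
        Twist.incl hq C.φ (m + l) (𝟙 (D ⊗ Z))))
    simp only [Category.assoc] at h₅ h₆
    rw [h₅, h₆, right_right, right_right, h₃]
  exact h

end GradedBraider

variable {R}

/-- A natural transformation between additive functors which is invertible on homogeneous numerators
is invertible. -/
lemma Frac.isIso_app_of_homogeneous {𝒟 : Type u'} [Category.{v'} 𝒟] [Preadditive 𝒟]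
    {F G : Frac R 𝒯 ⥤ 𝒟} [F.Additive] [G.Additive] (τ : F ⟶ G) (𝒢 : MonoidalGrading Λ 𝒯)
    (h : ∀ (A : 𝒯) (l : Λ) (Z : 𝒯), 𝒢.homogeneous l Z → IsIso (τ.app ⟨A, Z⟩)) (X : Frac R 𝒯) :
    IsIso (τ.app X) := by
  obtain ⟨A, Z⟩ := X
  have h₁ (m) (hm : m ∈ (𝒢.dec Z).s) : ∃ σ : G.obj ⟨A, (𝒢.dec Z).Y m⟩ ⟶ F.obj ⟨A, (𝒢.dec Z).Y m⟩,
      τ.app _ ≫ σ = 𝟙 _ ∧ σ ≫ τ.app _ = 𝟙 _ := (h A m _ ((𝒢.dec Z).mem m hm)).out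
  choose! σ h₂ h₃ using h₁
  have h₀ : ∑ m ∈ (𝒢.dec Z).s, right R A ((𝒢.dec Z).π m ≫ (𝒢.dec Z).ι m) = 𝟙 _ := by
    have h' := congrArg (right R A) (𝒢.dec Z).sum
    rw [right_id] at h'
    rw [← h']
    exact (map_sum (AddMonoidHom.mk' (fun z : Z ⟶ Z => right R A z)
      (fun z z' => right_add R A z z')) _ _).symm
  refine ⟨∑ m ∈ (𝒢.dec Z).s, G.map (right R A ((𝒢.dec Z).π m)) ≫ σ m ≫
    F.map (right R A ((𝒢.dec Z).ι m)), ?_, ?_⟩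
  · rw [Preadditive.comp_sum, Finset.sum_congr rfl (g := fun m =>
      F.map (right R A ((𝒢.dec Z).π m ≫ (𝒢.dec Z).ι m))) (fun m hm => by
      rw [← τ.naturality_assoc, reassoc_of% (h₂ m hm), ← F.map_comp, right_right]),
      ← F.map_sum, h₀, F.map_id]
  · rw [Preadditive.sum_comp, Finset.sum_congr rfl (g := fun m =>
      G.map (right R A ((𝒢.dec Z).π m ≫ (𝒢.dec Z).ι m))) (fun m hm => by
      rw [Category.assoc, Category.assoc, τ.naturality, reassoc_of% (h₃ m hm), ← G.map_comp,
        right_right]),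
      ← G.map_sum, h₀, G.map_id]

variable {I : Type w} {C : I → GradedBraider 𝒢 q} {deg : I → Λ}

namespace IsRealCommutingFamily

variable (hC : IsRealCommutingFamily R C deg)
include hC

lemma isIso_map_act_map_expand {𝒟 : Type u'} [Category.{v'} 𝒟] [Preadditive 𝒟]
    (F : Frac R 𝒯 ⥤ 𝒟) [F.Additive] (h : ∀ i X, IsIso (F.map (((C i).expand R hq).app X)))
    (i j : I) (X : Frac R 𝒯) :
    IsIso (F.map (((C j).act R hq).map (((C i).expand R hq).app X))) := by
  let τ : (C j).act R hq ⋙ F ⟶ ((C i).shift R hq ⋙ (C j).act R hq) ⋙ F :=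
    Functor.whiskerRight (Functor.whiskerRight ((C i).expand R hq) ((C j).act R hq)) F
  refine Frac.isIso_app_of_homogeneous τ 𝒢 (fun A l Z hZ => ?_) X
  change IsIso (F.map (((C j).act R hq).map (((C i).expand R hq).app ⟨A, Z⟩)))
  let A' := q.pow (-(C j).φ l) ⊗ ((C j).obj ⊗ A)
  let t : (C j).obj ⊗ A ≅ q.pow ((C j).φ l) ⊗ A' :=
    (λ_ _).symm ≪≫ whiskerRightIso (q.powInv ((C j).φ l) (-(C j).φ l) (by ring)).symm _ ≪≫ α_ _ _ _
  have := hC.isIso_R j i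
  have hZ' : 𝒢.homogeneous (deg i + l) ((C i).tw hq Z ⊗ (C i).obj) :=
    𝒢.tensor_mem' (Twist.homogeneous_obj hq hZ) (hC.homogeneous i) (add_comm _ _)
  have h₁ := (C j).toAct_e R hq (hC.homogeneous i) t.hom hZ
  have h₂ := (C j).toAct_natural R hq ((C j).expandDen (hC.homogeneous i) l t.hom)
    (𝒢.tensor_mem (hC.homogeneous i) hZ) ((C i).braid hq Z)
  have h₃ : (C j).toAct R hq l t.hom Z ≫ ((C j).act R hq).map (((C i).expand R hq).app ⟨A, Z⟩) =
      ((C i).expand R hq).app ⟨A', Z⟩ ≫ (C j).toAct R hq (deg i + l)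
        ((C j).expandDen (hC.homogeneous i) l t.hom) ((C i).tw hq Z ⊗ (C i).obj) := by
    rw [expand_app, expand_app]
    refine Eq.trans (congrArg _ (((C j).act R hq).map_comp _ _)) ?_
    rw [reassoc_of% h₁]
    exact (congrArg (_ ≫ ·) h₂.symm).trans (Category.assoc _ _ _).symm
  have h₄ := (C j).isIso_toAct R hq t.hom hZ
  have := (C j).isIso_expandDen (hC.homogeneous i) l t.hom
  have h₅ := (C j).isIso_toAct R hq ((C j).expandDen (hC.homogeneous i) l t.hom) hZ'
  have h₆ := h i ⟨A', Z⟩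
  have h₇ : IsIso (F.map ((C j).toAct R hq l t.hom Z) ≫
      F.map (((C j).act R hq).map (((C i).expand R hq).app ⟨A, Z⟩))) := by
    have h₈ : F.map ((C j).toAct R hq l t.hom Z) ≫
        F.map (((C j).act R hq).map (((C i).expand R hq).app ⟨A, Z⟩)) =
        F.map (((C i).expand R hq).app ⟨A', Z⟩) ≫ F.map ((C j).toAct R hq (deg i + l)
        ((C j).expandDen (hC.homogeneous i) l t.hom) ((C i).tw hq Z ⊗ (C i).obj)) :=
      (F.map_comp _ _).symm.trans ((congrArg F.map h₃).trans (F.map_comp _ _))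
    rw [h₈]
    exact @IsIso.comp_isIso _ _ _ _ _ _ _ h₆ (@Functor.map_isIso _ _ _ _ _ _ F _ h₅)
  exact IsIso.of_isIso_comp_left (F.map ((C j).toAct R hq l t.hom Z)) _

end IsRealCommutingFamily

end FracFunctors

/-! ### Localization at a family of pointed endofunctors -/

section Pointed

universe u v w u' v'

namespace PointedFamily

variable {𝒬 : Type u} [Category.{v} 𝒬] {I : Type w} {Ξ : I → 𝒬 ⥤ 𝒬} (r : ∀ i, 𝟭 𝒬 ⟶ Ξ i)

/-- The composite of two pointed endofunctors. -/
@[simps]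
def comp {Φ Ψ : 𝒬 ⥤ 𝒬} (τ : 𝟭 𝒬 ⟶ Φ) (σ : 𝟭 𝒬 ⟶ Ψ) : 𝟭 𝒬 ⟶ Φ ⋙ Ψ where
  app X := τ.app X ≫ σ.app (Φ.obj X)
  naturality X Y f := by
    have h₁ := τ.naturality f
    have h₂ := σ.naturality (Φ.map f)
    simp only [Functor.id_map] at h₁ h₂
    simp only [Functor.id_map, Functor.comp_map, Category.assoc]
    rw [reassoc_of% h₁, h₂]

/-- The composites of a family of pointed endofunctors. -/
inductive IsComposite : ∀ Φ : 𝒬 ⥤ 𝒬, (𝟭 𝒬 ⟶ Φ) → Prop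
  | id : IsComposite (𝟭 𝒬) (𝟙 _)
  | of (i : I) : IsComposite (Ξ i) (r i)
  | comp {Φ Ψ : 𝒬 ⥤ 𝒬} {τ : 𝟭 𝒬 ⟶ Φ} {σ : 𝟭 𝒬 ⟶ Ψ} : IsComposite Φ τ → IsComposite Ψ σ →
      IsComposite (Φ ⋙ Ψ) (comp τ σ)

/-- The morphisms which are invertible up to the points. -/
def weakEquivalences : MorphismProperty 𝒬 := fun M N s =>
  (∃ (Φ : 𝒬 ⥤ 𝒬) (τ : 𝟭 𝒬 ⟶ Φ), IsComposite r Φ τ ∧ ∃ k : N ⟶ Φ.obj M, s ≫ k = τ.app M) ∧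
  ∃ (Φ : 𝒬 ⥤ 𝒬) (τ : 𝟭 𝒬 ⟶ Φ), IsComposite r Φ τ ∧ ∃ l : N ⟶ Φ.obj M, l ≫ Φ.map s = τ.app N

instance : (weakEquivalences r).IsMultiplicative where
  id_mem X := ⟨⟨_, _, .id, 𝟙 X, by simp⟩, ⟨_, _, .id, 𝟙 X, by simp⟩⟩
  comp_mem {M N P} s t hs ht := by
    obtain ⟨⟨Φ₁, τ₁, h₁, k₁, e₁⟩, ⟨Φ₂, τ₂, h₂, k₂, e₂⟩⟩ := hs
    obtain ⟨⟨Ψ₁, σ₁, g₁, l₁, f₁⟩, ⟨Ψ₂, σ₂, g₂, l₂, f₂⟩⟩ := ht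
    refine ⟨⟨_, _, h₁.comp g₁, l₁ ≫ Ψ₁.map k₁, ?_⟩, ⟨_, _, h₂.comp g₂, l₂ ≫ Ψ₂.map k₂, ?_⟩⟩
    · have := σ₁.naturality k₁
      simp only [Functor.id_map] at this
      rw [Category.assoc, reassoc_of% f₁, ← this, reassoc_of% e₁]
      rfl
    · have h₃ := τ₂.naturality t
      have h₄ := σ₂.naturality (τ₂.app P)
      simp only [Functor.id_map] at h₃ h₄
      have h₅ : k₂ ≫ Φ₂.map (s ≫ t) = t ≫ τ₂.app P := by
        rw [Φ₂.map_comp, reassoc_of% e₂, h₃]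
      have h₆ : (l₂ ≫ Ψ₂.map k₂) ≫ Ψ₂.map (Φ₂.map (s ≫ t)) = τ₂.app P ≫ σ₂.app (Φ₂.obj P) := by
        rw [Category.assoc, ← Ψ₂.map_comp, h₅, Ψ₂.map_comp, reassoc_of% f₂]
        exact h₄.symm
      exact h₆

variable (hr : ∀ (i : I) (X : 𝒬), ∃ l : (Ξ i).obj X ⟶ (Ξ i).obj X,
  l ≫ (Ξ i).map ((r i).app X) = (r i).app ((Ξ i).obj X))

variable {r}

include hr in
lemma weakEquivalences_app {Φ : 𝒬 ⥤ 𝒬} {τ : 𝟭 𝒬 ⟶ Φ} (h : IsComposite r Φ τ) (X : 𝒬) :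
    weakEquivalences r (τ.app X) := by
  induction h generalizing X with
  | id => exact (weakEquivalences r).id_mem X
  | of i =>
    obtain ⟨l, hl⟩ := hr i X
    exact ⟨⟨_, _, .of i, 𝟙 _, Category.comp_id _⟩, ⟨_, _, .of i, l, hl⟩⟩
  | @comp Φ _ _ _ _ _ h₁ h₂ => exact (weakEquivalences r).comp_mem _ _ (h₁ X) (h₂ (Φ.obj X))

include hr in
lemma hasLeftCalculusOfFractions : (weakEquivalences r).HasLeftCalculusOfFractions where
  exists_leftFraction {X Y} φ := by
    obtain ⟨s, ⟨⟨Φ, τ, h, k, e⟩, -⟩, f⟩ := φ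
    refine ⟨⟨k ≫ Φ.map f, τ.app Y, weakEquivalences_app hr h Y⟩, ?_⟩
    have := τ.naturality f
    simp only [Functor.id_map] at this
    simp only
    rw [reassoc_of% e, this]
  ext {X' X Y} f g s hs e := by
    obtain ⟨-, ⟨Φ, τ, h, l, e'⟩⟩ := hs
    refine ⟨_, τ.app Y, weakEquivalences_app hr h Y, ?_⟩
    have h₁ := τ.naturality f
    have h₂ := τ.naturality g
    simp only [Functor.id_map] at h₁ h₂
    rw [h₁, h₂, ← e', Category.assoc, Category.assoc, ← Φ.map_comp, e, Φ.map_comp]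

lemma isIso_map_of_isComposite {𝒟 : Type u'} [Category.{v'} 𝒟] (F : 𝒬 ⥤ 𝒟)
    (hF : ∀ i X, IsIso (F.map ((r i).app X))) {Φ : 𝒬 ⥤ 𝒬} {τ : 𝟭 𝒬 ⟶ Φ} (h : IsComposite r Φ τ)
    (X : 𝒬) : IsIso (F.map (τ.app X)) := by
  induction h generalizing X with
  | id => exact inferInstanceAs (IsIso (F.map (𝟙 X)))
  | of i => exact hF i X
  | @comp Φ _ τ σ _ _ h₁ h₂ =>
    have := h₁ X
    have := h₂ (Φ.obj X)
    exact (F.map_comp (τ.app X) (σ.app (Φ.obj X))) ▸ IsIso.comp_isIso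

lemma isInvertedBy_weakEquivalences {𝒟 : Type u'} [Category.{v'} 𝒟] (F : 𝒬 ⥤ 𝒟)
    (hF : ∀ i X, IsIso (F.map ((r i).app X))) : (weakEquivalences r).IsInvertedBy F := by
  rintro M N s ⟨⟨Φ, τ, h, k, e⟩, ⟨Ψ, σ, h', l, e'⟩⟩
  have h₁ := isIso_map_of_isComposite F hF h M
  have h₂ := isIso_map_of_isComposite F hF h' N
  have h₃ := isIso_map_of_isComposite F hF h' M
  have h₄ := σ.naturality s
  simp only [Functor.id_map] at h₄
  have h₅ : IsSplitMono (F.map s) := ⟨⟨F.map k ≫ inv (F.map (τ.app M)), by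
    rw [← Category.assoc, ← F.map_comp, e]; exact IsIso.hom_inv_id _⟩⟩
  have h₆ : IsSplitEpi (F.map s) := ⟨⟨F.map l ≫ inv (F.map (σ.app M)), by
    rw [← cancel_mono (F.map (σ.app N)), Category.assoc, ← F.map_comp s, h₄, F.map_comp]
    rw [Category.assoc]
    have : inv (F.map (σ.app M)) ≫ F.map (σ.app M) = 𝟙 _ := IsIso.inv_hom_id _
    rw [reassoc_of% this, ← F.map_comp, e', Category.id_comp]⟩⟩
  exact isIso_of_mono_of_isSplitEpi _

include hr in
lemma exists_comp_eq_zero [Preadditive 𝒬] {X Y : 𝒬} (f : X ⟶ Y)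
    (hf : (weakEquivalences r).Q.map f = (weakEquivalences r).Q.map 0) :
    ∃ (Φ : 𝒬 ⥤ 𝒬) (τ : 𝟭 𝒬 ⟶ Φ), IsComposite r Φ τ ∧ f ≫ τ.app Y = 0 := by
  have := hasLeftCalculusOfFractions hr
  rw [MorphismProperty.map_eq_iff_postcomp _ (weakEquivalences r)] at hf
  obtain ⟨Z, s, ⟨⟨Φ, τ, h, k, e⟩, -⟩, h'⟩ := hf
  refine ⟨Φ, τ, h, ?_⟩
  rw [← e, ← Category.assoc, h', zero_comp, zero_comp]

end PointedFamily

end Pointed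

/-! ### Linear endofunctors, with the reversed composition as tensor product -/

section LinearEndofunctors

universe u v x

variable (R : Type x) [CommRing R] (𝓜 : Type u) [Category.{v} 𝓜] [Preadditive 𝓜] [Linear R 𝓜]

/-- The category of linear endofunctors. -/
def LinEnd : Type _ := ObjectProperty.FullSubcategory (C := 𝓜 ⥤ 𝓜)
  (fun F => ∃ _ : F.Additive, F.Linear R)

namespace LinEnd

instance : Category (LinEnd R 𝓜) :=
  inferInstanceAs (Category (ObjectProperty.FullSubcategory _))

instance : Preadditive (LinEnd R 𝓜) :=
  inferInstanceAs (Preadditive (ObjectProperty.FullSubcategory _))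

instance : Linear R (LinEnd R 𝓜) :=
  inferInstanceAs (Linear R (ObjectProperty.FullSubcategory _))

variable {R 𝓜}

/-- The underlying functor. -/
def functor (F : LinEnd R 𝓜) : 𝓜 ⥤ 𝓜 := F.obj

instance (F : LinEnd R 𝓜) : F.functor.Additive := F.property.1

instance (F : LinEnd R 𝓜) : F.functor.Linear R := F.property.2

/-- The underlying natural transformation. -/
def nat {F G : LinEnd R 𝓜} (f : F ⟶ G) : F.functor ⟶ G.functor := f.hom

/-- A linear endofunctor as an object. -/
def mk (F : 𝓜 ⥤ 𝓜) [h : F.Additive] [h' : F.Linear R] : LinEnd R 𝓜 := ⟨F, h, h'⟩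

/-- A natural transformation as a morphism. -/
def homMk {F G : LinEnd R 𝓜} (f : F.functor ⟶ G.functor) : F ⟶ G := ⟨f⟩

lemma hom_ext {F G : LinEnd R 𝓜} {f g : F ⟶ G} (h : ∀ X, (nat f).app X = (nat g).app X) : f = g :=
  ObjectProperty.hom_ext _ (by ext X; exact h X)

@[simp] lemma nat_homMk {F G : LinEnd R 𝓜} (f : F.functor ⟶ G.functor) : nat (homMk f) = f := rfl

@[simp] lemma nat_id (F : LinEnd R 𝓜) : nat (𝟙 F) = 𝟙 _ := rfl

@[simp] lemma nat_comp {F G H : LinEnd R 𝓜} (f : F ⟶ G) (g : G ⟶ H) :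
    nat (f ≫ g) = nat f ≫ nat g := rfl

@[simp] lemma nat_add {F G : LinEnd R 𝓜} (f g : F ⟶ G) : nat (f + g) = nat f + nat g := rfl

@[simp] lemma nat_smul {F G : LinEnd R 𝓜} (r : R) (f : F ⟶ G) : nat (r • f) = r • nat f := rfl

/-- A natural isomorphism as an isomorphism. -/
@[simps]
def isoMk {F G : LinEnd R 𝓜} (e : F.functor ≅ G.functor) : F ≅ G where
  hom := homMk e.hom
  inv := homMk e.inv
  hom_inv_id := hom_ext fun X => by simp
  inv_hom_id := hom_ext fun X => by simp

instance : MonoidalCategoryStruct (LinEnd R 𝓜) where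
  tensorObj F G := mk (G.functor ⋙ F.functor)
  whiskerLeft F _ _ g := homMk (Functor.whiskerRight (nat g) F.functor)
  whiskerRight f G := homMk (Functor.whiskerLeft G.functor (nat f))
  tensorHom {F F' G G'} f g := homMk (Functor.whiskerRight (nat g) F.functor ≫
    Functor.whiskerLeft G'.functor (nat f))
  tensorUnit := mk (𝟭 𝓜)
  associator F G H := isoMk (Functor.associator H.functor G.functor F.functor).symm
  leftUnitor F := isoMk (Functor.rightUnitor F.functor)
  rightUnitor F := isoMk (Functor.leftUnitor F.functor)

variable {F G H : LinEnd R 𝓜}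

@[simp] lemma tensor_functor_obj (X : 𝓜) :
    (F ⊗ G).functor.obj X = F.functor.obj (G.functor.obj X) := rfl

@[simp] lemma tensor_functor_map {X Y : 𝓜} (f : X ⟶ Y) :
    (F ⊗ G).functor.map f = F.functor.map (G.functor.map f) := rfl

@[simp] lemma unit_functor_obj (X : 𝓜) : (𝟙_ (LinEnd R 𝓜)).functor.obj X = X := rfl

@[simp] lemma unit_functor_map {X Y : 𝓜} (f : X ⟶ Y) : (𝟙_ (LinEnd R 𝓜)).functor.map f = f := rfl

@[simp] lemma nat_whiskerLeft_app (g : G ⟶ H) (X : 𝓜) :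
    (nat (F ◁ g)).app X = F.functor.map ((nat g).app X) := rfl

@[simp] lemma nat_whiskerRight_app (g : G ⟶ H) (X : 𝓜) :
    (nat (g ▷ F)).app X = (nat g).app (F.functor.obj X) := rfl

@[simp] lemma nat_associator_hom_app (X : 𝓜) : (nat (α_ F G H).hom).app X = 𝟙 _ := rfl

@[simp] lemma nat_associator_inv_app (X : 𝓜) : (nat (α_ F G H).inv).app X = 𝟙 _ := rfl

@[simp] lemma nat_leftUnitor_hom_app (X : 𝓜) : (nat (λ_ F).hom).app X = 𝟙 _ := rfl

@[simp] lemma nat_rightUnitor_hom_app (X : 𝓜) : (nat (ρ_ F).hom).app X = 𝟙 _ := rfl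

@[simp] lemma nat_leftUnitor_inv_app (X : 𝓜) : (nat (λ_ F).inv).app X = 𝟙 _ := rfl

@[simp] lemma nat_rightUnitor_inv_app (X : 𝓜) : (nat (ρ_ F).inv).app X = 𝟙 _ := rfl

@[simp] lemma nat_tensorHom_app {F' G' : LinEnd R 𝓜} (f : F ⟶ F') (g : G ⟶ G') (X : 𝓜) :
    (nat (f ⊗ₘ g)).app X = F.functor.map ((nat g).app X) ≫ (nat f).app (G'.functor.obj X) := rfl

instance : MonoidalCategory (LinEnd R 𝓜) where
  tensorHom_def f g := hom_ext fun X => by simp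
  id_tensorHom_id F G := hom_ext fun X => by simp
  tensorHom_comp_tensorHom f g f' g' := hom_ext fun X => by simp
  whiskerLeft_id F G := hom_ext fun X => by simp
  id_whiskerRight F G := hom_ext fun X => by simp
  associator_naturality f g h := hom_ext fun X => by simp [← Functor.map_comp]
  leftUnitor_naturality f := hom_ext fun X => by simp
  rightUnitor_naturality f := hom_ext fun X => by simp
  pentagon F G H K := hom_ext fun X => by simp
  triangle F G := hom_ext fun X => by simp

instance : MonoidalPreadditive (LinEnd R 𝓜) where
  whiskerLeft_zero := hom_ext fun X => by
    simp only [nat_whiskerLeft_app]; exact Functor.map_zero _ _ _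
  zero_whiskerRight := hom_ext fun X => rfl
  whiskerLeft_add f g := hom_ext fun X => Functor.map_add _
  add_whiskerRight f g := hom_ext fun X => rfl

instance : MonoidalLinear R (LinEnd R 𝓜) where
  whiskerLeft_smul F _ _ r g := hom_ext fun X => Functor.map_smul _ _ _
  smul_whiskerRight r _ _ f F := hom_ext fun X => rfl

end LinEnd

end LinearEndofunctors

/-! ### A model of the localization -/

section LocalFunctors

universe u v x y w u' v'

variable {R : Type x} [CommRing R] {𝒯 : Type u} [Category.{v} 𝒯] [Preadditive 𝒯] [Linear R 𝒯]
  [MonoidalCategory 𝒯] [MonoidalPreadditive 𝒯] [MonoidalLinear R 𝒯]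
  {Λ : Type y} [AddCommGroup Λ] {𝒢 : MonoidalGrading Λ 𝒯} {q : InvertibleCentralObject 𝒯}
  (hq : 𝒢.homogeneous 0 (q.pow 1)) {I : Type w} (C : I → GradedBraider 𝒢 q)
  (𝒟 : Type u') [Category.{v'} 𝒟] [Preadditive 𝒟] [Linear R 𝒟]

open Frac GradedBraider

/-- The linear functors on formal fractions which invert all expansions by braiders. -/
def IsLocalFunctor : ObjectProperty (Frac R 𝒯 ⥤ 𝒟) := fun F =>
  (∃ _ : F.Additive, F.Linear R) ∧ ∀ i X, IsIso (F.map (((C i).expand R hq).app X))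

variable (R)

/-- The category of linear functors on formal fractions which invert all expansions by braiders. -/
abbrev LocalFunctor : Type _ := (IsLocalFunctor (R := R) hq C 𝒟).FullSubcategory

variable {R hq C 𝒟}

namespace Frac

/-- Acting by the unit does nothing. -/
def mulRightUnit (R : Type x) [CommRing R] (𝒯 : Type u) [Category.{v} 𝒯] [Preadditive 𝒯]
    [Linear R 𝒯] [MonoidalCategory 𝒯] [MonoidalPreadditive 𝒯] [MonoidalLinear R 𝒯] :
    𝟭 (Frac R 𝒯) ⟶ mulRight R (𝟙_ 𝒯) :=
  natTransOfRight (fun X => right R X.den (ρ_ X.num).inv)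
    (fun a Z => left_right R a (ρ_ Z).inv)
    (fun A Z Z' z => by
      change right R A z ≫ right R A (ρ_ Z').inv = right R A (ρ_ Z).inv ≫ right R A (z ▷ 𝟙_ 𝒯)
      rw [right_right, right_right, rightUnitor_inv_naturality])
    (fun B A Z => by
      change e R B A Z ≫ right R (B ⊗ A) (ρ_ (B ⊗ Z)).inv =
        right R A (ρ_ Z).inv ≫ e R B A (Z ⊗ 𝟙_ 𝒯) ≫ right R _ (α_ B Z (𝟙_ 𝒯)).inv
      rw [right_e_comp, right_right]
      congr 2
      monoidal)

instance (X : Frac R 𝒯) : IsIso ((mulRightUnit R 𝒯).app X) :=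
  isIso_right (A := X.den) (ρ_ X.num).inv

variable (R) in
/-- Acting by a tensor product. -/
def mulRightTensor (V V' : 𝒯) : mulRight R V ⋙ mulRight R V' ⟶ mulRight R (V ⊗ V') :=
  natTransOfRight (fun X => right R X.den (α_ X.num V V').hom)
    (fun a Z => left_right R a (α_ Z V V').hom)
    (fun A Z Z' z => by
      change right R A (z ▷ V ▷ V') ≫ right R A (α_ Z' V V').hom =
        right R A (α_ Z V V').hom ≫ right R A (z ▷ (V ⊗ V'))
      rw [right_right, right_right, associator_naturality_left])
    (fun B A Z => by
      change ((e R B A ((Z ⊗ V) ⊗ V') ≫ right R _ (α_ B (Z ⊗ V) V').inv) ≫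
          right R _ ((α_ B Z V).inv ▷ V')) ≫ right R (B ⊗ A) (α_ (B ⊗ Z) V V').hom =
        right R A (α_ Z V V').hom ≫ e R B A (Z ⊗ (V ⊗ V')) ≫ right R _ (α_ B Z (V ⊗ V')).inv
      simp only [Category.assoc, right_e_comp, right_right]
      congr 2
      monoidal)

instance (V V' : 𝒯) (X : Frac R 𝒯) : IsIso ((mulRightTensor R V V').app X) :=
  isIso_right (A := X.den) (α_ X.num V V').hom

lemma map_right_congr₂ (F : Frac R 𝒯 ⥤ 𝒟) {A Z Z₁ Z₂ Z' : 𝒯} {a : Z ⟶ Z₁} {b : Z₁ ⟶ Z'}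
    {c : Z ⟶ Z₂} {d : Z₂ ⟶ Z'} (h : a ≫ b = c ≫ d) :
    F.map (right R A a) ≫ F.map (right R A b) = F.map (right R A c) ≫ F.map (right R A d) := by
  rw [← F.map_comp, ← F.map_comp, right_right, right_right, h]

end Frac

namespace LocalFunctor

/-- Endofunctors of formal fractions which preserve local functors. -/
def Preserves (hq : 𝒢.homogeneous 0 (q.pow 1)) (C : I → GradedBraider 𝒢 q)
    (𝒟 : Type u') [Category.{v'} 𝒟] [Preadditive 𝒟] [Linear R 𝒟]
    (Ψ : Frac R 𝒯 ⥤ Frac R 𝒯) : Prop :=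
  ∀ F : Frac R 𝒯 ⥤ 𝒟, IsLocalFunctor hq C 𝒟 F → IsLocalFunctor hq C 𝒟 (Ψ ⋙ F)

instance (F : LocalFunctor R hq C 𝒟) : F.obj.Additive := F.property.1.1

instance (F : LocalFunctor R hq C 𝒟) : F.obj.Linear R := F.property.1.2

/-- Precomposition, as a functor. -/
def preFunctor (Ψ : Frac R 𝒯 ⥤ Frac R 𝒯) (h : Preserves hq C 𝒟 Ψ) :
    LocalFunctor R hq C 𝒟 ⥤ LocalFunctor R hq C 𝒟 where
  obj F := ⟨Ψ ⋙ F.obj, h _ F.property⟩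
  map f := ObjectProperty.homMk (Functor.whiskerLeft Ψ f.hom)
  map_id F := rfl
  map_comp f g := rfl

instance (Ψ : Frac R 𝒯 ⥤ Frac R 𝒯) (h : Preserves hq C 𝒟 Ψ) : (preFunctor Ψ h).Additive where
  map_add := rfl

instance (Ψ : Frac R 𝒯 ⥤ Frac R 𝒯) (h : Preserves hq C 𝒟 Ψ) : (preFunctor Ψ h).Linear R where
  map_smul _ _ := rfl

/-- Precomposition, as a linear endofunctor of the category of local functors. -/
def pre (Ψ : Frac R 𝒯 ⥤ Frac R 𝒯) (h : Preserves hq C 𝒟 Ψ) : LinEnd R (LocalFunctor R hq C 𝒟) :=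
  LinEnd.mk (preFunctor Ψ h)

/-- The action of natural transformations on precompositions. -/
def preMap {Ψ Ψ' : Frac R 𝒯 ⥤ Frac R 𝒯} (h : Preserves hq C 𝒟 Ψ) (h' : Preserves hq C 𝒟 Ψ')
    (κ : Ψ ⟶ Ψ') : pre Ψ h ⟶ pre Ψ' h' :=
  LinEnd.homMk
    { app := fun F => ObjectProperty.homMk (Functor.whiskerRight κ F.obj)
      naturality := fun F G f => by
        ext X
        exact (f.hom.naturality _).symm }

lemma hom_ext {F G : LinEnd R (LocalFunctor R hq C 𝒟)} {f g : F ⟶ G}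
    (h : ∀ (L : LocalFunctor R hq C 𝒟) (X : Frac R 𝒯),
      ((LinEnd.nat f).app L).hom.app X = ((LinEnd.nat g).app L).hom.app X) : f = g :=
  LinEnd.hom_ext fun L => by ext X; exact h L X

lemma isIso_of_app {F G : LinEnd R (LocalFunctor R hq C 𝒟)} (f : F ⟶ G)
    (h : ∀ (L : LocalFunctor R hq C 𝒟) (X : Frac R 𝒯),
      IsIso (((LinEnd.nat f).app L).hom.app X)) : IsIso f := by
  have h₁ (L : LocalFunctor R hq C 𝒟) : IsIso ((LinEnd.nat f).app L) := by
    rw [← ObjectProperty.isIso_hom_iff]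
    have := h L
    exact NatIso.isIso_of_isIso_app _
  have h₂ : IsIso (LinEnd.nat f) := NatIso.isIso_of_isIso_app _
  exact (LinEnd.isoMk (asIso (LinEnd.nat f))).isIso_hom

variable {deg : I → Λ} (hC : IsRealCommutingFamily R C deg)

lemma preserves_of_weakEquivalences (Ψ : Frac R 𝒯 ⥤ Frac R 𝒯) [Ψ.Additive] [Ψ.Linear R]
    (h : ∀ (F : Frac R 𝒯 ⥤ 𝒟), IsLocalFunctor hq C 𝒟 F → ∀ i X,
      IsIso (F.map (Ψ.map (((C i).expand R hq).app X)))) : Preserves hq C 𝒟 Ψ := by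
  intro F hF
  obtain ⟨⟨h₁, h₂⟩, h₃⟩ := id hF
  exact ⟨⟨inferInstance, inferInstance⟩, fun i X => h F hF i X⟩

include hC

lemma preserves_act (i : I) : Preserves hq C 𝒟 ((C i).act R hq) :=
  preserves_of_weakEquivalences _ fun F hF j X =>
    have := hF.1.1
    hC.isIso_map_act_map_expand hq F hF.2 j i X

lemma preserves_mulRight (V : 𝒯) : Preserves hq C 𝒟 (mulRight R V) :=
  preserves_of_weakEquivalences _ fun F hF i X => by
    refine PointedFamily.isInvertedBy_weakEquivalences (r := fun i => (C i).expand R hq) F hF.2 _ ?_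
    obtain ⟨l, hl⟩ := hC.exists_comp_shift_expand hq i X
    refine ⟨⟨_, _, .of i, _, (C i).mulRight_map_expand R hq V X⟩, ⟨_, _, .of i,
      (mulRight R V).map l ≫ ((C i).shiftTensor R hq V).app X, ?_⟩⟩
    have h₁ := ((C i).shiftTensor R hq V).naturality (((C i).expand R hq).app X)
    have h₂ := (C i).mulRight_map_expand R hq V (((C i).shift R hq).obj X)
    rw [← hl, Functor.map_comp, Category.assoc] at h₂
    rw [Category.assoc]
    exact (congrArg (_ ≫ ·) h₁.symm).trans h₂

variable (𝒟) in
/-- The action of `𝒯` on local functors. -/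
def model : 𝒯 ⥤ LinEnd R (LocalFunctor R hq C 𝒟) where
  obj V := pre (mulRight R V) (preserves_mulRight hC V)
  map f := preMap _ _ (mulRightMap R f)
  map_id V := hom_ext fun L X => by
    change L.obj.map (right R X.den (X.num ◁ 𝟙 V)) = 𝟙 _
    rw [MonoidalCategory.whiskerLeft_id, right_id]
    exact L.obj.map_id _
  map_comp f g := hom_ext fun L X => by
    change L.obj.map (right R X.den (X.num ◁ (f ≫ g))) =
      L.obj.map (right R X.den (X.num ◁ f)) ≫ L.obj.map (right R X.den (X.num ◁ g))
    rw [MonoidalCategory.whiskerLeft_comp, right_comp]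
    exact L.obj.map_comp _ _

instance : (model (hq := hq) 𝒟 hC).Additive where
  map_add {V V' f g} := hom_ext fun L X => by
    change L.obj.map (right R X.den (X.num ◁ (f + g))) = L.obj.map (right R X.den (X.num ◁ f)) +
      L.obj.map (right R X.den (X.num ◁ g))
    rw [MonoidalPreadditive.whiskerLeft_add, right_add, L.obj.map_add]

instance : (model (hq := hq) 𝒟 hC).Linear R where
  map_smul {V V'} f r := hom_ext fun L X => by
    change L.obj.map (right R X.den (X.num ◁ (r • f))) = r • L.obj.map (right R X.den (X.num ◁ f))
    rw [MonoidalLinear.whiskerLeft_smul, right_smul, L.obj.map_smul]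

omit hC in
lemma preserves_id : Preserves hq C 𝒟 (𝟭 (Frac R 𝒯)) := fun _ h => h

omit hC in
lemma Preserves.comp {Ψ Ψ' : Frac R 𝒯 ⥤ Frac R 𝒯} (h : Preserves hq C 𝒟 Ψ)
    (h' : Preserves hq C 𝒟 Ψ') : Preserves hq C 𝒟 (Ψ ⋙ Ψ') := fun F hF => h _ (h' F hF)

/-- The unit morphism of the action. -/
def modelUnit : 𝟙_ (LinEnd R (LocalFunctor R hq C 𝒟)) ⟶ (model 𝒟 hC).obj (𝟙_ 𝒯) :=
  preMap preserves_id (preserves_mulRight hC (𝟙_ 𝒯)) (mulRightUnit R 𝒯)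

instance : IsIso (modelUnit (hq := hq) (𝒟 := 𝒟) hC) :=
  isIso_of_app _ fun L X => (L.obj.mapIso (asIso ((mulRightUnit R 𝒯).app X))).isIso_hom

/-- The multiplication morphism of the action. -/
def modelMul (V V' : 𝒯) :
    (model (hq := hq) 𝒟 hC).obj V ⊗ (model 𝒟 hC).obj V' ⟶ (model 𝒟 hC).obj (V ⊗ V') :=
  preMap ((preserves_mulRight hC V).comp (preserves_mulRight hC V'))
    (preserves_mulRight hC (V ⊗ V')) (mulRightTensor R V V')

instance (V V' : 𝒯) : IsIso (modelMul (hq := hq) (𝒟 := 𝒟) hC V V') :=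
  isIso_of_app _ fun L X => (L.obj.mapIso (asIso ((mulRightTensor R V V').app X))).isIso_hom

noncomputable instance : (model (hq := hq) 𝒟 hC).Monoidal :=
  Functor.CoreMonoidal.toMonoidal
    { εIso := asIso (modelUnit hC)
      μIso := fun V V' => asIso (modelMul hC V V')
      μIso_hom_natural_left := fun {V V'} f W => hom_ext fun L X => by
        change L.obj.map (right R X.den ((X.num ◁ f) ▷ W)) ≫
          L.obj.map (right R X.den (α_ X.num V' W).hom) =
          L.obj.map (right R X.den (α_ X.num V W).hom) ≫ L.obj.map (right R X.den (X.num ◁ f ▷ W))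
        exact map_right_congr₂ _ (by simp)
      μIso_hom_natural_right := fun {V V'} W f => hom_ext fun L X => by
        change L.obj.map (right R X.den ((X.num ⊗ W) ◁ f)) ≫
          L.obj.map (right R X.den (α_ X.num W V').hom) =
          L.obj.map (right R X.den (α_ X.num W V).hom) ≫ L.obj.map (right R X.den (X.num ◁ W ◁ f))
        exact map_right_congr₂ _ (by simp)
      associativity := fun V V' V'' => hom_ext fun L X => by
        have h : L.obj.map (right R X.den ((α_ X.num V V').hom ▷ V'')) ≫
            L.obj.map (right R X.den (α_ X.num (V ⊗ V') V'').hom) ≫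
            L.obj.map (right R X.den (X.num ◁ (α_ V V' V'').hom)) =
            𝟙 _ ≫ L.obj.map (right R X.den (α_ (X.num ⊗ V) V' V'').hom) ≫
            L.obj.map (right R X.den (α_ X.num V (V' ⊗ V'')).hom) := by
          rw [← L.obj.map_comp, right_right, Category.id_comp]
          exact map_right_congr₂ _ (by simp)
        exact h
      left_unitality := fun V => hom_ext fun L X => by
        have h : 𝟙 (L.obj.obj ⟨X.den, X.num ⊗ V⟩) =
            L.obj.map (right R X.den ((ρ_ X.num).inv ▷ V)) ≫
            L.obj.map (right R X.den (α_ X.num (𝟙_ 𝒯) V).hom) ≫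
            L.obj.map (right R X.den (X.num ◁ (λ_ V).hom)) := by
          rw [← L.obj.map_comp, ← L.obj.map_comp, right_right, right_right, ← L.obj.map_id,
            ← right_id]
          congr 2
          monoidal
        exact h
      right_unitality := fun V => hom_ext fun L X => by
        have h : 𝟙 (L.obj.obj ⟨X.den, X.num ⊗ V⟩) =
            L.obj.map (right R X.den (ρ_ (X.num ⊗ V)).inv) ≫
            L.obj.map (right R X.den (α_ X.num V (𝟙_ 𝒯)).hom) ≫
            L.obj.map (right R X.den (X.num ◁ (ρ_ V).hom)) := by
          rw [← L.obj.map_comp, ← L.obj.map_comp, right_right, right_right, ← L.obj.map_id,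
            ← right_id]
          congr 2
          monoidal
        exact h }

/-- The inverse of the action of `C i`. -/
lemma isInvertibleObj_model (i : I) : IsInvertibleObj ((model (hq := hq) 𝒟 hC).obj (C i).obj) := by
  let κ₁ : 𝟙_ (LinEnd R (LocalFunctor R hq C 𝒟)) ⟶
      pre ((C i).act R hq) (preserves_act hC i) ⊗ (model (hq := hq) 𝒟 hC).obj (C i).obj :=
    preMap preserves_id ((preserves_act hC i).comp (preserves_mulRight hC (C i).obj))
      ((C i).expand R hq)
  have h₁ : IsIso κ₁ := isIso_of_app _ fun L X => L.property.2 i X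
  let κ₂ : 𝟙_ (LinEnd R (LocalFunctor R hq C 𝒟)) ⟶
      (model (hq := hq) 𝒟 hC).obj (C i).obj ⊗ pre ((C i).act R hq) (preserves_act hC i) :=
    preMap preserves_id ((preserves_mulRight hC (C i).obj).comp (preserves_act hC i))
      ((C i).expand R hq ≫ hC.shiftSelf hq i)
  have h₂ : IsIso κ₂ := isIso_of_app _ fun L X => by
    have h₃ := L.property.2 i X
    have h₄ := hC.isIso_shiftSelf_app hq i X
    have h₅ := L.obj.map_comp (((C i).expand R hq).app X) ((hC.shiftSelf hq i).app X)
    have h₆ : IsIso (L.obj.map (((C i).expand R hq).app X ≫ (hC.shiftSelf hq i).app X)) := by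
      rw [h₅]; infer_instance
    exact h₆
  exact IsInvertibleObj.of_iso (asIso κ₁).symm (asIso κ₂).symm

lemma isIso_map_mulRightMap_braid (L : LocalFunctor R hq C 𝒟) (i : I) (V : 𝒯) (X : Frac R 𝒯) :
    IsIso (L.obj.map ((mulRightMap R ((C i).braid hq V)).app X)) := by
  have hact (X : Frac R 𝒯) :
      IsIso (L.obj.map ((mulRightMap R ((C i).braid hq V)).app (((C i).act R hq).obj X))) := by
    obtain ⟨A, Z⟩ := X
    change IsIso (L.obj.map (right R ((C i).obj ⊗ A) ((C i).tw hq Z ◁ (C i).braid hq V)))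
    have h₁ : IsIso (L.obj.map (right R ((C i).obj ⊗ A) ((α_ _ _ _).hom ≫
      (C i).tw hq Z ◁ (C i).braid hq V ≫ (α_ _ _ _).inv ≫ Twist.mu Z V ▷ (C i).obj))) := by
      have h := (C i).mulRight_map_expand R hq V ⟨A, Z⟩
      have h₂ := (preserves_mulRight hC V L.obj L.property).2 i ⟨A, Z⟩
      have h₃ := L.property.2 i ((mulRight R V).obj ⟨A, Z⟩)
      rw [← h, L.obj.map_comp] at h₃
      exact @IsIso.of_isIso_comp_left _ _ _ _ _ _ _ h₂ h₃
    have := Twist.isIso_mu hq (C i).φ Z V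
    have h₂ := isIso_right (R := R) (A := (C i).obj ⊗ A)
      (α_ ((C i).tw hq Z) (C i).obj V).hom
    have h₃ := isIso_right (R := R) (A := (C i).obj ⊗ A)
      ((α_ ((C i).tw hq Z) ((C i).tw hq V) (C i).obj).inv ≫ Twist.mu Z V ▷ (C i).obj)
    rw [right_comp, right_comp, L.obj.map_comp, L.obj.map_comp] at h₁
    have h₄ := @IsIso.of_isIso_comp_left _ _ _ _ _ _ _ inferInstance h₁
    exact IsIso.of_isIso_comp_right _ (L.obj.map (right R ((C i).obj ⊗ A)
      ((α_ ((C i).tw hq Z) ((C i).tw hq V) (C i).obj).inv ≫ Twist.mu Z V ▷ (C i).obj)))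
  let g : X ⟶ ((C i).act R hq).obj ((mulRight R (C i).obj).obj X) :=
    ((C i).expand R hq).app X ≫ (hC.shiftSelf hq i).app X
  have hg (V : 𝒯) : IsIso (L.obj.map ((mulRight R V).map g)) := by
    have h₃ := (preserves_mulRight hC V L.obj L.property).2 i X
    have h₄ := hC.isIso_shiftSelf_app hq i X
    have h₅ := (mulRight R V ⋙ L.obj).map_comp (((C i).expand R hq).app X)
      ((hC.shiftSelf hq i).app X)
    have h₆ : IsIso ((mulRight R V ⋙ L.obj).map (((C i).expand R hq).app X ≫
        (hC.shiftSelf hq i).app X)) := by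
      rw [h₅]; infer_instance
    exact h₆
  have h₁ := congrArg L.obj.map ((mulRightMap R ((C i).braid hq V)).naturality g)
  rw [L.obj.map_comp, L.obj.map_comp] at h₁
  have h₂ := hg ((C i).obj ⊗ V)
  have h₃ := hg ((C i).tw hq V ⊗ (C i).obj)
  have h₄ := hact ((mulRight R (C i).obj).obj X)
  have h₅ : IsIso (L.obj.map ((mulRightMap R ((C i).braid hq V)).app X) ≫
      L.obj.map ((mulRight R ((C i).tw hq V ⊗ (C i).obj)).map g)) := by
    rw [← h₁]; infer_instance
  exact IsIso.of_isIso_comp_right _ (L.obj.map ((mulRight R ((C i).tw hq V ⊗ (C i).obj)).map g))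

lemma invertsBraiders_model : InvertsBraiders C (model (hq := hq) 𝒟 hC) := by
  refine ⟨isInvertibleObj_model hC, fun i l X hX => ?_⟩
  have h₁ : IsIso ((model (hq := hq) 𝒟 hC).map ((C i).braid hq X)) :=
    isIso_of_app _ fun L Y => isIso_map_mulRightMap_braid hC L i X Y
  have h₂ := (C i).whiskerLeft_braid hq hX (𝟙 X)
  rw [MonoidalCategory.whiskerLeft_id, Category.id_comp] at h₂
  have h₃ := Twist.isIso_incl (hq := hq) (φ := (C i).φ) (𝟙 X) hX
  rw [h₂, Functor.map_comp] at h₁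
  exact IsIso.of_isIso_comp_right _ ((model (hq := hq) 𝒟 hC).map ((α_ _ _ _).inv ≫
    Twist.incl hq (C i).φ l (𝟙 X) ▷ (C i).obj))

end LocalFunctor

end LocalFunctors

section Vanishing

universe u v x y w

variable {R : Type x} [CommRing R] {𝒯 : Type u} [Category.{v} 𝒯] [Preadditive 𝒯] [Linear R 𝒯]
  [MonoidalCategory 𝒯] [MonoidalPreadditive 𝒯] [MonoidalLinear R 𝒯]
  {Λ : Type y} [AddCommGroup Λ] {𝒢 : MonoidalGrading Λ 𝒯} {q : InvertibleCentralObject 𝒯}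
  (hq : 𝒢.homogeneous 0 (q.pow 1)) {I : Type w} {C : I → GradedBraider 𝒢 q} {deg : I → Λ}
  (hC : IsRealCommutingFamily R C deg)

include hq hC

lemma IsRealCommutingFamily.homogeneous_braid (i : I) {l : Λ} {Y : 𝒯}
    (hY : 𝒢.homogeneous l Y) :
    𝒢.homogeneous (l + deg i) (q.pow ((C i).φ l) ⊗ (Y ⊗ (C i).obj)) :=
  q.pow_tensor_mem hq _ (𝒢.tensor_mem hY (hC.homogeneous i))

lemma BraidsToZero.comp {l : Λ} {X Y : 𝒯} {hY : 𝒢.homogeneous l Y} {f : X ⟶ Y}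
    (h : BraidsToZero C hY f) {Y' : 𝒯} (hY' : 𝒢.homogeneous l Y') (y : Y ⟶ Y') :
    BraidsToZero C hY' (f ≫ y) := by
  induction h generalizing Y' with
  | zero hY => rw [zero_comp]; exact .zero hY'
  | @step l m X Y hY f i h hf ih =>
    refine .step hY' _ i (hC.homogeneous_braid hq i hY') ?_
    have h₁ : (C i).obj ◁ (f ≫ y) ≫ (C i).R Y' hY' =
        ((C i).obj ◁ f ≫ (C i).R Y hY) ≫ q.pow ((C i).φ l) ◁ (y ▷ (C i).obj) := by
      rw [MonoidalCategory.whiskerLeft_comp, Category.assoc, Category.assoc, (C i).R_natural hY hY']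
    rw [h₁]
    by_cases hm : m = l + deg i
    · subst hm
      exact ih _ _
    · have h₂ : 𝟙 (q.pow ((C i).φ l) ⊗ (Y ⊗ (C i).obj)) = 0 :=
        𝒢.hom_eq_zero h (hC.homogeneous_braid hq i hY) hm _
      rw [← Category.id_comp (q.pow ((C i).φ l) ◁ (y ▷ (C i).obj)), h₂, zero_comp, comp_zero]
      exact .zero _

open Frac GradedBraider

lemma braidsToZero_of_isComposite {Φ : Frac R 𝒯 ⥤ Frac R 𝒯} {τ : 𝟭 (Frac R 𝒯) ⟶ Φ}
    (h : PointedFamily.IsComposite (fun i => (C i).expand R hq) Φ τ) {l : Λ} (X : Frac R 𝒯)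
    (hX : 𝒢.homogeneous l X.num) : ∃ (m : Λ) (hm : 𝒢.homogeneous m (Φ.obj X).num),
      ∀ f : X.den ⟶ X.num, BraidsToZero C hm (((homRep R 𝒯).functor.map (τ.app X)).hom f) →
        BraidsToZero C hX f := by
  induction h generalizing l X with
  | id => exact ⟨l, hX, fun f hf => hf⟩
  | of i =>
    obtain ⟨A, Y⟩ := X
    have hX' : 𝒢.homogeneous l Y := hX
    have hY : 𝒢.homogeneous (l + deg i) ((C i).tw hq Y ⊗ (C i).obj) :=
      𝒢.tensor_mem (Twist.homogeneous_obj hq hX) (hC.homogeneous i)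
    refine ⟨l + deg i, hY, fun f hf => .step _ _ i (hC.homogeneous_braid hq i hX) ?_⟩
    have h₁ : ((homRep R 𝒯).functor.map (((C i).expand R hq).app ⟨A, Y⟩)).hom f =
        (C i).obj ◁ f ≫ (C i).braid hq Y := rfl
    rw [h₁] at hf
    have h₂ := (C i).whiskerLeft_braid hq hX' (𝟙 Y)
    rw [MonoidalCategory.whiskerLeft_id, Category.id_comp] at h₂
    have h₀ := Twist.isIso_incl (hq := hq) (φ := (C i).φ) (𝟙 Y) hX'
    let e := whiskerRightIso (asIso (Twist.incl hq (C i).φ l (𝟙 Y))) (C i).obj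
    have h₃ := hf.comp hq hC (hC.homogeneous_braid hq i hX') (e.inv ≫ (α_ _ _ _).hom)
    have h₄ : Twist.incl hq (C i).φ l (𝟙 Y) ▷ (C i).obj ≫ e.inv = 𝟙 _ := e.hom_inv_id
    rw [h₂] at h₃
    have h₅ (f : A ⟶ Y) : ((C i).obj ◁ f ≫ (C i).R Y hX' ≫ (α_ _ _ _).inv ≫
        Twist.incl hq (C i).φ l (𝟙 Y) ▷ (C i).obj) ≫ e.inv ≫ (α_ _ _ _).hom =
        (C i).obj ◁ f ≫ (C i).R Y hX' := by
      simp [reassoc_of% h₄]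
    exact Eq.mp (congrArg (BraidsToZero C _) (h₅ f)) h₃
  | @comp Φ Ψ τ σ h₁ h₂ ih₁ ih₂ =>
    obtain ⟨m, hm, h₃⟩ := ih₁ X hX
    obtain ⟨n, hn, h₄⟩ := ih₂ (Φ.obj X) hm
    refine ⟨n, hn, fun f hf => h₃ f (h₄ _ ?_)⟩
    have h₅ := (homRep R 𝒯).functor.map_comp (τ.app X) (σ.app (Φ.obj X))
    have h₆ := congrArg (fun g => g.hom f) h₅
    exact Eq.mp (congrArg (BraidsToZero C hn) h₆) hf

theorem braidsToZero_of_map_eq_zero {l : Λ} {X Y : 𝒯} (hY : 𝒢.homogeneous l Y) (f : X ⟶ Y)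
    (hf : (toBraidLoc R C).map f = 0) : BraidsToZero C hY f := by
  have hr := hC.exists_comp_shift_expand hq
  have := PointedFamily.hasLeftCalculusOfFractions hr
  let W := PointedFamily.weakEquivalences (fun i => (C i).expand R hq)
  let L : LocalFunctor R hq C W.Localization := ⟨W.Q, ⟨inferInstance, inferInstance⟩,
    fun i X => Localization.inverts W.Q W _ (PointedFamily.weakEquivalences_app hr (.of i) X)⟩
  obtain ⟨⟨F, _, _, _, θ, -⟩, -⟩ := hasUniversalProperty_toBraidLoc R C _
    (LocalFunctor.model (hq := hq) W.Localization hC) (LocalFunctor.invertsBraiders_model hC)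
  have h₁ : (LocalFunctor.model (hq := hq) W.Localization hC).map f = 0 := by
    have h := θ.hom.naturality f
    rw [Functor.comp_map, hf, F.map_zero, zero_comp] at h
    rw [← cancel_epi (θ.hom.app X), ← h, comp_zero]
  have h₂ : W.Q.map (right R X (𝟙_ 𝒯 ◁ f)) = 0 :=
    congrArg (fun g => ((LinEnd.nat g).app L).hom.app ⟨X, 𝟙_ 𝒯⟩) h₁
  have h₃ : W.Q.map (right R X f) = W.Q.map 0 := by
    have h₄ : right R X f = right R X (λ_ X).inv ≫ right R X (𝟙_ 𝒯 ◁ f) ≫ right R X (λ_ Y).hom := by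
      rw [right_right, right_right]
      simp
    rw [h₄, W.Q.map_comp, W.Q.map_comp, h₂, zero_comp, comp_zero, W.Q.map_zero]
  obtain ⟨Φ, τ, h, h₅⟩ := PointedFamily.exists_comp_eq_zero hr _ h₃
  obtain ⟨m, hm, h₆⟩ := braidsToZero_of_isComposite hq hC h ⟨X, Y⟩ hY
  refine h₆ f ?_
  let x : (homRep R 𝒯).functor.obj ⟨X, X⟩ := 𝟙 X
  have h₇ : ((homRep R 𝒯).functor.map (right R X f ≫ τ.app ⟨X, Y⟩)).hom x =
      ((homRep R 𝒯).functor.map (τ.app ⟨X, Y⟩)).hom f := by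
    rw [Functor.map_comp]
    exact congrArg ((homRep R 𝒯).functor.map (τ.app ⟨X, Y⟩)).hom (Category.id_comp f)
  have h₈ : ((homRep R 𝒯).functor.map (τ.app ⟨X, Y⟩)).hom f = 0 := by
    refine h₇.symm.trans ((congrArg (fun g => ((homRep R 𝒯).functor.map g).hom x) h₅).trans ?_)
    simp only [Functor.map_zero]
    rfl
  rw [h₈]
  exact .zero _

end Vanishing

/-! ### Denominators -/

section Denominators

universe x

variable {Λ : Type*} [AddCommGroup Λ] {𝒯 : Type*} [Category 𝒯] [Preadditive 𝒯]
  [MonoidalCategory 𝒯] [MonoidalPreadditive 𝒯]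
  {𝒢 : MonoidalGrading Λ 𝒯} {q : InvertibleCentralObject 𝒯}
  (hq : 𝒢.homogeneous 0 (q.pow 1)) {I : Type*} {C : I → GradedBraider 𝒢 q}

section

variable {𝒟 : Type*} [Category 𝒟] [Preadditive 𝒟] [MonoidalCategory 𝒟]
  (Υ : 𝒯 ⥤ 𝒟) [Υ.Monoidal] [Υ.Additive] (hΥ : InvertsBraiders C Υ)

open Functor.LaxMonoidal Functor.OplaxMonoidal

include hΥ

lemma InvertsBraiders.isIso_map_braid (i : I) (X : 𝒯) : IsIso (Υ.map ((C i).braid hq X)) := by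
  have h (m) (hm : m ∈ (𝒢.dec X).s) : IsIso (Υ.map ((C i).braid hq ((𝒢.dec X).Y m))) := by
    have hY := (𝒢.dec X).mem m hm
    have h₂ := (C i).whiskerLeft_braid hq hY (𝟙 _)
    rw [MonoidalCategory.whiskerLeft_id, Category.id_comp] at h₂
    have h₃ := Twist.isIso_incl (hq := hq) (φ := (C i).φ) (𝟙 ((𝒢.dec X).Y m)) hY
    have h₄ := hΥ.2 i m _ hY
    rw [h₂, Functor.map_comp]
    infer_instance
  have h₁ (m) (hm : m ∈ (𝒢.dec X).s) := (h m hm).out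
  choose! σ h₂ h₃ using h₁
  refine ⟨∑ m ∈ (𝒢.dec X).s, Υ.map (Twist.map ((𝒢.dec X).π m) ▷ (C i).obj) ≫ σ m ≫
    Υ.map ((C i).obj ◁ (𝒢.dec X).ι m), ?_, ?_⟩
  · rw [Preadditive.comp_sum, Finset.sum_congr rfl (g := fun m =>
      Υ.map ((C i).obj ◁ ((𝒢.dec X).π m ≫ (𝒢.dec X).ι m))) (fun m hm => by
      rw [← Υ.map_comp_assoc, ← (C i).braid_natural hq, Υ.map_comp, Category.assoc,
        reassoc_of% (h₂ m hm), ← Υ.map_comp, MonoidalCategory.whiskerLeft_comp]),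
      ← Υ.map_sum, ← whiskerLeft_sum, (𝒢.dec X).sum, MonoidalCategory.whiskerLeft_id, Υ.map_id]
  · rw [Preadditive.sum_comp, Finset.sum_congr rfl (g := fun m =>
      Υ.map (Twist.map ((𝒢.dec X).π m ≫ (𝒢.dec X).ι m) ▷ (C i).obj)) (fun m hm => by
      rw [Category.assoc, Category.assoc, ← Υ.map_comp, (C i).braid_natural hq, Υ.map_comp,
        reassoc_of% (h₃ m hm), ← Υ.map_comp, ← comp_whiskerRight, Twist.map_comp]),
      ← Υ.map_sum, ← sum_whiskerRight]
    have h₄ : ∑ m ∈ (𝒢.dec X).s, (Twist.map ((𝒢.dec X).π m ≫ (𝒢.dec X).ι m) :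
        (C i).tw hq X ⟶ (C i).tw hq X) = 𝟙 _ := by
      rw [← Twist.map_id, ← (𝒢.dec X).sum]
      exact (map_sum (AddMonoidHom.mk' (fun z : X ⟶ X =>
        (Twist.map z : (C i).tw hq X ⟶ (C i).tw hq X)) (fun z z' => Twist.map_add z z')) _ _).symm
    rw [h₄, id_whiskerRight, Υ.map_id]

omit [Preadditive 𝒟] [Υ.Additive] hΥ [MonoidalPreadditive 𝒯] in
lemma nonempty_wordObj_append (v w : List I) :
    Nonempty (wordObj C (v ++ w) ≅ wordObj C v ⊗ wordObj C w) := by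
  induction v with
  | nil => exact ⟨(λ_ _).symm⟩
  | cons i v ih =>
    obtain ⟨e⟩ := ih
    exact ⟨whiskerLeftIso (C i).obj e ≪≫ (α_ _ _ _).symm⟩

end

end Denominators

section WordTwist

variable {Λ : Type*} [AddCommGroup Λ] {𝒯 : Type*} [Category 𝒯] [Preadditive 𝒯]
  [MonoidalCategory 𝒯] [MonoidalPreadditive 𝒯]
  {𝒢 : MonoidalGrading Λ 𝒯} {q : InvertibleCentralObject 𝒯}
  (hq : 𝒢.homogeneous 0 (q.pow 1)) {I : Type*} (C : I → GradedBraider 𝒢 q)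

/-- Twisting, as a functor. -/
@[simps]
noncomputable def Twist.functor (φ : Λ →+ ℤ) : 𝒯 ⥤ 𝒯 where
  obj := Twist.obj hq φ
  map := Twist.map
  map_id := Twist.map_id
  map_comp := Twist.map_comp

/-- The iterated twist along a word. -/
noncomputable def wordTwist : List I → 𝒯 ⥤ 𝒯
  | [] => 𝟭 𝒯
  | i :: w => wordTwist w ⋙ Twist.functor hq (C i).φ

/-- Moving a word to the right. -/
noncomputable def wordBraid : ∀ (w : List I) (X : 𝒯),
    wordObj C w ⊗ X ⟶ (wordTwist hq C w).obj X ⊗ wordObj C w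
  | [], X => (λ_ X).hom ≫ (ρ_ X).inv
  | i :: w, X => (α_ (C i).obj (wordObj C w) X).hom ≫ (C i).obj ◁ wordBraid w X ≫ (α_ _ _ _).inv ≫
      (C i).braid hq ((wordTwist hq C w).obj X) ▷ wordObj C w ≫ (α_ _ _ _).hom

variable {C}

lemma wordBraid_natural (w : List I) {X Y : 𝒯} (f : X ⟶ Y) :
    wordObj C w ◁ f ≫ wordBraid hq C w Y =
      wordBraid hq C w X ≫ (wordTwist hq C w).map f ▷ wordObj C w := by
  induction w with
  | nil =>
    change 𝟙_ 𝒯 ◁ f ≫ (λ_ Y).hom ≫ (ρ_ Y).inv = ((λ_ X).hom ≫ (ρ_ X).inv) ≫ f ▷ 𝟙_ 𝒯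
    simp
  | cons i w ih =>
    change ((C i).obj ⊗ wordObj C w) ◁ f ≫ ((α_ _ _ _).hom ≫ (C i).obj ◁ wordBraid hq C w Y ≫
        (α_ _ _ _).inv ≫ (C i).braid hq ((wordTwist hq C w).obj Y) ▷ wordObj C w ≫ (α_ _ _ _).hom) =
      ((α_ _ _ _).hom ≫ (C i).obj ◁ wordBraid hq C w X ≫
        (α_ _ _ _).inv ≫ (C i).braid hq ((wordTwist hq C w).obj X) ▷ wordObj C w ≫
        (α_ _ _ _).hom) ≫ Twist.map ((wordTwist hq C w).map f) ▷ ((C i).obj ⊗ wordObj C w)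
    have h := (C i).braid_natural hq ((wordTwist hq C w).map f)
    have h' := congrArg (fun g => g ▷ wordObj C w) h
    simp only [comp_whiskerRight] at h'
    simp only [Category.assoc]
    rw [associator_naturality_right_assoc, ← MonoidalCategory.whiskerLeft_comp_assoc, ih,
      MonoidalCategory.whiskerLeft_comp, Category.assoc, associator_inv_naturality_middle_assoc,
      reassoc_of% h', associator_naturality_left]

lemma wordTwist_mem (w : List I) {l : Λ} {X : 𝒯} (hX : 𝒢.homogeneous l X) :
    𝒢.homogeneous l ((wordTwist hq C w).obj X) := by
  induction w with
  | nil => exact hX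
  | cons i w ih => exact Twist.homogeneous_obj hq ih

lemma wordObj_mem {deg : I → Λ} (hdeg : ∀ i, 𝒢.homogeneous (deg i) (C i).obj) (w : List I) :
    𝒢.homogeneous (w.map deg).sum (wordObj C w) := by
  induction w with
  | nil => exact 𝒢.unit_mem
  | cons i w ih => exact 𝒢.tensor_mem (hdeg i) ih

variable {𝒟 : Type*} [Category 𝒟] [Preadditive 𝒟] [MonoidalCategory 𝒟] [MonoidalPreadditive 𝒟]
  (Υ : 𝒯 ⥤ 𝒟) [Υ.Monoidal] [Υ.Additive] (hΥ : InvertsBraiders C Υ)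

include hΥ in
lemma InvertsBraiders.isIso_map_wordBraid (w : List I) (X : 𝒯) :
    IsIso (Υ.map (wordBraid hq C w X)) := by
  induction w with
  | nil => exact inferInstanceAs (IsIso (Υ.map ((λ_ X).hom ≫ (ρ_ X).inv)))
  | cons i w ih =>
    have h₁ := hΥ.isIso_map_braid hq Υ i ((wordTwist hq C w).obj X)
    have h₂ : IsIso (Υ.map ((C i).obj ◁ wordBraid hq C w X)) := by
      rw [Functor.Monoidal.map_whiskerLeft]; infer_instance
    have h₃ : IsIso (Υ.map ((C i).braid hq ((wordTwist hq C w).obj X) ▷ wordObj C w)) := by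
      rw [Functor.Monoidal.map_whiskerRight]; infer_instance
    change IsIso (Υ.map ((α_ _ _ _).hom ≫ (C i).obj ◁ wordBraid hq C w X ≫ (α_ _ _ _).inv ≫
      (C i).braid hq ((wordTwist hq C w).obj X) ▷ wordObj C w ≫ (α_ _ _ _).hom))
    simp only [Functor.map_comp]
    infer_instance

/-- The functor `Υ(C_w) ⊗ -` intertwines `Υ(X) ⊗ -` and its twist. -/
noncomputable def InvertsBraiders.wordIso (hΥ : InvertsBraiders C Υ) (w : List I) (X : 𝒯) :
    Υ.obj (wordObj C w) ⊗ Υ.obj X ≅ Υ.obj ((wordTwist hq C w).obj X) ⊗ Υ.obj (wordObj C w) :=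
  Functor.Monoidal.μIso Υ _ _ ≪≫
    @asIso _ _ _ _ (Υ.map (wordBraid hq C w X)) (hΥ.isIso_map_wordBraid hq Υ w X) ≪≫
    (Functor.Monoidal.μIso Υ _ _).symm

lemma InvertsBraiders.wordIso_natural (w : List I) {X Y : 𝒯} (f : X ⟶ Y) :
    Υ.obj (wordObj C w) ◁ Υ.map f ≫ (hΥ.wordIso hq Υ w Y).hom =
      (hΥ.wordIso hq Υ w X).hom ≫ Υ.map ((wordTwist hq C w).map f) ▷ Υ.obj (wordObj C w) := by
  simp only [wordIso, Iso.trans_hom, Functor.Monoidal.μIso_hom, asIso_hom, Iso.symm_hom,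
    Functor.Monoidal.μIso_inv, Category.assoc]
  rw [Functor.LaxMonoidal.μ_natural_right_assoc, Functor.OplaxMonoidal.δ_natural_left,
    ← Υ.map_comp_assoc, ← Υ.map_comp_assoc, wordBraid_natural]

lemma isInvertibleObj_unit (𝒟 : Type*) [Category 𝒟] [MonoidalCategory 𝒟] :
    IsInvertibleObj (𝟙_ 𝒟) := .of_iso (λ_ _) (λ_ _)

omit [Preadditive 𝒟] [MonoidalPreadditive 𝒟] in
lemma IsInvertibleObj.congr {X Y : 𝒟} (h : IsInvertibleObj X) (e : X ≅ Y) : IsInvertibleObj Y := by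
  obtain ⟨D, ev, coev, -⟩ := h.exists_inverse
  exact .of_iso (whiskerLeftIso D e.symm ≪≫ ev) (whiskerRightIso e.symm D ≪≫ coev.symm)

omit [Preadditive 𝒟] [MonoidalPreadditive 𝒟] in
lemma IsInvertibleObj.tensor {X Y : 𝒟} (h : IsInvertibleObj X) (h' : IsInvertibleObj Y) :
    IsInvertibleObj (X ⊗ Y) := by
  obtain ⟨_, _⟩ := h
  obtain ⟨_, _⟩ := h'
  exact ⟨Functor.isEquivalence_of_iso (tensorLeftTensor X Y).symm,
    Functor.isEquivalence_of_iso (tensorRightTensor X Y).symm⟩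

include hΥ in
lemma InvertsBraiders.isInvertibleObj_word (w : List I) :
    IsInvertibleObj (Υ.obj (wordObj C w)) := by
  induction w with
  | nil => exact (isInvertibleObj_unit 𝒟).congr (Functor.Monoidal.εIso Υ)
  | cons i w ih => exact ((hΥ.1 i).tensor ih).congr (Functor.Monoidal.μIso Υ _ _)

/-- Denominators of a tensor product. -/
noncomputable def InvertsBraiders.tensorDenominator (hΥ : InvertsBraiders C Υ) {w w' : List I}
    {Z Z' : 𝒟} {X X' : 𝒯} (e : Υ.obj (wordObj C w) ⊗ Z ≅ Υ.obj X)
    (e' : Υ.obj (wordObj C w') ⊗ Z' ≅ Υ.obj X') :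
    Υ.obj (wordObj C (w' ++ w)) ⊗ (Z ⊗ Z') ≅ Υ.obj ((wordTwist hq C w').obj X ⊗ X') :=
  whiskerRightIso (Υ.mapIso (nonempty_wordObj_append w' w).some ≪≫
      (Functor.Monoidal.μIso Υ _ _).symm) _ ≪≫ α_ _ _ _ ≪≫
    whiskerLeftIso _ ((α_ _ _ _).symm ≪≫ whiskerRightIso e _) ≪≫ (α_ _ _ _).symm ≪≫
    whiskerRightIso (hΥ.wordIso hq Υ w' X) _ ≪≫
    α_ _ _ _ ≪≫ whiskerLeftIso _ e' ≪≫ Functor.Monoidal.μIso Υ _ _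

/-- Enlarging a denominator on the left. -/
noncomputable def appendDenominator (v : List I) {w : List I} {Z : 𝒟} {X : 𝒯}
    (e : Υ.obj (wordObj C w) ⊗ Z ≅ Υ.obj X) :
    Υ.obj (wordObj C (v ++ w)) ⊗ Z ≅ Υ.obj (wordObj C v ⊗ X) :=
  whiskerRightIso (Υ.mapIso (nonempty_wordObj_append v w).some ≪≫
      (Functor.Monoidal.μIso Υ _ _).symm) _ ≪≫ α_ _ _ _ ≪≫ whiskerLeftIso _ e ≪≫
    Functor.Monoidal.μIso Υ _ _

/-- Enlarging a denominator on the right. -/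
noncomputable def InvertsBraiders.prependDenominator (hΥ : InvertsBraiders C Υ) {v : List I}
    (w : List I) {Z : 𝒟} {X : 𝒯} (e : Υ.obj (wordObj C v) ⊗ Z ≅ Υ.obj X) :
    Υ.obj (wordObj C (v ++ w)) ⊗ Z ≅ Υ.obj ((wordTwist hq C v).obj (wordObj C w) ⊗ X) :=
  whiskerLeftIso _ (λ_ Z).symm ≪≫ hΥ.tensorDenominator hq Υ (ρ_ (Υ.obj (wordObj C w))) e

end WordTwist

section HasDenominator

universe x

variable {Λ : Type*} [AddCommGroup Λ] {𝒯 : Type*} [Category 𝒯] [Preadditive 𝒯]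
  [MonoidalCategory 𝒯] [MonoidalPreadditive 𝒯]
  {𝒢 : MonoidalGrading Λ 𝒯} {q : InvertibleCentralObject 𝒯}
  (hq : 𝒢.homogeneous 0 (q.pow 1)) {I : Type*} {C : I → GradedBraider 𝒢 q}

/-- `Z` is a fraction with numerator in `𝒯`. -/
def HasDenominator (C : I → GradedBraider 𝒢 q) {𝒟 : Type*} [Category 𝒟]
    [MonoidalCategory 𝒟] (Υ : 𝒯 ⥤ 𝒟) (Z : 𝒟) : Prop :=
  ∃ (w : List I) (X : 𝒯), Nonempty (Υ.obj (wordObj C w) ⊗ Z ≅ Υ.obj X)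

variable (R : Type x) [CommRing R] [Linear R 𝒯] [MonoidalLinear R 𝒯]

include hq in
lemma hasDenominator_braidLoc (Z : BraidLoc R C) : HasDenominator C (toBraidLoc R C) Z := by
  induction Z with
  | of X => exact ⟨[], 𝟙_ 𝒯 ⊗ X, ⟨Functor.Monoidal.μIso (toBraidLoc R C) _ _⟩⟩
  | inv i =>
    exact ⟨[i], 𝟙_ 𝒯, ⟨whiskerRightIso ((toBraidLoc R C).mapIso (ρ_ _)) _ ≪≫
      (FreeLoc.coev R _ (braidings C) i).symm ≪≫ Functor.Monoidal.εIso (toBraidLoc R C)⟩⟩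
  | unit =>
    exact ⟨[], 𝟙_ 𝒯, ⟨(ρ_ _ : (toBraidLoc R C).obj (𝟙_ 𝒯) ⊗ 𝟙_ (BraidLoc R C) ≅ _)⟩⟩
  | tensor Z Z' h h' =>
    obtain ⟨w, X, ⟨e⟩⟩ := h
    obtain ⟨w', X', ⟨e'⟩⟩ := h'
    exact ⟨_, _, ⟨(invertsBraiders_toBraidLoc R C).tensorDenominator hq (toBraidLoc R C) e e'⟩⟩

end HasDenominator

/-! ### Morphisms in the localization as a functor on formal fractions -/

section Realization

universe u v x y w u' v'

variable {R : Type x} [CommRing R] {𝒯 : Type u} [Category.{v} 𝒯] [Preadditive 𝒯] [Linear R 𝒯]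
  [MonoidalCategory 𝒯] [MonoidalPreadditive 𝒯] [MonoidalLinear R 𝒯]

variable {𝒟 : Type u'} [Category.{v'} 𝒟] [Preadditive 𝒟] [Linear R 𝒟] [MonoidalCategory 𝒟]
  [MonoidalPreadditive 𝒟] [MonoidalLinear R 𝒟]
  (Υ : 𝒯 ⥤ 𝒟) [Υ.Monoidal] [Υ.Additive] [Υ.Linear R]

open Functor.LaxMonoidal Functor.OplaxMonoidal

namespace Frac

variable (R) in
/-- The data of the functor `(A, Z) ↦ Hom(Υ(A), Υ(Z))`. -/
def homOfRep : Rep R 𝒯 (ModuleCat.{v'} R) where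
  obj X := ModuleCat.of R (Υ.obj X.den ⟶ Υ.obj X.num)
  left a Z := ModuleCat.ofHom (Linear.leftComp R (Υ.obj Z) (Υ.map a))
  right A _ _ z := ModuleCat.ofHom (Linear.rightComp R (Υ.obj A) (Υ.map z))
  e B A Z := ModuleCat.ofHom
    { toFun := fun f : Υ.obj A ⟶ Υ.obj Z => δ Υ B A ≫ Υ.obj B ◁ f ≫ μ Υ B Z
      map_add' := fun f g => by simp
      map_smul' := fun r f => by simp }
  left_id A Z := by
    ext (f : Υ.obj A ⟶ Υ.obj Z); change Υ.map (𝟙 A) ≫ f = f; simp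
  left_comp b a Z := by
    ext (f : Υ.obj _ ⟶ Υ.obj Z); change Υ.map (b ≫ a) ≫ f = Υ.map b ≫ Υ.map a ≫ f; simp
  left_add a b Z := by
    ext (f : Υ.obj _ ⟶ Υ.obj Z); change Υ.map (a + b) ≫ f = Υ.map a ≫ f + Υ.map b ≫ f; simp
  left_smul r a Z := by
    ext (f : Υ.obj _ ⟶ Υ.obj Z); change Υ.map (r • a) ≫ f = r • (Υ.map a ≫ f); simp
  right_id A Z := by
    ext (f : Υ.obj A ⟶ Υ.obj Z); change f ≫ Υ.map (𝟙 Z) = f; simp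
  right_comp A _ _ _ z z' := by
    ext (f : Υ.obj A ⟶ Υ.obj _); change f ≫ Υ.map (z ≫ z') = (f ≫ Υ.map z) ≫ Υ.map z'; simp
  right_add A _ _ z z' := by
    ext (f : Υ.obj A ⟶ Υ.obj _); change f ≫ Υ.map (z + z') = f ≫ Υ.map z + f ≫ Υ.map z'; simp
  right_smul A _ _ r z := by
    ext (f : Υ.obj A ⟶ Υ.obj _); change f ≫ Υ.map (r • z) = r • (f ≫ Υ.map z); simp
  left_right {A A' Z Z'} a z := by
    ext (f : Υ.obj A ⟶ Υ.obj Z); exact Category.assoc (Υ.map a) f (Υ.map z)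
  left_e B {A A'} a Z := by
    ext (f : Υ.obj A ⟶ Υ.obj Z)
    change δ Υ B A' ≫ Υ.obj B ◁ (Υ.map a ≫ f) ≫ μ Υ B Z =
      Υ.map (B ◁ a) ≫ δ Υ B A ≫ Υ.obj B ◁ f ≫ μ Υ B Z
    simp
  right_e B A {Z Z'} z := by
    ext (f : Υ.obj A ⟶ Υ.obj Z)
    change δ Υ B A ≫ Υ.obj B ◁ (f ≫ Υ.map z) ≫ μ Υ B Z' =
      (δ Υ B A ≫ Υ.obj B ◁ f ≫ μ Υ B Z) ≫ Υ.map (B ◁ z)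
    simp
  dinat {B B'} b A Z := by
    ext (f : Υ.obj A ⟶ Υ.obj Z)
    change (δ Υ B A ≫ Υ.obj B ◁ f ≫ μ Υ B Z) ≫ Υ.map (b ▷ Z) =
      Υ.map (b ▷ A) ≫ δ Υ B' A ≫ Υ.obj B' ◁ f ≫ μ Υ B' Z
    rw [Category.assoc, Category.assoc, ← Functor.LaxMonoidal.μ_natural_left, whisker_exchange_assoc,
      Functor.OplaxMonoidal.δ_natural_left_assoc]
  e_tensor B B' A Z := by
    ext (f : Υ.obj A ⟶ Υ.obj Z)
    change δ Υ B' (B ⊗ A) ≫ Υ.obj B' ◁ (δ Υ B A ≫ Υ.obj B ◁ f ≫ μ Υ B Z) ≫ μ Υ B' (B ⊗ Z) =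
      (Υ.map (α_ B' B A).inv ≫ δ Υ (B' ⊗ B) A ≫ Υ.obj (B' ⊗ B) ◁ f ≫ μ Υ (B' ⊗ B) Z) ≫
        Υ.map (α_ B' B Z).hom
    have h₁ := Functor.LaxMonoidal.associativity Υ B' B Z
    have h₂ := Functor.OplaxMonoidal.associativity_inv Υ B' B A
    have h₃ := whisker_exchange (δ Υ B' B) f
    have h₄ : Υ.obj (B' ⊗ B) ◁ f = δ Υ B' B ▷ _ ≫ (Υ.obj B' ⊗ Υ.obj B) ◁ f ≫ μ Υ B' B ▷ _ := by
      rw [← reassoc_of% h₃, ← comp_whiskerRight]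
      simp
    rw [h₄]
    simp only [Category.assoc, h₁]
    rw [← reassoc_of% h₂]
    simp
  e_unit A Z := by
    ext (f : Υ.obj A ⟶ Υ.obj Z)
    change (Υ.map (λ_ A).inv ≫ δ Υ (𝟙_ 𝒯) A ≫ Υ.obj (𝟙_ 𝒯) ◁ f ≫ μ Υ (𝟙_ 𝒯) Z) ≫ Υ.map (λ_ Z).hom = f
    have h₁ := whisker_exchange (η Υ) f
    have h₂ := Functor.LaxMonoidal.left_unitality Υ Z
    have h₃ := Functor.OplaxMonoidal.left_unitality Υ A
    have h₄ : Υ.obj (𝟙_ 𝒯) ◁ f = η Υ ▷ _ ≫ 𝟙_ 𝒟 ◁ f ≫ ε Υ ▷ _ := by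
      rw [← reassoc_of% h₁, ← comp_whiskerRight]
      simp
    rw [h₄]
    simp only [Category.assoc]
    rw [← h₂]
    have h₅ : Υ.map (λ_ A).inv ≫ δ Υ (𝟙_ 𝒯) A ≫ η Υ ▷ Υ.obj A = (λ_ _).inv := by
      rw [h₃]
    rw [reassoc_of% h₅]
    simp

variable (R) in
/-- The functor `(A, Z) ↦ Hom(Υ(A), Υ(Z))`. -/
def homOf : Frac R 𝒯 ⥤ ModuleCat.{v'} R := (homOfRep R Υ).functor

instance : (homOf R Υ).Additive := inferInstanceAs (homOfRep R Υ).functor.Additive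

instance : (homOf R Υ).Linear R := inferInstanceAs ((homOfRep R Υ).functor.Linear R)

lemma homOf_map_left {A A' : 𝒯} (a : A' ⟶ A) (Z : 𝒯) (f : Υ.obj A ⟶ Υ.obj Z) :
    ((homOf R Υ).map (left R a Z)).hom f = Υ.map a ≫ f := rfl

lemma homOf_map_right (A : 𝒯) {Z Z' : 𝒯} (z : Z ⟶ Z') (f : Υ.obj A ⟶ Υ.obj Z) :
    ((homOf R Υ).map (right R A z)).hom f = f ≫ Υ.map z := rfl

/-- The functor `Υ` on morphisms, as a natural transformation. -/
lemma homOf_map_map {X Y : Frac R 𝒯} (φ : X ⟶ Y) : ∀ f : X.den ⟶ X.num,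
    ((homOf R Υ).map φ).hom (Υ.map f) = Υ.map (((homRep R 𝒯).functor.map φ).hom f) := by
  let τ (X : Frac R 𝒯) (f : X.den ⟶ X.num) : (homOf R Υ).obj X := Υ.map f
  change ∀ f, ((homOf R Υ).map φ).hom (τ X f) = τ Y (((homRep R 𝒯).functor.map φ).hom f)
  induction φ using hom_induction with
  | id X => intro f; simp only [CategoryTheory.Functor.map_id]; rfl
  | comp φ ψ h h' =>
    intro f
    rw [Functor.map_comp, Functor.map_comp]
    exact (congrArg ((homOf R Υ).map ψ).hom (h f)).trans (h' _)
  | hleft a Z => intro f; exact (Υ.map_comp _ _).symm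
  | hright A z => intro f; exact (Υ.map_comp _ _).symm
  | he B A Z =>
    intro f
    change δ Υ B A ≫ Υ.obj B ◁ Υ.map f ≫ μ Υ B Z = Υ.map (B ◁ f)
    simp
  | zero X Y => intro f; simp only [Functor.map_zero]; exact Υ.map_zero _ _ |>.symm
  | add φ ψ h h' =>
    intro f
    rw [Functor.map_add, Functor.map_add]
    exact (congrArg₂ (· + ·) (h f) (h' f)).trans (Υ.map_add).symm
  | smul r φ h =>
    intro f
    rw [Functor.map_smul, Functor.map_smul]
    exact (congrArg (r • ·) (h f)).trans (Υ.map_smul _ _).symm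

end Frac

variable {Λ : Type y} [AddCommGroup Λ] {𝒢 : MonoidalGrading Λ 𝒯} {q : InvertibleCentralObject 𝒯}
  (hq : 𝒢.homogeneous 0 (q.pow 1)) {I : Type w} {C : I → GradedBraider 𝒢 q} {deg : I → Λ}
  (hC : IsRealCommutingFamily R C deg) (hΥ : InvertsBraiders C Υ)

open Frac GradedBraider

lemma homOf_map_expand (i : I) (A Z : 𝒯) (f : Υ.obj A ⟶ Υ.obj Z) :
    ((homOf R Υ).map (((C i).expand R hq).app ⟨A, Z⟩)).hom f =
      (δ Υ (C i).obj A ≫ Υ.obj (C i).obj ◁ f ≫ μ Υ (C i).obj Z) ≫ Υ.map ((C i).braid hq Z) := rfl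

include hΥ in
lemma isIso_homOf_map_expand (i : I) (X : Frac R 𝒯) :
    IsIso ((homOf R Υ).map (((C i).expand R hq).app X)) := by
  obtain ⟨A, Z⟩ := X
  have := hΥ.isIso_map_braid hq Υ i Z
  rw [ConcreteCategory.isIso_iff_bijective]
  have hinv := (hΥ.1 i).1
  constructor
  · intro (f : Υ.obj A ⟶ Υ.obj Z) (g : Υ.obj A ⟶ Υ.obj Z) h
    have h' : (δ Υ (C i).obj A ≫ Υ.obj (C i).obj ◁ f ≫ μ Υ (C i).obj Z) ≫ Υ.map ((C i).braid hq Z) =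
      (δ Υ (C i).obj A ≫ Υ.obj (C i).obj ◁ g ≫ μ Υ (C i).obj Z) ≫ Υ.map ((C i).braid hq Z) := h
    rw [cancel_mono, cancel_epi, cancel_mono] at h'
    exact (tensorLeft (Υ.obj (C i).obj)).map_injective h'
  · intro (g : Υ.obj ((C i).obj ⊗ A) ⟶ Υ.obj ((C i).tw hq Z ⊗ (C i).obj))
    obtain ⟨f, hf⟩ := (tensorLeft (Υ.obj (C i).obj)).map_surjective
      (X := Υ.obj A) (Y := Υ.obj Z) (μ Υ (C i).obj A ≫ g ≫ inv (Υ.map ((C i).braid hq Z)) ≫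
        δ Υ (C i).obj Z)
    refine ⟨f, ?_⟩
    have hf' : Υ.obj (C i).obj ◁ f = μ Υ (C i).obj A ≫ g ≫ inv (Υ.map ((C i).braid hq Z)) ≫
        δ Υ (C i).obj Z := hf
    change (δ Υ (C i).obj A ≫ Υ.obj (C i).obj ◁ f ≫ μ Υ (C i).obj Z) ≫ Υ.map ((C i).braid hq Z) = g
    rw [hf']
    simp

include hq hC

lemma IsBraidedFraction.comp {l : Λ} {X Y : 𝒯} {hY : 𝒢.homogeneous l Y} {g : Υ.obj X ⟶ Υ.obj Y}
    (h : IsBraidedFraction C Υ hY g) {Y' : 𝒯} (hY' : 𝒢.homogeneous l Y') (y : Y ⟶ Y') :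
    IsBraidedFraction C Υ hY' (g ≫ Υ.map y) := by
  induction h generalizing Y' with
  | of_map hY f => rw [← Υ.map_comp]; exact .of_map hY' _
  | @step l m X Y hY g i h hg ih =>
    refine .step hY' _ i (hC.homogeneous_braid hq i hY') ?_
    have h₁ : δ Υ (C i).obj X ≫ Υ.obj (C i).obj ◁ (g ≫ Υ.map y) ≫ μ Υ (C i).obj Y' ≫
          Υ.map ((C i).R Y' hY') =
        (δ Υ (C i).obj X ≫ Υ.obj (C i).obj ◁ g ≫ μ Υ (C i).obj Y ≫ Υ.map ((C i).R Y hY)) ≫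
          Υ.map (q.pow ((C i).φ l) ◁ (y ▷ (C i).obj)) := by
      simp only [Category.assoc, ← Υ.map_comp, ← (C i).R_natural hY hY']
      simp
    rw [h₁]
    by_cases hm : m = l + deg i
    · subst hm
      exact ih _ _
    · have h₂ : 𝟙 (q.pow ((C i).φ l) ⊗ (Y ⊗ (C i).obj)) = 0 :=
        𝒢.hom_eq_zero h (hC.homogeneous_braid hq i hY) hm _
      rw [← Category.id_comp (q.pow ((C i).φ l) ◁ (y ▷ (C i).obj)), h₂, zero_comp, Υ.map_zero,
        comp_zero, ← Υ.map_zero]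
      exact .of_map _ _

lemma isBraidedFraction_of_isComposite {Φ : Frac R 𝒯 ⥤ Frac R 𝒯} {τ : 𝟭 (Frac R 𝒯) ⟶ Φ}
    (h : PointedFamily.IsComposite (fun i => (C i).expand R hq) Φ τ) {l : Λ} (X : Frac R 𝒯)
    (hX : 𝒢.homogeneous l X.num) : ∃ (m : Λ) (hm : 𝒢.homogeneous m (Φ.obj X).num),
      ∀ f : Υ.obj X.den ⟶ Υ.obj X.num,
        IsBraidedFraction C Υ hm (((homOf R Υ).map (τ.app X)).hom f) →
        IsBraidedFraction C Υ hX f := by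
  induction h generalizing l X with
  | id => exact ⟨l, hX, fun f hf => by
      have h₁ : ((homOf R Υ).map ((𝟙 (𝟭 (Frac R 𝒯)) : 𝟭 (Frac R 𝒯) ⟶ _).app X)).hom f = f := by
        rw [NatTrans.id_app, CategoryTheory.Functor.map_id]; rfl
      exact Eq.mp (congrArg (IsBraidedFraction C Υ hX) h₁) hf⟩
  | of i =>
    obtain ⟨A, Y⟩ := X
    have hX' : 𝒢.homogeneous l Y := hX
    have hY : 𝒢.homogeneous (l + deg i) ((C i).tw hq Y ⊗ (C i).obj) :=
      𝒢.tensor_mem (Twist.homogeneous_obj hq hX) (hC.homogeneous i)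
    refine ⟨l + deg i, hY, fun f hf => .step _ _ i (hC.homogeneous_braid hq i hX) ?_⟩
    rw [homOf_map_expand] at hf
    have h₂ := (C i).whiskerLeft_braid hq hX' (𝟙 Y)
    rw [MonoidalCategory.whiskerLeft_id, Category.id_comp] at h₂
    have h₀ := Twist.isIso_incl (hq := hq) (φ := (C i).φ) (𝟙 Y) hX'
    let e := whiskerRightIso (asIso (Twist.incl hq (C i).φ l (𝟙 Y))) (C i).obj
    have h₃ := hf.comp Υ hq hC (hC.homogeneous_braid hq i hX') (e.inv ≫ (α_ _ _ _).hom)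
    have h₄ : Twist.incl hq (C i).φ l (𝟙 Y) ▷ (C i).obj ≫ e.inv = 𝟙 _ := e.hom_inv_id
    rw [h₂] at h₃
    have h₅ (f : Υ.obj A ⟶ Υ.obj Y) : ((δ Υ (C i).obj A ≫ Υ.obj (C i).obj ◁ f ≫ μ Υ (C i).obj Y) ≫
        Υ.map ((C i).R Y hX' ≫ (α_ _ _ _).inv ≫
        Twist.incl hq (C i).φ l (𝟙 Y) ▷ (C i).obj)) ≫ Υ.map (e.inv ≫ (α_ _ _ _).hom) =
        δ Υ (C i).obj A ≫ Υ.obj (C i).obj ◁ f ≫ μ Υ (C i).obj Y ≫ Υ.map ((C i).R Y hX') := by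
      simp only [Category.assoc, ← Υ.map_comp, reassoc_of% h₄, Iso.inv_hom_id, Category.comp_id]
    exact Eq.mp (congrArg (IsBraidedFraction C Υ _) (h₅ f)) h₃
  | @comp Φ Ψ τ σ h₁ h₂ ih₁ ih₂ =>
    obtain ⟨m, hm, h₃⟩ := ih₁ X hX
    obtain ⟨n, hn, h₄⟩ := ih₂ (Φ.obj X) hm
    refine ⟨n, hn, fun f hf => h₃ f (h₄ _ ?_)⟩
    have h₅ := (homOf R Υ).map_comp (τ.app X) (σ.app (Φ.obj X))
    have h₆ := congrArg (fun g => g.hom f) h₅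
    exact Eq.mp (congrArg (IsBraidedFraction C Υ hn) h₆) hf

end Realization

/-! ### Intertwiners between the left regular action and actions on linear categories -/

section Contract

variable {𝒞 : Type*} [Category 𝒞] [MonoidalCategory 𝒞] {X D : 𝒞} (e : D ⊗ X ≅ 𝟙_ 𝒞)
  (c : 𝟙_ 𝒞 ≅ X ⊗ D)

/-- Contracting an object with its inverse. -/
def contract (M : 𝒞) : X ⊗ (D ⊗ M) ≅ M :=
  (α_ _ _ _).symm ≪≫ whiskerRightIso c.symm M ≪≫ λ_ M

lemma contract_natural {M M' : 𝒞} (m : M ⟶ M') :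
    X ◁ (D ◁ m) ≫ (contract c M').hom = (contract c M).hom ≫ m := by
  simp only [contract, Iso.trans_hom, Iso.symm_hom, whiskerRightIso_hom, Category.assoc,
    ← leftUnitor_naturality]
  rw [← whisker_exchange_assoc, associator_inv_naturality_right_assoc]

lemma contract_tensor (h : c.hom ▷ X ≫ (α_ X D X).hom ≫ X ◁ e.hom = (λ_ X).hom ≫ (ρ_ X).inv)
    (M : 𝒞) : (contract c (X ⊗ M)).hom = X ◁ ((α_ D X M).inv ≫ e.hom ▷ M ≫ (λ_ M).hom) := by
  have h₂ : (contract c (X ⊗ M)).hom = (α_ _ _ _).inv ≫ (α_ _ _ _).inv ≫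
      c.inv ▷ _ ▷ M ≫ (λ_ _).hom ▷ M := by
    simp [contract]
  have h₃ : c.inv ▷ X ▷ M ≫ (λ_ X).hom ▷ M =
      ((α_ _ _ _).hom ≫ X ◁ e.hom ≫ (ρ_ _).hom) ▷ M := by
    rw [← comp_whiskerRight, ← cancel_epi (c.hom ▷ X ▷ M), ← comp_whiskerRight,
      ← comp_whiskerRight, reassoc_of% h]
    simp
  rw [h₂, h₃]
  simp only [comp_whiskerRight, MonoidalCategory.whiskerLeft_comp, Category.assoc]
  monoidal

lemma coev_contract (M : 𝒞) : c.hom ▷ M ≫ (α_ X D M).hom ≫ (contract c M).hom = (λ_ M).hom := by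
  simp [contract]

end Contract

namespace FreeLoc

section Intertwiner

universe u v w x u' v'

variable {R : Type x} [CommRing R] {𝒯 : Type u} [Category.{v} 𝒯] [Preadditive 𝒯] [Linear R 𝒯]
  [MonoidalCategory 𝒯] {I : Type w} {C : I → 𝒯} {W : MorphismProperty 𝒯}
  {𝓜 : Type u'} [Category.{v'} 𝓜] [Preadditive 𝓜] [Linear R 𝓜]
  (G : 𝒯 ⥤ LinEnd R 𝓜) [G.Monoidal] {D : I → LinEnd R 𝓜}
  (e : ∀ i, D i ⊗ G.obj (C i) ≅ 𝟙_ (LinEnd R 𝓜)) (c : ∀ i, 𝟙_ (LinEnd R 𝓜) ≅ G.obj (C i) ⊗ D i)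
  (hW : ∀ (X Y : 𝒯) (f : X ⟶ Y), W f → IsIso (G.map f)) [G.Additive] [G.Linear R]
  (hz : ∀ i, (c i).hom ▷ G.obj (C i) ≫ (α_ _ _ _).hom ≫ G.obj (C i) ◁ (e i).hom =
    (λ_ _).hom ≫ (ρ_ _).inv)
  (H : FreeLoc R C W ⥤ 𝓜) [H.Additive] [H.Linear R]

open LinEnd Functor.LaxMonoidal Functor.OplaxMonoidal

variable {G} in
/-- The unit of the equivalence given by an inverse, on an object. -/
noncomputable def unitApp (i : I) (L : 𝓜) : L ≅ (D i).functor.obj ((G.obj (C i)).functor.obj L) :=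
  ⟨(nat (e i).inv).app L, (nat (e i).hom).app L,
    congrArg (fun f => (nat f).app L) (e i).inv_hom_id,
    congrArg (fun f => (nat f).app L) (e i).hom_inv_id⟩

variable {G} in
/-- The inverse of the counit of the equivalence given by an inverse, on an object. -/
noncomputable def counitApp (i : I) (L : 𝓜) : L ≅ (G.obj (C i)).functor.obj ((D i).functor.obj L) :=
  ⟨(nat (c i).hom).app L, (nat (c i).inv).app L,
    congrArg (fun f => (nat f).app L) (c i).hom_inv_id,
    congrArg (fun f => (nat f).app L) (c i).inv_hom_id⟩

lemma unitApp_natural (i : I) {L L' : 𝓜} (f : L ⟶ L') : f ≫ (unitApp e i L').hom =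
    (unitApp e i L).hom ≫ (D i).functor.map ((G.obj (C i)).functor.map f) :=
  (nat (e i).inv).naturality f

lemma counitApp_natural (i : I) {L L' : 𝓜} (f : L ⟶ L') : f ≫ (counitApp c i L').hom =
    (counitApp c i L).hom ≫ (G.obj (C i)).functor.map ((D i).functor.map f) :=
  (nat (c i).hom).naturality f

include hz in
lemma map_unitApp (i : I) (L : 𝓜) :
    (G.obj (C i)).functor.map (unitApp e i L).hom = (counitApp c i ((G.obj (C i)).functor.obj L)).hom := by
  have h := congrArg (fun f => (nat f).app L) (hz i)
  have h₁ : (counitApp c i ((G.obj (C i)).functor.obj L)).hom ≫ (G.obj (C i)).functor.map (unitApp e i L).inv = 𝟙 _ := by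
    refine Eq.trans ?_ (h.trans (Category.comp_id _))
    exact congrArg (_ ≫ ·) (Category.id_comp _).symm
  rw [← cancel_mono ((G.obj (C i)).functor.map (unitApp e i L).inv), h₁, ← Functor.map_comp, Iso.hom_inv_id,
    CategoryTheory.Functor.map_id]

variable {G} in
/-- The action of a morphism on an object. -/
noncomputable def liftApp {Z Z' : FreeLoc R C W} (g : Z ⟶ Z') (L : 𝓜) : (evalObj G D Z).functor.obj L ⟶ (evalObj G D Z').functor.obj L :=
  (nat ((lift G e c hW hz).map g)).app L

lemma liftApp_id (Z : FreeLoc R C W) (L : 𝓜) : liftApp e c hW hz (𝟙 Z) L = 𝟙 _ := rfl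

lemma liftApp_comp {Z Z' Z'' : FreeLoc R C W} (g : Z ⟶ Z') (g' : Z' ⟶ Z'') (L : 𝓜) :
    liftApp e c hW hz (g ≫ g') L = liftApp e c hW hz g L ≫ liftApp e c hW hz g' L := by
  unfold liftApp
  rw [Functor.map_comp]
  rfl

lemma liftApp_natural {Z Z' : FreeLoc R C W} (g : Z ⟶ Z') {L L' : 𝓜} (f : L ⟶ L') :
    (evalObj G D Z).functor.map f ≫ liftApp e c hW hz g L' = liftApp e c hW hz g L ≫ (evalObj G D Z').functor.map f :=
  (nat ((lift G e c hW hz).map g)).naturality f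

lemma liftApp_whiskerLeft (X : FreeLoc R C W) {Z Z' : FreeLoc R C W} (g : Z ⟶ Z') (L : 𝓜) :
    liftApp e c hW hz (X ◁ g) L = (evalObj G D X).functor.map (liftApp e c hW hz g L) := by
  obtain ⟨g⟩ := g; rfl

lemma liftApp_whiskerRight {Z Z' : FreeLoc R C W} (g : Z ⟶ Z') (X : FreeLoc R C W) (L : 𝓜) :
    liftApp e c hW hz (g ▷ X) L = liftApp e c hW hz g ((evalObj G D X).functor.obj L) := by
  obtain ⟨g⟩ := g; rfl

/-- The unit constraint of the action, on an object. -/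
def epsApp (L : 𝓜) : L ⟶ (G.obj (𝟙_ 𝒯)).functor.obj L := (nat (ε G)).app L

/-- The tensor constraint of the action, on an object. -/
def muApp (V V' : 𝒯) (L : 𝓜) :
    (G.obj V).functor.obj ((G.obj V').functor.obj L) ⟶ (G.obj (V ⊗ V')).functor.obj L :=
  (nat (μ G V V')).app L

variable {G H} in
/-- Compatible isomorphisms `H(V ⊗ M) ≅ G(V)(H(M))`. -/
structure Intertwines (θ : ∀ (V : 𝒯) (M : FreeLoc R C W),
    H.obj ((ι R C W).obj V ⊗ M) ≅ (G.obj V).functor.obj (H.obj M)) : Prop where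
  natural : ∀ (V : 𝒯) {M M' : FreeLoc R C W} (m : M ⟶ M'),
    H.map ((ι R C W).obj V ◁ m) ≫ (θ V M').hom = (θ V M).hom ≫ (G.obj V).functor.map (H.map m)
  map : ∀ {V V' : 𝒯} (f : V ⟶ V') (M : FreeLoc R C W),
    H.map ((ι R C W).map f ▷ M) ≫ (θ V' M).hom = (θ V M).hom ≫ (nat (G.map f)).app (H.obj M)
  unit : ∀ M : FreeLoc R C W, H.map (ε (ι R C W) ▷ M) ≫ (θ (𝟙_ 𝒯) M).hom =
    H.map (λ_ M).hom ≫ epsApp G (H.obj M)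
  tensor : ∀ (V V' : 𝒯) (M : FreeLoc R C W),
    H.map (μ (ι R C W) V V' ▷ M) ≫ (θ (V ⊗ V') M).hom =
      H.map (α_ _ _ M).hom ≫ (θ V (_ ⊗ M)).hom ≫ (G.obj V).functor.map (θ V' M).hom ≫
        muApp G V V' (H.obj M)

variable (θ : ∀ (V : 𝒯) (M : FreeLoc R C W), H.obj ((ι R C W).obj V ⊗ M) ≅ (G.obj V).functor.obj (H.obj M))

variable {G H} in
/-- The isomorphism `H(Z ⊗ M) ≅ F(Z)(H(M))`, where `F` extends the action `G`. -/
noncomputable def inter : ∀ Z M : FreeLoc R C W, H.obj (Z ⊗ M) ≅ (evalObj G D Z).functor.obj (H.obj M)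
  | of V, M => θ V M
  | inv i, M => unitApp e i (H.obj ((inv i : FreeLoc R C W) ⊗ M)) ≪≫
      (D i).functor.mapIso ((θ (C i) (inv i ⊗ M)).symm ≪≫ H.mapIso (contract (coev R C W i) M))
  | unit, M => H.mapIso (λ_ M)
  | tensor X Y, M => H.mapIso (α_ X Y M) ≪≫ inter X (Y ⊗ M) ≪≫
      (evalObj G D X).functor.mapIso (inter Y M)

variable {θ} (hθ : Intertwines θ)

include hθ

lemma Intertwines.inv_natural (V : 𝒯) {M M' : FreeLoc R C W} (m : M ⟶ M') :
    (θ V M).inv ≫ H.map ((ι R C W).obj V ◁ m) =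
      (G.obj V).functor.map (H.map m) ≫ (θ V M').inv := by
  rw [Iso.inv_comp_eq, ← Category.assoc, Iso.eq_comp_inv, hθ.natural]

lemma inter_natural (Z : FreeLoc R C W) {M M' : FreeLoc R C W} (m : M ⟶ M') :
    H.map (Z ◁ m) ≫ (inter e θ Z M').hom = (inter e θ Z M).hom ≫ (evalObj G D Z).functor.map (H.map m) := by
  induction Z generalizing M M' with
  | of V => exact hθ.natural V m
  | inv i =>
    have h := hθ.inv_natural G H (C i) ((inv i : FreeLoc R C W) ◁ m)
    change H.map ((inv i : FreeLoc R C W) ◁ m) ≫ (unitApp e i _).hom ≫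
        (D i).functor.map ((θ (C i) _).inv ≫ H.map (contract (coev R C W i) M').hom) =
      ((unitApp e i _).hom ≫
        (D i).functor.map ((θ (C i) _).inv ≫ H.map (contract (coev R C W i) M).hom)) ≫ (D i).functor.map (H.map m)
    rw [reassoc_of% (unitApp_natural G e i), Category.assoc, ← Functor.map_comp,
      ← Functor.map_comp, ← reassoc_of% h, ← Functor.map_comp, contract_natural, Category.assoc,
      ← H.map_comp]
  | unit =>
    change H.map (𝟙_ _ ◁ m) ≫ H.map (λ_ M').hom = H.map (λ_ M).hom ≫ H.map m
    rw [← H.map_comp, ← H.map_comp, leftUnitor_naturality]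
  | tensor X Y hX hY =>
    change H.map ((X ⊗ Y) ◁ m) ≫ H.map (α_ X Y M').hom ≫ (inter e θ X (Y ⊗ M')).hom ≫
        (evalObj G D X).functor.map (inter e θ Y M').hom =
      (H.map (α_ X Y M).hom ≫ (inter e θ X (Y ⊗ M)).hom ≫
        (evalObj G D X).functor.map (inter e θ Y M).hom) ≫ (evalObj G D X).functor.map ((evalObj G D Y).functor.map (H.map m))
    rw [Category.assoc, Category.assoc, ← Functor.map_comp, ← hY, Functor.map_comp,
      ← reassoc_of% (hX (Y ◁ m)), ← Functor.map_comp_assoc, ← Functor.map_comp_assoc]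
    congr 2
    exact associator_naturality_right X Y m

theorem inter_map {Z Z' : FreeLoc R C W} (g : Z ⟶ Z') : ∀ M : FreeLoc R C W,
    H.map (g ▷ M) ≫ (inter e θ Z' M).hom =
      (inter e θ Z M).hom ≫ liftApp e c hW hz g (H.obj M) := by
  let P {X Y : FreeLoc R C W} (g : X ⟶ Y) : Prop := ∀ M : FreeLoc R C W,
    H.map (g ▷ M) ≫ (inter e θ Y M).hom =
      (inter e θ X M).hom ≫ liftApp e c hW hz g (H.obj M)
  have inverse {X Y : FreeLoc R C W} (f : X ⟶ Y) (g : Y ⟶ X) (h : f ≫ g = 𝟙 _) (h' : g ≫ f = 𝟙 _)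
      (hf : P f) : P g := by
    intro M
    have h₁ := congrArg (H.map (g ▷ M) ≫ · ≫ liftApp e c hW hz g (H.obj M)) (hf M)
    simp only [Category.assoc, ← liftApp_comp, h, ← Functor.map_comp_assoc, ← comp_whiskerRight, h',
      id_whiskerRight, CategoryTheory.Functor.map_id, Category.id_comp, liftApp_id] at h₁
    rw [h₁]
    simp
  change P g
  have hα (X Y Z : FreeLoc R C W) : P (α_ X Y Z).hom := by
    intro M
    change H.map ((α_ X Y Z).hom ▷ M) ≫ H.map (α_ X (Y ⊗ Z) M).hom ≫
        (inter e θ X ((Y ⊗ Z) ⊗ M)).hom ≫ (evalObj G D X).functor.map (H.map (α_ Y Z M).hom ≫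
          (inter e θ Y (Z ⊗ M)).hom ≫ (evalObj G D Y).functor.map (inter e θ Z M).hom) =
      (H.map (α_ (X ⊗ Y) Z M).hom ≫ (H.map (α_ X Y (Z ⊗ M)).hom ≫
        (inter e θ X (Y ⊗ (Z ⊗ M))).hom ≫ (evalObj G D X).functor.map (inter e θ Y (Z ⊗ M)).hom) ≫
          (evalObj G D X).functor.map ((evalObj G D Y).functor.map (inter e θ Z M).hom)) ≫ 𝟙 _
    rw [Category.comp_id]
    simp only [Functor.map_comp, Category.assoc]
    rw [← reassoc_of% (inter_natural G e H hθ X), ← Functor.map_comp_assoc,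
      ← Functor.map_comp_assoc, ← Functor.map_comp_assoc, Category.assoc, pentagon]
  have hl (X : FreeLoc R C W) : P (λ_ X).hom := by
    intro M
    change H.map ((λ_ X).hom ▷ M) ≫ (inter e θ X M).hom =
      (H.map (α_ (𝟙_ (FreeLoc R C W)) X M).hom ≫ H.map (λ_ (X ⊗ M)).hom ≫ (inter e θ X M).hom) ≫ 𝟙 _
    rw [Category.comp_id, ← Functor.map_comp_assoc]
    congr 2
    exact leftUnitor_whiskerRight X M
  have hr (X : FreeLoc R C W) : P (ρ_ X).hom := by
    intro M
    change H.map ((ρ_ X).hom ▷ M) ≫ (inter e θ X M).hom =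
      (H.map (α_ X (𝟙_ (FreeLoc R C W)) M).hom ≫ (inter e θ X (𝟙_ _ ⊗ M)).hom ≫
        (evalObj G D X).functor.map (H.map (λ_ M).hom)) ≫ 𝟙 _
    rw [Category.comp_id, ← inter_natural G e H hθ, ← Functor.map_comp_assoc, triangle]
  have hε : P (ε (ι R C W)) := hθ.unit
  have hμ (X Y : 𝒯) : P (μ (ι R C W) X Y) := by
    intro M
    change H.map (μ (ι R C W) X Y ▷ M) ≫ (θ (X ⊗ Y) M).hom =
      (H.map (α_ ((ι R C W).obj X) ((ι R C W).obj Y) M).hom ≫ (θ X ((ι R C W).obj Y ⊗ M)).hom ≫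
        (G.obj X).functor.map (θ Y M).hom) ≫ muApp G X Y (H.obj M)
    rw [hθ.tensor]
    simp only [Category.assoc]
  have hev (i : I) : P (ev R C W i).hom := by
    intro M
    have h := contract_tensor _ _ (zigzag R C W i) M
    change H.map ((ev R C W i).hom ▷ M) ≫ H.map (λ_ M).hom =
      (H.map (α_ (inv i : FreeLoc R C W) ((ι R C W).obj (C i)) M).hom ≫
        ((unitApp e i (H.obj ((inv i : FreeLoc R C W) ⊗ ((ι R C W).obj (C i) ⊗ M)))).hom ≫
        (D i).functor.map ((θ (C i) _).inv ≫ H.map (contract (coev R C W i) _).hom)) ≫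
        (D i).functor.map (θ (C i) M).hom) ≫ (unitApp e i (H.obj M)).inv
    rw [h]
    have h₁ := hθ.inv_natural G H (C i) ((α_ (inv i) ((ι R C W).obj (C i)) M).inv ≫
      (ev R C W i).hom ▷ M ≫ (λ_ M).hom)
    rw [h₁]
    simp only [Category.assoc, ← Functor.map_comp_assoc, Iso.inv_hom_id, Category.comp_id]
    rw [← reassoc_of% (unitApp_natural G e i)]
    simp [← Functor.map_comp]
  have hcoev (i : I) : P (coev R C W i).hom := by
    intro M
    change H.map ((coev R C W i).hom ▷ M) ≫
      (H.map (α_ ((ι R C W).obj (C i)) (inv i : FreeLoc R C W) M).hom ≫ (θ (C i) _).hom ≫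
        (G.obj (C i)).functor.map ((unitApp e i (H.obj ((inv i : FreeLoc R C W) ⊗ M))).hom ≫
          (D i).functor.map ((θ (C i) _).inv ≫ H.map (contract (coev R C W i) M).hom))) =
      H.map (λ_ M).hom ≫ (counitApp c i (H.obj M)).hom
    rw [Functor.map_comp, map_unitApp G e c hz, ← counitApp_natural]
    simp only [Category.assoc, Iso.hom_inv_id_assoc]
    rw [← Functor.map_comp_assoc, ← Functor.map_comp_assoc, Category.assoc, coev_contract]
  induction g using hom_induction with
  | id X =>
    intro M
    rw [id_whiskerRight, CategoryTheory.Functor.map_id, liftApp_id, Category.id_comp,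
      Category.comp_id]
  | comp f g hf hg =>
    intro M
    rw [comp_whiskerRight, Functor.map_comp, liftApp_comp, Category.assoc, hg M,
      ← Category.assoc, hf M, Category.assoc]
  | @wl X Y Y' f hf =>
    intro M
    rw [liftApp_whiskerLeft]
    change H.map ((X ◁ f) ▷ M) ≫ (H.map (α_ X Y' M).hom ≫ (inter e θ X (Y' ⊗ M)).hom ≫
        (evalObj G D X).functor.map (inter e θ Y' M).hom) =
      (H.map (α_ X Y M).hom ≫ (inter e θ X (Y ⊗ M)).hom ≫ (evalObj G D X).functor.map (inter e θ Y M).hom) ≫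
        (evalObj G D X).functor.map (liftApp e c hW hz f (H.obj M))
    simp only [Category.assoc]
    rw [← Functor.map_comp, ← hf M, Functor.map_comp, ← reassoc_of% (inter_natural G e H hθ X),
      ← Functor.map_comp_assoc, ← Functor.map_comp_assoc, associator_naturality_middle]
  | @wr Y Y' f X hf =>
    intro M
    rw [liftApp_whiskerRight]
    change H.map ((f ▷ X) ▷ M) ≫ (H.map (α_ Y' X M).hom ≫ (inter e θ Y' (X ⊗ M)).hom ≫
        (evalObj G D Y').functor.map (inter e θ X M).hom) =
      (H.map (α_ Y X M).hom ≫ (inter e θ Y (X ⊗ M)).hom ≫ (evalObj G D Y).functor.map (inter e θ X M).hom) ≫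
        liftApp e c hW hz f ((evalObj G D X).functor.obj (H.obj M))
    simp only [Category.assoc]
    rw [liftApp_natural, ← Category.assoc _ (liftApp e c hW hz f _), ← hf,
      ← Functor.map_comp_assoc, associator_naturality_left, Functor.map_comp_assoc, Category.assoc]
  | αHom X Y Z => exact hα X Y Z
  | αInv X Y Z => exact inverse _ _ (Iso.hom_inv_id _) (Iso.inv_hom_id _) (hα X Y Z)
  | lHom X => exact hl X
  | lInv X => exact inverse _ _ (Iso.hom_inv_id _) (Iso.inv_hom_id _) (hl X)
  | rHom X => exact hr X
  | rInv X => exact inverse _ _ (Iso.hom_inv_id _) (Iso.inv_hom_id _) (hr X)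
  | map f => exact hθ.map f
  | hε => exact hε
  | hη => exact inverse _ _ (Functor.Monoidal.ε_η _) (Functor.Monoidal.η_ε _) hε
  | hμ X Y => exact hμ X Y
  | hδ X Y => exact inverse _ _ (Functor.Monoidal.μ_δ _ _ _) (Functor.Monoidal.δ_μ _ _ _) (hμ X Y)
  | hwinv f hf => exact inverse _ _ (map_winv C f hf) (winv_map C f hf) (hθ.map f)
  | evHom i => exact hev i
  | evInv i => exact inverse _ _ (Iso.hom_inv_id _) (Iso.inv_hom_id _) (hev i)
  | coevHom i => exact hcoev i
  | coevInv i => exact inverse _ _ (Iso.hom_inv_id _) (Iso.inv_hom_id _) (hcoev i)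
  | zero X Y =>
    intro M
    have h : liftApp e c hW hz (0 : X ⟶ Y) (H.obj M) = 0 := rfl
    rw [MonoidalPreadditive.zero_whiskerRight, Functor.map_zero, zero_comp, h, comp_zero]
  | add f g hf hg =>
    intro M
    have h : liftApp e c hW hz (f + g) (H.obj M) = liftApp e c hW hz f (H.obj M) +
        liftApp e c hW hz g (H.obj M) := by
      unfold liftApp
      rw [Functor.map_add]
      rfl
    rw [MonoidalPreadditive.add_whiskerRight, Functor.map_add, Preadditive.add_comp, hf M, hg M, h,
      Preadditive.comp_add]
  | smul r f hf =>
    intro M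
    have h : liftApp e c hW hz (r • f) (H.obj M) = r • liftApp e c hW hz f (H.obj M) := by
      unfold liftApp
      rw [Functor.map_smul]
      rfl
    rw [MonoidalLinear.smul_whiskerRight, Functor.map_smul, Linear.smul_comp, hf M, h,
      Linear.comp_smul]

end Intertwiner

end FreeLoc

/-! ### Morphisms of the localization are fractions -/

section Fractions

universe u v x y w u' v'

variable {R : Type x} [CommRing R] {𝒯 : Type u} [Category.{v} 𝒯] [Preadditive 𝒯] [Linear R 𝒯]
  [MonoidalCategory 𝒯] [MonoidalPreadditive 𝒯] [MonoidalLinear R 𝒯]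

section HomInto

variable {𝒟 : Type u'} [Category.{v'} 𝒟] [Preadditive 𝒟] [Linear R 𝒟] [MonoidalCategory 𝒟]
  [MonoidalPreadditive 𝒟] [MonoidalLinear R 𝒟]
  (Υ : 𝒯 ⥤ 𝒟) [Υ.Monoidal] [Υ.Additive] [Υ.Linear R]

open Functor.LaxMonoidal Functor.OplaxMonoidal

/-- The strength of the functor `Z ↦ Υ(Z) ⊗ M`. -/
def strength (B Z : 𝒯) (M : 𝒟) : Υ.obj B ⊗ (Υ.obj Z ⊗ M) ≅ Υ.obj (B ⊗ Z) ⊗ M :=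
  (α_ _ _ _).symm ≪≫ whiskerRightIso (Functor.Monoidal.μIso Υ B Z) M

lemma strength_hom (B Z : 𝒯) (M : 𝒟) :
    (strength Υ B Z M).hom = (α_ _ _ _).inv ≫ μ Υ B Z ▷ M := rfl

lemma strength_natural_left {B B' : 𝒯} (b : B ⟶ B') (Z : 𝒯) (M : 𝒟) :
    Υ.map b ▷ (Υ.obj Z ⊗ M) ≫ (strength Υ B' Z M).hom =
      (strength Υ B Z M).hom ≫ Υ.map (b ▷ Z) ▷ M := by
  simp only [strength_hom, Category.assoc]
  rw [← comp_whiskerRight, ← Functor.LaxMonoidal.μ_natural_left, comp_whiskerRight]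
  simp

lemma strength_natural_middle (B : 𝒯) {Z Z' : 𝒯} (z : Z ⟶ Z') (M : 𝒟) :
    Υ.obj B ◁ Υ.map z ▷ M ≫ (strength Υ B Z' M).hom =
      (strength Υ B Z M).hom ≫ Υ.map (B ◁ z) ▷ M := by
  simp only [strength_hom, Category.assoc]
  rw [← comp_whiskerRight, ← Functor.LaxMonoidal.μ_natural_right, comp_whiskerRight]
  simp

lemma strength_natural_right (B Z : 𝒯) {M M' : 𝒟} (m : M ⟶ M') :
    Υ.obj B ◁ Υ.obj Z ◁ m ≫ (strength Υ B Z M').hom =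
      (strength Υ B Z M).hom ≫ Υ.obj (B ⊗ Z) ◁ m := by
  simp only [strength_hom, Category.assoc]
  rw [← whisker_exchange]
  simp

lemma strength_tensor (B' B Z : 𝒯) (M : 𝒟) :
    Υ.obj B' ◁ (strength Υ B Z M).hom ≫ (strength Υ B' (B ⊗ Z) M).hom =
      (α_ _ _ _).inv ≫ μ Υ B' B ▷ (Υ.obj Z ⊗ M) ≫ (strength Υ (B' ⊗ B) Z M).hom ≫
        Υ.map (α_ B' B Z).hom ▷ M := by
  have h := congrArg (· ▷ M) (Functor.LaxMonoidal.associativity Υ B' B Z)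
  simp only [comp_whiskerRight] at h
  have h' : μ Υ B' B ▷ (Υ.obj Z ⊗ M) ≫ (α_ _ _ _).inv = (α_ _ _ _).inv ≫ μ Υ B' B ▷ Υ.obj Z ▷ M := by
    simp
  simp only [strength_hom, Category.assoc]
  rw [reassoc_of% h', h]
  simp

lemma strength_unit (Z : 𝒯) (M : 𝒟) :
    ε Υ ▷ (Υ.obj Z ⊗ M) ≫ (strength Υ (𝟙_ 𝒯) Z M).hom ≫ Υ.map (λ_ Z).hom ▷ M = (λ_ _).hom := by
  have h := congrArg (· ▷ M) (Functor.LaxMonoidal.left_unitality Υ Z)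
  simp only [comp_whiskerRight] at h
  have h' : ε Υ ▷ (Υ.obj Z ⊗ M) ≫ (α_ _ _ _).inv = (α_ _ _ _).inv ≫ ε Υ ▷ Υ.obj Z ▷ M := by
    simp
  simp only [strength_hom, Category.assoc]
  rw [reassoc_of% h', ← h]
  monoidal

lemma strength_unit_right (Z : 𝒯) (M : 𝒟) :
    Υ.obj Z ◁ (ε Υ ▷ M) ≫ (strength Υ Z (𝟙_ 𝒯) M).hom =
      Υ.obj Z ◁ (λ_ M).hom ≫ Υ.map (ρ_ Z).inv ▷ M := by
  have h := congrArg (· ▷ M) (Functor.LaxMonoidal.right_unitality Υ Z)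
  simp only [comp_whiskerRight] at h
  have h' : Υ.obj Z ◁ (ε Υ ▷ M) ≫ (α_ _ _ _).inv = (α_ _ _ _).inv ≫ (Υ.obj Z ◁ ε Υ) ▷ M := by
    simp
  rw [strength_hom, reassoc_of% h', ← cancel_mono (Υ.map (ρ_ Z).hom ▷ M)]
  simp only [Category.assoc]
  rw [← h, ← comp_whiskerRight, ← Functor.map_comp, Iso.inv_hom_id,
    CategoryTheory.Functor.map_id, id_whiskerRight, Category.comp_id]
  monoidal

lemma strength_tensor_right (Z V V' : 𝒯) (M : 𝒟) :
    Υ.obj Z ◁ (μ Υ V V' ▷ M) ≫ (strength Υ Z (V ⊗ V') M).hom =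
      Υ.obj Z ◁ (α_ _ _ M).hom ≫ (strength Υ Z V (Υ.obj V' ⊗ M)).hom ≫
        (strength Υ (Z ⊗ V) V' M).hom ≫ Υ.map (α_ Z V V').hom ▷ M := by
  have h := congrArg (· ▷ M) (Functor.LaxMonoidal.associativity Υ Z V V')
  simp only [comp_whiskerRight] at h
  have h' : Υ.obj Z ◁ (μ Υ V V' ▷ M) ≫ (α_ _ _ _).inv =
      (α_ _ _ _).inv ≫ (Υ.obj Z ◁ μ Υ V V') ▷ M := by
    simp
  have h'' : μ Υ Z V ▷ (Υ.obj V' ⊗ M) ≫ (α_ _ _ _).inv = (α_ _ _ _).inv ≫ μ Υ Z V ▷ _ ▷ M := by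
    simp
  simp only [strength_hom, Category.assoc]
  rw [reassoc_of% h', reassoc_of% h'', h]
  monoidal

namespace Frac

variable (R) in
/-- The data of the functor `(A, Z) ↦ Hom(Υ(A), Υ(Z) ⊗ M)`. -/
def homIntoRep (M : 𝒟) : Rep R 𝒯 (ModuleCat.{v'} R) where
  obj X := ModuleCat.of R (Υ.obj X.den ⟶ Υ.obj X.num ⊗ M)
  left a Z := ModuleCat.ofHom (Linear.leftComp R (Υ.obj Z ⊗ M) (Υ.map a))
  right A _ _ z := ModuleCat.ofHom (Linear.rightComp R (Υ.obj A) (Υ.map z ▷ M))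
  e B A Z := ModuleCat.ofHom
    { toFun := fun f : Υ.obj A ⟶ Υ.obj Z ⊗ M => δ Υ B A ≫ Υ.obj B ◁ f ≫ (strength Υ B Z M).hom
      map_add' := fun f g => by simp
      map_smul' := fun r f => by simp }
  left_id A Z := by
    ext (f : Υ.obj A ⟶ Υ.obj Z ⊗ M); change Υ.map (𝟙 A) ≫ f = f; simp
  left_comp b a Z := by
    ext (f : Υ.obj _ ⟶ Υ.obj Z ⊗ M); change Υ.map (b ≫ a) ≫ f = Υ.map b ≫ Υ.map a ≫ f; simp
  left_add a b Z := by
    ext (f : Υ.obj _ ⟶ Υ.obj Z ⊗ M)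
    change Υ.map (a + b) ≫ f = Υ.map a ≫ f + Υ.map b ≫ f; simp
  left_smul r a Z := by
    ext (f : Υ.obj _ ⟶ Υ.obj Z ⊗ M); change Υ.map (r • a) ≫ f = r • (Υ.map a ≫ f); simp
  right_id A Z := by
    ext (f : Υ.obj A ⟶ Υ.obj Z ⊗ M); change f ≫ Υ.map (𝟙 Z) ▷ M = f; simp
  right_comp A _ _ _ z z' := by
    ext (f : Υ.obj A ⟶ Υ.obj _ ⊗ M)
    change f ≫ Υ.map (z ≫ z') ▷ M = (f ≫ Υ.map z ▷ M) ≫ Υ.map z' ▷ M; simp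
  right_add A _ _ z z' := by
    ext (f : Υ.obj A ⟶ Υ.obj _ ⊗ M)
    change f ≫ Υ.map (z + z') ▷ M = f ≫ Υ.map z ▷ M + f ≫ Υ.map z' ▷ M; simp
  right_smul A _ _ r z := by
    ext (f : Υ.obj A ⟶ Υ.obj _ ⊗ M)
    change f ≫ Υ.map (r • z) ▷ M = r • (f ≫ Υ.map z ▷ M); simp
  left_right {A A' Z Z'} a z := by
    ext (f : Υ.obj A ⟶ Υ.obj Z ⊗ M); exact Category.assoc (Υ.map a) f (Υ.map z ▷ M)
  left_e B {A A'} a Z := by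
    ext (f : Υ.obj A ⟶ Υ.obj Z ⊗ M)
    change δ Υ B A' ≫ Υ.obj B ◁ (Υ.map a ≫ f) ≫ (strength Υ B Z M).hom =
      Υ.map (B ◁ a) ≫ δ Υ B A ≫ Υ.obj B ◁ f ≫ (strength Υ B Z M).hom
    simp
  right_e B A {Z Z'} z := by
    ext (f : Υ.obj A ⟶ Υ.obj Z ⊗ M)
    change δ Υ B A ≫ Υ.obj B ◁ (f ≫ Υ.map z ▷ M) ≫ (strength Υ B Z' M).hom =
      (δ Υ B A ≫ Υ.obj B ◁ f ≫ (strength Υ B Z M).hom) ≫ Υ.map (B ◁ z) ▷ M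
    simp only [Category.assoc, ← strength_natural_middle, MonoidalCategory.whiskerLeft_comp]
  dinat {B B'} b A Z := by
    ext (f : Υ.obj A ⟶ Υ.obj Z ⊗ M)
    change (δ Υ B A ≫ Υ.obj B ◁ f ≫ (strength Υ B Z M).hom) ≫ Υ.map (b ▷ Z) ▷ M =
      Υ.map (b ▷ A) ≫ δ Υ B' A ≫ Υ.obj B' ◁ f ≫ (strength Υ B' Z M).hom
    rw [Category.assoc, Category.assoc, ← strength_natural_left, whisker_exchange_assoc,
      Functor.OplaxMonoidal.δ_natural_left_assoc]
  e_tensor B B' A Z := by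
    ext (f : Υ.obj A ⟶ Υ.obj Z ⊗ M)
    change δ Υ B' (B ⊗ A) ≫ Υ.obj B' ◁ (δ Υ B A ≫ Υ.obj B ◁ f ≫ (strength Υ B Z M).hom) ≫
        (strength Υ B' (B ⊗ Z) M).hom =
      (Υ.map (α_ B' B A).inv ≫ δ Υ (B' ⊗ B) A ≫ Υ.obj (B' ⊗ B) ◁ f ≫
        (strength Υ (B' ⊗ B) Z M).hom) ≫ Υ.map (α_ B' B Z).hom ▷ M
    have h₁ := strength_tensor Υ B' B Z M
    have h₂ := Functor.OplaxMonoidal.associativity_inv Υ B' B A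
    have h₃ := whisker_exchange (δ Υ B' B) f
    have h₄ : Υ.obj (B' ⊗ B) ◁ f = δ Υ B' B ▷ _ ≫ (Υ.obj B' ⊗ Υ.obj B) ◁ f ≫ μ Υ B' B ▷ _ := by
      rw [← reassoc_of% h₃, ← comp_whiskerRight]
      simp
    rw [h₄]
    simp only [Category.assoc, MonoidalCategory.whiskerLeft_comp, h₁]
    rw [← reassoc_of% h₂]
    simp
  e_unit A Z := by
    ext (f : Υ.obj A ⟶ Υ.obj Z ⊗ M)
    change (Υ.map (λ_ A).inv ≫ δ Υ (𝟙_ 𝒯) A ≫ Υ.obj (𝟙_ 𝒯) ◁ f ≫ (strength Υ (𝟙_ 𝒯) Z M).hom) ≫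
      Υ.map (λ_ Z).hom ▷ M = f
    have h₁ := whisker_exchange (η Υ) f
    have h₃ := Functor.OplaxMonoidal.left_unitality Υ A
    have h₄ : Υ.obj (𝟙_ 𝒯) ◁ f = η Υ ▷ _ ≫ 𝟙_ 𝒟 ◁ f ≫ ε Υ ▷ _ := by
      rw [← reassoc_of% h₁, ← comp_whiskerRight]
      simp
    rw [h₄]
    simp only [Category.assoc]
    rw [strength_unit]
    have h₅ : Υ.map (λ_ A).inv ≫ δ Υ (𝟙_ 𝒯) A ≫ η Υ ▷ Υ.obj A = (λ_ _).inv := by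
      rw [h₃]
    rw [reassoc_of% h₅]
    simp

variable (R) in
/-- The functor `(A, Z) ↦ Hom(Υ(A), Υ(Z) ⊗ M)`. -/
def homInto (M : 𝒟) : Frac R 𝒯 ⥤ ModuleCat.{v'} R := (homIntoRep R Υ M).functor

instance (M : 𝒟) : (homInto R Υ M).Additive := inferInstanceAs (homIntoRep R Υ M).functor.Additive

instance (M : 𝒟) : (homInto R Υ M).Linear R :=
  inferInstanceAs ((homIntoRep R Υ M).functor.Linear R)

variable (R) in
/-- The functoriality of `Hom(Υ(A), Υ(Z) ⊗ M)` in `M`. -/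
def homIntoMap {M M' : 𝒟} (m : M ⟶ M') : homInto R Υ M ⟶ homInto R Υ M' where
  app X := ModuleCat.ofHom (Linear.rightComp R (Υ.obj X.den) (Υ.obj X.num ◁ m))
  naturality _ _ g := naturality_of_generators (F := homInto R Υ M) (G := homInto R Υ M')
    (fun X => ModuleCat.ofHom (Linear.rightComp R (Υ.obj X.den) (Υ.obj X.num ◁ m)))
    (fun {A A'} a Z => by
      ext (f : Υ.obj A ⟶ Υ.obj Z ⊗ M)
      exact Category.assoc (Υ.map a) f _)
    (fun A Z Z' z => by
      ext (f : Υ.obj A ⟶ Υ.obj Z ⊗ M)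
      change (f ≫ Υ.map z ▷ M) ≫ Υ.obj Z' ◁ m = (f ≫ Υ.obj Z ◁ m) ≫ Υ.map z ▷ M'
      rw [Category.assoc, Category.assoc, whisker_exchange])
    (fun B A Z => by
      ext (f : Υ.obj A ⟶ Υ.obj Z ⊗ M)
      change (δ Υ B A ≫ Υ.obj B ◁ f ≫ (strength Υ B Z M).hom) ≫ Υ.obj (B ⊗ Z) ◁ m =
        δ Υ B A ≫ Υ.obj B ◁ (f ≫ Υ.obj Z ◁ m) ≫ (strength Υ B Z M').hom
      simp only [Category.assoc, ← strength_natural_right, MonoidalCategory.whiskerLeft_comp]) g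

variable (R) in
/-- The isomorphism `Hom(Υ(A), Υ(Z) ⊗ (Υ(V) ⊗ M)) ≅ Hom(Υ(A), Υ(Z ⊗ V) ⊗ M)`. -/
def homIntoTensor (V : 𝒯) (M : 𝒟) :
    homInto R Υ (Υ.obj V ⊗ M) ⟶ mulRight R V ⋙ homInto R Υ M where
  app X := ModuleCat.ofHom (Linear.rightComp R (Υ.obj X.den) (strength Υ X.num V M).hom)
  naturality _ _ g := naturality_of_generators (F := homInto R Υ (Υ.obj V ⊗ M))
    (G := mulRight R V ⋙ homInto R Υ M)
    (fun X => ModuleCat.ofHom (Linear.rightComp R (Υ.obj X.den) (strength Υ X.num V M).hom))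
    (fun {A A'} a Z => by
      ext (f : Υ.obj A ⟶ Υ.obj Z ⊗ (Υ.obj V ⊗ M))
      exact Category.assoc (Υ.map a) f _)
    (fun A Z Z' z => by
      ext (f : Υ.obj A ⟶ Υ.obj Z ⊗ (Υ.obj V ⊗ M))
      change (f ≫ Υ.map z ▷ _) ≫ (strength Υ Z' V M).hom =
        (f ≫ (strength Υ Z V M).hom) ≫ Υ.map (z ▷ V) ▷ M
      rw [Category.assoc, Category.assoc, strength_natural_left])
    (fun B A Z => by
      ext (f : Υ.obj A ⟶ Υ.obj Z ⊗ (Υ.obj V ⊗ M))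
      change (δ Υ B A ≫ Υ.obj B ◁ f ≫ (strength Υ B Z (Υ.obj V ⊗ M)).hom) ≫
          (strength Υ (B ⊗ Z) V M).hom =
        (δ Υ B A ≫ Υ.obj B ◁ (f ≫ (strength Υ Z V M).hom) ≫ (strength Υ B (Z ⊗ V) M).hom) ≫
          Υ.map (α_ B Z V).inv ▷ M
      have h := strength_tensor Υ B Z V M
      simp only [Category.assoc, MonoidalCategory.whiskerLeft_comp, reassoc_of% h,
        ← comp_whiskerRight, ← Functor.map_comp, Iso.hom_inv_id]
      simp [strength_hom Υ B Z]) g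

lemma isIso_homIntoTensor (V : 𝒯) (M : 𝒟) : IsIso (homIntoTensor R Υ V M) := by
  have (X : Frac R 𝒯) : IsIso ((homIntoTensor R Υ V M).app X) := by
    rw [ConcreteCategory.isIso_iff_bijective]
    constructor
    · intro (f : Υ.obj X.den ⟶ Υ.obj X.num ⊗ (Υ.obj V ⊗ M)) (g : Υ.obj X.den ⟶ _) h
      exact (cancel_mono (strength Υ X.num V M).hom).1 h
    · intro (g : Υ.obj X.den ⟶ Υ.obj (X.num ⊗ V) ⊗ M)
      refine ⟨(g ≫ (strength Υ X.num V M).inv : Υ.obj X.den ⟶ _), ?_⟩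
      change (g ≫ (strength Υ X.num V M).inv) ≫ (strength Υ X.num V M).hom = g
      simp
  exact NatIso.isIso_of_isIso_app _

end Frac

variable {Λ : Type y} [AddCommGroup Λ] {𝒢 : MonoidalGrading Λ 𝒯} {q : InvertibleCentralObject 𝒯}
  (hq : 𝒢.homogeneous 0 (q.pow 1)) {I : Type w} {C : I → GradedBraider 𝒢 q} {deg : I → Λ}
  (hC : IsRealCommutingFamily R C deg) (hΥ : InvertsBraiders C Υ)

open Frac GradedBraider

include hΥ in
lemma isLocalFunctor_homInto (M : 𝒟) : IsLocalFunctor hq C (ModuleCat.{v'} R) (homInto R Υ M) := by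
  refine ⟨⟨inferInstance, inferInstance⟩, fun i ⟨A, Z⟩ => ?_⟩
  have := hΥ.isIso_map_braid hq Υ i Z
  rw [ConcreteCategory.isIso_iff_bijective]
  have hinv := (hΥ.1 i).1
  let k := (strength Υ (C i).obj Z M).hom ≫ Υ.map ((C i).braid hq Z) ▷ M
  constructor
  · intro (f : Υ.obj A ⟶ Υ.obj Z ⊗ M) (g : Υ.obj A ⟶ Υ.obj Z ⊗ M) h
    have h' : (δ Υ (C i).obj A ≫ Υ.obj (C i).obj ◁ f ≫ (strength Υ (C i).obj Z M).hom) ≫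
        Υ.map ((C i).braid hq Z) ▷ M =
      (δ Υ (C i).obj A ≫ Υ.obj (C i).obj ◁ g ≫ (strength Υ (C i).obj Z M).hom) ≫
        Υ.map ((C i).braid hq Z) ▷ M := h
    rw [cancel_mono, cancel_epi, cancel_mono] at h'
    exact (tensorLeft (Υ.obj (C i).obj)).map_injective h'
  · intro (g : Υ.obj ((C i).obj ⊗ A) ⟶ Υ.obj ((C i).tw hq Z ⊗ (C i).obj) ⊗ M)
    obtain ⟨f, hf⟩ := (tensorLeft (Υ.obj (C i).obj)).map_surjective
      (X := Υ.obj A) (Y := Υ.obj Z ⊗ M) (μ Υ (C i).obj A ≫ g ≫ inv k)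
    refine ⟨f, ?_⟩
    have hf' : Υ.obj (C i).obj ◁ f = μ Υ (C i).obj A ≫ g ≫ inv k := hf
    change (δ Υ (C i).obj A ≫ Υ.obj (C i).obj ◁ f ≫ (strength Υ (C i).obj Z M).hom) ≫
      Υ.map ((C i).braid hq Z) ▷ M = g
    rw [hf', Category.assoc, Category.assoc, Category.assoc]
    change δ Υ (C i).obj A ≫ μ Υ (C i).obj A ≫ (g ≫ inv k) ≫ k = g
    simp

end HomInto

end Fractions

section FractionSubfunctor

universe u v x y w u' v'

variable {R : Type x} [CommRing R] {𝒯 : Type u} [Category.{v} 𝒯] [Preadditive 𝒯] [Linear R 𝒯]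
  [MonoidalCategory 𝒯] [MonoidalPreadditive 𝒯] [MonoidalLinear R 𝒯]
  {𝒟 : Type u'} [Category.{v'} 𝒟] [Preadditive 𝒟] [Linear R 𝒟] [MonoidalCategory 𝒟]
  [MonoidalPreadditive 𝒟] [MonoidalLinear R 𝒟]
  (Υ : 𝒯 ⥤ 𝒟) [Υ.Monoidal] [Υ.Additive] [Υ.Linear R]
  {Λ : Type y} [AddCommGroup Λ] {𝒢 : MonoidalGrading Λ 𝒯} {q : InvertibleCentralObject 𝒯}
  (hq : 𝒢.homogeneous 0 (q.pow 1)) {I : Type w} {C : I → GradedBraider 𝒢 q} {deg : I → Λ}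
  (hC : IsRealCommutingFamily R C deg) (hΥ : InvertsBraiders C Υ)

open Frac GradedBraider Functor.LaxMonoidal Functor.OplaxMonoidal

variable (R) in
/-- A morphism `Υ(A) ⟶ Υ(Z)` that some composite of expansions sends to the image of `Υ`. -/
def IsExpandable (C : I → GradedBraider 𝒢 q) (X : Frac R 𝒯) (f : Υ.obj X.den ⟶ Υ.obj X.num) : Prop :=
  ∃ (Φ : Frac R 𝒯 ⥤ Frac R 𝒯) (τ : 𝟭 (Frac R 𝒯) ⟶ Φ),
    PointedFamily.IsComposite (fun i => (C i).expand R hq) Φ τ ∧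
    ∃ k : (Φ.obj X).den ⟶ (Φ.obj X).num, ((homOf R Υ).map (τ.app X)).hom f = Υ.map k

variable {Υ hq}

lemma IsExpandable.of_map {X : Frac R 𝒯} (k : X.den ⟶ X.num) :
    IsExpandable R Υ hq C X (Υ.map k) := by
  refine ⟨_, _, .id, k, ?_⟩
  let k' : (homOf R Υ).obj X := Υ.map k
  exact congrArg (fun φ => φ.hom k') ((homOf R Υ).map_id X)

lemma IsExpandable.exists_common {X : Frac R 𝒯} {f g : Υ.obj X.den ⟶ Υ.obj X.num}
    (hf : IsExpandable R Υ hq C X f) (hg : IsExpandable R Υ hq C X g) :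
    ∃ (Φ : Frac R 𝒯 ⥤ Frac R 𝒯) (τ : 𝟭 (Frac R 𝒯) ⟶ Φ),
    PointedFamily.IsComposite (fun i => (C i).expand R hq) Φ τ ∧
    (∃ k : (Φ.obj X).den ⟶ (Φ.obj X).num, ((homOf R Υ).map (τ.app X)).hom f = Υ.map k) ∧
    ∃ k : (Φ.obj X).den ⟶ (Φ.obj X).num, ((homOf R Υ).map (τ.app X)).hom g = Υ.map k := by
  obtain ⟨Φ, τ, h, k, hk⟩ := hf
  obtain ⟨Ψ, σ, h', k', hk'⟩ := hg
  refine ⟨_, _, h.comp h', ⟨((homRep R 𝒯).functor.map (σ.app (Φ.obj X))).hom k, ?_⟩,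
    ⟨((homRep R 𝒯).functor.map (Ψ.map (τ.app X))).hom k', ?_⟩⟩
  · have h₁ := (homOf R Υ).map_comp (τ.app X) (σ.app (Φ.obj X))
    have h₂ := congrArg (fun φ => φ.hom f) h₁
    exact (h₂.trans (congrArg ((homOf R Υ).map (σ.app (Φ.obj X))).hom hk)).trans
      (homOf_map_map Υ (σ.app (Φ.obj X)) k)
  · have h₀ := σ.naturality (τ.app X)
    have h₁ := (homOf R Υ).map_comp (σ.app X) (Ψ.map (τ.app X))
    have h₂ := congrArg (fun φ => φ.hom g) ((congrArg (homOf R Υ).map h₀).trans h₁)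
    exact (h₂.trans (congrArg ((homOf R Υ).map (Ψ.map (τ.app X))).hom hk')).trans
      (homOf_map_map Υ (Ψ.map (τ.app X)) k')

lemma IsExpandable.map {X Y : Frac R 𝒯} {f : Υ.obj X.den ⟶ Υ.obj X.num}
    (hf : IsExpandable R Υ hq C X f) (φ : X ⟶ Y) :
    IsExpandable R Υ hq C Y (((homOf R Υ).map φ).hom f) := by
  obtain ⟨Φ, τ, h, k, hk⟩ := hf
  refine ⟨Φ, τ, h, ((homRep R 𝒯).functor.map (Φ.map φ)).hom k, ?_⟩
  have h₀ := congrArg (homOf R Υ).map (τ.naturality φ)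
  have h₁ := congrArg (fun φ => φ.hom f) (h₀.trans ((homOf R Υ).map_comp (τ.app X) (Φ.map φ)))
  have h₂ := congrArg (fun φ => φ.hom f) ((homOf R Υ).map_comp φ (τ.app Y))
  exact (h₂.symm.trans h₁).trans ((congrArg ((homOf R Υ).map (Φ.map φ)).hom hk).trans
    (homOf_map_map Υ (Φ.map φ) k))

variable (R Υ hq C)

/-- The submodule of expandable morphisms. -/
def expandable (X : Frac R 𝒯) : Submodule R (Υ.obj X.den ⟶ Υ.obj X.num) where
  carrier := {f | IsExpandable R Υ hq C X f}
  zero_mem' := ⟨_, _, .id, 0, (map_zero _).trans (Υ.map_zero _ _).symm⟩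
  add_mem' {f g} hf hg := by
    obtain ⟨Φ, τ, h, ⟨k, hk⟩, ⟨k', hk'⟩⟩ := hf.exists_common hg
    exact ⟨Φ, τ, h, k + k', by
      rw [Υ.map_add]
      exact (map_add _ f g).trans (congrArg₂ (· + ·) hk hk')⟩
  smul_mem' r f hf := by
    obtain ⟨Φ, τ, h, k, hk⟩ := hf
    exact ⟨Φ, τ, h, r • k, by
      rw [Υ.map_smul]
      exact (map_smul _ r f).trans (congrArg (r • ·) hk)⟩

/-- The expandable morphisms, as a functor on formal fractions. -/
def expandableFunctor : Frac R 𝒯 ⥤ ModuleCat.{v'} R where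
  obj X := ModuleCat.of R (expandable R Υ hq C X)
  map {X Y} φ := ModuleCat.ofHom (((homOf R Υ).map φ).hom.restrict
    (p := expandable R Υ hq C X) (q := expandable R Υ hq C Y) fun _ hf => hf.map φ)
  map_id X := by
    ext f
    exact congrArg (fun φ => φ.hom f.1) ((homOf R Υ).map_id X)
  map_comp φ ψ := by
    ext f
    exact congrArg (fun φ => φ.hom f.1) ((homOf R Υ).map_comp φ ψ)

instance : (expandableFunctor R Υ hq C).Additive where
  map_add {X Y φ ψ} := by
    ext f
    apply Subtype.ext
    exact congrArg (fun φ => φ.hom f.1) ((homOf R Υ).map_add (f := φ) (g := ψ))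

instance : (expandableFunctor R Υ hq C).Linear R where
  map_smul {X Y} φ r := by
    ext f
    apply Subtype.ext
    exact congrArg (fun φ => φ.hom f.1) ((homOf R Υ).map_smul r φ)

variable {R Υ C}

include hΥ in
lemma isLocalFunctor_expandableFunctor :
    IsLocalFunctor hq C (ModuleCat.{v'} R) (expandableFunctor R Υ hq C) := by
  refine ⟨⟨inferInstance, inferInstance⟩, fun i X => ?_⟩
  have h := isIso_homOf_map_expand Υ hq hΥ i X
  rw [ConcreteCategory.isIso_iff_bijective] at h ⊢
  constructor
  · intro f g hfg
    exact Subtype.ext (h.1 (congrArg Subtype.val hfg))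
  · intro g
    obtain ⟨f, hf⟩ := h.2 g.1
    obtain ⟨Φ, τ, h', k, hk⟩ := g.2
    refine ⟨⟨f, ⟨_, _, PointedFamily.IsComposite.comp (.of i) h', k, ?_⟩⟩, Subtype.ext hf⟩
    have h₁ := (homOf R Υ).map_comp (((C i).expand R hq).app X) (τ.app (((C i).shift R hq).obj X))
    have h₂ := congrArg (fun φ => φ.hom f) h₁
    exact h₂.trans ((congrArg ((homOf R Υ).map (τ.app (((C i).shift R hq).obj X))).hom hf).trans hk)

variable (R Υ C)

/-- The inclusion of the expandable morphisms into all morphisms. -/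
def expandableInclusion : expandableFunctor R Υ hq C ⟶ homInto R Υ (𝟙_ 𝒟) where
  app X := ModuleCat.ofHom ((Linear.rightComp R (Υ.obj X.den) (ρ_ (Υ.obj X.num)).inv) ∘ₗ
    (expandable R Υ hq C X).subtype)
  naturality _ _ g := naturality_of_generators (F := expandableFunctor R Υ hq C)
    (G := homInto R Υ (𝟙_ 𝒟)) (fun X => ModuleCat.ofHom
      ((Linear.rightComp R (Υ.obj X.den) (ρ_ (Υ.obj X.num)).inv) ∘ₗ
      (expandable R Υ hq C X).subtype))
    (fun {A A'} a Z => by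
      ext f
      exact Category.assoc (Υ.map a) f.1 _)
    (fun A Z Z' z => by
      ext f
      let f' : Υ.obj A ⟶ Υ.obj Z := f.1
      change (f' ≫ Υ.map z) ≫ (ρ_ _).inv = (f' ≫ (ρ_ _).inv) ≫ Υ.map z ▷ 𝟙_ 𝒟
      rw [Category.assoc, Category.assoc, rightUnitor_inv_naturality])
    (fun B A Z => by
      ext f
      let f' : Υ.obj A ⟶ Υ.obj Z := f.1
      change (δ Υ B A ≫ Υ.obj B ◁ f' ≫ μ Υ B Z) ≫ (ρ_ _).inv =
        δ Υ B A ≫ Υ.obj B ◁ (f' ≫ (ρ_ _).inv) ≫ (strength Υ B Z _).hom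
      rw [strength_hom, MonoidalCategory.whiskerLeft_comp, Category.assoc, Category.assoc,
        Category.assoc]
      congr 2
      have h := rightUnitor_inv_naturality (μ Υ B Z)
      have h' : (ρ_ (Υ.obj B ⊗ Υ.obj Z)).inv = Υ.obj B ◁ (ρ_ (Υ.obj Z)).inv ≫ (α_ _ _ _).inv := by
        monoidal
      rw [h, h', Category.assoc]) g

end FractionSubfunctor

section BraidLocFractions

universe u v x y w

variable {R : Type x} [CommRing R] {𝒯 : Type u} [Category.{v} 𝒯] [Preadditive 𝒯] [Linear R 𝒯]
  [MonoidalCategory 𝒯] [MonoidalPreadditive 𝒯] [MonoidalLinear R 𝒯]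
  {Λ : Type y} [AddCommGroup Λ] {𝒢 : MonoidalGrading Λ 𝒯} {q : InvertibleCentralObject 𝒯}
  (hq : 𝒢.homogeneous 0 (q.pow 1)) {I : Type w} {C : I → GradedBraider 𝒢 q} {deg : I → Λ}
  (hC : IsRealCommutingFamily R C deg)

open Frac GradedBraider Functor.LaxMonoidal Functor.OplaxMonoidal LocalFunctor

/-- The local functors `Hom(Υ(A), Υ(Z) ⊗ M)`, as a functor of `M`. -/
def homFunctor : BraidLoc R C ⥤ LocalFunctor R hq C (ModuleCat.{max u v w x} R) where
  obj M := ⟨homInto R (toBraidLoc R C) M,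
    isLocalFunctor_homInto _ hq (invertsBraiders_toBraidLoc R C) M⟩
  map m := ObjectProperty.homMk (homIntoMap R (toBraidLoc R C) m)
  map_id M := by
    ext X (f : (toBraidLoc R C).obj X.den ⟶ (toBraidLoc R C).obj X.num ⊗ M)
    change f ≫ _ ◁ 𝟙 M = f
    simp
  map_comp {M _ _} m m' := by
    ext X (f : (toBraidLoc R C).obj X.den ⟶ (toBraidLoc R C).obj X.num ⊗ M)
    change f ≫ _ ◁ (m ≫ m') = (f ≫ _ ◁ m) ≫ _ ◁ m'
    simp

instance : (homFunctor (R := R) (C := C) hq).Additive where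
  map_add {M _ m m'} := by
    ext X (f : (toBraidLoc R C).obj X.den ⟶ (toBraidLoc R C).obj X.num ⊗ M)
    change f ≫ _ ◁ (m + m') = f ≫ _ ◁ m + f ≫ _ ◁ m'
    simp

instance : (homFunctor (R := R) (C := C) hq).Linear R where
  map_smul {M _} m r := by
    ext X (f : (toBraidLoc R C).obj X.den ⟶ (toBraidLoc R C).obj X.num ⊗ M)
    change f ≫ _ ◁ (r • m) = r • (f ≫ _ ◁ m)
    simp

/-- The action of `𝒯` on the local functors `Hom(Υ(A), Υ(Z) ⊗ M)`. -/
noncomputable def homFunctorTensor (V : 𝒯) (M : BraidLoc R C) :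
    (homFunctor hq).obj ((toBraidLoc R C).obj V ⊗ M) ≅
      ((model (ModuleCat.{max u v w x} R) hC).obj V).functor.obj ((homFunctor hq).obj M) :=
  (IsLocalFunctor hq C _).isoMk (@asIso _ _ _ _ (homIntoTensor R (toBraidLoc R C) V M)
    (isIso_homIntoTensor _ V M))

lemma intertwines_homFunctorTensor : FreeLoc.Intertwines (H := homFunctor hq)
    (homFunctorTensor (R := R) (C := C) hq hC) where
  natural V M M' m := by
    ext X (f : (toBraidLoc R C).obj X.den ⟶ (toBraidLoc R C).obj X.num ⊗
      ((toBraidLoc R C).obj V ⊗ M))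
    change (f ≫ _ ◁ (_ ◁ m)) ≫ (strength (toBraidLoc R C) X.num V M').hom =
      (f ≫ (strength (toBraidLoc R C) X.num V M).hom) ≫ _ ◁ m
    rw [Category.assoc, Category.assoc, strength_natural_right]
  map {V V'} f M := by
    ext X (g : (toBraidLoc R C).obj X.den ⟶ (toBraidLoc R C).obj X.num ⊗
      ((toBraidLoc R C).obj V ⊗ M))
    change (g ≫ _ ◁ ((toBraidLoc R C).map f ▷ M)) ≫ (strength (toBraidLoc R C) X.num V' M).hom =
      (g ≫ (strength (toBraidLoc R C) X.num V M).hom) ≫ (toBraidLoc R C).map (X.num ◁ f) ▷ M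
    rw [Category.assoc, Category.assoc, strength_natural_middle]
  unit M := by
    ext X (g : (toBraidLoc R C).obj X.den ⟶ (toBraidLoc R C).obj X.num ⊗ (𝟙_ _ ⊗ M))
    change (g ≫ _ ◁ (ε (toBraidLoc R C) ▷ M)) ≫ (strength (toBraidLoc R C) X.num (𝟙_ 𝒯) M).hom =
      (g ≫ _ ◁ (λ_ M).hom) ≫ (toBraidLoc R C).map (ρ_ X.num).inv ▷ M
    rw [Category.assoc, Category.assoc, strength_unit_right]
  tensor V V' M := by
    ext X (g : (toBraidLoc R C).obj X.den ⟶ (toBraidLoc R C).obj X.num ⊗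
      (((toBraidLoc R C).obj V ⊗ (toBraidLoc R C).obj V') ⊗ M))
    change (g ≫ _ ◁ (μ (toBraidLoc R C) V V' ▷ M)) ≫
        (strength (toBraidLoc R C) X.num (V ⊗ V') M).hom =
      ((((g ≫ _ ◁ (α_ _ _ M).hom) ≫ (strength (toBraidLoc R C) X.num V _).hom) ≫
        (strength (toBraidLoc R C) (X.num ⊗ V) V' M).hom)) ≫
        (toBraidLoc R C).map (α_ X.num V V').hom ▷ M
    simp only [Category.assoc]
    rw [strength_tensor_right]

include hq hC in
theorem isExpandable_toBraidLoc {X Y : 𝒯} (g : (toBraidLoc R C).obj X ⟶ (toBraidLoc R C).obj Y) :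
    IsExpandable R (toBraidLoc R C) hq C ⟨X, Y⟩ g := by
  let 𝓜 := LocalFunctor R hq C (ModuleCat.{max u v w x} R)
  let G := model (hq := hq) (ModuleCat.{max u v w x} R) hC
  have hG : InvertsBraiders C G := invertsBraiders_model hC
  choose D e c hz using fun i => (hG.1 i).exists_inverse
  have hW : ∀ (X Y : 𝒯) (f : X ⟶ Y), braidings C f → IsIso (G.map f) := by
    rintro _ _ _ ⟨i, X, hX⟩
    exact hG.2 i _ X hX
  let L₀ : 𝓜 := ⟨expandableFunctor R (toBraidLoc R C) hq C,
    isLocalFunctor_expandableFunctor hq (invertsBraiders_toBraidLoc R C)⟩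
  let j : L₀ ⟶ (homFunctor hq).obj (𝟙_ _) :=
    ObjectProperty.homMk (expandableInclusion R (toBraidLoc R C) hq C)
  have h₁ := FreeLoc.inter_map G e c hW hz (homFunctor hq)
    (intertwines_homFunctorTensor hq hC) g (𝟙_ _)
  have h₂ := FreeLoc.liftApp_natural G e c hW hz g j
  let P : Frac R 𝒯 := ⟨X, 𝟙_ 𝒯⟩
  let u : (toBraidLoc R C).obj X ⟶ (toBraidLoc R C).obj (𝟙_ 𝒯) ⊗ ((toBraidLoc R C).obj X ⊗ 𝟙_ _) :=
    (ρ_ _).inv ≫ (λ_ _).inv ≫ ε (toBraidLoc R C) ▷ _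
  let k : expandable R (toBraidLoc R C) hq C ⟨X, 𝟙_ 𝒯 ⊗ X⟩ :=
    ⟨(toBraidLoc R C).map (λ_ X).inv, .of_map (X := ⟨X, 𝟙_ 𝒯 ⊗ X⟩) (λ_ X).inv⟩
  let p : expandable R (toBraidLoc R C) hq C ⟨X, 𝟙_ 𝒯 ⊗ Y⟩ :=
    ((FreeLoc.liftApp e c hW hz g L₀).hom.app P).hom k
  let p' : (toBraidLoc R C).obj X ⟶ (toBraidLoc R C).obj (𝟙_ 𝒯 ⊗ Y) := p.1
  have h₃ : (u ≫ _ ◁ (g ▷ 𝟙_ _)) ≫ (strength (toBraidLoc R C) (𝟙_ 𝒯) Y _).hom =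
      p' ≫ (ρ_ _).inv := by
    have h₄ := congrArg (fun φ => (φ.hom.app P).hom u) h₁
    have h₅ := congrArg (fun φ => (φ.hom.app P).hom k) h₂
    have h₆ : (toBraidLoc R C).map (λ_ X).inv ≫ (ρ_ _).inv =
      u ≫ (strength (toBraidLoc R C) (𝟙_ 𝒯) X _).hom := by
      rw [← cancel_mono ((toBraidLoc R C).map (λ_ X).hom ▷ 𝟙_ _)]
      simp only [u, Category.assoc]
      rw [strength_unit, ← rightUnitor_inv_naturality, ← Functor.map_comp_assoc]
      simp
    refine h₄.trans (Eq.trans ?_ h₅)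
    exact congrArg ((FreeLoc.liftApp e c hW hz g _).hom.app P).hom h₆.symm
  have h₇ : g = p' ≫ (toBraidLoc R C).map (λ_ Y).hom := by
    rw [← cancel_mono (ρ_ _).inv, Category.assoc,
      rightUnitor_inv_naturality ((toBraidLoc R C).map (λ_ Y).hom), ← reassoc_of% h₃]
    simp only [u, Category.assoc]
    rw [← whisker_exchange_assoc, strength_unit, leftUnitor_naturality]
    simp
  rw [h₇]
  exact IsExpandable.map p.2 (right R X (λ_ Y).hom)

include hq hC in
theorem isBraidedFraction_toBraidLoc {l : Λ} {X Y : 𝒯} (hY : 𝒢.homogeneous l Y)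
    (g : (toBraidLoc R C).obj X ⟶ (toBraidLoc R C).obj Y) :
    IsBraidedFraction C (toBraidLoc R C) hY g := by
  obtain ⟨Φ, τ, h, k, hk⟩ := isExpandable_toBraidLoc (R := R) hq hC g
  obtain ⟨m, hm, h'⟩ := isBraidedFraction_of_isComposite (toBraidLoc R C) hq hC h ⟨X, Y⟩ hY
  refine h' g ?_
  rw [hk]
  exact .of_map hm k

end BraidLocFractions

/-! ### Categories of fractions -/

section FractionCategory

universe u v x y w u' v'

variable {R : Type x} [CommRing R] {𝒯 : Type u} [Category.{v} 𝒯] [Preadditive 𝒯] [Linear R 𝒯]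
  [MonoidalCategory 𝒯] [MonoidalPreadditive 𝒯] [MonoidalLinear R 𝒯]
  {𝒟 : Type u'} [Category.{v'} 𝒟] [Preadditive 𝒟] [Linear R 𝒟] [MonoidalCategory 𝒟]
  [MonoidalPreadditive 𝒟] [MonoidalLinear R 𝒟]
  {Υ : 𝒯 ⥤ 𝒟} [Υ.Monoidal] [Υ.Additive] [Υ.Linear R]
  {Λ : Type y} [AddCommGroup Λ] {𝒢 : MonoidalGrading Λ 𝒯} {q : InvertibleCentralObject 𝒯}
  {hq : 𝒢.homogeneous 0 (q.pow 1)} {I : Type w} {C : I → GradedBraider 𝒢 q} {deg : I → Λ}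
  (hC : IsRealCommutingFamily R C deg) (hΥ : InvertsBraiders C Υ)

open Frac GradedBraider Functor.LaxMonoidal Functor.OplaxMonoidal

include hΥ in
lemma InvertsBraiders.map_eq_zero_of_braidsToZero {l : Λ} {X Y : 𝒯} {hY : 𝒢.homogeneous l Y}
    {f : X ⟶ Y} (h : BraidsToZero C hY f) : Υ.map f = 0 := by
  induction h with
  | zero hY => exact Υ.map_zero _ _
  | @step l m X Y hY f i h hf ih =>
    have := hΥ.2 i l Y hY
    have := (hΥ.1 i).1
    rw [Υ.map_comp] at ih
    have h₁ : Υ.map ((C i).obj ◁ f) = 0 := by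
      rw [← cancel_mono (Υ.map ((C i).R Y hY)), ih, zero_comp]
    have h₂ : Υ.obj (C i).obj ◁ Υ.map f = 0 := by
      rw [← cancel_mono (μ Υ _ _), Functor.LaxMonoidal.μ_natural_right, h₁, comp_zero, zero_comp]
    apply (tensorLeft (Υ.obj (C i).obj)).map_injective
    simpa using h₂

/-- The expansion of a morphism with homogeneous target, in terms of `R_C`. -/
lemma GradedBraider.braid_eq (C : GradedBraider 𝒢 q) {l : Λ} {Y : 𝒯} (hY : 𝒢.homogeneous l Y) :
    C.braid hq Y = C.R Y hY ≫ (α_ _ _ _).inv ≫ Twist.incl hq C.φ l (𝟙 Y) ▷ C.obj := by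
  have h := C.whiskerLeft_braid hq hY (𝟙 Y)
  rwa [MonoidalCategory.whiskerLeft_id, Category.id_comp] at h

lemma IsBraidedFraction.isExpandable {l : Λ} {X Y : 𝒯} {hY : 𝒢.homogeneous l Y}
    {g : Υ.obj X ⟶ Υ.obj Y} (h : IsBraidedFraction C Υ hY g) :
    IsExpandable R Υ hq C ⟨X, Y⟩ g := by
  induction h with
  | of_map hY f => exact .of_map (X := ⟨_, _⟩) f
  | @step l m X Y hY g i h hg ih =>
    obtain ⟨Φ, τ, h', k, hk⟩ := ih.map (right R _
      ((α_ _ _ _).inv ≫ Twist.incl hq (C i).φ l (𝟙 Y) ▷ (C i).obj))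
    refine ⟨_, _, PointedFamily.IsComposite.comp (.of i) h', k, ?_⟩
    have h₁ := (homOf R Υ).map_comp (((C i).expand R hq).app ⟨X, Y⟩)
      (τ.app (((C i).shift R hq).obj ⟨X, Y⟩))
    have h₂ : ((homOf R Υ).map (((C i).expand R hq).app ⟨X, Y⟩)).hom g =
      (δ Υ (C i).obj X ≫ (Υ.obj (C i).obj ◁ g) ≫ μ Υ (C i).obj Y ≫ Υ.map ((C i).R Y hY)) ≫
        Υ.map ((α_ _ _ _).inv ≫ Twist.incl hq (C i).φ l (𝟙 Y) ▷ (C i).obj) := by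
      rw [homOf_map_expand, (C i).braid_eq hY]
      simp only [Category.assoc, Υ.map_comp]
      rfl
    exact (congrArg (fun φ => φ.hom g) h₁).trans
      ((congrArg ((homOf R Υ).map (τ.app (((C i).shift R hq).obj ⟨X, Y⟩))).hom h₂).trans hk)

variable (R hq C) in
/-- A morphism `A ⟶ Z` that some composite of expansions sends to zero. -/
def IsExpandedToZero (X : Frac R 𝒯) (f : X.den ⟶ X.num) : Prop :=
  ∃ (Φ : Frac R 𝒯 ⥤ Frac R 𝒯) (τ : 𝟭 (Frac R 𝒯) ⟶ Φ),
    PointedFamily.IsComposite (fun i => (C i).expand R hq) Φ τ ∧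
    ((homRep R 𝒯).functor.map (τ.app X)).hom f = 0

lemma IsExpandedToZero.map {X Y : Frac R 𝒯} {f : X.den ⟶ X.num}
    (hf : IsExpandedToZero R hq C X f) (φ : X ⟶ Y) :
    IsExpandedToZero R hq C Y (((homRep R 𝒯).functor.map φ).hom f) := by
  obtain ⟨Φ, τ, h, hk⟩ := hf
  refine ⟨Φ, τ, h, ?_⟩
  have h₀ := congrArg (homRep R 𝒯).functor.map (τ.naturality φ)
  have h₁ := congrArg (fun φ => φ.hom f) (h₀.trans ((homRep R 𝒯).functor.map_comp (τ.app X) (Φ.map φ)))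
  have h₂ := congrArg (fun φ => φ.hom f) ((homRep R 𝒯).functor.map_comp φ (τ.app Y))
  exact (h₂.symm.trans h₁).trans ((congrArg ((homRep R 𝒯).functor.map (Φ.map φ)).hom hk).trans
    (map_zero _))

variable (R hq C) in
lemma IsExpandedToZero.zero (X : Frac R 𝒯) : IsExpandedToZero R hq C X 0 :=
  ⟨_, _, .id, map_zero _⟩

lemma IsExpandedToZero.add {X : Frac R 𝒯} {f g : X.den ⟶ X.num}
    (hf : IsExpandedToZero R hq C X f) (hg : IsExpandedToZero R hq C X g) :
    IsExpandedToZero R hq C X (f + g) := by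
  obtain ⟨Φ, τ, h, hk⟩ := hf
  obtain ⟨Ψ, σ, h', hk'⟩ := hg.map (τ.app X)
  refine ⟨_, _, h.comp h', ?_⟩
  have h₁ := (homRep R 𝒯).functor.map_comp (τ.app X) (σ.app (Φ.obj X))
  have hf' : ((homRep R 𝒯).functor.map (τ.app X ≫ σ.app (Φ.obj X))).hom f = 0 :=
    (congrArg (fun φ => φ.hom f) h₁).trans
      ((congrArg ((homRep R 𝒯).functor.map (σ.app (Φ.obj X))).hom hk).trans (map_zero _))
  have hg' : ((homRep R 𝒯).functor.map (τ.app X ≫ σ.app (Φ.obj X))).hom g = 0 :=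
    (congrArg (fun φ => φ.hom g) h₁).trans hk'
  exact (map_add ((homRep R 𝒯).functor.map (τ.app X ≫ σ.app (Φ.obj X))).hom f g).trans
    ((congrArg₂ (· + ·) hf' hg').trans (add_zero 0))

lemma BraidsToZero.isExpandedToZero {l : Λ} {X Y : 𝒯} {hY : 𝒢.homogeneous l Y}
    {f : X ⟶ Y} (h : BraidsToZero C hY f) : IsExpandedToZero R hq C ⟨X, Y⟩ f := by
  induction h with
  | zero hY => exact .zero R hq C _
  | @step l m X Y hY f i h hf ih =>
    obtain ⟨Φ, τ, h', hk⟩ := ih.map (right R _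
      ((α_ _ _ _).inv ≫ Twist.incl hq (C i).φ l (𝟙 Y) ▷ (C i).obj))
    refine ⟨_, _, PointedFamily.IsComposite.comp (.of i) h', ?_⟩
    have h₁ := (homRep R 𝒯).functor.map_comp (((C i).expand R hq).app ⟨X, Y⟩)
      (τ.app (((C i).shift R hq).obj ⟨X, Y⟩))
    have h₂ : (C i).obj ◁ f ≫ (C i).braid hq Y =
      ((C i).obj ◁ f ≫ (C i).R Y hY) ≫
        (α_ _ _ _).inv ≫ Twist.incl hq (C i).φ l (𝟙 Y) ▷ (C i).obj := by
      rw [(C i).braid_eq hY, Category.assoc]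
    exact (congrArg (fun φ => φ.hom f) h₁).trans
      ((congrArg ((homRep R 𝒯).functor.map (τ.app (((C i).shift R hq).obj ⟨X, Y⟩))).hom h₂).trans hk)

variable (hF : IsFractionCategory C Υ)

include hF

variable (R hq) in
lemma IsFractionCategory.isExpandable {X Y : 𝒯} (g : Υ.obj X ⟶ Υ.obj Y) :
    IsExpandable R Υ hq C ⟨X, Y⟩ g := by
  let d := 𝒢.dec Y
  have h : g = ∑ m ∈ d.s, (g ≫ Υ.map (d.π m)) ≫ Υ.map (d.ι m) := by
    simp only [Category.assoc, ← Υ.map_comp]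
    rw [← Preadditive.comp_sum, ← Υ.map_sum, d.sum, Υ.map_id, Category.comp_id]
  rw [h]
  refine Submodule.sum_mem (expandable R Υ hq C ⟨X, Y⟩) fun m hm => ?_
  exact ((hF.isBraidedFraction (d.mem m hm) (g ≫ Υ.map (d.π m))).isExpandable).map
    (right R X (d.ι m))

variable (R hq) in
lemma IsFractionCategory.isExpandedToZero {X Y : 𝒯} (f : X ⟶ Y) (hf : Υ.map f = 0) :
    IsExpandedToZero R hq C ⟨X, Y⟩ f := by
  let d := 𝒢.dec Y
  have h : f = ∑ m ∈ d.s, (f ≫ d.π m) ≫ d.ι m := by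
    simp only [Category.assoc]
    rw [← Preadditive.comp_sum, d.sum, Category.comp_id]
  rw [h]
  refine Finset.sum_induction _ (IsExpandedToZero R hq C ⟨X, Y⟩) (fun _ _ h h' => h.add h')
    (.zero R hq C _) fun m hm => ?_
  refine ((hF.map_eq_zero_iff (d.mem m hm) (f ≫ d.π m)).1 ?_).isExpandedToZero.map (right R X (d.ι m))
  rw [Υ.map_comp, hf, zero_comp]

end FractionCategory

section

universe u v x y w

variable {R : Type x} [CommRing R] {𝒯 : Type u} [Category.{v} 𝒯] [Preadditive 𝒯] [Linear R 𝒯]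
  [MonoidalCategory 𝒯] [MonoidalPreadditive 𝒯] [MonoidalLinear R 𝒯]
  {Λ : Type y} [AddCommGroup Λ] {𝒢 : MonoidalGrading Λ 𝒯} {q : InvertibleCentralObject 𝒯}
  (hq : 𝒢.homogeneous 0 (q.pow 1)) {I : Type w} {C : I → GradedBraider 𝒢 q} {deg : I → Λ}
  (hC : IsRealCommutingFamily R C deg)

include hq hC in
theorem isFractionCategory_toBraidLoc : IsFractionCategory C (toBraidLoc R C) where
  exists_denominator := hasDenominator_braidLoc hq R
  isBraidedFraction hY g := isBraidedFraction_toBraidLoc hq hC hY g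
  map_eq_zero_iff hY f := ⟨braidsToZero_of_map_eq_zero hq hC hY f,
    fun h => (invertsBraiders_toBraidLoc R C).map_eq_zero_of_braidsToZero h⟩

end

/-! ### The grading of a category of fractions -/

section DirectSum

variable {Λ : Type*} [AddCommGroup Λ] {𝒯 𝒟 : Type*} [Category 𝒯] [Preadditive 𝒯]
  [Category 𝒟] [Preadditive 𝒟]

lemma IsDirectSum.reflect {𝒟' : Type*} [Category 𝒟'] [Preadditive 𝒟'] (Υ : 𝒯 ⥤ 𝒟) [Υ.Additive]
    (E : 𝒟' ⥤ 𝒟) [E.Additive] [E.Full] [E.Faithful] {s : Finset Λ} (t : Λ) {Y : Λ → 𝒯} {X : 𝒯}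
    (h : IsDirectSum (s.map (addLeftEmbedding t)) Y X) {Y' : Λ → 𝒟'} {Z : 𝒟'}
    (e : E.obj Z ≅ Υ.obj X) (a : ∀ l ∈ s, Nonempty (E.obj (Y' l) ≅ Υ.obj (Y (t + l)))) :
    IsDirectSum s Y' Z := by
  classical
  obtain ⟨ι, π, h₁, h₂⟩ := h
  let b (l) (hl : l ∈ s) := (a l hl).some
  refine ⟨fun l => if hl : l ∈ s then E.preimage ((b l hl).hom ≫ Υ.map (ι (t + l)) ≫ e.inv) else 0,
    fun l => if hl : l ∈ s then E.preimage (e.hom ≫ Υ.map (π (t + l)) ≫ (b l hl).inv) else 0,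
    fun l hl => ?_, ?_⟩
  · apply E.map_injective
    have h := h₁ (t + l) (Finset.mem_map_of_mem _ hl)
    simp only [dif_pos hl, Functor.map_comp, Functor.map_preimage, CategoryTheory.Functor.map_id,
      Category.assoc, Iso.inv_hom_id_assoc]
    rw [← Υ.map_comp_assoc, h]
    simp
  · apply E.map_injective
    rw [E.map_sum, E.map_id, Finset.sum_congr rfl (g := fun l => e.hom ≫
      Υ.map (π (t + l) ≫ ι (t + l)) ≫ e.inv) (fun l hl => by simp [dif_pos hl]),
      ← Preadditive.comp_sum, ← Preadditive.sum_comp, ← Υ.map_sum]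
    have h : ∑ l ∈ s, π (t + l) ≫ ι (t + l) = 𝟙 X := by
      rw [← h₂, Finset.sum_map]; rfl
    rw [h]
    simp

end DirectSum

section FractionGrading

variable {Λ : Type*} [AddCommGroup Λ] {𝒯 : Type*} [Category 𝒯] [Preadditive 𝒯]
  [MonoidalCategory 𝒯] [MonoidalPreadditive 𝒯]
  {𝒢 : MonoidalGrading Λ 𝒯} {q : InvertibleCentralObject 𝒯}
  (hq : 𝒢.homogeneous 0 (q.pow 1)) {I : Type*} {C : I → GradedBraider 𝒢 q} {deg : I → Λ}
  (hdeg : ∀ i, 𝒢.homogeneous (deg i) (C i).obj)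
  {𝒟 : Type*} [Category 𝒟] [Preadditive 𝒟] [MonoidalCategory 𝒟] [MonoidalPreadditive 𝒟]
  (Υ : 𝒯 ⥤ 𝒟) [Υ.Monoidal] [Υ.Additive] (hΥ : InvertsBraiders C Υ) (hF : IsFractionCategory C Υ)

include hq hdeg hΥ in
lemma IsBraidedFraction.eq_zero {l m : Λ} {X Y : 𝒯} {hY : 𝒢.homogeneous m Y}
    {g : Υ.obj X ⟶ Υ.obj Y} (h : IsBraidedFraction C Υ hY g) (hX : 𝒢.homogeneous l X)
    (hlm : l ≠ m) : g = 0 := by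
  induction h generalizing l with
  | of_map hY f => rw [𝒢.hom_eq_zero hX hY hlm f, Υ.map_zero]
  | @step m n X Y hY g i h hg ih =>
    have := hΥ.2 i m Y hY
    have := (hΥ.1 i).1
    have hmem : 𝒢.homogeneous (deg i + m) (q.pow ((C i).φ m) ⊗ (Y ⊗ (C i).obj)) :=
      q.pow_tensor_mem hq _ (𝒢.tensor_mem' hY (hdeg i) (add_comm _ _))
    have h₁ : Functor.OplaxMonoidal.δ Υ (C i).obj X ≫ (Υ.obj (C i).obj ◁ g) ≫
        Functor.LaxMonoidal.μ Υ (C i).obj Y ≫ Υ.map ((C i).R Y hY) = 0 := by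
      by_cases hn : deg i + m = n
      · exact ih (𝒢.tensor_mem (hdeg i) hX) (fun h => hlm (add_left_cancel (h.trans hn.symm)))
      · have h₂ : 𝟙 (q.pow ((C i).φ m) ⊗ (Y ⊗ (C i).obj)) = 0 := 𝒢.hom_eq_zero hmem h hn _
        rw [← Category.comp_id (Υ.map ((C i).R Y hY)), ← Υ.map_id, h₂]
        simp
    rw [← cancel_epi (Functor.LaxMonoidal.μ Υ _ _), comp_zero,
      Functor.Monoidal.μ_δ_assoc, ← Category.assoc, ← cancel_mono (inv (Υ.map ((C i).R Y hY)))] at h₁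
    simp only [Category.assoc, IsIso.hom_inv_id, Category.comp_id, zero_comp] at h₁
    rw [← cancel_mono (Functor.OplaxMonoidal.δ Υ _ _), Category.assoc, Functor.Monoidal.μ_δ,
      zero_comp, Category.comp_id] at h₁
    apply (tensorLeft (Υ.obj (C i).obj)).map_injective
    simpa using h₁

/-- The fractions of degree `l` with denominator `C_w`. -/
def IsHomogeneousFraction (C : I → GradedBraider 𝒢 q) (deg : I → Λ) (Υ : 𝒯 ⥤ 𝒟) (w : List I)
    (l : Λ) (Z : 𝒟) : Prop :=
  ∃ X, 𝒢.homogeneous ((w.map deg).sum + l) X ∧ Nonempty (Υ.obj (wordObj C w) ⊗ Z ≅ Υ.obj X)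

variable {Υ}

include hdeg in
lemma IsHomogeneousFraction.append {w : List I} {l : Λ} {Z : 𝒟}
    (h : IsHomogeneousFraction C deg Υ w l Z) (v : List I) :
    IsHomogeneousFraction C deg Υ (v ++ w) l Z := by
  obtain ⟨X, hX, ⟨e⟩⟩ := h
  exact ⟨_, 𝒢.tensor_mem' (wordObj_mem hdeg v) hX (by simp [add_assoc]),
    ⟨appendDenominator Υ v e⟩⟩

include hq hdeg hΥ in
lemma IsHomogeneousFraction.prepend {w : List I} {l : Λ} {Z : 𝒟}
    (h : IsHomogeneousFraction C deg Υ w l Z) (v : List I) :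
    IsHomogeneousFraction C deg Υ (w ++ v) l Z := by
  obtain ⟨X, hX, ⟨e⟩⟩ := h
  exact ⟨_, 𝒢.tensor_mem' (wordTwist_mem hq w (wordObj_mem hdeg v)) hX
    (by simp only [List.map_append, List.sum_append]; abel), ⟨hΥ.prependDenominator hq Υ v e⟩⟩

include hq hdeg hΥ in
lemma exists_common_denominator (s : Finset Λ) (Y : Λ → 𝒟)
    (h : ∀ l ∈ s, ∃ w, IsHomogeneousFraction C deg Υ w l (Y l)) :
    ∃ w, ∀ l ∈ s, IsHomogeneousFraction C deg Υ w l (Y l) := by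
  classical
  induction s using Finset.induction_on with
  | empty => exact ⟨[], by simp⟩
  | insert a s _ ih =>
    obtain ⟨w, hw⟩ := ih fun l hl => h l (Finset.mem_insert_of_mem hl)
    obtain ⟨v, hv⟩ := h a (Finset.mem_insert_self _ _)
    refine ⟨v ++ w, fun l hl => ?_⟩
    obtain rfl | hl := Finset.mem_insert.1 hl
    · exact hv.prepend hq hdeg hΥ w
    · exact (hw l hl).append hdeg v

variable (Υ)

/-- The grading of a category of fractions. -/
noncomputable def fractionGrading : MonoidalGrading Λ 𝒟 where
  homogeneous l Z := ∃ w, IsHomogeneousFraction C deg Υ w l Z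
  closedUnderIso l := ⟨by
    rintro Z Z' a ⟨w, X, hX, ⟨e⟩⟩
    exact ⟨w, X, hX, ⟨whiskerLeftIso _ a.symm ≪≫ e⟩⟩⟩
  hom_eq_zero {l m Z Z'} := by
    rintro ⟨w, h⟩ ⟨w', h'⟩ hlm f
    obtain ⟨X, hX, ⟨e⟩⟩ := h.append hdeg w'
    obtain ⟨X', hX', ⟨e'⟩⟩ := h'.prepend hq hdeg hΥ w
    have h₁ := (hF.isBraidedFraction hX' (e.inv ≫ _ ◁ f ≫ e'.hom)).eq_zero hq hdeg Υ hΥ hX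
      (fun h => hlm (add_left_cancel h))
    have := (hΥ.isInvertibleObj_word Υ (w' ++ w)).1
    apply (tensorLeft (Υ.obj (wordObj C (w' ++ w)))).map_injective
    rw [Functor.map_zero, ← cancel_mono e'.hom, ← cancel_epi e.inv]
    simpa using h₁
  exists_decomposition Z := by
    obtain ⟨w, X, ⟨e⟩⟩ := hF.exists_denominator Z
    obtain ⟨s, Y, hY, h⟩ := 𝒢.exists_decomposition X
    have := (hΥ.isInvertibleObj_word Υ w).1
    let E := tensorLeft (Υ.obj (wordObj C w))
    let t := (w.map deg).sum
    refine ⟨s.map (addLeftEmbedding (-t)), fun l => E.objPreimage (Υ.obj (Y (t + l))),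
      fun l hl => ⟨w, _, hY _ ?_, ⟨E.objObjPreimageIso _⟩⟩,
      IsDirectSum.reflect Υ E t (Y := Y) (X := X) ?_ e fun l _ => ⟨E.objObjPreimageIso _⟩⟩
    · obtain ⟨m, hm, rfl⟩ := Finset.mem_map.1 hl
      simpa [t] using hm
    · have hs : (s.map (addLeftEmbedding (-t))).map (addLeftEmbedding t) = s := by
        ext; simp
      rwa [hs]
  exists_sum s Y hY := by
    obtain ⟨w, hw⟩ := exists_common_denominator hq hdeg hΥ s Y hY
    have hw' : ∀ l, ∃ X, l ∈ s → 𝒢.homogeneous ((w.map deg).sum + l) X ∧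
        Nonempty (Υ.obj (wordObj C w) ⊗ Y l ≅ Υ.obj X) := fun l => by
      by_cases hl : l ∈ s
      · obtain ⟨X, h⟩ := hw l hl
        exact ⟨X, fun _ => h⟩
      · exact ⟨𝟙_ 𝒯, fun h => (hl h).elim⟩
    choose X hX using hw'
    have := (hΥ.isInvertibleObj_word Υ w).1
    let E := tensorLeft (Υ.obj (wordObj C w))
    let t := (w.map deg).sum
    obtain ⟨S, hS⟩ := 𝒢.exists_sum (s.map (addLeftEmbedding t)) (fun m => X (-t + m)) fun m hm => by
      obtain ⟨l, hl, rfl⟩ := Finset.mem_map.1 hm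
      simpa using (hX l hl).1
    refine ⟨E.objPreimage (Υ.obj S), IsDirectSum.reflect Υ E t hS (E.objObjPreimageIso _)
      fun l hl => ?_⟩
    simpa [E] using (hX l hl).2
  unit_mem := ⟨[], 𝟙_ 𝒯, by simpa using 𝒢.unit_mem, ⟨ρ_ (Υ.obj (𝟙_ 𝒯))⟩⟩
  tensor_mem := by
    rintro l m Z Z' ⟨w, X, hX, ⟨e⟩⟩ ⟨w', X', hX', ⟨e'⟩⟩
    exact ⟨w' ++ w, _, 𝒢.tensor_mem' (wordTwist_mem hq w' hX) hX'
      (by simp only [List.map_append, List.sum_append]; abel), ⟨hΥ.tensorDenominator hq Υ e e'⟩⟩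

lemma fractionGrading_obj {l : Λ} {X : 𝒯} (hX : 𝒢.homogeneous l X) :
    (fractionGrading hq hdeg Υ hΥ hF).homogeneous l (Υ.obj X) :=
  ⟨[], 𝟙_ 𝒯 ⊗ X, 𝒢.tensor_mem' 𝒢.unit_mem hX (by simp), ⟨Functor.Monoidal.μIso Υ _ _⟩⟩

end FractionGrading

/-! ### Kernels and cokernels -/

section Kernels

variable {𝒯 𝒟 𝒟' : Type*} [Category 𝒯] [Preadditive 𝒯] [Category 𝒟] [Preadditive 𝒟]
  [Category 𝒟'] [Preadditive 𝒟']

/-- `ι` is a kernel of `k`. -/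
structure IsKer {K A B : 𝒯} (ι : K ⟶ A) (k : A ⟶ B) : Prop where
  w : ι ≫ k = 0
  eq_zero : ∀ {W : 𝒯} (g : W ⟶ K), g ≫ ι = 0 → g = 0
  exists_lift : ∀ {W : 𝒯} (g : W ⟶ A), g ≫ k = 0 → ∃ h : W ⟶ K, h ≫ ι = g

/-- `p` is a cokernel of `k`. -/
structure IsCoker {A B Q : 𝒯} (k : A ⟶ B) (p : B ⟶ Q) : Prop where
  w : k ≫ p = 0
  eq_zero : ∀ {W : 𝒯} (g : Q ⟶ W), p ≫ g = 0 → g = 0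
  exists_desc : ∀ {W : 𝒯} (g : B ⟶ W), k ≫ g = 0 → ∃ h : Q ⟶ W, p ≫ h = g

lemma IsCoker.op {A B Q : 𝒯} {k : A ⟶ B} {p : B ⟶ Q} (h : IsCoker k p) : IsKer p.op k.op where
  w := congrArg Quiver.Hom.op h.w
  eq_zero g hg := congrArg Quiver.Hom.op (h.eq_zero g.unop (congrArg Quiver.Hom.unop hg))
  exists_lift g hg :=
    have ⟨l, hl⟩ := h.exists_desc g.unop (congrArg Quiver.Hom.unop hg)
    ⟨l.op, congrArg Quiver.Hom.op hl⟩

lemma IsKer.unop {K A B : 𝒯ᵒᵖ} {ι : K ⟶ A} {k : A ⟶ B} (h : IsKer ι k) :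
    IsCoker k.unop ι.unop where
  w := congrArg Quiver.Hom.unop h.w
  eq_zero g hg := congrArg Quiver.Hom.unop (h.eq_zero g.op (congrArg Quiver.Hom.op hg))
  exists_desc g hg :=
    have ⟨l, hl⟩ := h.exists_lift g.op (congrArg Quiver.Hom.op hg)
    ⟨l.unop, congrArg Quiver.Hom.unop hl⟩

lemma IsKer.mono {K A B : 𝒯} {ι : K ⟶ A} {k : A ⟶ B} (h : IsKer ι k) : Mono ι :=
  Preadditive.mono_of_cancel_zero _ h.eq_zero

lemma IsCoker.epi {A B Q : 𝒯} {k : A ⟶ B} {p : B ⟶ Q} (h : IsCoker k p) : Epi p :=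
  Preadditive.epi_of_cancel_zero _ h.eq_zero

/-- A kernel in the sense of limits. -/
noncomputable def IsKer.isLimit {K A B : 𝒯} {ι : K ⟶ A} {k : A ⟶ B} (h : IsKer ι k) :
    IsLimit (KernelFork.ofι ι h.w) :=
  have := h.mono
  KernelFork.IsLimit.ofι' ι h.w fun g hg => ⟨_, (h.exists_lift g hg).choose_spec⟩

/-- A cokernel in the sense of colimits. -/
noncomputable def IsCoker.isColimit {A B Q : 𝒯} {k : A ⟶ B} {p : B ⟶ Q} (h : IsCoker k p) :
    IsColimit (CokernelCofork.ofπ p h.w) :=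
  have := h.epi
  CokernelCofork.IsColimit.ofπ' p h.w fun g hg => ⟨_, (h.exists_desc g hg).choose_spec⟩

lemma IsKer.of_isLimit {A B : 𝒯} {k : A ⟶ B} {c : KernelFork k} (h : IsLimit c) :
    IsKer (Fork.ι c) k where
  w := KernelFork.condition c
  eq_zero g hg := Fork.IsLimit.hom_ext h (by rw [hg, zero_comp])
  exists_lift g hg := ⟨_, (KernelFork.IsLimit.lift' h g hg).2⟩

lemma IsKer.reflect (E : 𝒟 ⥤ 𝒟') [E.Additive] [E.Full] [E.Faithful] {K A B : 𝒟} {K' A' B' : 𝒟'}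
    {ι : K ⟶ A} {k : A ⟶ B} {ι' : K' ⟶ A'} {k' : A' ⟶ B'} (h : IsKer ι' k') (c : E.obj K ≅ K')
    (a : E.obj A ≅ A') (b : E.obj B ≅ B') (hι : E.map ι ≫ a.hom = c.hom ≫ ι')
    (hk : E.map k ≫ b.hom = a.hom ≫ k') : IsKer ι k where
  w := by
    apply E.map_injective
    rw [← cancel_mono b.hom, E.map_comp, Category.assoc, hk, reassoc_of% hι, h.w]
    simp
  eq_zero g hg := by
    apply E.map_injective
    rw [← cancel_mono c.hom, E.map_zero, zero_comp]
    apply h.eq_zero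
    rw [Category.assoc, ← hι, ← E.map_comp_assoc, hg, E.map_zero, zero_comp]
  exists_lift g hg := by
    obtain ⟨l, hl⟩ := h.exists_lift (E.map g ≫ a.hom) (by
      rw [Category.assoc, ← hk, ← E.map_comp_assoc, hg, E.map_zero, zero_comp])
    refine ⟨E.preimage (l ≫ c.inv), E.map_injective ?_⟩
    rw [← cancel_mono a.hom, E.map_comp, Category.assoc, hι]
    simpa using hl

lemma IsCoker.reflect (E : 𝒟 ⥤ 𝒟') [E.Additive] [E.Full] [E.Faithful] {A B Q : 𝒟} {A' B' Q' : 𝒟'}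
    {k : A ⟶ B} {p : B ⟶ Q} {k' : A' ⟶ B'} {p' : B' ⟶ Q'} (h : IsCoker k' p') (a : E.obj A ≅ A')
    (b : E.obj B ≅ B') (c : E.obj Q ≅ Q') (hk : E.map k ≫ b.hom = a.hom ≫ k')
    (hp : E.map p ≫ c.hom = b.hom ≫ p') : IsCoker k p := by
  refine (IsKer.reflect E.op (ι := p.op) (k := k.op) h.op c.symm.op b.symm.op a.symm.op ?_ ?_).unop
  · refine Quiver.Hom.unop_inj ?_
    change b.inv ≫ E.map p = p' ≫ c.inv
    rw [Iso.inv_comp_eq, ← reassoc_of% hp]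
    simp
  · refine Quiver.Hom.unop_inj ?_
    change a.inv ≫ E.map k = k' ≫ b.inv
    rw [Iso.inv_comp_eq, ← reassoc_of% hk]
    simp

lemma IsKer.exists_iso {K K' A B : 𝒯} {ι : K ⟶ A} {ι' : K' ⟶ A} {k : A ⟶ B} (h : IsKer ι k)
    (h' : IsKer ι' k) : ∃ c : K ≅ K', c.hom ≫ ι' = ι := by
  obtain ⟨l, hl⟩ := h'.exists_lift ι h.w
  obtain ⟨l', hl'⟩ := h.exists_lift ι' h'.w
  have := h.mono
  have := h'.mono
  exact ⟨⟨l, l', by simp [← cancel_mono ι, hl, hl'], by simp [← cancel_mono ι', hl, hl']⟩, hl⟩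

/-- The functor `F` preserves kernels. -/
def PreservesKer (F : 𝒯 ⥤ 𝒟) : Prop :=
  ∀ {K A B : 𝒯} {ι : K ⟶ A} {k : A ⟶ B}, IsKer ι k → IsKer (F.map ι) (F.map k)

/-- The functor `F` preserves cokernels. -/
def PreservesCoker (F : 𝒯 ⥤ 𝒟) : Prop :=
  ∀ {A B Q : 𝒯} {k : A ⟶ B} {p : B ⟶ Q}, IsCoker k p → IsCoker (F.map k) (F.map p)

lemma PreservesCoker.op {F : 𝒯 ⥤ 𝒟} (h : PreservesCoker F) : PreservesKer F.op :=
  fun hk => (h hk.unop).op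

lemma PreservesKer.unop {F : 𝒯 ⥤ 𝒟} (h : PreservesKer F.op) : PreservesCoker F :=
  fun hk => (h hk.op).unop

lemma PreservesKer.comp {F : 𝒯 ⥤ 𝒟} (hF : PreservesKer F) {G : 𝒟 ⥤ 𝒟'} (hG : PreservesKer G) :
    PreservesKer (F ⋙ G) := fun h => hG (hF h)

lemma PreservesCoker.comp {F : 𝒯 ⥤ 𝒟} (hF : PreservesCoker F) {G : 𝒟 ⥤ 𝒟'}
    (hG : PreservesCoker G) : PreservesCoker (F ⋙ G) := fun h => hG (hF h)

lemma PreservesKer.of_comp {F : 𝒯 ⥤ 𝒟} {E : 𝒟 ⥤ 𝒟'} [E.Additive] [E.Full] [E.Faithful]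
    {G : 𝒯 ⥤ 𝒟'} (hG : PreservesKer G) (e : F ⋙ E ≅ G) : PreservesKer F := fun h =>
  (hG h).reflect E (e.app _) (e.app _) (e.app _) (e.hom.naturality _) (e.hom.naturality _)

lemma PreservesCoker.of_comp {F : 𝒯 ⥤ 𝒟} {E : 𝒟 ⥤ 𝒟'} [E.Additive] [E.Full] [E.Faithful]
    {G : 𝒯 ⥤ 𝒟'} (hG : PreservesCoker G) (e : F ⋙ E ≅ G) : PreservesCoker F := fun h =>
  (hG h).reflect E (e.app _) (e.app _) (e.app _) (e.hom.naturality _) (e.hom.naturality _)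

lemma preservesKer_of_preservesFiniteLimits (F : 𝒯 ⥤ 𝒟) [F.Additive] [PreservesFiniteLimits F] :
    PreservesKer F := fun {K A B ι k} h =>
  IsKer.of_isLimit (c := KernelFork.ofι (F.map ι) (by rw [← F.map_comp, h.w, F.map_zero]))
    (isLimitForkMapOfIsLimit' F h.w h.isLimit)

lemma preservesCoker_of_preservesFiniteColimits (F : 𝒯 ⥤ 𝒟) [F.Additive]
    [PreservesFiniteColimits F] : PreservesCoker F :=
  have := preservesFiniteLimits_op F
  PreservesKer.unop (preservesKer_of_preservesFiniteLimits F.op)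

/-- A morphism whose canonical factorization is as in an abelian category. -/
def IsStrict {A B : 𝒯} (f : A ⟶ B) : Prop :=
  ∃ (K M Q : 𝒯) (ι : K ⟶ A) (e : A ⟶ M) (m : M ⟶ B) (p : B ⟶ Q),
    e ≫ m = f ∧ IsKer ι f ∧ IsCoker ι e ∧ IsKer m p ∧ IsCoker f p

lemma IsStrict.map {A B : 𝒯} {f : A ⟶ B} (h : IsStrict f) {F : 𝒯 ⥤ 𝒟} (hF : PreservesKer F)
    (hF' : PreservesCoker F) : IsStrict (F.map f) := by
  obtain ⟨K, M, Q, ι, e, m, p, rfl, h₁, h₂, h₃, h₄⟩ := h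
  exact ⟨_, _, _, _, _, _, _, (F.map_comp e m).symm, hF h₁, hF' h₂, hF h₃, hF' h₄⟩

lemma IsStrict.reflect (E : 𝒟 ⥤ 𝒟') [E.Additive] [E.IsEquivalence] {A B : 𝒟} {A' B' : 𝒟'}
    {f : A ⟶ B} {f' : A' ⟶ B'} (h : IsStrict f') (a : E.obj A ≅ A') (b : E.obj B ≅ B')
    (hf : E.map f ≫ b.hom = a.hom ≫ f') : IsStrict f := by
  obtain ⟨K, M, Q, ι, e, m, p, h₀, h₁, h₂, h₃, h₄⟩ := h
  let cK := E.objObjPreimageIso K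
  let cM := E.objObjPreimageIso M
  let cQ := E.objObjPreimageIso Q
  refine ⟨_, _, _, E.preimage (cK.hom ≫ ι ≫ a.inv), E.preimage (a.hom ≫ e ≫ cM.inv),
    E.preimage (cM.hom ≫ m ≫ b.inv), E.preimage (b.hom ≫ p ≫ cQ.inv), E.map_injective ?_,
    h₁.reflect E cK a b (by simp) hf, h₂.reflect E cK a cM (by simp) (by simp),
    h₃.reflect E cM b cQ (by simp) (by simp), h₄.reflect E a b cQ hf (by simp)⟩
  rw [← cancel_mono b.hom, hf, ← h₀]
  simp

/-- To show that `F` preserves kernels, it is enough to do so up to equivalences for some family of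
morphisms in the image of `Υ`. -/
lemma preservesKer_of_conj (Υ : 𝒯 ⥤ 𝒟) (hΥ : PreservesKer Υ)
    (hker : ∀ {A B : 𝒯} (k : A ⟶ B), ∃ (K : 𝒯) (ι : K ⟶ A), IsKer ι k) (F : 𝒟 ⥤ 𝒟)
    (h : ∀ {Z Z' : 𝒟} (f : Z ⟶ Z'), ∃ (E F' : 𝒟 ⥤ 𝒟) (_ : E.Additive) (_ : E.IsEquivalence)
      (_ : F ⋙ E ≅ E ⋙ F') (A B : 𝒯) (k : A ⟶ B) (a : E.obj Z ≅ Υ.obj A) (b : E.obj Z' ≅ Υ.obj B),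
      PreservesKer (Υ ⋙ F') ∧ E.map f ≫ b.hom = a.hom ≫ Υ.map k) : PreservesKer F := by
  intro K Z Z' ι f hf
  obtain ⟨E, F', _, _, e, A, B, k, a, b, hF', hk⟩ := h f
  obtain ⟨K', ι', h'⟩ := hker k
  let κ := E.preimage ((E.objObjPreimageIso (Υ.obj K')).hom ≫ Υ.map ι' ≫ a.inv)
  have hκ : E.map κ ≫ a.hom = (E.objObjPreimageIso (Υ.obj K')).hom ≫ Υ.map ι' := by simp [κ]
  obtain ⟨c, hc⟩ := hf.exists_iso ((hΥ h').reflect E _ a b hκ hk)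
  have hι : E.map ι ≫ a.hom =
      (E.mapIso c ≪≫ E.objObjPreimageIso (Υ.obj K')).hom ≫ Υ.map ι' := by
    rw [Iso.trans_hom, Functor.mapIso_hom, Category.assoc, ← hκ, ← E.map_comp_assoc, hc]
  refine (hF' h').reflect E (e.app _ ≪≫ F'.mapIso (E.mapIso c ≪≫ E.objObjPreimageIso (Υ.obj K')))
    (e.app _ ≪≫ F'.mapIso a) (e.app _ ≪≫ F'.mapIso b) ?_ ?_
  · have h₁ := e.hom.naturality ι
    simp only [Functor.comp_map] at h₁
    rw [Iso.trans_hom, Iso.trans_hom, Iso.app_hom, Iso.app_hom, reassoc_of% h₁, Functor.mapIso_hom,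
      Functor.mapIso_hom, ← F'.map_comp, hι, F'.map_comp, Category.assoc]
    rfl
  · have h₁ := e.hom.naturality f
    simp only [Functor.comp_map] at h₁
    rw [Iso.trans_hom, Iso.trans_hom, Iso.app_hom, Iso.app_hom, reassoc_of% h₁, Functor.mapIso_hom,
      Functor.mapIso_hom, ← F'.map_comp, hk, F'.map_comp, Category.assoc]
    rfl

end Kernels

section Abelian

universe u v

variable {𝒯 : Type u} [Category.{v} 𝒯]

lemma isKer_kernel [Preadditive 𝒯] {A B : 𝒯} (f : A ⟶ B) [HasKernel f] : IsKer (kernel.ι f) f :=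
  ⟨kernel.condition f, fun g hg => by rwa [← cancel_mono (kernel.ι f), zero_comp],
    fun g hg => ⟨kernel.lift f g hg, kernel.lift_ι f g hg⟩⟩

lemma IsAbelianCategory.isStrict [P : Preadditive 𝒯] (h : IsAbelianCategory 𝒯) {A B : 𝒯}
    (f : A ⟶ B) : IsStrict f := by
  obtain ⟨_, rfl⟩ := h
  have hk {A B : 𝒯} (f : A ⟶ B) : IsKer (kernel.ι f) f := isKer_kernel f
  have hc {A B : 𝒯} (f : A ⟶ B) : IsCoker f (cokernel.π f) :=
    ⟨cokernel.condition f, fun g hg => by rwa [← cancel_epi (cokernel.π f), comp_zero],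
      fun g hg => ⟨cokernel.desc f g hg, cokernel.π_desc f g hg⟩⟩
  exact ⟨_, _, _, kernel.ι f, Abelian.factorThruImage f, kernel.ι (cokernel.π f), cokernel.π f,
    Abelian.image.fac f, hk f, (hc (kernel.ι f)).reflect (𝟭 _) (Iso.refl _) (Iso.refl _)
      ((asIso (Abelian.coimageImageComparison f)).symm) (by simp) (by
        change Abelian.factorThruImage f ≫ inv (Abelian.coimageImageComparison f) =
          𝟙 A ≫ Abelian.coimage.π f
        rw [IsIso.comp_inv_eq, ← cancel_mono (Abelian.image.ι f), Abelian.image.fac,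
          Category.id_comp, Category.assoc, Abelian.coimage_image_factorisation]), hk _, hc f⟩

lemma isAbelianCategory_of_isStrict [P : Preadditive 𝒯] [HasZeroObject 𝒯] [HasBinaryBiproducts 𝒯]
    (h : ∀ {A B : 𝒯} (f : A ⟶ B), IsStrict f) : IsAbelianCategory 𝒯 := by
  have : HasFiniteProducts 𝒯 :=
    have := HasZeroObject.hasTerminal (C := 𝒯)
    hasFiniteProducts_of_has_binary_and_terminal
  have : HasKernels 𝒯 := ⟨fun f => by
    obtain ⟨K, M, Q, ι, e, m, p, h₀, h₁, h₂, h₃, h₄⟩ := h f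
    exact ⟨_, h₁.isLimit⟩⟩
  have : HasCokernels 𝒯 := ⟨fun f => by
    obtain ⟨K, M, Q, ι, e, m, p, h₀, h₁, h₂, h₃, h₄⟩ := h f
    exact ⟨_, h₄.isColimit⟩⟩
  have hm : IsNormalMonoCategory 𝒯 := ⟨fun {A B} f _ => by
    obtain ⟨K, M, Q, ι, e, m, p, h₀, h₁, h₂, h₃, h₄⟩ := h f
    obtain rfl : ι = 0 := by rw [← cancel_mono f, h₁.w, zero_comp]
    obtain ⟨d, hd⟩ := h₂.exists_desc (𝟙 A) zero_comp
    have h₅ : IsKer f p := ⟨h₄.w, fun g hg => by rwa [← cancel_mono f, zero_comp], fun g hg => by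
      obtain ⟨l, hl⟩ := h₃.exists_lift g hg
      have := h₂.epi
      have hd' : d ≫ e = 𝟙 M := by rw [← cancel_epi e, reassoc_of% hd, Category.comp_id]
      exact ⟨l ≫ d, by rw [← h₀, Category.assoc, reassoc_of% hd', hl]⟩⟩
    exact ⟨⟨_, p, h₅.w, h₅.isLimit⟩⟩⟩
  have he : IsNormalEpiCategory 𝒯 := ⟨fun {A B} f _ => by
    obtain ⟨K, M, Q, ι, e, m, p, h₀, h₁, h₂, h₃, h₄⟩ := h f
    obtain rfl : p = 0 := by rw [← cancel_epi f, h₄.w, comp_zero]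
    obtain ⟨d, hd⟩ := h₃.exists_lift (𝟙 B) comp_zero
    have h₅ : IsCoker ι f := ⟨h₁.w, fun g hg => by rwa [← cancel_epi f, comp_zero], fun g hg => by
      obtain ⟨l, hl⟩ := h₂.exists_desc g hg
      have := h₃.mono
      have hd' : m ≫ d = 𝟙 M := by rw [← cancel_mono m, Category.assoc, hd, Category.id_comp, Category.comp_id]
      exact ⟨d ≫ l, by rw [← h₀, Category.assoc, reassoc_of% hd', hl]⟩⟩
    exact ⟨⟨_, ι, h₅.w, h₅.isColimit⟩⟩⟩
  exact ⟨{ P, hm, he with }, rfl⟩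

universe u' v'

variable {𝒟 : Type u'} [Category.{v'} 𝒟]

lemma IsAbelianCategory.preservesFiniteLimits [P : Preadditive 𝒯] (h : IsAbelianCategory 𝒯)
    [P' : Preadditive 𝒟] (h' : IsAbelianCategory 𝒟) (F : 𝒯 ⥤ 𝒟) [F.Additive]
    (hF : PreservesKer F) : PreservesFiniteLimits F := by
  obtain ⟨_, rfl⟩ := h
  obtain ⟨_, rfl⟩ := h'
  have {X Y : 𝒯} (f : X ⟶ Y) : PreservesLimit (parallelPair f 0) F := by
    have hk := isKer_kernel f
    exact preservesLimit_of_preserves_limit_cone hk.isLimit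
      ((KernelFork.isLimitMapConeEquiv _ F).symm
        (IsLimit.ofIsoLimit (hF hk).isLimit (Fork.ext (Iso.refl _) (Category.id_comp _))))
  exact F.preservesFiniteLimits_of_preservesKernels

lemma IsAbelianCategory.op [P : Preadditive 𝒯] (h : IsAbelianCategory 𝒯) :
    IsAbelianCategory 𝒯ᵒᵖ := by
  obtain ⟨A, rfl⟩ := h
  exact ⟨inferInstance, rfl⟩

lemma IsAbelianCategory.isExactFunctor [P : Preadditive 𝒯] (h : IsAbelianCategory 𝒯)
    [P' : Preadditive 𝒟] (h' : IsAbelianCategory 𝒟) (F : 𝒯 ⥤ 𝒟) [F.Additive]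
    (hF : PreservesKer F) (hF' : PreservesCoker F) : IsExactFunctor F :=
  ⟨h.preservesFiniteLimits h' F hF,
    have := h.op.preservesFiniteLimits h'.op F.op hF'.op
    preservesFiniteColimits_of_op F⟩

end Abelian

/-! ### Abelian categories of fractions -/

section TwistEquivalence

variable {Λ : Type*} [AddCommGroup Λ] {𝒯 : Type*} [Category 𝒯] [Preadditive 𝒯]
  [MonoidalCategory 𝒯] [MonoidalPreadditive 𝒯]
  {𝒢 : MonoidalGrading Λ 𝒯} {q : InvertibleCentralObject 𝒯}
  {hq : 𝒢.homogeneous 0 (q.pow 1)} {φ ψ : Λ →+ ℤ}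

namespace Twist

lemma twist_hom_ext {X Z : 𝒯} {f g : obj hq φ (obj hq ψ X) ⟶ Z}
    (h : ∀ (l : Λ) (W : 𝒯), 𝒢.homogeneous l W → ∀ x : W ⟶ X,
      incl hq φ l (incl hq ψ l x) ≫ f = incl hq φ l (incl hq ψ l x) ≫ g) : f = g := by
  refine hom_ext fun l W hW x => ?_
  by_cases hl : l ∈ (𝒢.dec X).s
  · have h₁ : x = (x ≫ π hq ψ X l) ≫ incl hq ψ l ((𝒢.dec X).ι l) := by
      have h₂ : x ≫ π hq ψ X l ≫ ι hq ψ X l = x := (dec hq ψ X).comp_π_ι hW x hl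
      rw [incl, (𝒢.dec X).ι_π l hl, MonoidalCategory.whiskerLeft_id, Category.id_comp,
        Category.assoc, h₂]
    rw [h₁, ← whiskerLeft_incl, Category.assoc, Category.assoc, h l _ ((𝒢.dec X).mem l hl)]
  · rw [(dec hq ψ X).comp_eq_zero hW x hl, incl_zero, zero_comp, zero_comp]

/-- Opposite powers cancel. -/
noncomputable def powCancel (h : φ + ψ = 0) (l : Λ) (W : 𝒯) :
    q.pow (φ l) ⊗ (q.pow (ψ l) ⊗ W) ≅ W :=
  (α_ _ _ _).symm ≪≫ whiskerRightIso (q.powInv (φ l) (ψ l) (DFunLike.congr_fun h l)) W ≪≫ λ_ W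

lemma powCancel_natural (h : φ + ψ = 0) (l : Λ) {W W' : 𝒯} (x : W ⟶ W') :
    q.pow (φ l) ◁ q.pow (ψ l) ◁ x ≫ (powCancel h l W').hom = (powCancel h l W).hom ≫ x := by
  simp only [powCancel, Iso.trans_hom, Iso.symm_hom, whiskerRightIso_hom, Category.assoc]
  rw [associator_inv_naturality_right_assoc, whisker_exchange_assoc, leftUnitor_naturality]

lemma exists_twist_iso (h : φ + ψ = 0) (X : 𝒯) : ∃ e : obj hq φ (obj hq ψ X) ≅ X,
    ∀ (l : Λ) (W : 𝒯), 𝒢.homogeneous l W → ∀ x : W ⟶ X,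
      incl hq φ l (incl hq ψ l x) ≫ e.hom = (powCancel h l W).hom ≫ x := by
  let f : obj hq φ (obj hq ψ X) ⟶ X := ∑ l ∈ (𝒢.dec X).s,
    proj hq φ l (proj hq ψ l ((𝒢.dec X).π l)) ≫ (powCancel h l _).hom ≫ (𝒢.dec X).ι l
  let g : X ⟶ obj hq φ (obj hq ψ X) := ∑ l ∈ (𝒢.dec X).s,
    (𝒢.dec X).π l ≫ (powCancel h l _).inv ≫ incl hq φ l (incl hq ψ l ((𝒢.dec X).ι l))
  have hf (l : Λ) (W : 𝒯) (hW : 𝒢.homogeneous l W) (x : W ⟶ X) :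
      incl hq φ l (incl hq ψ l x) ≫ f = (powCancel h l W).hom ≫ x := by
    by_cases hl : l ∈ (𝒢.dec X).s
    · rw [Preadditive.comp_sum, Finset.sum_eq_single_of_mem l hl,
        reassoc_of% (incl_proj (q.pow_tensor_mem hq (ψ l) hW)), incl_proj hW,
        reassoc_of% powCancel_natural, Category.assoc, (𝒢.dec X).comp_π_ι hW x hl]
      intro m hm hml
      rw [← Category.assoc, incl_proj_eq_zero (q.pow_tensor_mem hq _ hW)
        (q.pow_tensor_mem hq _ ((𝒢.dec X).mem m hm)), zero_comp]
      exact incl_proj_eq_zero hW ((𝒢.dec X).mem m hm) _ _ ((𝒢.dec X).eq_zero hW x hm hml.symm)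
    · simp [(𝒢.dec X).comp_eq_zero hW x hl, incl_zero]
  refine ⟨⟨f, g, twist_hom_ext fun l W hW x => ?_, ?_⟩, hf⟩
  · rw [reassoc_of% (hf l W hW x), Category.comp_id]
    by_cases hl : l ∈ (𝒢.dec X).s
    · rw [Preadditive.comp_sum, Finset.sum_eq_single_of_mem l hl, ← Category.assoc x,
        ← reassoc_of% powCancel_natural, Iso.hom_inv_id_assoc, whiskerLeft_incl,
        whiskerLeft_incl, Category.assoc, (𝒢.dec X).comp_π_ι hW x hl]
      intro m hm hml
      rw [← Category.assoc, (𝒢.dec X).eq_zero hW x hm hml.symm, zero_comp]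
    · simp [(𝒢.dec X).comp_eq_zero hW x hl, incl_zero]
  · rw [Preadditive.sum_comp, ← (𝒢.dec X).sum]
    refine Finset.sum_congr rfl fun l hl => ?_
    rw [Category.assoc, Category.assoc, hf l _ ((𝒢.dec X).mem l hl), Iso.inv_hom_id_assoc]

/-- Opposite twists cancel. -/
noncomputable def twistIso (h : φ + ψ = 0) :
    Twist.functor hq ψ ⋙ Twist.functor hq φ ≅ 𝟭 𝒯 :=
  NatIso.ofComponents (fun X => (exists_twist_iso h X).choose) fun {X Y} f =>
    twist_hom_ext fun l W hW x => by
      have h₁ (X : 𝒯) := (exists_twist_iso (hq := hq) h X).choose_spec l W hW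
      change incl hq φ l (incl hq ψ l x) ≫ map (map f) ≫ _ = incl hq φ l (incl hq ψ l x) ≫ _ ≫ f
      rw [reassoc_of% (incl_map (hq := hq) (q.pow_tensor_mem hq (ψ l) hW)), incl_map hW, h₁,
        reassoc_of% h₁]

instance : (Twist.functor hq φ).IsEquivalence :=
  (CategoryTheory.Equivalence.mk (Twist.functor hq φ) (Twist.functor hq (-φ))
    (twistIso (neg_add_cancel φ)).symm (twistIso (add_neg_cancel φ))).isEquivalence_functor

instance : (Twist.functor hq φ).Additive := ⟨Twist.map_add _ _⟩

end Twist

variable {I : Type*} (C : I → GradedBraider 𝒢 q)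

instance (w : List I) : (wordTwist hq C w).IsEquivalence := by
  induction w with
  | nil => exact inferInstanceAs (𝟭 𝒯).IsEquivalence
  | cons i w ih => exact inferInstanceAs (wordTwist hq C w ⋙ Twist.functor hq (C i).φ).IsEquivalence

instance (w : List I) : (wordTwist hq C w).Additive := by
  induction w with
  | nil => exact inferInstanceAs (𝟭 𝒯).Additive
  | cons i w ih => exact inferInstanceAs (wordTwist hq C w ⋙ Twist.functor hq (C i).φ).Additive

end TwistEquivalence

section ExactFractions

universe u v x y w u' v'

variable {R : Type x} [CommRing R] {𝒯 : Type u} [Category.{v} 𝒯] [Preadditive 𝒯] [Linear R 𝒯]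
  [MonoidalCategory 𝒯] [MonoidalPreadditive 𝒯] [MonoidalLinear R 𝒯]

open Frac GradedBraider Functor.LaxMonoidal Functor.OplaxMonoidal

lemma HasExactTensor.preservesKer_tensorLeft (hT : HasExactTensor 𝒯) (X : 𝒯) :
    PreservesKer (tensorLeft X) :=
  have := (hT X).1.1
  preservesKer_of_preservesFiniteLimits _

lemma HasExactTensor.preservesKer_tensorRight (hT : HasExactTensor 𝒯) (X : 𝒯) :
    PreservesKer (tensorRight X) :=
  have := (hT X).2.1
  preservesKer_of_preservesFiniteLimits _

lemma HasExactTensor.preservesCoker_tensorLeft (hT : HasExactTensor 𝒯) (X : 𝒯) :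
    PreservesCoker (tensorLeft X) :=
  have := (hT X).1.2
  preservesCoker_of_preservesFiniteColimits _

lemma HasExactTensor.preservesCoker_tensorRight (hT : HasExactTensor 𝒯) (X : 𝒯) :
    PreservesCoker (tensorRight X) :=
  have := (hT X).2.2
  preservesCoker_of_preservesFiniteColimits _

/-- Sequences of formal fractions that induce left exact sequences of morphisms. -/
inductive IsLeftExact : ∀ {P Q S : Frac R 𝒯}, (P ⟶ Q) → (Q ⟶ S) → Prop
  | right (A : 𝒯) {K X Y : 𝒯} {ι : K ⟶ X} {k : X ⟶ Y} (h : IsKer ι k) :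
      IsLeftExact (right R A ι) (right R A k)
  | left (Z : 𝒯) {X Y Q : 𝒯} {k : X ⟶ Y} {p : Y ⟶ Q} (h : IsCoker k p) :
      IsLeftExact (left R p Z) (left R k Z)

lemma IsLeftExact.homRep_eq_zero {P Q S : Frac R 𝒯} {u : P ⟶ Q} {v : Q ⟶ S} (h : IsLeftExact u v)
    (f : P.den ⟶ P.num) (hf : ((homRep R 𝒯).functor.map u).hom f = 0) : f = 0 := by
  cases h with
  | right A h => exact h.eq_zero f hf
  | left Z h => exact h.eq_zero f hf

lemma IsLeftExact.exists_homRep {P Q S : Frac R 𝒯} {u : P ⟶ Q} {v : Q ⟶ S} (h : IsLeftExact u v)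
    (f : Q.den ⟶ Q.num) (hf : ((homRep R 𝒯).functor.map v).hom f = 0) :
    ∃ j : P.den ⟶ P.num, ((homRep R 𝒯).functor.map u).hom j = f := by
  cases h with
  | right A h => exact h.exists_lift f hf
  | left Z h => exact h.exists_desc f hf

variable {𝒟 : Type u'} [Category.{v'} 𝒟] [Preadditive 𝒟] [Linear R 𝒟] [MonoidalCategory 𝒟]
  [MonoidalPreadditive 𝒟] [MonoidalLinear R 𝒟]
  {Υ : 𝒯 ⥤ 𝒟} [Υ.Monoidal] [Υ.Additive] [Υ.Linear R]
  {Λ : Type y} [AddCommGroup Λ] {𝒢 : MonoidalGrading Λ 𝒯} {q : InvertibleCentralObject 𝒯}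
  {hq : 𝒢.homogeneous 0 (q.pow 1)} {I : Type w} {C : I → GradedBraider 𝒢 q}
  (hΥ : InvertsBraiders C Υ) (hF : IsFractionCategory C Υ) (hT : HasExactTensor 𝒯)

include hT in
lemma IsLeftExact.map {P Q S : Frac R 𝒯} {u : P ⟶ Q} {v : Q ⟶ S} (h : IsLeftExact u v)
    {Φ : Frac R 𝒯 ⥤ Frac R 𝒯} {τ : 𝟭 (Frac R 𝒯) ⟶ Φ}
    (hτ : PointedFamily.IsComposite (fun i => (C i).expand R hq) Φ τ) :
    IsLeftExact (Φ.map u) (Φ.map v) := by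
  induction hτ generalizing P Q S with
  | id => exact h
  | of i =>
    cases h with
    | right A h =>
      exact .right _ (hT.preservesKer_tensorRight (C i).obj
        (preservesKer_of_preservesFiniteLimits (Twist.functor hq (C i).φ) h))
    | left Z h => exact .left _ (hT.preservesCoker_tensorLeft (C i).obj h)
  | comp _ _ h₁ h₂ => exact h₂ (h₁ h)

include hΥ in
lemma bijective_homOf_map {Φ : Frac R 𝒯 ⥤ Frac R 𝒯} {τ : 𝟭 (Frac R 𝒯) ⟶ Φ}
    (hτ : PointedFamily.IsComposite (fun i => (C i).expand R hq) Φ τ) (X : Frac R 𝒯) :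
    Function.Bijective ((homOf R Υ).map (τ.app X)).hom :=
  (ConcreteCategory.isIso_iff_bijective _).1 (PointedFamily.isIso_map_of_isComposite (homOf R Υ)
    (isIso_homOf_map_expand Υ hq hΥ) hτ X)

lemma homOf_naturality {Φ : Frac R 𝒯 ⥤ Frac R 𝒯} (τ : 𝟭 (Frac R 𝒯) ⟶ Φ) {X Y : Frac R 𝒯}
    (u : X ⟶ Y) (f : Υ.obj X.den ⟶ Υ.obj X.num) :
    ((homOf R Υ).map (τ.app Y)).hom (((homOf R Υ).map u).hom f) =
      ((homOf R Υ).map (Φ.map u)).hom (((homOf R Υ).map (τ.app X)).hom f) := by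
  have h := congrArg (homOf R Υ).map (τ.naturality u)
  exact congrArg (fun φ => φ.hom f) (((homOf R Υ).map_comp u (τ.app Y)).symm.trans
    (h.trans ((homOf R Υ).map_comp (τ.app X) (Φ.map u))))

include hF hq in
/-- A fraction killed by `w` becomes, after expansion, a morphism of `𝒯` killed by `w`. -/
lemma IsFractionCategory.exists_expansion {Q S : Frac R 𝒯} (w : Q ⟶ S) (f : Υ.obj Q.den ⟶ Υ.obj Q.num)
    (hf : ((homOf R Υ).map w).hom f = 0) :
    ∃ (Φ : Frac R 𝒯 ⥤ Frac R 𝒯) (τ : 𝟭 (Frac R 𝒯) ⟶ Φ),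
      PointedFamily.IsComposite (fun i => (C i).expand R hq) Φ τ ∧
      ∃ k : (Φ.obj Q).den ⟶ (Φ.obj Q).num, ((homOf R Υ).map (τ.app Q)).hom f = Υ.map k ∧
        ((homRep R 𝒯).functor.map (Φ.map w)).hom k = 0 := by
  obtain ⟨Φ, τ, hτ, k, hk⟩ := hF.isExpandable R hq f
  have h₁ : Υ.map (((homRep R 𝒯).functor.map (Φ.map w)).hom k) = 0 := by
    refine (homOf_map_map Υ (Φ.map w) k).symm.trans ?_
    refine ((congrArg ((homOf R Υ).map (Φ.map w)).hom hk.symm).trans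
      (homOf_naturality τ w f).symm).trans ?_
    exact (congrArg ((homOf R Υ).map (τ.app S)).hom hf).trans (map_zero _)
  obtain ⟨Ψ, σ, hσ, hk'⟩ := hF.isExpandedToZero R hq _ h₁
  refine ⟨_, _, hτ.comp hσ, ((homRep R 𝒯).functor.map (σ.app (Φ.obj Q))).hom k, ?_, ?_⟩
  · have h₂ := (homOf R Υ).map_comp (τ.app Q) (σ.app (Φ.obj Q))
    exact (congrArg (fun φ => φ.hom f) h₂).trans ((congrArg ((homOf R Υ).map
      (σ.app (Φ.obj Q))).hom hk).trans (homOf_map_map Υ (σ.app (Φ.obj Q)) k))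
  · have h₂ := congrArg (homRep R 𝒯).functor.map (σ.naturality (Φ.map w))
    exact (congrArg (fun φ => φ.hom k) (((homRep R 𝒯).functor.map_comp (Φ.map w)
      (σ.app (Φ.obj S))).symm.trans (h₂.trans ((homRep R 𝒯).functor.map_comp
      (σ.app (Φ.obj Q)) (Ψ.map (Φ.map w)))))).symm.trans hk'

include hΥ hF hq hT in
lemma IsLeftExact.homOf_eq_zero {P Q S : Frac R 𝒯} {u : P ⟶ Q} {v : Q ⟶ S} (h : IsLeftExact u v)
    (f : Υ.obj P.den ⟶ Υ.obj P.num) (hf : ((homOf R Υ).map u).hom f = 0) : f = 0 := by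
  obtain ⟨Φ, τ, hτ, k, hk, hk'⟩ := hF.exists_expansion (hq := hq) u f hf
  have h₁ := (h.map hT hτ).homRep_eq_zero k hk'
  refine (bijective_homOf_map hΥ hτ P).1 (hk.trans ?_)
  rw [h₁, Υ.map_zero]
  exact (map_zero _).symm

include hΥ hF hq hT in
lemma IsLeftExact.exists_homOf {P Q S : Frac R 𝒯} {u : P ⟶ Q} {v : Q ⟶ S} (h : IsLeftExact u v)
    (f : Υ.obj Q.den ⟶ Υ.obj Q.num) (hf : ((homOf R Υ).map v).hom f = 0) :
    ∃ j : Υ.obj P.den ⟶ Υ.obj P.num, ((homOf R Υ).map u).hom j = f := by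
  obtain ⟨Φ, τ, hτ, k, hk, hk'⟩ := hF.exists_expansion (hq := hq) v f hf
  obtain ⟨j, hj⟩ := (h.map hT hτ).exists_homRep k hk'
  obtain ⟨j', hj'⟩ := (bijective_homOf_map hΥ hτ P).2 (Υ.map j)
  refine ⟨j', (bijective_homOf_map hΥ hτ Q).1 ?_⟩
  refine (homOf_naturality τ u j').trans ((congrArg ((homOf R Υ).map (Φ.map u)).hom hj').trans ?_)
  exact (homOf_map_map Υ (Φ.map u) j).trans ((congrArg Υ.map hj).trans hk.symm)

variable (R)

include R hΥ hF hq hT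

lemma IsFractionCategory.preservesKer : PreservesKer Υ := by
  intro K A B ι k hk
  have key (v : List I) := hT.preservesKer_tensorLeft (wordObj C v) hk
  refine ⟨by rw [← Υ.map_comp, hk.w, Υ.map_zero], fun {W} g hg => ?_, fun {W} g hg => ?_⟩
  · obtain ⟨v, V, ⟨e⟩⟩ := hF.exists_denominator W
    have := (hΥ.isInvertibleObj_word Υ v).1
    have h := (IsLeftExact.right (R := R) V (key v)).homOf_eq_zero (hq := hq) hΥ hF hT
      (e.inv ≫ _ ◁ g ≫ μ Υ _ _) (by
        refine (homOf_map_right Υ V _ _).trans ?_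
        change (e.inv ≫ _ ◁ g ≫ μ Υ _ _) ≫ Υ.map (_ ◁ ι) = 0
        rw [Category.assoc, Category.assoc, ← μ_natural_right, ← MonoidalCategory.whiskerLeft_comp_assoc,
          hg]
        simp)
    apply (tensorLeft (Υ.obj (wordObj C v))).map_injective
    rw [Functor.map_zero, ← cancel_mono (μ Υ _ _), ← cancel_epi e.inv]
    simpa using h
  · obtain ⟨v, V, ⟨e⟩⟩ := hF.exists_denominator W
    have := (hΥ.isInvertibleObj_word Υ v).1
    obtain ⟨j, hj⟩ := (IsLeftExact.right (R := R) V (key v)).exists_homOf (hq := hq) hΥ hF hT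
      (e.inv ≫ _ ◁ g ≫ μ Υ _ _) (by
        refine (homOf_map_right Υ V _ _).trans ?_
        change (e.inv ≫ _ ◁ g ≫ μ Υ _ _) ≫ Υ.map (_ ◁ k) = 0
        rw [Category.assoc, Category.assoc, ← μ_natural_right, ← MonoidalCategory.whiskerLeft_comp_assoc,
          hg]
        simp)
    have hj' : j ≫ Υ.map (_ ◁ ι) = e.inv ≫ _ ◁ g ≫ μ Υ _ _ := hj
    refine ⟨(tensorLeft (Υ.obj (wordObj C v))).preimage (e.hom ≫ j ≫ δ Υ _ _),
      (tensorLeft (Υ.obj (wordObj C v))).map_injective ?_⟩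
    rw [Functor.map_comp, Functor.map_preimage, ← cancel_mono (μ Υ _ _), ← cancel_epi e.inv]
    simpa using hj'

lemma IsFractionCategory.preservesCoker : PreservesCoker Υ := by
  intro A B Q k p hk
  have key (v : List I) := hT.preservesCoker_tensorLeft (wordObj C v) hk
  refine ⟨by rw [← Υ.map_comp, hk.w, Υ.map_zero], fun {W} g hg => ?_, fun {W} g hg => ?_⟩
  · obtain ⟨v, V, ⟨e⟩⟩ := hF.exists_denominator W
    have := (hΥ.isInvertibleObj_word Υ v).1
    have h := (IsLeftExact.left (R := R) V (key v)).homOf_eq_zero (hq := hq) hΥ hF hT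
      (δ Υ _ _ ≫ _ ◁ g ≫ e.hom) (by
        refine (homOf_map_left Υ _ V _).trans ?_
        change Υ.map (_ ◁ p) ≫ δ Υ _ _ ≫ _ ◁ g ≫ e.hom = 0
        rw [← δ_natural_right_assoc, ← MonoidalCategory.whiskerLeft_comp_assoc, hg]
        simp)
    apply (tensorLeft (Υ.obj (wordObj C v))).map_injective
    rw [Functor.map_zero, ← cancel_mono e.hom, ← cancel_epi (δ Υ _ _)]
    simpa using h
  · obtain ⟨v, V, ⟨e⟩⟩ := hF.exists_denominator W
    have := (hΥ.isInvertibleObj_word Υ v).1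
    obtain ⟨j, hj⟩ := (IsLeftExact.left (R := R) V (key v)).exists_homOf (hq := hq) hΥ hF hT
      (δ Υ _ _ ≫ _ ◁ g ≫ e.hom) (by
        refine (homOf_map_left Υ _ V _).trans ?_
        change Υ.map (_ ◁ k) ≫ δ Υ _ _ ≫ _ ◁ g ≫ e.hom = 0
        rw [← δ_natural_right_assoc, ← MonoidalCategory.whiskerLeft_comp_assoc, hg]
        simp)
    have hj' : Υ.map (_ ◁ p) ≫ j = δ Υ _ _ ≫ _ ◁ g ≫ e.hom := hj
    refine ⟨(tensorLeft (Υ.obj (wordObj C v))).preimage (μ Υ _ _ ≫ j ≫ e.inv),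
      (tensorLeft (Υ.obj (wordObj C v))).map_injective ?_⟩
    rw [Functor.map_comp, Functor.map_preimage, ← cancel_mono e.hom, ← cancel_epi (δ Υ _ _)]
    simpa using hj'

end ExactFractions

section AbelianFractions

universe u v x y w u' v'

variable (R : Type x) [CommRing R] {𝒯 : Type u} [Category.{v} 𝒯] [Preadditive 𝒯] [Linear R 𝒯]
  [MonoidalCategory 𝒯] [MonoidalPreadditive 𝒯] [MonoidalLinear R 𝒯]
  {𝒟 : Type u'} [Category.{v'} 𝒟] [Preadditive 𝒟] [Linear R 𝒟] [MonoidalCategory 𝒟]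
  [MonoidalPreadditive 𝒟] [MonoidalLinear R 𝒟]
  {Υ : 𝒯 ⥤ 𝒟} [Υ.Monoidal] [Υ.Additive] [Υ.Linear R]
  {Λ : Type y} [AddCommGroup Λ] {𝒢 : MonoidalGrading Λ 𝒯} {q : InvertibleCentralObject 𝒯}
  (hq : 𝒢.homogeneous 0 (q.pow 1)) {I : Type w} {C : I → GradedBraider 𝒢 q}
  (hΥ : InvertsBraiders C Υ) (hF : IsFractionCategory C Υ) (hT : HasExactTensor 𝒯)

lemma preservesCoker_of_conj {𝒯 𝒟 : Type*} [Category 𝒯] [Preadditive 𝒯] [Category 𝒟]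
    [Preadditive 𝒟] (Υ : 𝒯 ⥤ 𝒟) (hΥ : PreservesCoker Υ)
    (hcoker : ∀ {A B : 𝒯} (k : A ⟶ B), ∃ (Q : 𝒯) (p : B ⟶ Q), IsCoker k p) (F : 𝒟 ⥤ 𝒟)
    (h : ∀ {Z Z' : 𝒟} (f : Z ⟶ Z'), ∃ (E F' : 𝒟 ⥤ 𝒟) (_ : E.Additive) (_ : E.IsEquivalence)
      (_ : F ⋙ E ≅ E ⋙ F') (A B : 𝒯) (k : A ⟶ B) (a : E.obj Z ≅ Υ.obj A) (b : E.obj Z' ≅ Υ.obj B),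
      PreservesCoker (Υ ⋙ F') ∧ E.map f ≫ b.hom = a.hom ≫ Υ.map k) : PreservesCoker F := by
  refine PreservesKer.unop (preservesKer_of_conj Υ.op hΥ.op (fun k => ?_) F.op fun f => ?_)
  · obtain ⟨Q, p, hp⟩ := hcoker k.unop
    exact ⟨_, p.op, hp.op⟩
  · obtain ⟨E, F', _, _, e, A, B, k, a, b, h₁, h₂⟩ := h f.unop
    refine ⟨E.op, F'.op, inferInstance, inferInstance, (NatIso.op e).symm, _, _, k.op, b.symm.op,
      a.symm.op, h₁.op, Quiver.Hom.unop_inj ?_⟩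
    change a.inv ≫ E.map f.unop = Υ.map k ≫ b.inv
    rw [Iso.inv_comp_eq, ← reassoc_of% h₂]
    simp

open Frac GradedBraider Functor.LaxMonoidal Functor.OplaxMonoidal

include R in
lemma exists_isInvertibleObj_of_isComposite {Φ : Frac R 𝒯 ⥤ Frac R 𝒯} {τ : 𝟭 (Frac R 𝒯) ⟶ Φ}
    (hΥ : InvertsBraiders C Υ)
    (h : PointedFamily.IsComposite (fun i => (C i).expand R hq) Φ τ) (X : Frac R 𝒯) :
    ∃ (T : 𝒟) (_ : IsInvertibleObj T) (a : T ⊗ Υ.obj X.den ≅ Υ.obj (Φ.obj X).den)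
      (b : T ⊗ Υ.obj X.num ≅ Υ.obj (Φ.obj X).num), ∀ f : Υ.obj X.den ⟶ Υ.obj X.num,
        T ◁ f ≫ b.hom = a.hom ≫ ((homOf R Υ).map (τ.app X)).hom f := by
  induction h generalizing X with
  | id =>
    refine ⟨𝟙_ 𝒟, isInvertibleObj_unit 𝒟, λ_ _, λ_ _, fun f => ?_⟩
    have h : ((homOf R Υ).map ((𝟙 (𝟭 (Frac R 𝒯)) : 𝟭 (Frac R 𝒯) ⟶ _).app X)).hom f = f := by
      rw [NatTrans.id_app, CategoryTheory.Functor.map_id]; rfl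
    exact (leftUnitor_naturality f).trans (congrArg ((λ_ (Υ.obj X.den)).hom ≫ ·) h.symm)
  | of i =>
    obtain ⟨A, Z⟩ := X
    have := hΥ.isIso_map_braid hq Υ i Z
    refine ⟨_, hΥ.1 i, Functor.Monoidal.μIso Υ _ A,
      Functor.Monoidal.μIso Υ _ Z ≪≫ @asIso _ _ _ _ (Υ.map ((C i).braid hq Z)) this, fun f => ?_⟩
    change _ = μ Υ _ A ≫ (δ Υ (C i).obj A ≫ Υ.obj (C i).obj ◁ f ≫ μ Υ (C i).obj Z) ≫
      Υ.map ((C i).braid hq Z)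
    simp only [Category.assoc, Functor.Monoidal.μ_δ_assoc]
    rfl
  | @comp Φ Ψ τ σ h h' ih ih' =>
    obtain ⟨T, hT, a, b, h₁⟩ := ih X
    obtain ⟨T', hT', a', b', h₂⟩ := ih' (Φ.obj X)
    refine ⟨T' ⊗ T, hT'.tensor hT, α_ _ _ _ ≪≫ whiskerLeftIso T' a ≪≫ a',
      α_ _ _ _ ≪≫ whiskerLeftIso T' b ≪≫ b', fun f => ?_⟩
    let y : Υ.obj (Φ.obj X).den ⟶ Υ.obj (Φ.obj X).num := ((homOf R Υ).map (τ.app X)).hom f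
    let z : Υ.obj (Ψ.obj (Φ.obj X)).den ⟶ Υ.obj (Ψ.obj (Φ.obj X)).num :=
      ((homOf R Υ).map (σ.app (Φ.obj X))).hom y
    have h₃ : ((homOf R Υ).map ((PointedFamily.comp τ σ).app X)).hom f = z :=
      congrArg (fun φ => φ.hom f) ((homOf R Υ).map_comp (τ.app X) (σ.app (Φ.obj X)))
    refine Eq.trans ?_ (congrArg ((α_ T' T _ ≪≫ whiskerLeftIso T' a ≪≫ a').hom ≫ ·) h₃.symm)
    have h₄ : T ◁ f ≫ b.hom = a.hom ≫ y := h₁ f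
    have h₅ : T' ◁ y ≫ b'.hom = a'.hom ≫ z := h₂ y
    simp only [Iso.trans_hom, whiskerLeftIso_hom, Category.assoc]
    rw [associator_naturality_right_assoc, ← MonoidalCategory.whiskerLeft_comp_assoc, h₄,
      MonoidalCategory.whiskerLeft_comp_assoc, h₅]

include R hΥ hF hq in
/-- Up to tensoring with an invertible object, every morphism comes from `𝒯`. -/
lemma IsFractionCategory.exists_conj {Z Z' : 𝒟} (f : Z ⟶ Z') :
    ∃ (T : 𝒟) (_ : IsInvertibleObj T) (A B : 𝒯) (k : A ⟶ B) (a : T ⊗ Z ≅ Υ.obj A)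
      (b : T ⊗ Z' ≅ Υ.obj B), T ◁ f ≫ b.hom = a.hom ≫ Υ.map k := by
  obtain ⟨v, X, ⟨e⟩⟩ := hF.exists_denominator Z
  obtain ⟨v', X', ⟨e'⟩⟩ := hF.exists_denominator Z'
  let d := appendDenominator Υ v' e
  let d' := hΥ.prependDenominator hq Υ v e'
  let g := d.inv ≫ _ ◁ f ≫ d'.hom
  obtain ⟨Φ, τ, hτ, k, hk⟩ := hF.isExpandable R hq g
  obtain ⟨T, hT, a, b, h⟩ := exists_isInvertibleObj_of_isComposite R hq hΥ hτ ⟨_, _⟩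
  refine ⟨_, hT.tensor (hΥ.isInvertibleObj_word Υ (v' ++ v)), _, _, k,
    α_ _ _ _ ≪≫ whiskerLeftIso T d ≪≫ a, α_ _ _ _ ≪≫ whiskerLeftIso T d' ≪≫ b, ?_⟩
  have h₁ : T ◁ g ≫ b.hom = a.hom ≫ Υ.map k := (h g).trans (congrArg (a.hom ≫ ·) hk)
  simp only [Iso.trans_hom, whiskerLeftIso_hom, Category.assoc]
  rw [← h₁, associator_naturality_right_assoc, ← MonoidalCategory.whiskerLeft_comp_assoc,
    ← MonoidalCategory.whiskerLeft_comp_assoc]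
  simp [g]

/-- Moving a word past `Υ` in a tensor product on the right. -/
noncomputable def InvertsBraiders.tensorRightIso (hΥ : InvertsBraiders C Υ) {v : List I} {Z : 𝒟}
    {X : 𝒯} (e : Υ.obj (wordObj C v) ⊗ Z ≅ Υ.obj X) :
    (Υ ⋙ tensorRight Z) ⋙ tensorLeft (Υ.obj (wordObj C v)) ≅
      (wordTwist hq C v ⋙ tensorRight X) ⋙ Υ :=
  NatIso.ofComponents (fun A => (α_ _ (Υ.obj A) Z).symm ≪≫ whiskerRightIso (hΥ.wordIso hq Υ v A) Z ≪≫
    α_ _ _ _ ≪≫ whiskerLeftIso _ e ≪≫ Functor.Monoidal.μIso Υ _ _) fun {A B} f => by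
      have h := congrArg (fun g => g ▷ Z) (hΥ.wordIso_natural hq Υ v f)
      simp only [comp_whiskerRight] at h
      change _ ◁ (Υ.map f ▷ Z) ≫ ((α_ _ _ _).inv ≫ (hΥ.wordIso hq Υ v B).hom ▷ Z ≫ (α_ _ _ _).hom ≫
        _ ◁ e.hom ≫ μ Υ _ _) = ((α_ _ _ _).inv ≫ (hΥ.wordIso hq Υ v A).hom ▷ Z ≫ (α_ _ _ _).hom ≫
        _ ◁ e.hom ≫ μ Υ _ _) ≫ Υ.map ((wordTwist hq C v).map f ▷ X)
      simp only [Category.assoc]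
      rw [associator_inv_naturality_middle_assoc, reassoc_of% h, associator_naturality_left_assoc,
        ← whisker_exchange_assoc, μ_natural_left]

/-- Clearing the denominator of a tensor factor on the left. -/
noncomputable def tensorLeftDenominatorIso {V Z : 𝒟} {X : 𝒯} (e : V ⊗ Z ≅ Υ.obj X) :
    (Υ ⋙ tensorLeft Z) ⋙ tensorLeft V ≅ tensorLeft X ⋙ Υ :=
  NatIso.ofComponents (fun A => (α_ V Z (Υ.obj A)).symm ≪≫ whiskerRightIso e _ ≪≫
    Functor.Monoidal.μIso Υ _ _) fun {A B} f => by
      change V ◁ (Z ◁ Υ.map f) ≫ ((α_ _ _ _).inv ≫ e.hom ▷ _ ≫ μ Υ _ _) =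
        ((α_ _ _ _).inv ≫ e.hom ▷ _ ≫ μ Υ _ _) ≫ Υ.map (X ◁ f)
      simp only [Category.assoc]
      rw [associator_inv_naturality_right_assoc, whisker_exchange_assoc, μ_natural_right]

include R hΥ hF hq in
lemma IsFractionCategory.hasBinaryBiproducts [HasBinaryBiproducts 𝒯] : HasBinaryBiproducts 𝒟 := by
  refine ⟨fun Z Z' => ?_⟩
  obtain ⟨v, X, ⟨e⟩⟩ := hF.exists_denominator Z
  obtain ⟨v', X', ⟨e'⟩⟩ := hF.exists_denominator Z'
  let d := appendDenominator Υ v' e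
  let d' := hΥ.prependDenominator hq Υ v e'
  have := (hΥ.isInvertibleObj_word Υ (v' ++ v)).1
  let E := tensorLeft (Υ.obj (wordObj C (v' ++ v)))
  let P := (wordObj C v' ⊗ X) ⊞ ((wordTwist hq C v').obj (wordObj C v) ⊗ X')
  let c := E.objObjPreimageIso (Υ.obj P)
  refine hasBinaryBiproduct_of_total
    { pt := E.objPreimage (Υ.obj P)
      fst := E.preimage (c.hom ≫ Υ.map biprod.fst ≫ d.inv)
      snd := E.preimage (c.hom ≫ Υ.map biprod.snd ≫ d'.inv)
      inl := E.preimage (d.hom ≫ Υ.map biprod.inl ≫ c.inv)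
      inr := E.preimage (d'.hom ≫ Υ.map biprod.inr ≫ c.inv)
      inl_fst := E.map_injective ?_
      inl_snd := E.map_injective ?_
      inr_fst := E.map_injective ?_
      inr_snd := E.map_injective ?_ } (E.map_injective ?_)
  · rw [E.map_comp, E.map_preimage, E.map_preimage]
    simp [← Υ.map_comp_assoc]
  · simp [← Υ.map_comp_assoc]
  · simp [← Υ.map_comp_assoc]
  · rw [E.map_comp, E.map_preimage, E.map_preimage]
    simp [← Υ.map_comp_assoc]
  · simp only [Functor.map_add, Functor.map_comp, Functor.map_preimage, Category.assoc,
      Iso.inv_hom_id_assoc, CategoryTheory.Functor.map_id]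
    have h : Υ.map biprod.fst ≫ Υ.map biprod.inl + Υ.map biprod.snd ≫ Υ.map biprod.inr =
        𝟙 (Υ.obj P) := by
      rw [← Υ.map_comp, ← Υ.map_comp, ← Υ.map_add, biprod.total, Υ.map_id]
    have h' := congrArg (fun g => c.hom ≫ g ≫ c.inv) h
    simpa using h'

include R hΥ hF hq in
theorem IsFractionCategory.isAbelianCategory (hA : IsAbelianCategory 𝒯) (hT : HasExactTensor 𝒯) :
    IsAbelianCategory 𝒟 ∧ HasExactTensor 𝒟 ∧ IsExactFunctor Υ := by
  have hK : PreservesKer Υ := hF.preservesKer R (hq := hq) hΥ hT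
  have hK' : PreservesCoker Υ := hF.preservesCoker R (hq := hq) hΥ hT
  have h₁ : HasBinaryBiproducts 𝒯 ∧ HasZeroObject 𝒯 := by
    obtain ⟨_, rfl⟩ := hA
    exact ⟨inferInstance, inferInstance⟩
  obtain ⟨_, _⟩ := h₁
  have := hF.hasBinaryBiproducts R hq hΥ
  have : HasZeroObject 𝒟 := ⟨_, Υ.map_isZero (isZero_zero 𝒯)⟩
  have h𝒟 : IsAbelianCategory 𝒟 := isAbelianCategory_of_isStrict fun f => by
    obtain ⟨T, hT, A, B, k, a, b, h⟩ := hF.exists_conj R hq hΥ f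
    have := hT.1
    exact ((hA.isStrict k).map hK hK').reflect (tensorLeft T) a b h
  have hker {A B : 𝒯} (k : A ⟶ B) : ∃ (K : 𝒯) (ι : K ⟶ A), IsKer ι k := by
    obtain ⟨_, _, _, _, _, _, _, -, h, -⟩ := hA.isStrict k
    exact ⟨_, _, h⟩
  have hcoker {A B : 𝒯} (k : A ⟶ B) : ∃ (Q : 𝒯) (p : B ⟶ Q), IsCoker k p := by
    obtain ⟨_, _, _, _, _, _, _, -, -, -, -, h⟩ := hA.isStrict k
    exact ⟨_, _, h⟩
  have hl (Z : 𝒟) : PreservesKer (Υ ⋙ tensorLeft Z) ∧ PreservesCoker (Υ ⋙ tensorLeft Z) := by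
    obtain ⟨v, X, ⟨e⟩⟩ := hF.exists_denominator Z
    have := (hΥ.isInvertibleObj_word Υ v).1
    exact ⟨PreservesKer.of_comp (PreservesKer.comp (hT.preservesKer_tensorLeft X) hK) (tensorLeftDenominatorIso e),
      PreservesCoker.of_comp (PreservesCoker.comp (hT.preservesCoker_tensorLeft X) hK')
        (tensorLeftDenominatorIso e)⟩
  have hr (Z : 𝒟) : PreservesKer (Υ ⋙ tensorRight Z) ∧ PreservesCoker (Υ ⋙ tensorRight Z) := by
    obtain ⟨v, X, ⟨e⟩⟩ := hF.exists_denominator Z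
    have := (hΥ.isInvertibleObj_word Υ v).1
    exact ⟨PreservesKer.of_comp (PreservesKer.comp (PreservesKer.comp
        (preservesKer_of_preservesFiniteLimits (wordTwist hq C v))
        (hT.preservesKer_tensorRight X)) hK) (hΥ.tensorRightIso hq e),
      PreservesCoker.of_comp (PreservesCoker.comp (PreservesCoker.comp
        (preservesCoker_of_preservesFiniteColimits (wordTwist hq C v))
        (hT.preservesCoker_tensorRight X)) hK') (hΥ.tensorRightIso hq e)⟩
  have el {T : 𝒟} (hT : IsInvertibleObj T) (Z : 𝒟) : ∃ Z', Nonempty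
      (tensorLeft Z ⋙ tensorLeft T ≅ tensorLeft T ⋙ tensorLeft Z') := by
    have := hT.2
    let c : (tensorRight T).objPreimage (T ⊗ Z) ⊗ T ≅ T ⊗ Z := (tensorRight T).objObjPreimageIso _
    exact ⟨_, ⟨(tensorLeftTensor T Z).symm ≪≫
      (NatIso.ofComponents (fun W => whiskerRightIso c.symm W) (fun f => whisker_exchange _ _) :
        tensorLeft (T ⊗ Z) ≅ tensorLeft (_ ⊗ T)) ≪≫ tensorLeftTensor _ T⟩⟩
  have er (T Z : 𝒟) : tensorRight Z ⋙ tensorLeft T ≅ tensorLeft T ⋙ tensorRight Z :=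
    NatIso.ofComponents (fun W => (α_ T W Z).symm) fun f => associator_inv_naturality_middle _ _ _
  refine ⟨h𝒟, fun Z => ⟨h𝒟.isExactFunctor h𝒟 _ ?_ ?_, h𝒟.isExactFunctor h𝒟 _ ?_ ?_⟩,
    hA.isExactFunctor h𝒟 Υ hK hK'⟩
  · refine preservesKer_of_conj Υ hK hker _ fun f => ?_
    obtain ⟨T, hT, A, B, k, a, b, h⟩ := hF.exists_conj R hq hΥ f
    obtain ⟨Z', ⟨e⟩⟩ := el hT Z
    exact ⟨_, _, inferInstance, hT.1, e, _, _, k, a, b, (hl Z').1, h⟩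
  · refine preservesCoker_of_conj Υ hK' hcoker _ fun f => ?_
    obtain ⟨T, hT, A, B, k, a, b, h⟩ := hF.exists_conj R hq hΥ f
    obtain ⟨Z', ⟨e⟩⟩ := el hT Z
    exact ⟨_, _, inferInstance, hT.1, e, _, _, k, a, b, (hl Z').2, h⟩
  · refine preservesKer_of_conj Υ hK hker _ fun f => ?_
    obtain ⟨T, hT, A, B, k, a, b, h⟩ := hF.exists_conj R hq hΥ f
    exact ⟨_, _, inferInstance, hT.1, er T Z, _, _, k, a, b, (hr Z).1, h⟩
  · refine preservesCoker_of_conj Υ hK' hcoker _ fun f => ?_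
    obtain ⟨T, hT, A, B, k, a, b, h⟩ := hF.exists_conj R hq hΥ f
    exact ⟨_, _, inferInstance, hT.1, er T Z, _, _, k, a, b, (hr Z).2, h⟩

end AbelianFractions

/-! ### Transport along monoidal equivalences -/

section Transport

universe u v x y w u₁ v₁ u₂ v₂ u' v'

open Functor.LaxMonoidal Functor.OplaxMonoidal

variable {𝒯 : Type u} [Category.{v} 𝒯] [Preadditive 𝒯] [MonoidalCategory 𝒯]
  {Λ : Type y} [AddCommGroup Λ] {𝒢 : MonoidalGrading Λ 𝒯} {q : InvertibleCentralObject 𝒯}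
  {I : Type w} {C : I → GradedBraider 𝒢 q}
  {ℬ : Type u₁} [Category.{v₁} ℬ] [MonoidalCategory ℬ]
  {𝒟 : Type u₂} [Category.{v₂} 𝒟] [MonoidalCategory 𝒟]
  {𝒟' : Type u'} [Category.{v'} 𝒟'] [MonoidalCategory 𝒟']
  (E : ℬ ⥤ 𝒟) [E.Monoidal] (Υ : 𝒯 ⥤ ℬ) [Υ.Monoidal]

lemma isMonoidal_of_whiskerLeft [E.EssSurj] {F₁ F₂ : 𝒟 ⥤ 𝒟'} [F₁.Monoidal] [F₂.Monoidal]
    (τ : F₁ ⟶ F₂) (h : NatTrans.IsMonoidal (Functor.whiskerLeft E τ)) :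
    NatTrans.IsMonoidal τ where
  unit := by
    have h₁ := h.unit
    rw [Functor.LaxMonoidal.comp_ε, Functor.LaxMonoidal.comp_ε] at h₁
    rw [← cancel_mono (F₂.map (ε E)), ← h₁, Functor.whiskerLeft_app, Category.assoc, Category.assoc,
      τ.naturality]
  tensor X Y := by
    let a := E.objObjPreimageIso X
    let b := E.objObjPreimageIso Y
    have h₁ := h.tensor (E.objPreimage X) (E.objPreimage Y)
    rw [Functor.LaxMonoidal.comp_μ, Functor.LaxMonoidal.comp_μ] at h₁
    simp only [Functor.whiskerLeft_app, Category.assoc, Functor.comp_obj] at h₁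
    rw [τ.naturality, ← Category.assoc, ← Category.assoc, cancel_mono] at h₁
    have h₂ : (F₁.map a.hom ⊗ₘ F₁.map b.hom) ≫ (τ.app X ⊗ₘ τ.app Y) =
        (τ.app _ ⊗ₘ τ.app _) ≫ (F₂.map a.hom ⊗ₘ F₂.map b.hom) := by
      rw [MonoidalCategory.tensorHom_comp_tensorHom, MonoidalCategory.tensorHom_comp_tensorHom,
        τ.naturality, τ.naturality]
    rw [← cancel_epi (F₁.map a.hom ⊗ₘ F₁.map b.hom), reassoc_of% h₂,
      Functor.LaxMonoidal.μ_natural, Functor.LaxMonoidal.μ_natural_assoc, τ.naturality,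
      reassoc_of% h₁]

lemma InvertsBraiders.comp_monoidal (hΥ : InvertsBraiders C Υ) : InvertsBraiders C (Υ ⋙ E) := by
  refine ⟨fun i => ?_, fun i l X hX => ?_⟩
  · obtain ⟨D, ev, coev, -⟩ := (hΥ.1 i).exists_inverse
    exact .of_iso (D := E.obj D)
      (Functor.Monoidal.μIso E _ _ ≪≫ E.mapIso ev ≪≫ (Functor.Monoidal.εIso E).symm)
      (Functor.Monoidal.μIso E _ _ ≪≫ E.mapIso coev.symm ≪≫ (Functor.Monoidal.εIso E).symm)
  · have := hΥ.2 i l X hX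
    exact inferInstanceAs (IsIso (E.map (Υ.map _)))

lemma IsBraidedFraction.comp_monoidal {l : Λ} {X Y : 𝒯} {hY : 𝒢.homogeneous l Y}
    {g : Υ.obj X ⟶ Υ.obj Y} (h : IsBraidedFraction C Υ hY g) :
    IsBraidedFraction C (Υ ⋙ E) hY (E.map g) := by
  induction h with
  | of_map hY f => exact .of_map hY f
  | step hY g i h hg ih =>
    refine .step hY _ i h (Eq.mp (congrArg (IsBraidedFraction C (Υ ⋙ E) h) ?_) ih)
    rw [Functor.LaxMonoidal.comp_μ, Functor.OplaxMonoidal.comp_δ]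
    simp

lemma IsFractionCategory.comp_equivalence [Preadditive ℬ] [Preadditive 𝒟] [E.Additive]
    [E.IsEquivalence] (hF : IsFractionCategory C Υ) : IsFractionCategory C (Υ ⋙ E) where
  exists_denominator Z := by
    obtain ⟨w, X, ⟨e⟩⟩ := hF.exists_denominator (E.objPreimage Z)
    exact ⟨w, X, ⟨whiskerLeftIso _ (E.objObjPreimageIso Z).symm ≪≫
      Functor.Monoidal.μIso E (Υ.obj (wordObj C w)) _ ≪≫ E.mapIso e⟩⟩
  isBraidedFraction hY g := by
    obtain ⟨g, rfl⟩ := E.map_surjective (X := Υ.obj _) (Y := Υ.obj _) g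
    exact (hF.isBraidedFraction hY g).comp_monoidal E Υ
  map_eq_zero_iff hY f := by
    rw [← hF.map_eq_zero_iff hY f, Functor.comp_map, E.map_eq_zero_iff]

variable (R : Type x) [CommRing R] [Linear R 𝒯] [Preadditive ℬ] [Linear R ℬ]
  [Preadditive 𝒟] [Linear R 𝒟] [E.Additive] [E.Linear R] [E.IsEquivalence] {E Υ}

lemma HasUniversalProperty.comp_equivalence (G : 𝒟 ⥤ ℬ) [G.Monoidal] [G.Additive]
    [G.Linear R] (η : E ⋙ G ≅ 𝟭 ℬ) (hη : NatTrans.IsMonoidal η.hom)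
    (h : HasUniversalProperty.{u', v'} R C Υ) : HasUniversalProperty.{u', v'} R C (Υ ⋙ E) := by
  intro 𝒟' _ _ _ _ _ _ Υ' _ _ _ hΥ'
  obtain ⟨⟨F, _, _, _, θ, hθ⟩, huniq⟩ := h 𝒟' Υ' hΥ'
  constructor
  · refine ⟨G ⋙ F, inferInstance, inferInstance, inferInstance,
      NatIso.ofComponents (fun X => F.mapIso (η.app (Υ.obj X)) ≪≫ θ.app X) (fun {X Y} f => ?_), ?_⟩
    · have h₁ := θ.hom.naturality f
      have h₂ := η.hom.naturality (Υ.map f)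
      simp only [Functor.comp_map, Functor.id_map] at h₁ h₂
      simp only [Functor.comp_map, Iso.trans_hom, Functor.mapIso_hom, Iso.app_hom, Category.assoc]
      rw [← h₁, ← F.map_comp_assoc, h₂, F.map_comp_assoc]
    · constructor
      · have h₁ := hθ.unit
        have h₂ := hη.unit
        simp only [Functor.LaxMonoidal.comp_ε, Functor.LaxMonoidal.id_ε] at h₁ h₂ ⊢
        have h₃ := η.hom.naturality (ε Υ)
        simp only [Functor.comp_map, Functor.id_map] at h₃
        simp only [Functor.comp_map, NatIso.ofComponents_hom_app, Iso.trans_hom,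
          Functor.mapIso_hom, Iso.app_hom, Category.assoc]
        rw [Category.assoc] at h₁ h₂
        have h₄ : F.map (ε G) ≫ F.map (G.map (ε E ≫ E.map (ε Υ))) ≫
            F.map (η.hom.app (Υ.obj (𝟙_ 𝒯))) = F.map (ε Υ) := by
          rw [← F.map_comp, ← F.map_comp, G.map_comp, Category.assoc, h₃, reassoc_of% h₂]
        change ε F ≫ F.map (ε G) ≫ F.map (G.map (ε E ≫ E.map (ε Υ))) ≫
          F.map (η.hom.app (Υ.obj (𝟙_ 𝒯))) ≫ θ.hom.app (𝟙_ 𝒯) = _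
        rw [reassoc_of% h₄, h₁]
      · intro X Y
        have h₁ := hθ.tensor X Y
        have h₂ := hη.tensor (Υ.obj X) (Υ.obj Y)
        have h₃ := η.hom.naturality (μ Υ X Y)
        simp only [Functor.LaxMonoidal.comp_μ, Functor.LaxMonoidal.id_μ, Functor.comp_obj,
          Functor.comp_map, Functor.id_obj, Functor.id_map, Category.comp_id] at h₁ h₂ h₃ ⊢
        simp only [Category.assoc] at h₁ h₂
        simp only [NatIso.ofComponents_hom_app, Iso.trans_hom, Functor.comp_obj,
          Functor.mapIso_hom, Iso.app_hom, Category.assoc, Functor.map_comp]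
        rw [← MonoidalCategory.tensorHom_comp_tensorHom, Category.assoc, ← h₁,
          Functor.LaxMonoidal.μ_natural_assoc, ← h₂]
        simp only [← F.map_comp_assoc, Category.assoc, h₃]
  · intro F₁ F₂ _ _ _ _ _ _ θ₁ θ₂ hθ₁ hθ₂
    have hm {F : 𝒟 ⥤ 𝒟'} [F.Monoidal] (θ : (Υ ⋙ E) ⋙ F ≅ Υ') (hθ : NatTrans.IsMonoidal θ.hom) :
        NatTrans.IsMonoidal (F₁ := Υ ⋙ (E ⋙ F)) θ.hom := by
      constructor
      · have h₁ := hθ.unit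
        simp only [Functor.LaxMonoidal.comp_ε, Functor.comp_map, Functor.map_comp,
          Category.assoc] at h₁ ⊢
        exact h₁
      · intro X Y
        have h₁ := hθ.tensor X Y
        simp only [Functor.LaxMonoidal.comp_μ, Functor.comp_map, Functor.map_comp,
          Category.assoc, Functor.comp_obj] at h₁ ⊢
        exact h₁
    have hE : ((Functor.whiskeringLeft ℬ 𝒟 𝒟').obj E).IsEquivalence :=
      (E.asEquivalence.symm.congrLeft (E := 𝒟')).isEquivalence_functor
    obtain ⟨τ, ⟨hτ, hτ'⟩, hu⟩ := huniq (E ⋙ F₁) (E ⋙ F₂) θ₁ θ₂ (hm θ₁ hθ₁) (hm θ₂ hθ₂)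
    let σ : F₁ ≅ F₂ := ((Functor.whiskeringLeft ℬ 𝒟 𝒟').obj E).preimageIso τ
    have hσ : Functor.whiskerLeft E σ.hom = τ.hom :=
      ((Functor.whiskeringLeft ℬ 𝒟 𝒟').obj E).map_preimage τ.hom
    refine ⟨σ, ⟨isMonoidal_of_whiskerLeft E σ.hom (hσ ▸ hτ), fun X => ?_⟩, fun σ' hσ' => ?_⟩
    · have h₁ := congrArg (fun t => t.app (Υ.obj X)) hσ
      exact (congrArg (· ≫ θ₂.hom.app X) h₁).trans (hτ' X)
    · have h₁ : Functor.isoWhiskerLeft E σ' = τ := hu _ ⟨?_, fun X => hσ'.2 X⟩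
      · apply ((Functor.whiskeringLeft ℬ 𝒟 𝒟').obj E).mapIso_injective
        refine Eq.trans h₁ (Iso.ext hσ.symm)
      · have := hσ'.1
        constructor
        · have h₁ := this.unit
          simp only [Functor.isoWhiskerLeft_hom, Functor.LaxMonoidal.comp_ε,
            Functor.whiskerLeft_app, Category.assoc, σ'.hom.naturality]
          rw [reassoc_of% h₁]
        · intro X Y
          have h₁ := this.tensor (E.obj X) (E.obj Y)
          simp only [Functor.isoWhiskerLeft_hom, Functor.LaxMonoidal.comp_μ, Functor.comp_obj,
            Functor.whiskerLeft_app, Category.assoc, σ'.hom.naturality]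
          rw [reassoc_of% h₁]

end Transport

/-! ### A category of fractions is locally small -/

namespace PointedFamily

universe u v w

variable {𝒬 : Type u} [Category.{v} 𝒬] {I : Type w} {Ξ : I → 𝒬 ⥤ 𝒬} (r : ∀ i, 𝟭 𝒬 ⟶ Ξ i)

/-- The composite of a bracketed word in the family, with optional letters. -/
def ofMagma : FreeMagma (Option I) → Σ Φ : 𝒬 ⥤ 𝒬, 𝟭 𝒬 ⟶ Φ
  | .of none => ⟨_, 𝟙 _⟩
  | .of (some i) => ⟨_, r i⟩
  | .mul s t => ⟨_, comp (ofMagma s).2 (ofMagma t).2⟩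

lemma IsComposite.exists_ofMagma {Φ : 𝒬 ⥤ 𝒬} {τ : 𝟭 𝒬 ⟶ Φ} (h : IsComposite r Φ τ) :
    ∃ s, ofMagma r s = ⟨Φ, τ⟩ := by
  induction h with
  | id => exact ⟨.of none, rfl⟩
  | of i => exact ⟨.of (some i), rfl⟩
  | @comp Φ Ψ τ σ _ _ h₁ h₂ =>
    obtain ⟨s, hs⟩ := h₁
    obtain ⟨t, ht⟩ := h₂
    refine ⟨.mul s t, ?_⟩
    change (⟨_, PointedFamily.comp (ofMagma r s).2 (ofMagma r t).2⟩ : Σ Φ : 𝒬 ⥤ 𝒬, 𝟭 𝒬 ⟶ Φ) = _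
    rw [hs, ht]

end PointedFamily

section LocallySmall

universe u v x y w u' v'

variable {R : Type x} [CommRing R] {𝒯 : Type u} [Category.{v} 𝒯] [Preadditive 𝒯] [Linear R 𝒯]
  [MonoidalCategory 𝒯] [MonoidalPreadditive 𝒯] [MonoidalLinear R 𝒯]
  {𝒟 : Type u'} [Category.{v'} 𝒟] [Preadditive 𝒟] [Linear R 𝒟] [MonoidalCategory 𝒟]
  [MonoidalPreadditive 𝒟] [MonoidalLinear R 𝒟]
  {Υ : 𝒯 ⥤ 𝒟} [Υ.Monoidal] [Υ.Additive] [Υ.Linear R]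
  {Λ : Type y} [AddCommGroup Λ] {𝒢 : MonoidalGrading Λ 𝒯} {q : InvertibleCentralObject 𝒯}
  (hq : 𝒢.homogeneous 0 (q.pow 1)) {I : Type w} {C : I → GradedBraider 𝒢 q}
  (hΥ : InvertsBraiders C Υ) (hF : IsFractionCategory C Υ)

open Frac

variable (R)

include R hq hΥ hF

lemma IsFractionCategory.small_hom_map (X Y : 𝒯) : Small.{max v w} (Υ.obj X ⟶ Υ.obj Y) := by
  let r := fun i => (C i).expand R hq
  let P : Frac R 𝒯 := ⟨X, Y⟩
  have h (g : Υ.obj X ⟶ Υ.obj Y) : ∃ p : Σ s : FreeMagma (Option I),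
      (((PointedFamily.ofMagma r s).1.obj P).den ⟶ ((PointedFamily.ofMagma r s).1.obj P).num),
      PointedFamily.IsComposite r _ (PointedFamily.ofMagma r p.1).2 ∧
      ((homOf R Υ).map ((PointedFamily.ofMagma r p.1).2.app P)).hom g = Υ.map p.2 := by
    obtain ⟨Φ, τ, hτ, k, hk⟩ := hF.isExpandable R hq g
    obtain ⟨s, hs⟩ := hτ.exists_ofMagma
    suffices H : ∀ p : Σ Φ : Frac R 𝒯 ⥤ Frac R 𝒯, 𝟭 (Frac R 𝒯) ⟶ Φ, p = ⟨Φ, τ⟩ →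
        PointedFamily.IsComposite r _ p.2 ∧ ∃ k : (p.1.obj P).den ⟶ (p.1.obj P).num,
          ((homOf R Υ).map (p.2.app P)).hom g = Υ.map k by
      obtain ⟨h₁, k, hk⟩ := H _ hs
      exact ⟨⟨s, k⟩, h₁, hk⟩
    rintro _ rfl
    exact ⟨hτ, k, hk⟩
  choose p hp hp' using h
  refine small_of_injective.{max v w} (f := p) fun g g' hg => ?_
  have h' := hp' g'
  rw [← hg] at h'
  exact (bijective_homOf_map hΥ (hp g) P).1 ((hp' g).trans h'.symm)

lemma IsFractionCategory.locallySmall : LocallySmall.{max v w} 𝒟 where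
  hom_small Z Z' := by
    obtain ⟨w, X, ⟨e⟩⟩ := hF.exists_denominator Z
    obtain ⟨w', X', ⟨e'⟩⟩ := hF.exists_denominator Z'
    have := hF.small_hom_map R hq hΥ (wordObj C w' ⊗ X) ((wordTwist hq C w').obj (wordObj C w) ⊗ X')
    have := (hΥ.isInvertibleObj_word Υ (w' ++ w)).1
    refine small_of_injective (f := fun f : Z ⟶ Z' => (appendDenominator Υ w' e).inv ≫
      Υ.obj (wordObj C (w' ++ w)) ◁ f ≫ (hΥ.prependDenominator hq Υ w e').hom) fun f g h => ?_
    apply (tensorLeft (Υ.obj (wordObj C (w' ++ w)))).map_injective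
    simpa using h

end LocallySmall

/-! ### Shrinking the morphisms of a linear monoidal category -/

namespace CategoryTheory.ShrinkHoms

universe u v x w

variable (R : Type x) [CommRing R] (𝒟 : Type u) [Category.{v} 𝒟] [LocallySmall.{w} 𝒟]
  [MonoidalCategory 𝒟]

/-- A monoidal category with small sets of morphisms. -/
abbrev Transported := Monoidal.Transported (equivalence.{w} 𝒟)

variable [Preadditive 𝒟]

noncomputable instance : Preadditive (Transported.{u, v, w} 𝒟) := preadditive 𝒟

/-- The equivalence with the category with small sets of morphisms. -/
noncomputable abbrev toTransported : 𝒟 ⥤ Transported.{u, v, w} 𝒟 :=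
  (Monoidal.equivalenceTransported (equivalence.{w} 𝒟)).functor

/-- The equivalence from the category with small sets of morphisms. -/
noncomputable abbrev fromTransported : Transported.{u, v, w} 𝒟 ⥤ 𝒟 :=
  (Monoidal.equivalenceTransported (equivalence.{w} 𝒟)).inverse

instance : (toTransported.{u, v, w} 𝒟).Additive := inferInstanceAs (functor 𝒟).Additive

instance : (fromTransported.{u, v, w} 𝒟).Additive := inferInstanceAs (inverse 𝒟).Additive

variable [Linear R 𝒟]

noncomputable instance (X Y : Transported.{u, v, w} 𝒟) : SMul R (X ⟶ Y) :=
  ⟨fun r f => equivShrink _ (r • (fromTransported 𝒟).map f)⟩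

lemma fromTransported_map_smul {X Y : Transported.{u, v, w} 𝒟} (r : R) (f : X ⟶ Y) :
    (fromTransported 𝒟).map (r • f) = r • (fromTransported 𝒟).map f :=
  (equivShrink _).symm_apply_apply _

noncomputable instance : Linear R (Transported.{u, v, w} 𝒟) where
  homModule X Y := Function.Injective.module R (fromTransported 𝒟).mapAddHom
    (fromTransported 𝒟).map_injective (fromTransported_map_smul R 𝒟)
  smul_comp X Y Z r f g := (fromTransported 𝒟).map_injective <| by
    simp only [Functor.map_comp, fromTransported_map_smul, Linear.smul_comp]
  comp_smul X Y Z f r g := (fromTransported 𝒟).map_injective <| by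
    simp only [Functor.map_comp, fromTransported_map_smul, Linear.comp_smul]

instance : (fromTransported.{u, v, w} 𝒟).Linear R where
  map_smul f r := fromTransported_map_smul R 𝒟 r f

instance : (toTransported.{u, v, w} 𝒟).Linear R where
  map_smul {X Y} f r := congrArg (equivShrink (X ⟶ Y))
    (congrArg (r • ·) ((equivShrink (X ⟶ Y)).symm_apply_apply f).symm)

variable [MonoidalPreadditive 𝒟] [MonoidalLinear R 𝒟]

instance : MonoidalPreadditive (Transported.{u, v, w} 𝒟) :=
  monoidalPreadditive_of_faithful (fromTransported 𝒟)

instance : MonoidalLinear R (Transported.{u, v, w} 𝒟) :=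
  MonoidalLinear.ofFaithful R (fromTransported 𝒟)

end CategoryTheory.ShrinkHoms

universe u v w x y u' v'

theorem theorem2p12 (R : Type x) [CommRing R] (Λ : Type y) [AddCommGroup Λ]
    (𝒯 : Type u) [Category.{v} 𝒯] [Preadditive 𝒯] [Linear R 𝒯] [MonoidalCategory 𝒯]
    [MonoidalPreadditive 𝒯] [MonoidalLinear R 𝒯] (𝒢 : MonoidalGrading Λ 𝒯)
    (q : InvertibleCentralObject 𝒯) (hq : 𝒢.homogeneous 0 (q.pow 1))
    (I : Type w) (C : I → GradedBraider 𝒢 q) (deg : I → Λ)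
    (hC : IsRealCommutingFamily R C deg) :
    ∃ (𝒟 : Type (max u w)) (_ : Category.{max v w} 𝒟) (_ : Preadditive 𝒟) (_ : Linear R 𝒟)
      (_ : MonoidalCategory 𝒟) (_ : MonoidalPreadditive 𝒟) (_ : MonoidalLinear R 𝒟)
      (𝒢' : MonoidalGrading Λ 𝒟) (Υ : 𝒯 ⥤ 𝒟) (_ : Υ.Monoidal) (_ : Υ.Additive) (_ : Υ.Linear R),
      (∀ (l : Λ) (X : 𝒯), 𝒢.homogeneous l X → 𝒢'.homogeneous l (Υ.obj X)) ∧
      InvertsBraiders C Υ ∧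
      HasUniversalProperty.{max u w, max v w} R C Υ ∧
      HasUniversalProperty.{u', v'} R C Υ ∧
      IsFractionCategory C Υ ∧
      (IsAbelianCategory 𝒯 → HasExactTensor 𝒯 →
        IsAbelianCategory 𝒟 ∧ HasExactTensor 𝒟 ∧ IsExactFunctor Υ) := by
  have hΥ := invertsBraiders_toBraidLoc R C
  have hF := isFractionCategory_toBraidLoc hq hC
  have := hF.locallySmall R hq hΥ
  let E := ShrinkHoms.toTransported.{_, _, max v w} (BraidLoc R C)
  let Υ := toBraidLoc R C ⋙ E
  have hΥ' : InvertsBraiders C Υ := hΥ.comp_monoidal E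
  have hF' : IsFractionCategory C Υ := hF.comp_equivalence E
  let η : E ⋙ ShrinkHoms.fromTransported (BraidLoc R C) ≅ 𝟭 _ :=
    (Monoidal.equivalenceTransported (ShrinkHoms.equivalence (BraidLoc R C))).unitIso.symm
  have hη : NatTrans.IsMonoidal η.hom := inferInstanceAs (NatTrans.IsMonoidal
    (Monoidal.equivalenceTransported (ShrinkHoms.equivalence (BraidLoc R C))).symm.counit)
  exact ⟨ShrinkHoms.Transported (BraidLoc R C), inferInstance, inferInstance, inferInstance, inferInstance,
    inferInstance, inferInstance, fractionGrading hq hC.homogeneous Υ hΥ' hF', Υ, inferInstance,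
    inferInstance, inferInstance, fun l X hX => fractionGrading_obj hq hC.homogeneous Υ hΥ' hF' hX,
    hΥ', (hasUniversalProperty_toBraidLoc R C).comp_equivalence R _ η hη,
    (hasUniversalProperty_toBraidLoc R C).comp_equivalence R _ η hη, hF',
    fun hA hT => hF'.isAbelianCategory R hq hΥ' hA hT⟩
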